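/- Let $\Sigma$ be a compact connected Riemann surface of genus $g>1$. Let $E\to\Sigma$ be a smooth real vector bundle of rank $3$ with a smooth fibre metric $h$ of signature $(2,1)$, such that $E\cong T\Sigma\oplus\underline{\mathbb R}$ as bundles with Lorentzian structure group ($T\Sigma$ spacelike, $\underline{\mathbb R}$ timelike). Let $\nabla_B$ be a smooth, flat, irreducible $\mathrm{SO}(2,1)$ connection on $E$ (so $\nabla_B h=0$). Let $\pi:\Sigma\times\mathbb R\to\Sigma$ be the projection, let $D=\pi^*\nabla_B$ be the pulled back connection on $\pi^*E$, write $h$ also for the pulled back metric, and let $$H^1(\pi^*\nabla_B)=\frac{\mathrm{Ker}\,\bigl(D:\Omega^1(\Sigma\times\mathbb R,\pi^*E)\to\Omega^2(\Sigma\times\mathbb R,\pi^*E)\bigr)}{\mathrm{Im}\,\bigl(D:\Omega^0(\Sigma\times\mathbb R,\pi^*E)\to\Omega^1(\Sigma\times\mathbb R,\pi^*E)\bigr)} .$$ (1) For $\xi\in\Omega^1(\Sigma\times\mathbb R,\pi^*E)$ the $\mathrm{ISO}(2,1)$ connection $\pi^*\nabla_B+\xi$ on the affine bundle underlying $\pi^*E$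 ($\xi$ acting by translations) is flat if and only if $D\xi=0$. The map $[\xi]\mapsto[\pi^*\nabla_B+\xi]$ is a well-defined bijection from $H^1(\pi^*\nabla_B)$ onto the set of $\mathrm{ISO}(2,1)$ gauge equivalence classes of flat $\mathrm{ISO}(2,1)$ connections of the form $\pi^*\nabla_B+\xi$, and it is linear for the vector space structure induced on these classes. (2) For $\xi$ with $D\xi=0$ put $g_\xi=h\circ(\xi\times\xi)$, a possibly degenerate ("singular") metric on $\Sigma\times\mathbb R$. On the open set where $\xi:T(\Sigma\times\mathbb R)\to\pi^*E$ is invertible, $g_\xi$ is a flat Lorentzian metric with Levi-Civita connection $\nabla_{B,\xi}=\xi^{-1}\circ D\circ\xi$. Two closed forms $\xi,\xi'$ are said to present the same singular metric (with its connection) if $\xi'=A\xi$ for an isometric automorphism $A$ of $(\pi^*E,h)$ commuting with $D$; this holds for $\xi'=-\xi$, and if $\xi$ is invertible everywhere it holds if and only if $g_\xi=g_{\xi'}$, if and only if $\xi'=\pm\xi$. Singular metrics are called equivalent if their forms $\xi$ differ by some $Dv$, $v\in\Omega^0(\Sigma\times\mathbb R,\pi^*E)$, and equivalence classes are taken for the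 equivalence relation generated by these two identifications. Call a possibly degenerate metric on $\Sigma\times\mathbb R$ inextensible if there is no isometric diffeomorphism of $\Sigma\times\mathbb R$ onto a proper open subset of a connected Lorentzian three-manifold. Let $\mathbb Z_2$ act on $H^1(\pi^*\nabla_B)$ by $[\xi]\mapsto[-\xi]$. Then $[\xi]\mapsto[g_\xi]$ induces a bijection from $H^1(\pi^*\nabla_B)/\mathbb Z_2$ onto the set of equivalence classes of inextensible, flat, singular Lorentzian metrics $g_\xi$; the same holds without the restriction to inextensible metrics. (3) $\dim_{\mathbb R}H^1(\pi^*\nabla_B)=6g-6$. -/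

import Mathlib

open Bundle Set Topology
open scoped Manifold ContDiff

set_option linter.unusedSectionVars false

noncomputable section

/-! ## The pull-back of a vector bundle to the cylinder -/

section Cylinder

variable {EM : Type*} [NormedAddCommGroup EM] [NormedSpace ℝ EM]
  {H : Type*} [TopologicalSpace H] (I : ModelWithCorners ℝ EM H)
  (M : Type*) [TopologicalSpace M] [ChartedSpace H M]

/-- The projection `π : M × ℝ → M` as a smooth map. -/
abbrev cylProj : C^∞⟮I.prod 𝓘(ℝ, ℝ), M × ℝ; I, M⟯ := ContMDiffMap.fst

variable {M}

/-- The pull-back `π^*E` of a bundle along `π : M × ℝ → M`. -/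
abbrev CylBundle (E : M → Type*) : M × ℝ → Type _ := ⇑(cylProj I M) *ᵖ E

instance CylBundle.instAddCommGroup (E : M → Type*) [∀ x, AddCommGroup (E x)] (p : M × ℝ) :
    AddCommGroup (CylBundle I E p) :=
  { (inferInstance : AddCommMonoid (CylBundle I E p)) with
    neg := (Neg.neg : E p.1 → E p.1)
    sub := (Sub.sub : E p.1 → E p.1 → E p.1)
    sub_eq_add_neg := sub_eq_add_neg (G := E p.1)
    zsmul := fun n (v : E p.1) => (n • v : E p.1)
    zsmul_zero' := fun v => zero_zsmul (G := E p.1) v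
    zsmul_succ' := fun n v => SubNegMonoid.zsmul_succ' (G := E p.1) n v
    zsmul_neg' := fun n v => SubNegMonoid.zsmul_neg' (G := E p.1) n v
    neg_add_cancel := neg_add_cancel (G := E p.1) }

instance CylBundle.instTAG (E : M → Type*) [∀ x, AddCommGroup (E x)]
    [∀ x, TopologicalSpace (E x)] [∀ x, IsTopologicalAddGroup (E x)] (p : M × ℝ) :
    IsTopologicalAddGroup (CylBundle I E p) :=
  inferInstanceAs (IsTopologicalAddGroup (E p.1))

instance CylBundle.instCS (E : M → Type*) [∀ x, AddCommGroup (E x)] [∀ x, Module ℝ (E x)]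
    [∀ x, TopologicalSpace (E x)] [∀ x, ContinuousSMul ℝ (E x)] (p : M × ℝ) :
    ContinuousSMul ℝ (CylBundle I E p) :=
  inferInstanceAs (ContinuousSMul ℝ (E p.1))


end Cylinder

/-! ## Forms with values in a bundle, connections, and the twisted de Rham complex -/

section Forms

variable {EM : Type*} [NormedAddCommGroup EM] [NormedSpace ℝ EM]
  {H : Type*} [TopologicalSpace H] {I : ModelWithCorners ℝ EM H}
  {M : Type*} [TopologicalSpace M] [ChartedSpace H M] [IsManifold I ∞ M]
  {F : Type*} [NormedAddCommGroup F] [NormedSpace ℝ F]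
  {V : M → Type*} [TopologicalSpace (TotalSpace F V)]
  [∀ x, AddCommGroup (V x)] [∀ x, Module ℝ (V x)] [∀ x, TopologicalSpace (V x)]
  [∀ x, IsTopologicalAddGroup (V x)] [∀ x, ContinuousSMul ℝ (V x)]
  [FiberBundle F V] [VectorBundle ℝ F V]

variable (I F V) in
/-- `Ω⁰(M, V)`: smooth sections of `V`. -/
abbrev SmoothSec := Cₛ^∞⟮I; F, V⟯

variable (I F V) in
/-- `Ω¹(M, V)`: smooth sections of `Hom(TM, V)`. -/
abbrev OneForm := Cₛ^∞⟮I; EM →L[ℝ] F, fun x : M ↦ TangentSpace I x →L[ℝ] V x⟯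

variable (I M) in
/-- Smooth vector fields. -/
abbrev VField := Cₛ^∞⟮I; EM, (TangentSpace I : M → Type _)⟯

variable (I F V) in
/-- Smooth sections of `End V`. -/
abbrev EndSec := Cₛ^∞⟮I; F →L[ℝ] F, fun x : M ↦ V x →L[ℝ] V x⟯

/-- The section `ξ(X)` of `V`. -/
def OneForm.eval (ξ : OneForm I F V) (X : VField I M) : SmoothSec I F V :=
  ⟨fun x ↦ ξ x (X x), ξ.contMDiff.clm_bundle_apply X.contMDiff⟩

/-- The exterior covariant derivative of a one-form,
`(d^∇ ξ)(X, Y) = ∇_X (ξ(Y)) - ∇_Y (ξ(X)) - ξ([X, Y])`. -/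
def extCovDeriv (D : CovariantDerivative I F V) (ξ : OneForm I F V) (X Y : VField I M) (x : M) :
    V x :=
  D (ξ.eval Y) x (X x) - D (ξ.eval X) x (Y x) - ξ x (VectorField.mlieBracket I X Y x)

/-- `Ker (d^∇ : Ω¹(M, V) → Ω²(M, V))`. -/
def closedForms (D : CovariantDerivative I F V) : Submodule ℝ (OneForm I F V) where
  carrier := {ξ | ∀ (X Y : VField I M) (x : M), extCovDeriv D ξ X Y x = 0}
  add_mem' := by
    intro ξ η hξ hη X Y x
    have e : ∀ Z : VField I M, D ((ξ + η).eval Z) x = D (ξ.eval Z) x + D (η.eval Z) x :=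
      fun Z ↦ D.isCovariantDerivativeOnUniv.add (ξ.eval Z).mdifferentiableAt
        (η.eval Z).mdifferentiableAt
    have h1 := hξ X Y x
    have h2 := hη X Y x
    unfold extCovDeriv at h1 h2 ⊢
    rw [e, e]
    refine Eq.trans ?_ ((congrArg₂ (· + ·) h1 h2).trans (add_zero 0))
    simp only [add_apply, ContMDiffSection.coe_add, Pi.add_apply]
    abel
  zero_mem' := by
    intro X Y x
    have e : ∀ Z : VField I M, D ((0 : OneForm I F V).eval Z) x = 0 := by
      intro Z
      exact D.isCovariantDerivativeOnUniv.zero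
    unfold extCovDeriv
    rw [e, e]
    simp
  smul_mem' := by
    intro c ξ hξ X Y x
    have e : ∀ Z : VField I M, D ((c • ξ).eval Z) x = c • D (ξ.eval Z) x :=
      fun Z ↦ D.isCovariantDerivativeOnUniv.smul_const c (ξ.eval Z).mdifferentiableAt
    have h1 := hξ X Y x
    unfold extCovDeriv at h1 ⊢
    rw [e, e]
    refine Eq.trans ?_ ((congrArg (c • ·) h1).trans (smul_zero c))
    simp only [smul_apply, ContMDiffSection.coe_smul, Pi.smul_apply, smul_sub]

/-- `Im (∇ : Ω⁰(M, V) → Ω¹(M, V))`. -/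
def exactForms (D : CovariantDerivative I F V) : Submodule ℝ (OneForm I F V) where
  carrier := {ξ | ∃ v : SmoothSec I F V, ∀ x, ξ x = D v x}
  add_mem' := by
    rintro ξ η ⟨v, hv⟩ ⟨w, hw⟩
    refine ⟨v + w, fun x ↦ ?_⟩
    have h := D.isCovariantDerivativeOnUniv.add (v.mdifferentiableAt (x := x)) w.mdifferentiableAt
    exact (congrArg₂ (· + ·) (hv x) (hw x)).trans h.symm
  zero_mem' := ⟨0, fun x ↦ (D.isCovariantDerivativeOnUniv.zero (x := x)).symm⟩
  smul_mem' := by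
    rintro c ξ ⟨v, hv⟩
    refine ⟨c • v, fun x ↦ ?_⟩
    have h := D.isCovariantDerivativeOnUniv.smul_const c (v.mdifferentiableAt (x := x))
    exact (congrArg (c • ·) (hv x)).trans h.symm

/-- The first cohomology `H¹(∇) = Ker d^∇ / Im ∇` of the twisted de Rham complex
`Ω⁰(M, V) → Ω¹(M, V) → Ω²(M, V)`. -/
abbrev TwistedH1 (D : CovariantDerivative I F V) : Type _ :=
  closedForms D ⧸ (exactForms D).submoduleOf (closedForms D)

/-- The class of a closed form. -/
abbrev cohClass (D : CovariantDerivative I F V) (ξ : closedForms D) : TwistedH1 D :=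
  Submodule.Quotient.mk ξ

/-- The curvature of an operator `∇` on sections of `V` vanishes on the open set `U`. -/
def IsFlatOn (F : Type*) [NormedAddCommGroup F] [NormedSpace ℝ F]
    {V : M → Type*} [TopologicalSpace (TotalSpace F V)]
    [∀ x, AddCommGroup (V x)] [∀ x, Module ℝ (V x)] [∀ x, TopologicalSpace (V x)]
    [FiberBundle F V]
    (D : (Π x : M, V x) → (Π x : M, TangentSpace I x →L[ℝ] V x)) (U : Set M) : Prop :=
  ∀ (X Y : Π x : M, TangentSpace I x) (s : Π x, V x),
    ContMDiffOn I (I.prod 𝓘(ℝ, EM)) ∞ (fun x ↦ TotalSpace.mk' EM x (X x)) U →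
    ContMDiffOn I (I.prod 𝓘(ℝ, EM)) ∞ (fun x ↦ TotalSpace.mk' EM x (Y x)) U →
    ContMDiffOn I (I.prod 𝓘(ℝ, F)) ∞ (fun x ↦ TotalSpace.mk' F x (s x)) U →
    ∀ x ∈ U, D (fun y ↦ D s y (Y y)) x (X x) - D (fun y ↦ D s y (X y)) x (Y x)
      - D s x (VectorField.mlieBracket I X Y x) = 0

/-- The operator `∇` is compatible with the bilinear form `b` on the open set `U`:
`d(b(s, s')) = b(∇s, s') + b(s, ∇s')`. -/
def IsMetricOn (F : Type*) [NormedAddCommGroup F] [NormedSpace ℝ F]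
    {V : M → Type*} [TopologicalSpace (TotalSpace F V)]
    [∀ x, AddCommGroup (V x)] [∀ x, Module ℝ (V x)] [∀ x, TopologicalSpace (V x)]
    [FiberBundle F V]
    (D : (Π x : M, V x) → (Π x : M, TangentSpace I x →L[ℝ] V x))
    (b : Π x, V x → V x → ℝ) (U : Set M) : Prop :=
  ∀ s s' : Π x, V x,
    ContMDiffOn I (I.prod 𝓘(ℝ, F)) ∞ (fun x ↦ TotalSpace.mk' F x (s x)) U →
    ContMDiffOn I (I.prod 𝓘(ℝ, F)) ∞ (fun x ↦ TotalSpace.mk' F x (s' x)) U →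
    ∀ x ∈ U, ∀ u : TangentSpace I x,
      mvfderiv I (fun y ↦ b y (s y) (s' y)) x u =
        b x (D s x u) (s' x) + b x (s x) (D s' x u)

/-- The torsion `∇_X Y - ∇_Y X - [X, Y]` vanishes on the open set `U`. -/
def IsTorsionFreeOn
    (D : (Π x : M, TangentSpace I x) → (Π x : M, TangentSpace I x →L[ℝ] TangentSpace I x))
    (U : Set M) : Prop :=
  ∀ X Y : Π x : M, TangentSpace I x,
    ContMDiffOn I (I.prod 𝓘(ℝ, EM)) ∞ (fun x ↦ TotalSpace.mk' EM x (X x)) U →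
    ContMDiffOn I (I.prod 𝓘(ℝ, EM)) ∞ (fun x ↦ TotalSpace.mk' EM x (Y x)) U →
    ∀ x ∈ U, D Y x (X x) - D X x (Y x) = VectorField.mlieBracket I X Y x

/-- A connection is irreducible: the only smooth subbundles preserved by it are `0` and `V`.
A subbundle is a family of subspaces of constant dimension such that every vector of it extends
to a smooth section with values in it. -/
def IsIrreducibleConn (D : CovariantDerivative I F V) : Prop :=
  ∀ W : Π x, Submodule ℝ (V x),
    (∃ k : ℕ, ∀ x, Module.finrank ℝ (W x) = k) →
    (∀ x, ∀ w ∈ W x, ∃ s : SmoothSec I F V, s x = w ∧ ∀ y, s y ∈ W y) →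
    (∀ s : SmoothSec I F V, (∀ y, s y ∈ W y) → ∀ x (u : TangentSpace I x), D s x u ∈ W x) →
    (∀ x, W x = ⊥) ∨ (∀ x, W x = ⊤)

/-! ### The pulled back connection -/

lemma CylBundle.mdiff_triv {σ : Π p, CylBundle I V p} {p : M × ℝ}
    (h : MDifferentiableAt (I.prod 𝓘(ℝ, ℝ)) ((I.prod 𝓘(ℝ, ℝ)).prod 𝓘(ℝ, F))
      (fun q ↦ TotalSpace.mk' F q (σ q)) p) :
    MDifferentiableAt (I.prod 𝓘(ℝ, ℝ)) 𝓘(ℝ, F)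
      (fun q : M × ℝ ↦ (trivializationAt F V p.1 ⟨q.1, σ q⟩).2) p :=
  (mdifferentiableAt_section _ σ).1 h

/-- The restriction of a section of the pulled back bundle to the slice `M × {t}`. -/
def CylBundle.slice (σ : Π p, CylBundle I V p) (t : ℝ) : Π y, V y := fun y ↦ σ (y, t)

lemma CylBundle.mdiff_slice {σ : Π p, CylBundle I V p} {p : M × ℝ}
    (h : MDifferentiableAt (I.prod 𝓘(ℝ, ℝ)) ((I.prod 𝓘(ℝ, ℝ)).prod 𝓘(ℝ, F))
      (fun q ↦ TotalSpace.mk' F q (σ q)) p) :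
    MDifferentiableAt I (I.prod 𝓘(ℝ, F))
      (fun y ↦ TotalSpace.mk' F (E := V) y (CylBundle.slice σ p.2 y)) p.1 := by
  refine (mdifferentiableAt_section (F := F) (E := V) _ (CylBundle.slice σ p.2)).2 ?_
  have h1 : MDifferentiableAt I (I.prod 𝓘(ℝ, ℝ)) (fun y : M ↦ (y, p.2)) p.1 :=
    mdifferentiableAt_id.prodMk mdifferentiableAt_const
  exact (CylBundle.mdiff_triv h).comp (x := p.1) (f := fun y : M ↦ (y, p.2)) h1

lemma CylBundle.diff_vert {σ : Π p, CylBundle I V p} {p : M × ℝ}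
    (h : MDifferentiableAt (I.prod 𝓘(ℝ, ℝ)) ((I.prod 𝓘(ℝ, ℝ)).prod 𝓘(ℝ, F))
      (fun q ↦ TotalSpace.mk' F q (σ q)) p) :
    DifferentiableAt ℝ (fun s : ℝ ↦ (trivializationAt F V p.1 ⟨p.1, σ (p.1, s)⟩).2) p.2 := by
  have h1 : MDifferentiableAt 𝓘(ℝ, ℝ) (I.prod 𝓘(ℝ, ℝ)) (fun s : ℝ ↦ (p.1, s)) p.2 :=
    mdifferentiableAt_const.prodMk mdifferentiableAt_id
  exact mdifferentiableAt_iff_differentiableAt.1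
    ((CylBundle.mdiff_triv h).comp (x := p.2) (f := fun s : ℝ ↦ (p.1, s)) h1)

variable (F) in
/-- The derivative `∂σ/∂t` of a section `σ` of the pulled back bundle at `(x, t)`. Along the line
`{x} × ℝ` the section is a curve in the fixed vector space `V x`; it is differentiated after the
linear identification of `V x` with the model fibre that a trivialization around `x` provides. -/
def CylBundle.vertDeriv (σ : Π p, CylBundle I V p) (p : M × ℝ) : V p.1 :=
  (trivializationAt F V p.1).symmL ℝ p.1
    (deriv (fun s : ℝ ↦ (trivializationAt F V p.1 ⟨p.1, σ (p.1, s)⟩).2) p.2)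

lemma CylBundle.vertDeriv_add {σ σ' : Π p, CylBundle I V p} {p : M × ℝ}
    (h : MDifferentiableAt (I.prod 𝓘(ℝ, ℝ)) ((I.prod 𝓘(ℝ, ℝ)).prod 𝓘(ℝ, F))
      (fun q ↦ TotalSpace.mk' F q (σ q)) p)
    (h' : MDifferentiableAt (I.prod 𝓘(ℝ, ℝ)) ((I.prod 𝓘(ℝ, ℝ)).prod 𝓘(ℝ, F))
      (fun q ↦ TotalSpace.mk' F q (σ' q)) p) :
    CylBundle.vertDeriv F (σ + σ') p =
      CylBundle.vertDeriv F σ p + CylBundle.vertDeriv F σ' p := by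
  have e : (fun s : ℝ ↦ (trivializationAt F V p.1 ⟨p.1, (σ + σ') (p.1, s)⟩).2) =
      (fun s : ℝ ↦ (trivializationAt F V p.1 ⟨p.1, σ (p.1, s)⟩).2) +
      (fun s : ℝ ↦ (trivializationAt F V p.1 ⟨p.1, σ' (p.1, s)⟩).2) := by
    funext s
    exact ((trivializationAt F V p.1).linear ℝ (mem_baseSet_trivializationAt F V p.1)).1
      (σ (p.1, s)) (σ' (p.1, s))
  unfold CylBundle.vertDeriv
  rw [e, deriv_add (CylBundle.diff_vert h) (CylBundle.diff_vert h'), map_add]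

lemma CylBundle.vertDeriv_smul {σ : Π p, CylBundle I V p} {g : M × ℝ → ℝ} {p : M × ℝ}
    (h : MDifferentiableAt (I.prod 𝓘(ℝ, ℝ)) ((I.prod 𝓘(ℝ, ℝ)).prod 𝓘(ℝ, F))
      (fun q ↦ TotalSpace.mk' F q (σ q)) p)
    (hg : DifferentiableAt ℝ (fun s : ℝ ↦ g (p.1, s)) p.2) :
    CylBundle.vertDeriv F (g • σ) p = g p • CylBundle.vertDeriv F σ p +
      deriv (fun s : ℝ ↦ g (p.1, s)) p.2 • CylBundle.slice σ p.2 p.1 := by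
  have hb := mem_baseSet_trivializationAt F V p.1
  have e : (fun s : ℝ ↦ (trivializationAt F V p.1 ⟨p.1, (g • σ) (p.1, s)⟩).2) =
      (fun s : ℝ ↦ g (p.1, s)) •
      (fun s : ℝ ↦ (trivializationAt F V p.1 ⟨p.1, σ (p.1, s)⟩).2) := by
    funext s
    exact ((trivializationAt F V p.1).linear ℝ hb).2 (g (p.1, s)) (σ (p.1, s))
  unfold CylBundle.vertDeriv
  rw [e, deriv_smul hg (CylBundle.diff_vert h), map_add, map_smul, map_smul]
  congr 2
  exact (Trivialization.symmL_apply _ hb _).trans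
    ((trivializationAt F V p.1).symm_apply_apply_mk hb (CylBundle.slice σ p.2 p.1))

/-- The pull-back `π^*∇` of a connection along `π : M × ℝ → M`:
`(π^*∇)_{(u, c)} σ = ∇_u (σ|_{M × {t}}) + c ∂σ/∂t` at `(x, t)`. -/
def CovariantDerivative.cylinder (D : CovariantDerivative I F V) :
    CovariantDerivative (I.prod 𝓘(ℝ, ℝ)) F (CylBundle I V) where
  toFun σ p :=
    ((D (CylBundle.slice σ p.2) p.1 : EM →L[ℝ] V p.1) ∘L ContinuousLinearMap.fst ℝ EM ℝ +
      (ContinuousLinearMap.snd ℝ EM ℝ).smulRight (CylBundle.vertDeriv F σ p) :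
      EM × ℝ →L[ℝ] V p.1)
  isCovariantDerivativeOnUniv :=
    { add := by
        intro σ σ' p hσ hσ' _
        have h1 := D.isCovariantDerivativeOnUniv.add (CylBundle.mdiff_slice hσ)
          (CylBundle.mdiff_slice hσ')
        have h2 := CylBundle.vertDeriv_add hσ hσ'
        ext u
        change D (CylBundle.slice σ p.2 + CylBundle.slice σ' p.2) p.1 u.1 +
            (u.2 : ℝ) • CylBundle.vertDeriv F (σ + σ') p =
          (D (CylBundle.slice σ p.2) p.1 u.1 + (u.2 : ℝ) • CylBundle.vertDeriv F σ p) +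
          (D (CylBundle.slice σ' p.2) p.1 u.1 + (u.2 : ℝ) • CylBundle.vertDeriv F σ' p)
        rw [h1, h2, smul_add]
        exact add_add_add_comm _ _ _ _
      leibniz := by
        intro σ g p hσ hg _
        have hg1 : MDifferentiableAt I 𝓘(ℝ, ℝ) (fun y : M ↦ g (y, p.2)) p.1 :=
          MDifferentiableAt.comp (x := p.1) (f := fun y : M ↦ (y, p.2)) (g := g) hg
            (mdifferentiableAt_id.prodMk mdifferentiableAt_const)
        have hg2 : MDifferentiableAt 𝓘(ℝ, ℝ) 𝓘(ℝ, ℝ) (fun s : ℝ ↦ g (p.1, s)) p.2 :=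
          MDifferentiableAt.comp (x := p.2) (f := fun s : ℝ ↦ (p.1, s)) (g := g) hg
            (mdifferentiableAt_const.prodMk mdifferentiableAt_id)
        have h1 := D.isCovariantDerivativeOnUniv.leibniz (CylBundle.mdiff_slice hσ) hg1
        have h2 := CylBundle.vertDeriv_smul hσ (mdifferentiableAt_iff_differentiableAt.1 hg2)
        ext u
        have h3 : mvfderiv (I.prod 𝓘(ℝ, ℝ)) g p u =
            mvfderiv I (fun y : M ↦ g (y, p.2)) p.1 u.1 +
              u.2 * deriv (fun s : ℝ ↦ g (p.1, s)) p.2 := by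
          refine (mfderiv_prod_eq_add_apply hg).trans (congrArg _ ?_)
          rw [mfderiv_eq_fderiv]
          exact fderiv_eq_smul_deriv _
        change D ((fun y : M ↦ g (y, p.2)) • CylBundle.slice σ p.2) p.1 u.1 +
            (u.2 : ℝ) • CylBundle.vertDeriv F (g • σ) p =
          g p • (D (CylBundle.slice σ p.2) p.1 u.1 + (u.2 : ℝ) • CylBundle.vertDeriv F σ p) +
          mvfderiv (I.prod 𝓘(ℝ, ℝ)) g p u • CylBundle.slice σ p.2 p.1
        rw [h1, h2, h3]
        change g p • D (CylBundle.slice σ p.2) p.1 u.1 +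
          mvfderiv I (fun y : M ↦ g (y, p.2)) p.1 u.1 • CylBundle.slice σ p.2 p.1 + _ = _
        module }

end Forms

/-! ## Lorentzian forms and the group `SO(2,1)` -/

section Lorentz

/-- A bilinear form is symmetric of signature `(+, …, +, -)`: there is a vector of negative square
on whose orthogonal complement the form is positive definite. -/
def IsLorentzForm {W : Type*} [AddCommGroup W] (b : W → W → ℝ) : Prop :=
  (∀ u w, b u w = b w u) ∧ ∃ e, b e e < 0 ∧ ∀ u, u ≠ 0 → b e u = 0 → 0 < b u u

/-- `A` lies in the identity component of the isometry group of the Lorentzian form `b`: it is an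
isometry of determinant one that preserves each of the two cones of timelike vectors. For `b` of
signature `(2,1)` this group is `PSL(2, ℝ)`. -/
def IsSO21 {W : Type*} [AddCommGroup W] [Module ℝ W] (b : W → W → ℝ) (A : W →ₗ[ℝ] W) : Prop :=
  (∀ u w, b (A u) (A w) = b u w) ∧ LinearMap.det A = 1 ∧ ∀ u, b u u < 0 → b (A u) u < 0

variable {EM : Type*} [NormedAddCommGroup EM] [NormedSpace ℝ EM]
  {H : Type*} [TopologicalSpace H] (I : ModelWithCorners ℝ EM H)
  {M : Type*} [TopologicalSpace M] [ChartedSpace H M]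
  (F : Type*) [NormedAddCommGroup F] [NormedSpace ℝ F]
  (V : M → Type*) [TopologicalSpace (TotalSpace F V)]
  [∀ x, AddCommGroup (V x)] [∀ x, Module ℝ (V x)] [∀ x, TopologicalSpace (V x)]
  [∀ x, IsTopologicalAddGroup (V x)] [∀ x, ContinuousSMul ℝ (V x)]
  [FiberBundle F V] [VectorBundle ℝ F V]

/-- A smooth Lorentzian metric on the vector bundle `V`. -/
structure LorentzMetric where
  inner (x : M) : V x →L[ℝ] V x →L[ℝ] ℝ
  isLorentz (x : M) : IsLorentzForm (fun u w : V x ↦ inner x u w)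
  contMDiff : ContMDiff I (I.prod 𝓘(ℝ, F →L[ℝ] F →L[ℝ] ℝ)) ∞
    (fun x ↦ TotalSpace.mk' (F →L[ℝ] F →L[ℝ] ℝ) x (inner x))

variable {I F V}

/-- The bilinear form of a Lorentzian metric. -/
def LorentzMetric.form (h : LorentzMetric I F V) (x : M) (u w : V x) : ℝ := h.inner x u w

/-- The pulled back Lorentzian metric on `π^*V`. -/
def LorentzMetric.cylForm (h : LorentzMetric I F V) (p : M × ℝ) (u w : CylBundle I V p) : ℝ :=
  h.form p.1 u w

/-- `(V, h)` is isomorphic to `TM ⊕ ℝ` as a bundle with Lorentzian structure group, with `TM`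
spacelike and `ℝ` timelike (`V` having rank `dim M + 1`). -/
def LorentzMetric.IsTangentPlusLine [IsManifold I ∞ M] (h : LorentzMetric I F V) : Prop :=
  ∃ (ι : OneForm I F V) (e : SmoothSec I F V),
    (∀ x (u : TangentSpace I x), u ≠ 0 → 0 < h.form x (ι x u) (ι x u)) ∧
    (∀ x, h.form x (e x) (e x) < 0) ∧
    ∀ x (u : TangentSpace I x), h.form x (e x) (ι x u) = 0

end Lorentz

/-! ## `ISO(2,1)` connections -/

section Affine

variable {EM : Type*} [NormedAddCommGroup EM] [NormedSpace ℝ EM]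
  {H : Type*} [TopologicalSpace H] {I : ModelWithCorners ℝ EM H}
  {M : Type*} [TopologicalSpace M] [ChartedSpace H M] [IsManifold I ∞ M]
  {F : Type*} [NormedAddCommGroup F] [NormedSpace ℝ F]
  {V : M → Type*} [TopologicalSpace (TotalSpace F V)]
  [∀ x, AddCommGroup (V x)] [∀ x, Module ℝ (V x)] [∀ x, TopologicalSpace (V x)]
  [∀ x, IsTopologicalAddGroup (V x)] [∀ x, ContinuousSMul ℝ (V x)]
  [FiberBundle F V] [VectorBundle ℝ F V]

variable (I F V) in
/-- An affine connection on the affine bundle underlying `V` (that is, `V` with the origins of its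
fibres forgotten): it differentiates sections of the affine bundle to `V`-valued one-forms, and
`∇^(s + v) = ∇^ s + ∇ v` for its linear part `∇`, a linear connection on `V`. -/
structure AffineConnection where
  toFun : (Π x : M, V x) → (Π x : M, TangentSpace I x →L[ℝ] V x)
  linearPart : CovariantDerivative I F V
  map_add (s v : Π x : M, V x) (x : M) :
    MDifferentiableAt I (I.prod 𝓘(ℝ, F)) (fun y ↦ TotalSpace.mk' F y (s y)) x →
    MDifferentiableAt I (I.prod 𝓘(ℝ, F)) (fun y ↦ TotalSpace.mk' F y (v y)) x →
    toFun (s + v) x = toFun s x + linearPart v x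

/-- The affine connection `∇ + ξ`, where the one-form `ξ` acts by translations. -/
def CovariantDerivative.addTranslation (D : CovariantDerivative I F V) (ξ : OneForm I F V) :
    AffineConnection I F V where
  toFun s x := D s x + ξ x
  linearPart := D
  map_add s v x hs hv := by
    rw [D.isCovariantDerivativeOnUniv.add hs hv]
    abel

/-- An affine connection is an `ISO(2,1)` connection if its linear part is an `SO(2,1)`
connection, that is, preserves the Lorentzian form `b`. -/
def AffineConnection.IsISO (A : AffineConnection I F V) (b : Π x, V x → V x → ℝ) : Prop :=
  IsMetricOn F A.linearPart b univ

/-- The curvature of an affine connection vanishes: for every section `s`,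
`∇_X (∇^_Y s) - ∇_Y (∇^_X s) - ∇^_{[X, Y]} s = 0`, `∇` being the linear part of `∇^`. -/
def AffineConnection.IsFlat (A : AffineConnection I F V) : Prop :=
  ∀ (X Y : VField I M) (s : SmoothSec I F V) (x : M),
    A.linearPart (fun y ↦ A.toFun s y (Y y)) x (X x) -
      A.linearPart (fun y ↦ A.toFun s y (X y)) x (Y x) -
      A.toFun s x (VectorField.mlieBracket I X Y x) = 0

/-- Gauge equivalence of affine connections under the `ISO(2,1)` gauge group: there is a smooth
automorphism `γ(s) = G s + v` of the affine bundle, with linear part `G` in `SO(2,1)`, such that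
`∇^'(γ s) = G (∇^ s)` for all sections `s`. -/
def AffineConnection.GaugeEquiv (b : Π x, V x → V x → ℝ) (A A' : AffineConnection I F V) : Prop :=
  ∃ (G : EndSec I F V) (v : SmoothSec I F V),
    (∀ x, IsSO21 (b x) (G x : V x →ₗ[ℝ] V x)) ∧
    ∀ (s : SmoothSec I F V) (x : M),
      A'.toFun (fun y ↦ G y (s y) + v y) x = (G x).comp (A.toFun s x)

/-- The flat `ISO(2,1)` connections of the form `∇ + ξ`. -/
abbrev FlatISOConnection (D : CovariantDerivative I F V) (b : Π x, V x → V x → ℝ) : Type _ :=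
  {A : AffineConnection I F V // A.IsISO b ∧ A.IsFlat ∧ ∃ ξ, A = D.addTranslation ξ}

/-- The set of gauge equivalence classes of flat `ISO(2,1)` connections of the form `∇ + ξ`. -/
abbrev GaugeClasses (D : CovariantDerivative I F V) (b : Π x, V x → V x → ℝ) : Type _ :=
  Quot fun A A' : FlatISOConnection D b ↦ AffineConnection.GaugeEquiv b A.1 A'.1

end Affine

/-! ## Singular metrics -/

section Metrics

variable {EM : Type*} [NormedAddCommGroup EM] [NormedSpace ℝ EM]
  {H : Type*} [TopologicalSpace H] {I : ModelWithCorners ℝ EM H}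
  {M : Type*} [TopologicalSpace M] [ChartedSpace H M] [IsManifold I ∞ M]
  {F : Type*} [NormedAddCommGroup F] [NormedSpace ℝ F]
  {V : M → Type*} [TopologicalSpace (TotalSpace F V)]
  [∀ x, AddCommGroup (V x)] [∀ x, Module ℝ (V x)] [∀ x, TopologicalSpace (V x)]
  [∀ x, IsTopologicalAddGroup (V x)] [∀ x, ContinuousSMul ℝ (V x)]
  [FiberBundle F V] [VectorBundle ℝ F V]

/-- The (possibly degenerate) metric `b ∘ (ξ × ξ)` on `TM` defined by the one-form `ξ`. -/
def pulledMetric (b : Π x, V x → V x → ℝ) (ξ : OneForm I F V) (x : M) (u w : TangentSpace I x) :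
    ℝ :=
  b x (ξ x u) (ξ x w)

/-- The connection `ξ⁻¹ ∘ ∇ ∘ ξ` on `TM`, meaningful where `ξ` is invertible. -/
def pulledConnection (D : CovariantDerivative I F V) (ξ : OneForm I F V)
    (X : Π x : M, TangentSpace I x) (x : M) : TangentSpace I x →L[ℝ] TangentSpace I x :=
  (ξ x).inverse.comp (D (fun y ↦ ξ y (X y)) x)

/-- On the open set `U`, the tensor `m` is a flat Lorentzian metric with Levi-Civita connection
`D`. -/
structure IsFlatLorentzOn (m : Π x : M, TangentSpace I x → TangentSpace I x → ℝ)
    (D : (Π x : M, TangentSpace I x) → (Π x : M, TangentSpace I x →L[ℝ] TangentSpace I x))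
    (U : Set M) : Prop where
  isOpen : IsOpen U
  isLorentz : ∀ x ∈ U, IsLorentzForm (m x)
  isConnection : IsCovariantDerivativeOn EM D U
  isMetric : IsMetricOn EM D m U
  isTorsionFree : IsTorsionFreeOn D U
  isFlat : IsFlatOn EM D U

/-- The (possibly degenerate) metric `m` on a three-manifold `M` is inextensible: `M` cannot be
mapped isometrically and diffeomorphically onto a proper open subset of a connected Lorentzian
three-manifold. -/
def IsInextensible (m : Π x : M, TangentSpace I x → TangentSpace I x → ℝ) : Prop :=
  ∀ (N : Type) [TopologicalSpace N] [ChartedSpace (EuclideanSpace ℝ (Fin 3)) N]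
    [IsManifold (𝓡 3) ∞ N] [T2Space N] [SecondCountableTopology N] [ConnectedSpace N]
    (k : LorentzMetric (𝓡 3) (EuclideanSpace ℝ (Fin 3)) (TangentSpace (𝓡 3) : N → Type _))
    (j : M → N), IsLocalDiffeomorph I (𝓡 3) ∞ j → Function.Injective j →
    (∀ x (u w : TangentSpace I x),
      k.form (j x) (mfderiv I (𝓡 3) j x u) (mfderiv I (𝓡 3) j x w) = m x u w) →
    Function.Surjective j

/-- Two closed one-forms present the same pair consisting of a metric `b ∘ (ξ × ξ)` and a
connection `ξ⁻¹ ∘ ∇ ∘ ξ`: they differ by an isometric bundle automorphism `A` of `(V, b)` that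
commutes with `∇`. -/
def SameMetric (D : CovariantDerivative I F V) (b : Π x, V x → V x → ℝ) (ξ ξ' : OneForm I F V) :
    Prop :=
  ∃ A : EndSec I F V, (∀ x (u w : V x), b x (A x u) (A x w) = b x u w) ∧
    (∀ (s : SmoothSec I F V) (x : M), D (fun y ↦ A y (s y)) x = (A x).comp (D s x)) ∧
    ∀ x, ξ' x = (A x).comp (ξ x)

/-- Equivalence classes of the flat singular metrics `b ∘ (ξ × ξ)`, `∇`-closed `ξ`, with the
property `P`: forms presenting the same metric are identified, and metrics are equivalent if their
forms differ by some `∇v`. -/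
abbrev MetricClasses (D : CovariantDerivative I F V) (b : Π x, V x → V x → ℝ)
    (P : (Π x : M, TangentSpace I x → TangentSpace I x → ℝ) → Prop) : Type _ :=
  Quot fun ξ ξ' : {ξ : closedForms D // P (pulledMetric b ξ.1)} ↦
    SameMetric D b ξ.1.1 ξ'.1.1 ∨ ξ'.1.1 - ξ.1.1 ∈ exactForms D

end Metrics

/-! ## Riemann surfaces and their genus -/

section Surface

variable {EM : Type*} [NormedAddCommGroup EM] [NormedSpace ℝ EM]
  {H : Type*} [TopologicalSpace H] (I : ModelWithCorners ℝ EM H)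
  (M : Type*) [TopologicalSpace M] [ChartedSpace H M]

/-- The exterior derivative of functions as a connection on the trivial line bundle. -/
def trivialConnection : CovariantDerivative I ℝ (Bundle.Trivial M ℝ) where
  toFun f x := mvfderiv I (fun y ↦ (f y : ℝ)) x
  isCovariantDerivativeOnUniv :=
    { add := fun hf hf' _ ↦ mvfderiv_add (I := I) ((mdifferentiableAt_section _ _).1 hf)
        ((mdifferentiableAt_section _ _).1 hf')
      leibniz := fun hf hg _ ↦ mvfderiv_smul (I := I) hg ((mdifferentiableAt_section _ _).1 hf) }

/-- A Riemann surface is a smooth real surface. -/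
instance RiemannSurface.isManifold_real (S : Type*) [TopologicalSpace S] [ChartedSpace ℂ S]
    [IsManifold 𝓘(ℂ) ω S] : IsManifold 𝓘(ℝ, ℂ) ∞ S :=
  isManifold_of_contDiffOn _ _ _ fun e e' he he' ↦ by
    have h := (contDiffGroupoid ω 𝓘(ℂ)).compatible he he'
    rw [contDiffGroupoid, mem_groupoid_of_pregroupoid] at h
    exact (h.1.restrict_scalars ℝ).of_le le_top

/-- A compact connected Riemann surface has genus `g` if its first de Rham cohomology has
dimension `2g`. -/
def HasGenus (S : Type*) [TopologicalSpace S] [ChartedSpace ℂ S] [IsManifold 𝓘(ℂ) ω S]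
    (g : ℕ) : Prop :=
  Module.finrank ℝ (TwistedH1 (trivialConnection 𝓘(ℝ, ℂ) S)) = 2 * g

end Surface

end

/-! A smooth flat connection has local parallel frames (`exists_flatFrame`, resting on the
Frobenius-type theorem `exists_parallel`). In such a frame the connection is componentwise
differentiation, so the Poincaré lemma and all curvature identities become statements about
vector-valued functions, and anything with constant coefficients is parallel.

Irreducibility enters through one principle, `IsParallelFamily.eq_bot_or_eq_top`: a family of
subspaces that is constant in parallel frames is zero or everything. An endomorphism over the
cylinder commuting with the connection has a real eigenvalue because the rank is odd, its
eigenspaces form such a family, and so it is a scalar (`exists_scalar_of_commute`). The linear part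
of a gauge transformation between two connections `D + ξ` commutes with `D`; determinant one forces
the scalar to be one, only translations by sections `v` remain, and they change `ξ` by `Dv`. Hence
gauge classes are cohomology classes. For an isometry the scalar is `±1`, which is the source of the
`ℤ₂`. If `ξ` is invertible and `ξ'` has the same metric, then `ξ' ∘ ξ⁻¹` is an isometry, and
uniqueness of the Levi-Civita connection makes it commute with `D`
(`sameMetric_of_pulledMetric_eq`).

Inextensibility excludes no class: every class contains a form pulled back from the surface
(`exists_cohomologous_cylPull`). Its metric is degenerate along the line direction, so it cannot be
isometric to an open part of any Lorentzian manifold.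

For the dimension, the projection induces an isomorphism of cohomology, so the count takes place on
the surface. A Mayer–Vietoris induction over a good cover shows that the Euler characteristic of a
flat bundle is its rank times that of the trivial line (`exists_hasEuler_univ`). For the trivial
line the Betti numbers are `1, 2g, 1`. For the irreducible bundle of rank three, degree zero
vanishes since a parallel section spans a parallel family. Degree two vanishes by duality without a
dual bundle: the vectors killed by a functional on top classes form a parallel family (`killed`),
non-zero as soon as the rank exceeds one. So `-h¹ = 3 (2 - 2g)`. The value one in top degree for the
trivial line combines the same argument with Stokes' theorem, where the orientation comes from the
complex structure. -/

noncomputable section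
-- Coordinate vector fields and local smoothness of sections.
section Toolkit

variable {EM : Type*} [NormedAddCommGroup EM] [NormedSpace ℝ EM] [FiniteDimensional ℝ EM]
  {H : Type*} [TopologicalSpace H] {I : ModelWithCorners ℝ EM H} [I.Boundaryless]
  {M : Type*} [TopologicalSpace M] [ChartedSpace H M] [IsManifold I ∞ M]

variable (I) in
/-- The coordinate vector field of the chart at `q` in the direction `u`. -/
def coordField (q : M) (u : EM) (y : M) : TangentSpace I y :=
  VectorField.mpullback I 𝓘(ℝ, EM) (extChartAt I q) (fun _ ↦ u) y

lemma coordField_def (q : M) (u : EM) (y : M) :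
    coordField I q u y = (mfderiv I 𝓘(ℝ, EM) (extChartAt I q) y).inverse u := rfl

lemma mfderiv_extChartAt_coordField {q y : M} (hy : y ∈ (chartAt H q).source) (u : EM) :
    mfderiv I 𝓘(ℝ, EM) (extChartAt I q) y (coordField I q u y) = u := by
  have h := isInvertible_mfderiv_extChartAt (I := I) (x := q) (y := y) (by simpa using hy)
  obtain ⟨e, he⟩ := h
  rw [coordField_def, ← he, ContinuousLinearMap.inverse_equiv]
  exact e.apply_symm_apply u

lemma coordField_mfderiv {q y : M} (hy : y ∈ (chartAt H q).source) (w : TangentSpace I y) :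
    coordField I q (mfderiv I 𝓘(ℝ, EM) (extChartAt I q) y w) y = w := by
  have h := isInvertible_mfderiv_extChartAt (I := I) (x := q) (y := y) (by simpa using hy)
  obtain ⟨e, he⟩ := h
  refine (coordField_def q _ y).trans ?_
  rw [← he, ContinuousLinearMap.inverse_equiv]
  exact e.symm_apply_apply w

lemma coordField_add (q : M) (u v : EM) (y : M) :
    coordField I q (u + v) y = coordField I q u y + coordField I q v y := by
  simp only [coordField_def]; exact map_add _ _ _

lemma coordField_smul (q : M) (c : ℝ) (u : EM) (y : M) :
    coordField I q (c • u) y = c • coordField I q u y := by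
  simp only [coordField_def]; exact map_smul _ _ _

lemma contMDiff_constField (u : EM) : ContMDiff 𝓘(ℝ, EM) (𝓘(ℝ, EM).prod 𝓘(ℝ, EM)) ∞
    (fun x : EM ↦ TotalSpace.mk' EM (E := TangentSpace 𝓘(ℝ, EM)) x u) := by
  intro z
  refine (contMDiffAt_section (F := EM) (E := TangentSpace 𝓘(ℝ, EM)) (n := ∞)
    (s := fun _ ↦ u) z).2 ?_
  refine (contMDiffAt_const (c := u)).congr_of_eventuallyEq (Filter.Eventually.of_forall fun y ↦ ?_)
  simp

lemma contMDiffAt_coordField {q y : M} (hy : y ∈ (chartAt H q).source) (u : EM) :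
    ContMDiffAt I (I.prod 𝓘(ℝ, EM)) ∞ (fun x ↦ TotalSpace.mk' EM x (coordField I q u x)) y := by
  have hy' : y ∈ (extChartAt I q).source := by simpa using hy
  refine ContMDiffAt.mpullback_vectorField_preimage (n := ∞) (m := ∞) (I' := 𝓘(ℝ, EM)) ?_
    (contMDiffAt_extChartAt' hy) (isInvertible_mfderiv_extChartAt hy') (by simp)
  exact contMDiff_constField u _

/-- Coordinate fields are pull-backs of constant fields under the chart, and pull-back preserves
brackets. -/
lemma mlieBracket_coordField {q y : M} (hy : y ∈ (chartAt H q).source) (u v : EM) :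
    VectorField.mlieBracket I (coordField I q u) (coordField I q v) y = 0 := by
  have hc : ∀ w : EM, MDifferentiableAt 𝓘(ℝ, EM) (𝓘(ℝ, EM).prod 𝓘(ℝ, EM))
      (fun x : EM ↦ TotalSpace.mk' EM (E := TangentSpace 𝓘(ℝ, EM)) x w) (extChartAt I q y) :=
    fun w ↦ (contMDiff_constField w).mdifferentiable (by simp) _
  have hI : IsManifold I (minSmoothness ℝ 2) M := by
    rw [minSmoothness_of_isRCLikeNormedField]; infer_instance
  have hI3 : IsManifold I (minSmoothness ℝ 3) M := by
    rw [minSmoothness_of_isRCLikeNormedField]; infer_instance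
  have h := VectorField.mpullback_mlieBracket (I := I) (I' := 𝓘(ℝ, EM)) (n := ∞)
    (f := extChartAt I q) (V := fun _ ↦ u) (W := fun _ ↦ v) (x₀ := y) (hc u) (hc v)
    (contMDiffAt_extChartAt' hy)
    (by rw [minSmoothness_of_isRCLikeNormedField]; exact ENat.LEInfty.out)
  refine h.symm.trans ?_
  have h0 : VectorField.mlieBracket 𝓘(ℝ, EM) (fun _ : EM ↦ u) (fun _ ↦ v) = 0 := by
    refine (VectorField.mlieBracketWithin_univ (I := 𝓘(ℝ, EM))).symm.trans ?_
    refine VectorField.mlieBracketWithin_eq_lieBracketWithin.trans ?_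
    ext x
    simp [VectorField.lieBracketWithin]
    rfl
  refine (congrArg (fun W ↦ VectorField.mpullback I 𝓘(ℝ, EM) (extChartAt I q) W y) h0).trans ?_
  exact map_zero (mfderiv I 𝓘(ℝ, EM) (extChartAt I q) y).inverse

lemma extChartAt_target_mem_nhds'' {q : M} {z : EM} (hz : z ∈ (extChartAt I q).target) :
    (extChartAt I q).target ∈ 𝓝 z := (isOpen_extChartAt_target q).mem_nhds hz

lemma mvfderiv_coordField {G : Type*} [NormedAddCommGroup G] [NormedSpace ℝ G] {q y : M}
    (hy : y ∈ (chartAt H q).source) {f : M → G}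
    (hf : MDifferentiableAt I 𝓘(ℝ, G) f y) (u : EM) :
    mvfderiv I f y (coordField I q u y) =
      fderiv ℝ (f ∘ (extChartAt I q).symm) (extChartAt I q y) u := by
  have hy' : y ∈ (extChartAt I q).source := by simpa using hy
  have ht := (extChartAt I q).map_source hy'
  have hs : MDifferentiableAt 𝓘(ℝ, EM) I (extChartAt I q).symm (extChartAt I q y) :=
    ((contMDiffOn_extChartAt_symm (n := ∞) q).contMDiffAt
      (extChartAt_target_mem_nhds'' ht)).mdifferentiableAt (by simp)
  have hg : MDifferentiableAt 𝓘(ℝ, EM) 𝓘(ℝ, G) (f ∘ (extChartAt I q).symm) (extChartAt I q y) := by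
    refine MDifferentiableAt.comp _ (I' := I) ?_ hs
    rwa [(extChartAt I q).left_inv hy']
  have he : f =ᶠ[𝓝 y] (f ∘ (extChartAt I q).symm) ∘ extChartAt I q := by
    filter_upwards [extChartAt_source_mem_nhds' (I := I) hy'] with x hx
    exact congrArg f ((extChartAt I q).left_inv hx).symm
  have h1 : mfderiv I 𝓘(ℝ, G) f y = (mfderiv 𝓘(ℝ, EM) 𝓘(ℝ, G) (f ∘ (extChartAt I q).symm)
      (extChartAt I q y)).comp (mfderiv I 𝓘(ℝ, EM) (extChartAt I q) y) := by
    rw [he.mfderiv_eq]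
    exact mfderiv_comp y hg ((contMDiffAt_extChartAt' hy).mdifferentiableAt (n := ∞) (by simp))
  have h2 : mvfderiv I f y (coordField I q u y) =
    mfderiv I 𝓘(ℝ, G) f y (coordField I q u y) := rfl
  rw [h2, h1, mfderiv_eq_fderiv]
  exact congrArg _ (mfderiv_extChartAt_coordField hy u)

lemma contMDiffAt_comp_extChartAt {G : Type*} [NormedAddCommGroup G] [NormedSpace ℝ G] {q y : M}
    (hy : y ∈ (chartAt H q).source) {f : EM → G} (hf : ContDiffAt ℝ ∞ f (extChartAt I q y)) :
    ContMDiffAt I 𝓘(ℝ, G) ∞ (fun x ↦ f (extChartAt I q x)) y :=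
  hf.contMDiffAt.comp y (contMDiffAt_extChartAt' hy)

lemma contDiffAt_comp_extChartAt_symm {G : Type*} [NormedAddCommGroup G] [NormedSpace ℝ G]
    {q y : M} (hy : y ∈ (chartAt H q).source) {f : M → G} (hf : ContMDiffAt I 𝓘(ℝ, G) ∞ f y) :
    ContDiffAt ℝ ∞ (f ∘ (extChartAt I q).symm) (extChartAt I q y) := by
  have hy' : y ∈ (extChartAt I q).source := by simpa using hy
  have ht := (extChartAt I q).map_source hy'
  rw [← contMDiffAt_iff_contDiffAt]
  refine ContMDiffAt.comp _ (I' := I) ?_ ((contMDiffOn_extChartAt_symm (n := ∞) q).contMDiffAt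
      (extChartAt_target_mem_nhds'' ht))
  rwa [(extChartAt I q).left_inv hy']

section Bundle

variable {F : Type*} [NormedAddCommGroup F] [NormedSpace ℝ F]
  {V : M → Type*} [TopologicalSpace (TotalSpace F V)]
  [∀ x, AddCommGroup (V x)] [∀ x, Module ℝ (V x)] [∀ x, TopologicalSpace (V x)]
  [∀ x, IsTopologicalAddGroup (V x)] [∀ x, ContinuousSMul ℝ (V x)]
  [FiberBundle F V] [VectorBundle ℝ F V]

variable (I F) in
/-- Smoothness of a section of `V` at a point. -/
abbrev SmoothAt (s : Π x, V x) (x : M) : Prop :=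
  ContMDiffAt I (I.prod 𝓘(ℝ, F)) ∞ (fun y ↦ TotalSpace.mk' F y (s y)) x

variable (I F) in
/-- Smoothness of a `V`-valued one-form at a point. -/
abbrev FormSmoothAt (ξ : Π x : M, TangentSpace I x →L[ℝ] V x) (x : M) : Prop :=
  SmoothAt I (EM →L[ℝ] F) (V := fun x : M ↦ TangentSpace I x →L[ℝ] V x) ξ x

lemma SmoothAt.congr {s s' : Π x, V x} {x : M} (h : SmoothAt I F s x) (e : ∀ᶠ y in 𝓝 x, s' y = s y) :
    SmoothAt I F s' x :=
  ContMDiffAt.congr_of_eventuallyEq h (e.mono fun y hy ↦ by simp [hy])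

lemma SmoothAt.mdiff {s : Π x, V x} {x : M} (h : SmoothAt I F s x) :
    MDifferentiableAt I (I.prod 𝓘(ℝ, F)) (fun y ↦ TotalSpace.mk' F y (s y)) x :=
  ContMDiffAt.mdifferentiableAt h (by simp)

lemma ContMDiffSection.smoothAt (s : SmoothSec I F V) (x : M) : SmoothAt I F s x :=
  s.contMDiff x

lemma SmoothAt.add {s t : Π x, V x} {x : M} (hs : SmoothAt I F s x) (ht : SmoothAt I F t x) :
    SmoothAt I F (fun y ↦ s y + t y) x := ContMDiffAt.add_section hs ht

lemma SmoothAt.sub {s t : Π x, V x} {x : M} (hs : SmoothAt I F s x) (ht : SmoothAt I F t x) :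
    SmoothAt I F (fun y ↦ s y - t y) x := ContMDiffAt.sub_section hs ht

lemma SmoothAt.smul {f : M → ℝ} {t : Π x, V x} {x : M} (hf : ContMDiffAt I 𝓘(ℝ) ∞ f x)
    (ht : SmoothAt I F t x) : SmoothAt I F (fun y ↦ f y • t y) x := ContMDiffAt.smul_section hf ht

lemma SmoothAt.const_smul {t : Π x, V x} {x : M} (c : ℝ)
    (ht : SmoothAt I F t x) : SmoothAt I F (fun y ↦ c • t y) x :=
  SmoothAt.smul contMDiffAt_const ht

lemma SmoothAt.zero {x : M} : SmoothAt I F (fun y ↦ (0 : V y)) x :=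
  (contMDiff_zeroSection ℝ V).contMDiffAt

lemma SmoothAt.sum {ι : Type*} (J : Finset ι) {t : ι → Π x, V x} {x : M}
    (ht : ∀ i ∈ J, SmoothAt I F (t i) x) : SmoothAt I F (fun y ↦ ∑ i ∈ J, t i y) x :=
  ContMDiffAt.sum_section ht

lemma FormSmoothAt.apply {ξ : Π x : M, TangentSpace I x →L[ℝ] V x} {X : Π x : M, TangentSpace I x}
    {x : M} (hξ : FormSmoothAt I F ξ x) (hX : SmoothAt I EM X x) :
    SmoothAt I F (fun y ↦ ξ y (X y)) x :=
  ContMDiffAt.clm_bundle_apply hξ hX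

/-- Smooth sections near a point extend to smooth sections. -/
lemma exists_smoothSec_eventuallyEq [T2Space M] {s : Π x, V x} {x : M} {U : Set M} (hU : IsOpen U)
    (hx : x ∈ U) (hs : ∀ y ∈ U, SmoothAt I F s y) :
    ∃ s' : SmoothSec I F V, ∀ᶠ y in 𝓝 x, s' y = s y := by
  -- The closed support of the bump function lies in `U`, so off it the product is locally zero,
  -- however wild `s` is outside `U`.
  obtain ⟨f, -, hf⟩ := (SmoothBumpFunction.nhds_basis_tsupport (I := I) x).mem_iff.1
    (hU.mem_nhds hx)
  refine ⟨⟨fun y ↦ f y • s y, fun y ↦ ?_⟩, ?_⟩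
  · by_cases hy : y ∈ tsupport f
    · exact SmoothAt.smul f.contMDiffAt (hs y (hf hy))
    · refine SmoothAt.congr (s := fun y ↦ (0 : V y)) SmoothAt.zero ?_
      filter_upwards [(isClosed_tsupport f).isOpen_compl.mem_nhds hy] with z hz
      rw [image_eq_zero_of_notMem_tsupport hz, zero_smul]
  · filter_upwards [f.eventuallyEq_one] with y hy
    show f y • s y = s y
    rw [hy, Pi.one_apply, one_smul]

end Bundle

end Toolkit
end

/-! ### Testing smoothness of homomorphisms and one-forms on sections. -/

noncomputable section
section Toolkit2

variable {EM : Type*} [NormedAddCommGroup EM] [NormedSpace ℝ EM] [FiniteDimensional ℝ EM]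
  {H : Type*} [TopologicalSpace H] {I : ModelWithCorners ℝ EM H} [I.Boundaryless]
  {M : Type*} [TopologicalSpace M] [ChartedSpace H M] [IsManifold I ∞ M]

/-- In finite dimension an operator is the sum of its values on a basis tensored with the dual
basis, so smoothness of the values suffices. -/
lemma contMDiffAt_clm_of_apply {F₁ F₂ : Type*} [NormedAddCommGroup F₁] [NormedSpace ℝ F₁]
    [FiniteDimensional ℝ F₁] [NormedAddCommGroup F₂] [NormedSpace ℝ F₂] {L : M → F₁ →L[ℝ] F₂}
    {x : M} (h : ∀ u, ContMDiffAt I 𝓘(ℝ, F₂) ∞ (fun y ↦ L y u) x) :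
    ContMDiffAt I 𝓘(ℝ, F₁ →L[ℝ] F₂) ∞ L x := by
  let b := Module.finBasis ℝ F₁
  have e : L = fun y ↦ ∑ i, ContinuousLinearMap.smulRightL ℝ F₁ F₂
      (LinearMap.toContinuousLinearMap (b.coord i)) (L y (b i)) := by
    funext y
    refine ContinuousLinearMap.coe_injective (b.ext fun j ↦ ?_)
    simp [Finsupp.single_apply]
  rw [e]
  refine contMDiffAt_finsetSum fun i _ ↦ ?_
  exact (ContinuousLinearMap.contMDiff _).contMDiffAt.comp x (h (b i))

/-- The derivative of a smooth function along a smooth vector field is smooth. -/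
lemma contMDiffAt_mvfderiv_apply {G : Type*} [NormedAddCommGroup G] [NormedSpace ℝ G] {x : M}
    {f : M → G} (hf : ContMDiffAt I 𝓘(ℝ, G) ∞ f x) {X : Π x : M, TangentSpace I x}
    (hX : SmoothAt I EM X x) :
    ContMDiffAt I 𝓘(ℝ, G) ∞ (fun y ↦ mvfderiv I f y (X y)) x := by
  have h := ContMDiffAt.mfderiv_const (m := ∞) hf (by simp)
  have h2 := ContMDiffAt.clm_apply_of_inCoordinates (E₂ := TangentSpace 𝓘(ℝ, G)) (F₂ := G)
    (b₂ := f) h hX hf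
  have h3 := (contMDiffAt_totalSpace.1 h2).2
  refine h3.congr_of_eventuallyEq (Filter.Eventually.of_forall fun y ↦ ?_)
  simp
  rfl

section HomBundle

variable {F₁ : Type*} [NormedAddCommGroup F₁] [NormedSpace ℝ F₁] [FiniteDimensional ℝ F₁]
  {E₁ : M → Type*} [TopologicalSpace (TotalSpace F₁ E₁)]
  [∀ x, AddCommGroup (E₁ x)] [∀ x, Module ℝ (E₁ x)] [∀ x, TopologicalSpace (E₁ x)]
  [∀ x, IsTopologicalAddGroup (E₁ x)] [∀ x, ContinuousSMul ℝ (E₁ x)]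
  [FiberBundle F₁ E₁] [VectorBundle ℝ F₁ E₁] [ContMDiffVectorBundle ∞ F₁ E₁ I]
  {F : Type*} [NormedAddCommGroup F] [NormedSpace ℝ F]
  {V : M → Type*} [TopologicalSpace (TotalSpace F V)]
  [∀ x, AddCommGroup (V x)] [∀ x, Module ℝ (V x)] [∀ x, TopologicalSpace (V x)]
  [∀ x, IsTopologicalAddGroup (V x)] [∀ x, ContinuousSMul ℝ (V x)]
  [FiberBundle F V] [VectorBundle ℝ F V]

lemma smoothAt_trivialization_symm (x : M) (u : F₁) :
    SmoothAt I F₁ (fun y ↦ (trivializationAt F₁ E₁ x).symm y u) x := by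
  refine (contMDiffAt_section _).2 ?_
  refine (contMDiffAt_const (c := u)).congr_of_eventuallyEq ?_
  filter_upwards [(trivializationAt F₁ E₁ x).open_baseSet.mem_nhds
    (mem_baseSet_trivializationAt F₁ E₁ x)] with y hy
  rw [Trivialization.apply_mk_symm _ hy]

/-- A bundle homomorphism is smooth if it maps smooth sections to smooth sections. -/
lemma smoothAt_hom_of_apply {φ : Π x : M, E₁ x →L[ℝ] V x} {x : M}
    (h : ∀ σ : Π x, E₁ x, SmoothAt I F₁ σ x → SmoothAt I F (fun y ↦ φ y (σ y)) x) :
    SmoothAt I (F₁ →L[ℝ] F) (V := fun x : M ↦ E₁ x →L[ℝ] V x) φ x := by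
  refine contMDiffAt_hom_bundle _ |>.2 ⟨contMDiffAt_id, contMDiffAt_clm_of_apply fun u ↦ ?_⟩
  have h1 := (contMDiffAt_section _).1 (h _ (smoothAt_trivialization_symm x u))
  refine h1.congr_of_eventuallyEq ?_
  filter_upwards [(trivializationAt F₁ E₁ x).open_baseSet.mem_nhds
    (mem_baseSet_trivializationAt F₁ E₁ x), (trivializationAt F V x).open_baseSet.mem_nhds
    (mem_baseSet_trivializationAt F V x)] with y hy hy'
  show ContinuousLinearMap.inCoordinates F₁ E₁ F V x y x y (φ y) u = _
  rw [ContinuousLinearMap.inCoordinates_eq hy hy']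
  simp

lemma coordField_sum {ι : Type*} [Fintype ι] (b : Module.Basis ι ℝ EM) {q y : M}
    (hy : y ∈ (chartAt H q).source) (w : TangentSpace I y) :
    w = ∑ i, b.repr (mvfderiv I (extChartAt I q) y w) i • coordField I q (b i) y := by
  conv_lhs => rw [← coordField_mfderiv hy w]
  have h : ∀ v : EM, coordField I q v y = ∑ i, b.repr v i • coordField I q (b i) y := by
    intro v
    let L : EM →ₗ[ℝ] TangentSpace I y :=
      { toFun := fun u ↦ coordField I q u y
        map_add' := fun u v ↦ coordField_add q u v y
        map_smul' := fun c u ↦ coordField_smul q c u y }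
    show L v = ∑ i, b.repr v i • L (b i)
    conv_lhs => rw [← b.sum_repr v]
    rw [map_sum]
    exact Finset.sum_congr rfl fun i _ ↦ map_smul _ _ _
  exact h _

/-- The coordinate fields are a local frame, and the coefficients of a smooth field in it are
derivatives of the chart, hence smooth. -/
lemma formSmoothAt_of_coordField {ξ : Π x : M, TangentSpace I x →L[ℝ] V x} {q x : M}
    (hx : x ∈ (chartAt H q).source)
    (h : ∀ u, SmoothAt I F (fun y ↦ ξ y (coordField I q u y)) x) : FormSmoothAt I F ξ x := by
  refine smoothAt_hom_of_apply fun X hX ↦ ?_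
  let b := Module.finBasis ℝ EM
  have h1 : SmoothAt I F (fun y ↦ ∑ i, b.repr (mvfderiv I (extChartAt I q) y (X y)) i •
      ξ y (coordField I q (b i) y)) x := by
    refine SmoothAt.sum _ fun i _ ↦ SmoothAt.smul ?_ (h (b i))
    exact (ContinuousLinearMap.contMDiff
      (LinearMap.toContinuousLinearMap (b.coord i))).contMDiffAt.comp x
      (contMDiffAt_mvfderiv_apply (contMDiffAt_extChartAt' hx) hX)
  refine h1.congr ?_
  filter_upwards [(chartAt H q).open_source.mem_nhds hx] with y hy
  conv_lhs => rw [coordField_sum b hy (X y)]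
  rw [map_sum]
  refine Finset.sum_congr rfl fun i _ ↦ ?_
  rw [map_smul]

lemma SmoothAt.id {x : M} : SmoothAt I (F₁ →L[ℝ] F₁) (V := fun x : M ↦ E₁ x →L[ℝ] E₁ x)
    (fun y ↦ ContinuousLinearMap.id ℝ (E₁ y)) x :=
  smoothAt_hom_of_apply fun _ h ↦ h

end HomBundle
end Toolkit2
end

/-! ### The Lie bracket as a commutator of derivations. -/

noncomputable section
section Frames

variable {EM : Type*} [NormedAddCommGroup EM] [NormedSpace ℝ EM] [FiniteDimensional ℝ EM]
  {H : Type*} [TopologicalSpace H] {I : ModelWithCorners ℝ EM H} [I.Boundaryless]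
  {M : Type*} [TopologicalSpace M] [ChartedSpace H M] [IsManifold I ∞ M]

lemma mvfderiv_congr {G : Type*} [NormedAddCommGroup G] [NormedSpace ℝ G] {x : M}
    {f g : M → G} (h : f =ᶠ[𝓝 x] g) : mvfderiv I f x = mvfderiv I g x := by
  show (mfderiv I 𝓘(ℝ, G) f x : EM →L[ℝ] G) = mfderiv I 𝓘(ℝ, G) g x
  exact h.mfderiv_eq

/-- The commutator of two vector fields acts on functions as the Lie bracket. -/
lemma mvfderiv_mlieBracket {G : Type*} [NormedAddCommGroup G] [NormedSpace ℝ G] {x : M}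
    {f : M → G} (hf : ∀ᶠ y in 𝓝 x, ContMDiffAt I 𝓘(ℝ, G) ∞ f y)
    {X Y : Π x : M, TangentSpace I x} (hX : SmoothAt I EM X x) (hY : SmoothAt I EM Y x) :
    mvfderiv I (fun y ↦ mvfderiv I f y (Y y)) x (X x) -
      mvfderiv I (fun y ↦ mvfderiv I f y (X y)) x (Y x) =
      mvfderiv I f x (VectorField.mlieBracket I X Y x) := by
  have hI : IsManifold I (minSmoothness ℝ 2) M := by
    rw [minSmoothness_of_isRCLikeNormedField]; infer_instance
  have hI3 : IsManifold I (minSmoothness ℝ 3) M := by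
    rw [minSmoothness_of_isRCLikeNormedField]; infer_instance
  set f' : EM → G := f ∘ (extChartAt I x).symm with hf'
  -- The coordinate expression of a vector field in the chart at `x`.
  let pb : (Π x : M, TangentSpace I x) → EM → EM := fun Z ↦
    VectorField.mpullbackWithin 𝓘(ℝ, EM) I (extChartAt I x).symm Z (range I)
  have hpb : ∀ {Z : Π x : M, TangentSpace I x}, SmoothAt I EM Z x →
      DifferentiableAt ℝ (pb Z) (extChartAt I x x) := by
    intro Z hZ
    have h := MDifferentiableWithinAt.differentiableWithinAt_mpullbackWithin_vectorField
      (s := univ) (hZ.mdiff.mdifferentiableWithinAt)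
    have e : (extChartAt I x).symm ⁻¹' univ ∩ range I = univ := by
      rw [preimage_univ, univ_inter, I.range_eq_univ]
    refine differentiableWithinAt_univ.1 ?_
    rw [← e]
    exact h
  have hval : ∀ Z : Π x : M, TangentSpace I x, ∀ᶠ y in 𝓝 x,
      Z y = coordField I x (pb Z (extChartAt I x y)) y := by
    intro Z
    have h := VectorField.eventuallyEq_mpullback_mpullbackWithin_extChartAt (I := I) (x := x)
      (s := univ) Z
    rw [nhdsWithin_univ] at h
    exact h
  have hd : ∀ᶠ y in 𝓝 x, ∀ Z : Π x : M, TangentSpace I x,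
      Z y = coordField I x (pb Z (extChartAt I x y)) y →
      mvfderiv I f y (Z y) = fderiv ℝ f' (extChartAt I x y) (pb Z (extChartAt I x y)) := by
    filter_upwards [hf, (chartAt H x).open_source.mem_nhds (mem_chart_source H x)] with y hy hy'
    intro Z hZ
    rw [hZ, mvfderiv_coordField hy' (hy.mdifferentiableAt (by simp))]
  have hf2 : ContDiffAt ℝ ∞ f' (extChartAt I x x) :=
    contDiffAt_comp_extChartAt_symm (mem_chart_source H x) hf.self_of_nhds
  have hfd : DifferentiableAt ℝ (fderiv ℝ f') (extChartAt I x x) :=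
    (hf2.fderiv_right (m := ∞) (by simp)).differentiableAt (by simp)
  -- In coordinates `W (Z f) = D²f (W, Z) + Df (DZ W)`. After antisymmetrisation the second
  -- derivative drops out by symmetry and the remainder is `Df` of the coordinate bracket.
  have key : ∀ {Z W : Π x : M, TangentSpace I x}, SmoothAt I EM Z x → SmoothAt I EM W x →
      mvfderiv I (fun y ↦ mvfderiv I f y (Z y)) x (W x) =
        fderiv ℝ (fderiv ℝ f') (extChartAt I x x) (pb W (extChartAt I x x))
          (pb Z (extChartAt I x x)) + fderiv ℝ f' (extChartAt I x x)
          (fderiv ℝ (pb Z) (extChartAt I x x) (pb W (extChartAt I x x))) := by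
    intro Z W hZ hW
    have e : (fun y ↦ mvfderiv I f y (Z y)) =ᶠ[𝓝 x]
        fun y ↦ (fun z ↦ fderiv ℝ f' z (pb Z z)) (extChartAt I x y) := by
      filter_upwards [hd, hval Z] with y h1 h2 using h1 Z h2
    have hdiff : DifferentiableAt ℝ (fun z ↦ fderiv ℝ f' z (pb Z z)) (extChartAt I x x) :=
      hfd.clm_apply (hpb hZ)
    have hm : MDifferentiableAt I 𝓘(ℝ, G)
        (fun y ↦ (fun z ↦ fderiv ℝ f' z (pb Z z)) (extChartAt I x y)) x :=
      MDifferentiableAt.comp x (I' := 𝓘(ℝ, EM)) (g := (fun z ↦ fderiv ℝ f' z (pb Z z)))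
        hdiff.mdifferentiableAt
        ((contMDiffAt_extChartAt (n := ∞)).mdifferentiableAt (by simp))
    have e1 : mvfderiv I (fun y ↦ mvfderiv I f y (Z y)) x (W x) =
        mvfderiv I (fun y ↦ (fun z ↦ fderiv ℝ f' z (pb Z z)) (extChartAt I x y)) x (W x) :=
      congrArg (fun L : TangentSpace I x →L[ℝ] G ↦ L (W x)) (mvfderiv_congr e)
    rw [e1, (hval W).self_of_nhds, mvfderiv_coordField (mem_chart_source H x) hm]
    have e2 : (fun y ↦ (fun z ↦ fderiv ℝ f' z (pb Z z)) (extChartAt I x y)) ∘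
        (extChartAt I x).symm =ᶠ[𝓝 (extChartAt I x x)] (fun z ↦ fderiv ℝ f' z (pb Z z)) := by
      filter_upwards [extChartAt_target_mem_nhds'' (mem_extChartAt_target (I := I) x)] with z hz
      show (fun z ↦ fderiv ℝ f' z (pb Z z)) (extChartAt I x ((extChartAt I x).symm z)) = _
      rw [(extChartAt I x).right_inv hz]
    rw [e2.fderiv_eq, fderiv_clm_apply hfd (hpb hZ)]
    simp [add_comm]
  have hbr : VectorField.mlieBracket I X Y x = coordField I x
      (VectorField.lieBracket ℝ (pb X) (pb Y) (extChartAt I x x)) x := by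
    rw [← VectorField.mlieBracketWithin_univ]
    refine VectorField.mlieBracketWithin_apply.trans ?_
    refine congrArg _ ?_
    rw [preimage_univ, univ_inter, I.range_eq_univ]
    simp only [pb, I.range_eq_univ]
    exact VectorField.lieBracketWithin_univ (𝕜 := ℝ) |> fun h ↦ congrFun h _
  rw [key hY hX, key hX hY, hbr, mvfderiv_coordField (mem_chart_source H x)
    (hf.self_of_nhds.mdifferentiableAt (by simp)), VectorField.lieBracket, map_sub]
  have hs : IsSymmSndFDerivAt ℝ f' (extChartAt I x x) := hf2.isSymmSndFDerivAt (by
    rw [minSmoothness_of_isRCLikeNormedField]; exact ENat.LEInfty.out)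
  rw [hs (pb X (extChartAt I x x)) (pb Y (extChartAt I x x))]
  abel

end Frames
end

/-! ### Frames, their coefficients, and parallel frames. -/

noncomputable section
section FrameCoef

variable {ι : Type*} [Fintype ι]

/-- The vector with the given coefficients. -/
def frameSum {W : Type*} [AddCommGroup W] [Module ℝ W] (e : ι → W) : (ι → ℝ) →ₗ[ℝ] W :=
  Fintype.linearCombination ℝ e

lemma frameSum_apply {W : Type*} [AddCommGroup W] [Module ℝ W] (e : ι → W) (a : ι → ℝ) :
    frameSum e a = ∑ i, a i • e i := rfl

open Classical in
/-- The coefficients of a vector with respect to a basis (zero if `e` is not a basis). -/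
def frameCoef {W : Type*} [AddCommGroup W] [Module ℝ W] (e : ι → W) : W →ₗ[ℝ] (ι → ℝ) :=
  if h : Function.Bijective (frameSum e) then (LinearEquiv.ofBijective _ h).symm.toLinearMap else 0

lemma frameSum_frameCoef {W : Type*} [AddCommGroup W] [Module ℝ W] {e : ι → W}
    (h : Function.Bijective (frameSum e)) (w : W) : frameSum e (frameCoef e w) = w := by
  rw [frameCoef, dif_pos h]
  exact (LinearEquiv.ofBijective _ h).apply_symm_apply w

lemma frameCoef_frameSum {W : Type*} [AddCommGroup W] [Module ℝ W] {e : ι → W}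
    (h : Function.Bijective (frameSum e)) (a : ι → ℝ) : frameCoef e (frameSum e a) = a := by
  rw [frameCoef, dif_pos h]
  exact (LinearEquiv.ofBijective _ h).symm_apply_apply a

end FrameCoef

section Frames

variable {EM : Type*} [NormedAddCommGroup EM] [NormedSpace ℝ EM] [FiniteDimensional ℝ EM]
  {H : Type*} [TopologicalSpace H] {I : ModelWithCorners ℝ EM H} [I.Boundaryless]
  {M : Type*} [TopologicalSpace M] [ChartedSpace H M] [IsManifold I ∞ M]
  {F : Type*} [NormedAddCommGroup F] [NormedSpace ℝ F] [FiniteDimensional ℝ F]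
  {V : M → Type*} [TopologicalSpace (TotalSpace F V)]
  [∀ x, AddCommGroup (V x)] [∀ x, Module ℝ (V x)] [∀ x, TopologicalSpace (V x)]
  [∀ x, IsTopologicalAddGroup (V x)] [∀ x, ContinuousSMul ℝ (V x)]
  [FiberBundle F V] [VectorBundle ℝ F V]
  {ι : Type*} [Fintype ι]

variable (I F) in
/-- A smooth frame of `V` over an open set. -/
structure SmoothFrame (e : ι → Π x : M, V x) (U : Set M) : Prop where
  isOpen : IsOpen U
  smooth : ∀ i, ∀ x ∈ U, SmoothAt I F (e i) x
  bij : ∀ x ∈ U, Function.Bijective (frameSum fun i ↦ e i x)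

namespace SmoothFrame

variable {e : ι → Π x : M, V x} {U : Set M}

lemma mono (h : SmoothFrame I F e U) {U' : Set M} (hU' : IsOpen U') (hs : U' ⊆ U) :
    SmoothFrame I F e U' :=
  ⟨hU', fun i x hx ↦ h.smooth i x (hs hx), fun x hx ↦ h.bij x (hs hx)⟩

lemma smoothAt_sum (h : SmoothFrame I F e U) {x : M} (hx : x ∈ U) {a : M → ι → ℝ}
    (ha : ContMDiffAt I 𝓘(ℝ, ι → ℝ) ∞ a x) :
    SmoothAt I F (fun y ↦ frameSum (fun i ↦ e i y) (a y)) x := by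
  simp only [frameSum_apply]
  exact SmoothAt.sum _ fun i _ ↦ SmoothAt.smul (contMDiffAt_pi_space.1 ha i) (h.smooth i x hx)

/-- In a trivialization the frame is a smooth operator-valued function `L`; the coefficients are
`L⁻¹` applied to the section, and inversion is smooth on invertible operators. -/
lemma contMDiffAt_coef (h : SmoothFrame I F e U) {x : M} (hx : x ∈ U) {s : Π x, V x}
    (hs : SmoothAt I F s x) :
    ContMDiffAt I 𝓘(ℝ, ι → ℝ) ∞ (fun y ↦ frameCoef (fun i ↦ e i y) (s y)) x := by
  let t := trivializationAt F V x
  have hxt : x ∈ t.baseSet := mem_baseSet_trivializationAt F V x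
  let L : M → ((ι → ℝ) →L[ℝ] F) := fun y ↦
    LinearMap.toContinuousLinearMap (Fintype.linearCombination ℝ fun i ↦ (t ⟨y, e i y⟩).2)
  have hL : ContMDiffAt I 𝓘(ℝ, (ι → ℝ) →L[ℝ] F) ∞ L x := by
    refine contMDiffAt_clm_of_apply fun u ↦ ?_
    simp only [L, LinearMap.coe_toContinuousLinearMap', Fintype.linearCombination_apply]
    refine contMDiffAt_finsetSum fun i _ ↦ ?_
    have hc : ContMDiffAt I 𝓘(ℝ, ℝ) ∞ (fun _ : M ↦ u i) x := contMDiffAt_const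
    exact hc.smul ((contMDiffAt_section _).1 (h.smooth i x hx))
  have hLe : ∀ y ∈ t.baseSet, ∀ a, L y a = (t ⟨y, frameSum (fun i ↦ e i y) a⟩).2 := by
    intro y hy a
    have h2 : ∀ v : V y, (t ⟨y, v⟩).2 = t.linearEquivAt ℝ y hy v := fun v ↦ rfl
    simp only [L, LinearMap.coe_toContinuousLinearMap', Fintype.linearCombination_apply, h2,
      frameSum_apply, map_sum, map_smul]
  have hbij : ∀ y ∈ U ∩ t.baseSet, Function.Bijective (L y) := by
    intro y hy
    have : ⇑(L y) = (t.linearEquivAt ℝ y hy.2) ∘ (frameSum fun i ↦ e i y) := by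
      funext a; exact hLe y hy.2 a
    rw [this]
    exact (t.linearEquivAt ℝ y hy.2).bijective.comp (h.bij y hy.1)
  let Le : ∀ y, y ∈ U ∩ t.baseSet → ((ι → ℝ) ≃L[ℝ] F) := fun y hy ↦
    (LinearEquiv.ofBijective (L y : (ι → ℝ) →ₗ[ℝ] F) (hbij y hy)).toContinuousLinearEquiv
  have hLe' : ∀ y hy, (Le y hy : (ι → ℝ) →L[ℝ] F) = L y := fun y hy ↦ rfl
  have hinv : ContMDiffAt I 𝓘(ℝ, F →L[ℝ] (ι → ℝ)) ∞ (fun y ↦ (L y).inverse) x := by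
    have h1 : ContDiffAt ℝ ∞ (ContinuousLinearMap.inverse : ((ι → ℝ) →L[ℝ] F) → _)
        (L x) := by
      rw [← hLe' x ⟨hx, hxt⟩]
      exact contDiffAt_map_inverse _
    exact h1.contMDiffAt.comp x hL
  refine (hinv.clm_apply ((contMDiffAt_section _).1 hs)).congr_of_eventuallyEq ?_
  filter_upwards [(h.isOpen.inter t.open_baseSet).mem_nhds ⟨hx, hxt⟩] with y hy
  have h3 : (t ⟨y, s y⟩).2 = L y (frameCoef (fun i ↦ e i y) (s y)) := by
    rw [hLe y hy.2, frameSum_frameCoef (h.bij y hy.1)]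
  show _ = (L y).inverse ((t ⟨y, s y⟩).2)
  rw [h3, ← hLe' y hy, ContinuousLinearMap.inverse_equiv]
  exact ((Le y hy).symm_apply_apply _).symm

end SmoothFrame

lemma SmoothFrame.deriv_sum {e : ι → Π x : M, V x} {U : Set M} (h : SmoothFrame I F e U)
    (D : CovariantDerivative I F V) {x : M} (hx : x ∈ U) {a : M → ι → ℝ}
    (ha : MDifferentiableAt I 𝓘(ℝ, ι → ℝ) a x) (w : TangentSpace I x) :
    D (fun y ↦ frameSum (fun i ↦ e i y) (a y)) x w =
      frameSum (fun i ↦ e i x) (mvfderiv I a x w) + ∑ i, a x i • D (e i) x w := by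
  classical
  have hai : ∀ i, MDifferentiableAt I 𝓘(ℝ, ℝ) (fun y ↦ a y i) x := fun i ↦
    ((ContinuousLinearMap.proj (R := ℝ) (φ := fun _ : ι ↦ ℝ) i).mdifferentiableAt (x := a x)).comp
      x ha
  have hmd : ∀ i, MDifferentiableAt I (I.prod 𝓘(ℝ, F))
      (fun y ↦ TotalSpace.mk' F y (a y i • e i y)) x :=
    fun i ↦ (hai i).smul_section (h.smooth i x hx).mdiff
  have key : ∀ J : Finset ι, D (fun y ↦ ∑ i ∈ J, a y i • e i y) x w =
      ∑ i ∈ J, (mvfderiv I (fun y ↦ a y i) x w • e i x + a x i • D (e i) x w) := by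
    intro J
    induction J using Finset.induction_on with
    | empty =>
      simp only [Finset.sum_empty]
      have := D.isCovariantDerivativeOnUniv.zero (x := x)
      exact congrArg (fun L ↦ L w) this
    | insert i J hi ih =>
      rw [Finset.sum_insert hi, ← ih]
      have h1 : D (fun y ↦ ∑ j ∈ insert i J, a y j • e j y) x =
          D ((fun y ↦ a y i • e i y) + fun y ↦ ∑ j ∈ J, a y j • e j y) x := by
        congr 1; funext y; simp [Finset.sum_insert hi]
      rw [h1, D.isCovariantDerivativeOnUniv.add (hmd i) (.sum_section fun j _ ↦ hmd j)]
      have h2 := D.isCovariantDerivativeOnUniv.leibniz (h.smooth i x hx).mdiff (hai i)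
      have h3 : D (fun y ↦ a y i • e i y) x w =
          mvfderiv I (fun y ↦ a y i) x w • e i x + a x i • D (e i) x w := by
        refine (congrArg (fun L ↦ L w) h2).trans ?_
        exact add_comm _ _
      rw [add_apply, h3]
  refine (key Finset.univ).trans ?_
  rw [Finset.sum_add_distrib, frameSum_apply]
  congr 1
  refine Finset.sum_congr rfl fun i _ ↦ ?_
  congr 1
  have h5 : HasMFDerivAt I 𝓘(ℝ, ι → ℝ) a x (mfderiv I 𝓘(ℝ, ι → ℝ) a x) := ha.hasMFDerivAt
  have h6 := (ContinuousLinearMap.hasMFDerivAt (ContinuousLinearMap.proj (R := ℝ)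
    (φ := fun _ : ι ↦ ℝ) i) (x := a x)).comp x h5
  exact congrArg (fun L : EM →L[ℝ] ℝ ↦ L w) h6.mfderiv

/-- A frame of parallel sections over an open set. -/
structure FlatFrame (D : CovariantDerivative I F V) (e : ι → Π x : M, V x) (U : Set M) : Prop
    extends SmoothFrame I F e U where
  flat : ∀ i, ∀ x ∈ U, D (e i) x = 0

lemma CovariantDerivative.congr_of_eventuallyEq (D : CovariantDerivative I F V) {s s' : Π x, V x}
    {x : M} (hs : MDifferentiableAt I (I.prod 𝓘(ℝ, F)) (fun y ↦ TotalSpace.mk' F y (s y)) x)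
    (h : ∀ᶠ y in 𝓝 x, s' y = s y) : D s' x = D s x := by
  refine (D.isCovariantDerivativeOnUniv.congr_of_eventuallyEq ?_ hs Filter.univ_mem h)
  exact MDifferentiableAt.congr_of_eventuallyEq hs
    (h.mono fun y hy ↦ congrArg (TotalSpace.mk' F y) hy)

namespace FlatFrame

variable {D : CovariantDerivative I F V} {e : ι → Π x : M, V x} {U : Set M}

lemma mono (h : FlatFrame D e U) {U' : Set M} (hU' : IsOpen U') (hs : U' ⊆ U) :
    FlatFrame D e U' :=
  { h.toSmoothFrame.mono hU' hs with flat := fun i x hx ↦ h.flat i x (hs hx) }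

lemma deriv_sum (h : FlatFrame D e U) {x : M} (hx : x ∈ U) {a : M → ι → ℝ}
    (ha : MDifferentiableAt I 𝓘(ℝ, ι → ℝ) a x) (w : TangentSpace I x) :
    D (fun y ↦ frameSum (fun i ↦ e i y) (a y)) x w =
      frameSum (fun i ↦ e i x) (mvfderiv I a x w) := by
  rw [h.toSmoothFrame.deriv_sum D hx ha]
  simp [h.flat _ x hx]

lemma deriv_eq (h : FlatFrame D e U) {x : M} (hx : x ∈ U) {s : Π x, V x}
    (hs : SmoothAt I F s x) (w : TangentSpace I x) :
    D s x w = frameSum (fun i ↦ e i x)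
      (mvfderiv I (fun y ↦ frameCoef (fun i ↦ e i y) (s y)) x w) := by
  have hc := h.contMDiffAt_coef hx hs
  rw [← h.deriv_sum hx (hc.mdifferentiableAt (by simp))]
  rw [D.congr_of_eventuallyEq (h.smoothAt_sum hx hc).mdiff]
  filter_upwards [h.isOpen.mem_nhds hx] with y hy
  rw [frameSum_frameCoef (h.bij y hy)]

lemma smoothAt_deriv_apply (h : FlatFrame D e U) {x : M} (hx : x ∈ U) {s : Π x, V x}
    (hs : ∀ᶠ y in 𝓝 x, SmoothAt I F s y) {X : Π x : M, TangentSpace I x} (hX : SmoothAt I EM X x) :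
    SmoothAt I F (fun y ↦ D s y (X y)) x := by
  have h1 := contMDiffAt_mvfderiv_apply (h.contMDiffAt_coef hx hs.self_of_nhds) hX
  refine (h.smoothAt_sum hx h1).congr ?_
  filter_upwards [hs, h.isOpen.mem_nhds hx] with y hy hyU using h.deriv_eq hyU hy _

lemma formSmoothAt_deriv (h : FlatFrame D e U) {x : M} (hx : x ∈ U) {s : Π x, V x}
    (hs : ∀ᶠ y in 𝓝 x, SmoothAt I F s y) : FormSmoothAt I F (fun y ↦ D s y) x :=
  formSmoothAt_of_coordField (mem_chart_source H x) fun u ↦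
    h.smoothAt_deriv_apply hx hs (contMDiffAt_coordField (mem_chart_source H x) u)

/-- The curvature of a connection with a parallel frame vanishes. -/
lemma curvature_eq_zero (h : FlatFrame D e U) {x : M} (hx : x ∈ U) {s : Π x, V x}
    (hs : ∀ᶠ y in 𝓝 x, SmoothAt I F s y) {X Y : Π x : M, TangentSpace I x}
    (hX : SmoothAt I EM X x) (hY : SmoothAt I EM Y x) :
    D (fun y ↦ D s y (Y y)) x (X x) - D (fun y ↦ D s y (X y)) x (Y x) -
      D s x (VectorField.mlieBracket I X Y x) = 0 := by
  have hc : ∀ᶠ y in 𝓝 x, ContMDiffAt I 𝓘(ℝ, ι → ℝ) ∞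
      (fun y ↦ frameCoef (fun i ↦ e i y) (s y)) y := by
    filter_upwards [hs, h.isOpen.mem_nhds hx] with y hy hyU using h.contMDiffAt_coef hyU hy
  -- In a parallel frame covariant derivatives are derivatives of coefficients, so the curvature
  -- becomes the failure of the bracket identity for functions, which is zero.
  have key : ∀ {Z : Π x : M, TangentSpace I x}, SmoothAt I EM Z x → ∀ w,
      D (fun y ↦ D s y (Z y)) x w = frameSum (fun i ↦ e i x) (mvfderiv I (fun y ↦ mvfderiv I
        (fun y ↦ frameCoef (fun i ↦ e i y) (s y)) y (Z y)) x w) := by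
    intro Z hZ w
    have h1 := contMDiffAt_mvfderiv_apply hc.self_of_nhds hZ
    rw [← h.deriv_sum hx (h1.mdifferentiableAt (by simp))]
    rw [D.congr_of_eventuallyEq (h.smoothAt_sum hx h1).mdiff]
    filter_upwards [hs, h.isOpen.mem_nhds hx] with y hy hyU using h.deriv_eq hyU hy _
  rw [key hX, key hY, h.deriv_eq hx hs.self_of_nhds, ← map_sub, ← map_sub,
    mvfderiv_mlieBracket hc hX hY, sub_self, map_zero]

end FlatFrame

end Frames
end

/-! ### Integrability of flat linear total differential equations. -/

noncomputable section
section ParallelTransport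

lemma norm_lt_of_mem_ball_one {X : Type*} [NormedAddCommGroup X] {a b : X} {C : ℝ}
    (h : a ∈ Metric.ball b 1) (hb : ‖b‖ + 1 ≤ C) : ‖a‖ < C := by
  have h4 := mem_ball_iff_norm.1 h
  linarith [norm_le_norm_add_norm_sub' a b]

variable {E R : Type*} [NormedAddCommGroup E] [NormedSpace ℝ E]
  [NormedRing R] [NormedAlgebra ℝ R] [CompleteSpace R]

/-- The radial linear differential equation has solutions on the unit interval. -/
lemma exists_radial_solution {A : E → E →L[ℝ] R} {ρ C : ℝ} (hC : 0 < C)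
    (hAc : ContinuousOn A (Metric.ball 0 ρ)) (hA : ∀ z ∈ Metric.ball (0 : E) ρ, ‖A z‖ ≤ C)
    (hρ : C * ρ ≤ 1 / 2) (c : R) {z : E} (hz : z ∈ Metric.ball (0 : E) ρ) :
    ∃ γ : ℝ → R, γ 0 = c ∧ ∀ t ∈ Icc (0 : ℝ) 1,
      HasDerivWithinAt γ (-(A (t • z) z * γ t)) (Icc 0 1) t := by
  have hz' : ‖z‖ < ρ := by simpa using hz
  have hmem : ∀ t ∈ Icc (0 : ℝ) 1, t • z ∈ Metric.ball (0 : E) ρ := by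
    intro t ht
    rw [mem_ball_zero_iff, norm_smul, Real.norm_of_nonneg ht.1]
    nlinarith [norm_nonneg z, ht.2]
  have hM : ∀ t ∈ Icc (0 : ℝ) 1, ‖A (t • z) z‖ ≤ 1 / 2 := fun t ht ↦
    ((A (t • z)).le_opNorm z).trans (by
      have := hA _ (hmem t ht)
      have h1 : ‖A (t • z)‖ * ‖z‖ ≤ C * ρ :=
        mul_le_mul this hz'.le (norm_nonneg _) hC.le
      linarith)
  -- On the ball of radius `‖c‖ + 1` about `c` one has `‖x‖ ≤ 2‖c‖ + 1`. Since `C ρ ≤ 1 / 2`, the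
  -- field is bounded there by half of this, so by the radius of the ball, and the solution survives
  -- until time one.
  have hf : IsPicardLindelof (fun t x ↦ -(A (t • z) z * x)) (tmin := 0) (tmax := 1)
      ⟨0, by simp⟩ c (‖c‖₊ + 1) 0 (‖c‖₊ + 1) 1 := by
    refine ⟨fun t ht ↦ ?_, fun x _ ↦ ?_, fun t ht x hx ↦ ?_, ?_⟩
    · refine LipschitzOnWith.of_dist_le_mul fun x _ y _ ↦ ?_
      rw [dist_neg_neg, dist_eq_norm, dist_eq_norm, ← mul_sub]
      refine (norm_mul_le _ _).trans ?_
      have := hM t ht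
      simp only [NNReal.coe_one]
      nlinarith [norm_nonneg (x - y)]
    · have h1 : ContinuousOn (fun t : ℝ ↦ A (t • z)) (Icc 0 1) :=
        hAc.comp (by fun_prop) hmem
      exact ((h1.clm_apply continuousOn_const).mul continuousOn_const).neg
    · have hx' : ‖x‖ ≤ 2 * ‖c‖ + 1 := by
        have : ‖x - c‖ ≤ ‖c‖ + 1 := by simpa [dist_eq_norm] using hx
        linarith [norm_le_norm_add_norm_sub' x c]
      rw [norm_neg]
      refine (norm_mul_le _ _).trans ?_
      have := hM t ht
      simp only [NNReal.coe_add, coe_nnnorm, NNReal.coe_one]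
      nlinarith [norm_nonneg x]
    · simp
  obtain ⟨γ, h0, h1⟩ := hf.exists_eq_forall_mem_Icc_hasDerivWithinAt₀
  exact ⟨γ, h0, h1⟩

/-- These six terms are the defect of the first order variation in `radial_variation_bound`, where
`η = ‖h‖`. The first two are bounded by `C η²` each and the other four by `C² η²` each, times `‖x‖`.
-/
lemma remainder_bound {Y P Q T : R} {C η t : ℝ} (hC : 0 ≤ C) (hη : 0 ≤ η) (hη1 : η ≤ 1)
    (ht : ‖t‖ ≤ 1) (hY : ‖Y‖ ≤ C * η) (hP : ‖P‖ ≤ C * η) (hQ : ‖Q‖ ≤ C * η ^ 2)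
    (hT : ‖T‖ ≤ C * η ^ 2) (x : R) :
    ‖t • (Q * x) + T * x - t • (Y * (Y * x)) - t • t • (P * (Y * x)) - t • t • (Q * (Y * x)) -
      t • (T * (Y * x))‖ ≤ (2 * C + 4 * C ^ 2) * η ^ 2 * ‖x‖ := by
  have bs : ∀ y : R, ‖t • y‖ ≤ ‖y‖ := fun y ↦ by
    rw [norm_smul]; exact mul_le_of_le_one_left (norm_nonneg _) ht
  have bl : ∀ {L : R} {a : ℝ}, ‖L‖ ≤ a → ∀ y, ‖L * y‖ ≤ a * ‖y‖ := fun h y ↦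
    (norm_mul_le _ y).trans (mul_le_mul_of_nonneg_right h (norm_nonneg _))
  have hYx : ‖Y * x‖ ≤ C * η * ‖x‖ := bl hY x
  have hYx' : ‖Y * x‖ ≤ C * ‖x‖ := hYx.trans (by
    gcongr
    exact mul_le_of_le_one_right hC hη1)
  have c1 : ‖t • (Q * x)‖ ≤ C * η ^ 2 * ‖x‖ := (bs _).trans (bl hQ x)
  have c2 : ‖T * x‖ ≤ C * η ^ 2 * ‖x‖ := bl hT x
  have c3 : ‖t • (Y * (Y * x))‖ ≤ C * η * (C * η * ‖x‖) :=
    (bs _).trans ((bl hY _).trans (by gcongr))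
  have c4 : ‖t • t • (P * (Y * x))‖ ≤ C * η * (C * η * ‖x‖) :=
    (bs _).trans ((bs _).trans ((bl hP _).trans (by gcongr)))
  have c5 : ‖t • t • (Q * (Y * x))‖ ≤ C * η ^ 2 * (C * ‖x‖) :=
    (bs _).trans ((bs _).trans ((bl hQ _).trans (by gcongr)))
  have c6 : ‖t • (T * (Y * x))‖ ≤ C * η ^ 2 * (C * ‖x‖) :=
    (bs _).trans ((bl hT _).trans (by gcongr))
  have := norm_sub_le (t • (Q * x) + T * x - t • (Y * (Y * x)) - t • t • (P * (Y * x)) -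
    t • t • (Q * (Y * x))) (t • (T * (Y * x)))
  have := norm_sub_le (t • (Q * x) + T * x - t • (Y * (Y * x)) - t • t • (P * (Y * x)))
    (t • t • (Q * (Y * x)))
  have := norm_sub_le (t • (Q * x) + T * x - t • (Y * (Y * x))) (t • t • (P * (Y * x)))
  have := norm_sub_le (t • (Q * x) + T * x) (t • (Y * (Y * x)))
  have := norm_add_le (t • (Q * x)) (T * x)
  calc _ ≤ C * η ^ 2 * ‖x‖ + C * η ^ 2 * ‖x‖ + C * η * (C * η * ‖x‖) + C * η * (C * η * ‖x‖) +
        C * η ^ 2 * (C * ‖x‖) + C * η ^ 2 * (C * ‖x‖) := by linarith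
    _ = _ := by ring

set_option maxHeartbeats 400000 in
/-- The error of the first order variation of a radial solution. -/
lemma radial_variation_bound {A : E → E →L[ℝ] R} {ρ C : ℝ} (hC : 0 < C) (hρ : ρ ≤ 1 / 2)
    (hAd : ∀ z ∈ Metric.ball (0 : E) ρ, DifferentiableAt ℝ A z)
    (hA : ∀ z ∈ Metric.ball (0 : E) ρ, ‖A z‖ ≤ C)
    (hA' : ∀ z ∈ Metric.ball (0 : E) ρ, ‖fderiv ℝ A z‖ ≤ C)
    (hT : ∀ z ∈ Metric.ball (0 : E) ρ, ∀ w ∈ Metric.ball (0 : E) ρ,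
      ‖A w - A z - fderiv ℝ A z (w - z)‖ ≤ C * ‖w - z‖ ^ 2)
    (hflat : ∀ z ∈ Metric.ball (0 : E) ρ, ∀ u v, fderiv ℝ A z u v + A z u * A z v =
      fderiv ℝ A z v u + A z v * A z u)
    {z h : E} (hz : z ∈ Metric.ball (0 : E) ρ) (hzh : z + h ∈ Metric.ball (0 : E) ρ)
    {g γ : ℝ → R} (h0 : γ 0 = g 0)
    (hg : ∀ t ∈ Icc (0 : ℝ) 1, HasDerivWithinAt g (-(A (t • z) z * g t)) (Icc 0 1) t)
    (hγ : ∀ t ∈ Icc (0 : ℝ) 1,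
      HasDerivWithinAt γ (-(A (t • (z + h)) (z + h) * γ t)) (Icc 0 1) t)
    {N : ℝ} (hN : ∀ t ∈ Icc (0 : ℝ) 1, ‖g t‖ ≤ N) :
    ‖γ 1 - g 1 + A z h * g 1‖ ≤ (2 * C + 4 * C ^ 2) * N / C * (Real.exp C - 1) * ‖h‖ ^ 2 := by
  have hz' : ‖z‖ < ρ := by simpa using hz
  have hzh' : ‖z + h‖ < ρ := by simpa using hzh
  have hh1 : ‖h‖ ≤ 1 := by
    have : ‖h‖ ≤ ‖z + h‖ + ‖z‖ := by simpa using norm_sub_le (z + h) z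
    linarith
  have hmem : ∀ {w : E}, ‖w‖ < ρ → ∀ t ∈ Icc (0 : ℝ) 1, t • w ∈ Metric.ball (0 : E) ρ := by
    intro w hw t ht
    rw [mem_ball_zero_iff, norm_smul, Real.norm_of_nonneg ht.1]
    nlinarith [norm_nonneg w, ht.2]
  have hN0 : 0 ≤ N := (norm_nonneg _).trans (hN 0 (by simp))
  -- The first order prediction for `γ`: moving from `t • z` by `t • h` would change a solution of
  -- `df = -A f` by `-t A(t z) h g`. At `t = 1` this yields the derivative to be proved.
  let k : ℝ → R := fun t ↦ g t - t • (A (t • z) h * g t)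
  let k' : ℝ → R := fun t ↦ -(A (t • z) z * g t) - (A (t • z) h * g t +
    t • (fderiv ℝ A (t • z) z h * g t - A (t • z) h * (A (t • z) z * g t)))
  have hk : ∀ t ∈ Icc (0 : ℝ) 1, HasDerivWithinAt k (k' t) (Icc 0 1) t := by
    intro t ht
    have h1 : HasDerivWithinAt (fun t : ℝ ↦ A (t • z)) (fderiv ℝ A (t • z) z) (Icc 0 1) t := by
      have h2 : HasDerivAt (fun t : ℝ ↦ t • z) z t := by
        simpa using (hasDerivAt_id t).smul_const z
      exact ((hAd _ (hmem hz' t ht)).hasFDerivAt.comp_hasDerivAt t h2).hasDerivWithinAt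
    have h3 := (h1.clm_apply (hasDerivWithinAt_const t _ h)).mul (hg t ht)
    have h4 := (hg t ht).sub ((hasDerivWithinAt_id t _).smul h3)
    refine h4.congr_deriv ?_
    simp only [k', id_eq, map_zero, add_zero, mul_neg, one_smul]
    module
  have hr : ∀ t ∈ Icc (0 : ℝ) 1, ‖k' t + A (t • (z + h)) (z + h) * k t‖ ≤
      (2 * C + 4 * C ^ 2) * N * ‖h‖ ^ 2 := by
    intro t ht
    have hw := hmem hz' t ht
    have hw2 := hmem hzh' t ht
    have htn : ‖t‖ ≤ 1 := by rw [Real.norm_of_nonneg ht.1]; exact ht.2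
    set a := A (t • z) with ha
    set a' := fderiv ℝ A (t • z) with ha'
    set T := (A (t • (z + h)) - a - a' (t • (z + h) - t • z)) (z + h) with hTd
    have hfl := hflat _ hw z h
    rw [← ha, ← ha'] at hfl
    have hM : A (t • (z + h)) (z + h) = a z + a h + t • a' h z + t • a' h h + T := by
      have e1 : t • (z + h) - t • z = t • h := by rw [smul_add, add_sub_cancel_left]
      simp only [hTd, e1, sub_apply, map_add, map_smul, smul_apply]
      abel
    -- Flatness exchanges the two arguments of `a'` at the cost of a commutator. This cancels every
    -- term of first order in `h`.
    have hfl' : a' z h = a' h z + a h * a z - a z * a h := by rw [← hfl]; abel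
    have hid : k' t + A (t • (z + h)) (z + h) * k t =
        t • (a' h h * g t) + T * g t - t • (a h * (a h * g t)) - t • t • (a' h z * (a h * g t)) -
          t • t • (a' h h * (a h * g t)) - t • (T * (a h * g t)) := by
      rw [hM]
      simp only [k', k, ← ha, ← ha', hfl', add_mul, mul_sub, sub_mul, mul_smul_comm,
        smul_mul_assoc, smul_add, smul_sub, mul_assoc]
      abel
    have hw1 : t • (z + h) - t • z = t • h := by rw [smul_add, add_sub_cancel_left]
    have hth : ‖t • h‖ ≤ ‖h‖ := by
      rw [norm_smul]
      exact mul_le_of_le_one_left (norm_nonneg _) htn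
    have bY : ‖a h‖ ≤ C * ‖h‖ := (a.le_opNorm h).trans (by gcongr; exact hA _ hw)
    have bP : ∀ w, ‖a' h w‖ ≤ C * ‖h‖ * ‖w‖ := fun w ↦
      ((a' h).le_opNorm w).trans (by
        gcongr
        exact (a'.le_opNorm h).trans (by gcongr; exact hA' _ hw))
    have bR : ‖T‖ ≤ C * ‖h‖ ^ 2 := by
      refine (ContinuousLinearMap.le_opNorm _ _).trans ?_
      have h1 := hT _ hw _ hw2
      have h2 : ‖z + h‖ ≤ 1 := by linarith
      refine (mul_le_mul_of_nonneg_left h2 (norm_nonneg _)).trans ?_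
      rw [mul_one]
      refine h1.trans ?_
      rw [hw1]
      gcongr
    rw [hid]
    refine (remainder_bound hC.le (norm_nonneg h) hh1 htn bY
      ((bP z).trans (mul_le_of_le_one_right (by positivity) (by linarith)))
      ((bP h).trans (le_of_eq (by ring))) bR (g t)).trans ?_
    have := hN t ht
    rw [mul_right_comm]
    gcongr
  have hcont : ContinuousOn (fun t ↦ γ t - k t) (Icc 0 1) := fun t ht ↦
    ((hγ t ht).continuousWithinAt).sub (hk t ht).continuousWithinAt
  -- `γ - k` starts at zero and satisfies the linear equation up to a defect quadratic in `h`, so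
  -- Grönwall's inequality keeps it quadratically small.
  have hb := norm_le_gronwallBound_of_norm_deriv_right_le (K := C) (δ := 0)
    (ε := (2 * C + 4 * C ^ 2) * N * ‖h‖ ^ 2) hcont
    (f' := fun t ↦ -(A (t • (z + h)) (z + h) * γ t) - k' t)
    (fun t ht ↦ ((hγ t ⟨ht.1, ht.2.le⟩).sub (hk t ⟨ht.1, ht.2.le⟩)).mono_of_mem_nhdsWithin
      (Icc_mem_nhdsGE_of_mem ht)) (by simp [k, h0]) (fun t ht ↦ ?_) 1 (by simp)
  · rw [gronwallBound_of_K_ne_0 hC.ne'] at hb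
    simp only [k, one_smul, zero_mul, sub_zero, mul_one, zero_add] at hb
    refine le_trans (le_of_eq ?_) (hb.trans (le_of_eq ?_))
    · congr 1; abel
    · ring
  · have ht' : t ∈ Icc (0 : ℝ) 1 := ⟨ht.1, ht.2.le⟩
    have e : -(A (t • (z + h)) (z + h) * γ t) - k' t = -(A (t • (z + h)) (z + h) * (γ t - k t)) -
        (k' t + A (t • (z + h)) (z + h) * k t) := by
      rw [mul_sub]; abel
    rw [e]
    refine (norm_sub_le _ _).trans (add_le_add ?_ (hr t ht'))
    rw [norm_neg]
    refine (norm_mul_le _ _).trans ?_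
    have := hA _ (hmem hzh' t ht')
    have h3 : ‖A (t • (z + h)) (z + h)‖ ≤ C * 1 :=
      (ContinuousLinearMap.le_opNorm _ _).trans (by gcongr; linarith)
    rw [mul_one] at h3
    gcongr

set_option synthInstance.maxHeartbeats 200000 in
set_option maxHeartbeats 1000000 in
/-- Integrability of the linear total differential equation `df + A f = 0`: if the curvature
`dA + A ∧ A` vanishes, there are smooth local solutions with arbitrary initial values. -/
theorem exists_parallel {A : E → E →L[ℝ] R} {Ω : Set E} (hΩ : Ω ∈ 𝓝 0)
    (hA : ContDiffOn ℝ ∞ A Ω)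
    (hflat : ∀ z ∈ Ω, ∀ u v, fderiv ℝ A z u v + A z u * A z v =
      fderiv ℝ A z v u + A z v * A z u) :
    ∃ ρ > 0, ∀ c : R, ∃ f : E → R, f 0 = c ∧ ContDiffOn ℝ ∞ f (Metric.ball 0 ρ) ∧
      ∀ z ∈ Metric.ball (0 : E) ρ, HasFDerivAt f (-((ContinuousLinearMap.mul ℝ R).flip (f z)).comp (A z)) z := by
  have hA0 : ContDiffAt ℝ ∞ A 0 := hA.contDiffAt hΩ
  have hd : ContDiffAt ℝ 1 (fderiv ℝ A) 0 := hA0.fderiv_right (by rw [one_add_one_eq_two]; exact ENat.LEInfty.out)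
  -- A Lipschitz bound for the derivative of `A` gives the quadratic Taylor estimate required by the
  -- variation bound.
  obtain ⟨K, T, hT, hK⟩ := hd.exists_lipschitzOnWith
  obtain ⟨C, hC1, hC2, hC3⟩ : ∃ C : ℝ, ‖A 0‖ + 1 ≤ C ∧ ‖fderiv ℝ A 0‖ + 1 ≤ C ∧ K ≤ C :=
    ⟨max (‖A 0‖ + 1) (max (‖fderiv ℝ A 0‖ + 1) K), le_max_left _ _,
      (le_max_left _ _).trans (le_max_right _ _), (le_max_right _ _).trans (le_max_right _ _)⟩
  have hC : 0 < C := lt_of_lt_of_le (by positivity) hC1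
  have h1 : ∀ᶠ z in 𝓝 (0 : E), ‖A z‖ < C :=
    hA0.continuousAt.norm.eventually_lt_const (by linarith)
  have h2 : ∀ᶠ z in 𝓝 (0 : E), ‖fderiv ℝ A z‖ < C :=
    (hd.continuousAt.eventually_mem (Metric.ball_mem_nhds _ one_pos)).mono fun z hz ↦
      norm_lt_of_mem_ball_one hz hC2
  obtain ⟨r, hr, hb⟩ := Metric.mem_nhds_iff.1
    (Filter.inter_mem (Filter.inter_mem (interior_mem_nhds.2 hΩ) hT) (Filter.inter_mem h1 h2))
  obtain ⟨ρ, hρ0, hρr, hρ1, hρ2⟩ : ∃ ρ > 0, ρ ≤ r ∧ ρ ≤ 1 / 2 ∧ C * ρ ≤ 1 / 2 := by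
    refine ⟨min r (min (1 / 2) (1 / (2 * C))), by positivity, min_le_left _ _,
      (min_le_right _ _).trans (min_le_left _ _), ?_⟩
    calc C * min r (min (1 / 2) (1 / (2 * C))) ≤ C * (1 / (2 * C)) := by
          gcongr; exact (min_le_right _ _).trans (min_le_right _ _)
      _ = 1 / 2 := by field_simp
  have hsub : Metric.ball (0 : E) ρ ⊆ Metric.ball 0 r := Metric.ball_subset_ball hρr
  have hΩ' : ∀ z ∈ Metric.ball (0 : E) ρ, Ω ∈ 𝓝 z := fun z hz ↦
    mem_interior_iff_mem_nhds.1 (hb (hsub hz)).1.1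
  have hAs : ∀ z ∈ Metric.ball (0 : E) ρ, ContDiffAt ℝ ∞ A z := fun z hz ↦
    hA.contDiffAt (hΩ' z hz)
  have hAd : ∀ z ∈ Metric.ball (0 : E) ρ, DifferentiableAt ℝ A z := fun z hz ↦
    (hAs z hz).differentiableAt (by simp)
  have hAb : ∀ z ∈ Metric.ball (0 : E) ρ, ‖A z‖ ≤ C := fun z hz ↦ (hb (hsub hz)).2.1.le
  have hTay : ∀ z ∈ Metric.ball (0 : E) ρ, ∀ w ∈ Metric.ball (0 : E) ρ,
      ‖A w - A z - fderiv ℝ A z (w - z)‖ ≤ C * ‖w - z‖ ^ 2 := by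
    intro z hz w hw
    have hseg : segment ℝ z w ⊆ Metric.ball 0 ρ := (convex_ball 0 ρ).segment_subset hz hw
    rw [pow_two, ← mul_assoc]
    refine (convex_segment z w).norm_image_sub_le_of_norm_fderiv_le'
      (fun y hy ↦ hAd y (hseg hy)) (fun y hy ↦ ?_) (left_mem_segment ℝ z w)
      (right_mem_segment ℝ z w)
    have h3 := hK.norm_sub_le (hb (hsub (hseg hy))).1.2 (hb (hsub hz)).1.2
    refine h3.trans ?_
    have h4 : ‖y - z‖ ≤ ‖w - z‖ := norm_sub_le_of_mem_segment hy
    gcongr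
  refine ⟨ρ, hρ0, fun c ↦ ?_⟩
  -- The candidate at `z` is the value at time one of the solution along the ray through `z`.
  -- Flatness is needed only to differentiate it in the other directions.
  have hex : ∀ z : E, ∃ γ : ℝ → R, z ∈ Metric.ball (0 : E) ρ → (γ 0 = c ∧ ∀ t ∈ Icc (0 : ℝ) 1,
      HasDerivWithinAt γ (-(A (t • z) z * γ t)) (Icc 0 1) t) := by
    intro z
    by_cases hz : z ∈ Metric.ball (0 : E) ρ
    · obtain ⟨γ, hγ⟩ := exists_radial_solution hC
        (fun z hz ↦ (hAs z hz).continuousAt.continuousWithinAt) hAb hρ2 c hz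
      exact ⟨γ, fun _ ↦ hγ⟩
    · exact ⟨0, fun h ↦ absurd h hz⟩
  choose γ hγ using hex
  have hder : ∀ z ∈ Metric.ball (0 : E) ρ, HasFDerivAt (fun z ↦ γ z 1)
      (-((ContinuousLinearMap.mul ℝ R).flip (γ z 1)).comp (A z)) z := by
    intro z hz
    have hcont : ContinuousOn (γ z) (Icc 0 1) := fun t ht ↦ ((hγ z hz).2 t ht).continuousWithinAt
    obtain ⟨N, hN⟩ := isCompact_Icc.exists_bound_of_continuousOn hcont
    rw [hasFDerivAt_iff_isLittleO_nhds_zero]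
    refine Asymptotics.IsBigO.trans_isLittleO (g := fun h : E ↦ ‖h‖ ^ 2) ?_
      (Asymptotics.isLittleO_norm_pow_id one_lt_two)
    refine Asymptotics.IsBigO.of_bound ((2 * C + 4 * C ^ 2) * N / C * (Real.exp C - 1)) ?_
    have hev : ∀ᶠ h in 𝓝 (0 : E), z + h ∈ Metric.ball (0 : E) ρ := by
      refine (Continuous.tendsto (f := fun h : E ↦ z + h) (by fun_prop) 0).eventually_mem ?_
      simpa using Metric.isOpen_ball.mem_nhds hz
    filter_upwards [hev] with h hh
    have := radial_variation_bound hC hρ1 hAd hAb (fun z hz ↦ (hb (hsub hz)).2.2.le) hTay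
      (fun z hz ↦ hflat z (mem_of_mem_nhds (hΩ' z hz))) hz hh
      ((hγ _ hh).1.trans (hγ z hz).1.symm) (hγ z hz).2 (hγ _ hh).2 hN
    simpa using this
  refine ⟨fun z ↦ γ z 1, ?_, ?_, hder⟩
  -- On the ray through the origin the equation has right-hand side zero, so the solution is
  -- constant.
  · have h0 := (hγ 0 (Metric.mem_ball_self hρ0)).2
    have : ∀ t ∈ Icc (0 : ℝ) 1, γ 0 t = γ 0 0 := by
      refine constant_of_has_deriv_right_zero (fun t ht ↦ (h0 t ht).continuousWithinAt) ?_
      intro t ht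
      have := (h0 t ⟨ht.1, ht.2.le⟩).mono_of_mem_nhdsWithin (Icc_mem_nhdsGE_of_mem ht)
      simpa using this
    exact (this 1 (by simp)).trans (hγ 0 (Metric.mem_ball_self hρ0)).1
  -- Bootstrap: the derivative is an expression in the solution and `A`, so it is as regular as the
  -- solution.
  · have hn : ∀ n : ℕ, ContDiffOn ℝ n (fun z ↦ γ z 1) (Metric.ball 0 ρ) := by
      intro n
      induction n with
      | zero =>
        exact contDiffOn_zero.2 fun z hz ↦ (hder z hz).continuousAt.continuousWithinAt
      | succ n ih =>
        push_cast
        rw [contDiffOn_succ_iff_fderiv_of_isOpen Metric.isOpen_ball]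
        refine ⟨fun z hz ↦ (hder z hz).differentiableAt.differentiableWithinAt, by simp, ?_⟩
        have h1 : ContDiffOn ℝ n A (Metric.ball 0 ρ) := fun z hz ↦
          ((hAs z hz).of_le (by exact_mod_cast le_top)).contDiffWithinAt
        have h2 : ContDiffOn ℝ n
            (fun z ↦ -((ContinuousLinearMap.mul ℝ R).flip (γ z 1)).comp (A z))
            (Metric.ball 0 ρ) :=
          (((ContinuousLinearMap.mul ℝ R).flip.contDiff.comp_contDiffOn ih).clm_comp h1).neg
        exact h2.congr fun z hz ↦ (hder z hz).fderiv
    exact contDiffOn_infty.2 hn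

end ParallelTransport
end

/-! ### Existence of parallel frames for a smooth flat connection. -/

noncomputable section
section FlatFrameExistence

variable {EM : Type*} [NormedAddCommGroup EM] [NormedSpace ℝ EM] [FiniteDimensional ℝ EM]
  {H : Type*} [TopologicalSpace H] {I : ModelWithCorners ℝ EM H} [I.Boundaryless]
  {M : Type*} [TopologicalSpace M] [ChartedSpace H M] [IsManifold I ∞ M]
  {F : Type*} [NormedAddCommGroup F] [NormedSpace ℝ F] [FiniteDimensional ℝ F]
  {V : M → Type*} [TopologicalSpace (TotalSpace F V)]
  [∀ x, AddCommGroup (V x)] [∀ x, Module ℝ (V x)] [∀ x, TopologicalSpace (V x)]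
  [∀ x, IsTopologicalAddGroup (V x)] [∀ x, ContinuousSMul ℝ (V x)]
  [FiberBundle F V] [VectorBundle ℝ F V]

variable (I F) in
lemma exists_smoothFrame [ContMDiffVectorBundle ∞ F V I] (x : M) :
    ∃ (U : Set M) (e : Fin (Module.finrank ℝ F) → Π x : M, V x), x ∈ U ∧ SmoothFrame I F e U := by
  let t := trivializationAt F V x
  let b := Module.finBasis ℝ F
  refine ⟨t.baseSet, t.localFrame b, mem_baseSet_trivializationAt F V x, t.open_baseSet,
    fun i y hy ↦ contMDiffAt_localFrame_of_mem ∞ t b i hy, fun y hy ↦ ?_⟩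
  have h : (fun i ↦ t.localFrame b i y) = t.basisAt b hy := by
    funext i
    exact t.localFrame_apply_of_mem_baseSet b hy
  rw [h]
  have h2 : ⇑(frameSum ⇑(t.basisAt b hy)) = (t.basisAt b hy).equivFun.symm := by
    funext a
    rw [frameSum_apply, Module.Basis.equivFun_symm_apply]
  rw [h2]
  exact LinearEquiv.bijective _

section Extension

variable [T2Space M] {D : CovariantDerivative I F V}

/-- Smoothness of the connection is applied to a global section with the same germ; covariant
derivatives depend on the germ only. -/
lemma formSmoothAt_covariantDerivative (hsm : D.ContMDiffCovariantDerivative ∞) {s : Π x, V x}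
    {x : M} {U : Set M} (hU : IsOpen U) (hx : x ∈ U) (hs : ∀ y ∈ U, SmoothAt I F s y) :
    FormSmoothAt I F (fun y ↦ D s y) x := by
  obtain ⟨s', hs'⟩ := exists_smoothSec_eventuallyEq hU hx hs
  have h := hsm.contMDiff.contMDiff (σ := s') (s'.contMDiff.contMDiffOn)
  refine SmoothAt.congr (h.contMDiffAt Filter.univ_mem) ?_
  filter_upwards [hs'.eventually_nhds] with y hy
  exact D.congr_of_eventuallyEq (s'.smoothAt y).mdiff (hy.mono fun _ h ↦ h.symm)

/-- Flatness on `univ` speaks of globally smooth sections and fields. Local ones are replaced by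
global ones with the same germs at `x`. -/
lemma curvature_eq_zero_of_isFlatOn (hsm : D.ContMDiffCovariantDerivative ∞)
    (hfl : IsFlatOn F D univ)
    {s : Π x, V x} {X Y : Π x : M, TangentSpace I x} {x : M} {U : Set M} (hU : IsOpen U)
    (hx : x ∈ U) (hs : ∀ y ∈ U, SmoothAt I F s y) (hX : ∀ y ∈ U, SmoothAt I EM X y)
    (hY : ∀ y ∈ U, SmoothAt I EM Y y) :
    D (fun y ↦ D s y (Y y)) x (X x) - D (fun y ↦ D s y (X y)) x (Y x) -
      D s x (VectorField.mlieBracket I X Y x) = 0 := by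
  obtain ⟨s', hs'⟩ := exists_smoothSec_eventuallyEq hU hx hs
  obtain ⟨X', hX'⟩ := exists_smoothSec_eventuallyEq hU hx hX
  obtain ⟨Y', hY'⟩ := exists_smoothSec_eventuallyEq hU hx hY
  have h := hfl X' Y' s' X'.contMDiff.contMDiffOn Y'.contMDiff.contMDiffOn
    s'.contMDiff.contMDiffOn x (mem_univ x)
  have e1 : ∀ᶠ y in 𝓝 x, D s' y = D s y := by
    filter_upwards [hs'.eventually_nhds, hU.mem_nhds hx] with y hy hyU
    exact D.congr_of_eventuallyEq (hs y hyU).mdiff hy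
  have key : ∀ {Z Z' : Π x : M, TangentSpace I x}, (∀ y ∈ U, SmoothAt I EM Z y) →
      (∀ᶠ y in 𝓝 x, Z' y = Z y) →
      D (fun y ↦ D s' y (Z' y)) x = D (fun y ↦ D s y (Z y)) x := by
    intro Z Z' hZ hZ'
    refine D.congr_of_eventuallyEq (SmoothAt.mdiff
      ((formSmoothAt_covariantDerivative hsm hU hx hs).apply (hZ x hx))) ?_
    filter_upwards [e1, hZ'] with y h1 h2
    rw [h1, h2]
  rw [key hX hX', key hY hY', e1.self_of_nhds, hX'.self_of_nhds, hY'.self_of_nhds,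
    Filter.EventuallyEq.mlieBracket_vectorField_eq hX' hY'] at h
  exact h

end Extension

lemma clm_ext_coordField {q y : M} (hy : y ∈ (chartAt H q).source)
    {L L' : TangentSpace I y →L[ℝ] V y}
    (h : ∀ u : EM, L (coordField I q u y) = L' (coordField I q u y)) : L = L' := by
  refine ContinuousLinearMap.ext fun w ↦ ?_
  rw [← coordField_mfderiv hy w]
  exact h _

lemma fderiv_apply_clm {E R G : Type*} [NormedAddCommGroup E] [NormedSpace ℝ E]
    [NormedAddCommGroup R] [NormedSpace ℝ R] [NormedAddCommGroup G] [NormedSpace ℝ G]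
    {A : E → E →L[ℝ] R} {z : E} (hA : DifferentiableAt ℝ A z) (ev : R →L[ℝ] G) (w w' : E) :
    fderiv ℝ (fun z ↦ ev (A z w)) z w' = ev (fderiv ℝ A z w' w) :=
  congrArg (fun L : E →L[ℝ] G ↦ L w')
    ((ev.comp (ContinuousLinearMap.apply ℝ R w)).hasFDerivAt.comp z hA.hasFDerivAt).fderiv

section Connection

variable {ι : Type*} [Fintype ι] (D : CovariantDerivative I F V) (e : ι → Π x : M, V x) (q : M)

/-- The connection matrix of `D` in the frame `e` and the chart at `q`. -/
def connMatrix (y : M) : EM →L[ℝ] ((ι → ℝ) →L[ℝ] (ι → ℝ)) :=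
  LinearMap.toContinuousLinearMap
    { toFun := fun u ↦ LinearMap.toContinuousLinearMap
        ((frameCoef fun i ↦ e i y) ∘ₗ frameSum fun i ↦ D (e i) y (coordField I q u y))
      map_add' := fun u v ↦ by
        ext c
        simp [frameSum_apply, coordField_add, Finset.sum_add_distrib]
      map_smul' := fun r u ↦ by
        ext c
        simp [frameSum_apply, coordField_smul, smul_comm _ r, ← Finset.smul_sum] }

lemma connMatrix_apply (y : M) (u : EM) (c : ι → ℝ) : connMatrix D e q y u c =
    frameCoef (fun i ↦ e i y) (∑ i, c i • D (e i) y (coordField I q u y)) := rfl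

variable {D e q} {U : Set M}

lemma SmoothFrame.deriv_coordField (h : SmoothFrame I F e U) {y : M} (hyU : y ∈ U)
    (hy : y ∈ (chartAt H q).source) {a : M → ι → ℝ}
    (ha : MDifferentiableAt I 𝓘(ℝ, ι → ℝ) a y) (u : EM) :
    D (fun y ↦ frameSum (fun i ↦ e i y) (a y)) y (coordField I q u y) =
      frameSum (fun i ↦ e i y) (fderiv ℝ (a ∘ (extChartAt I q).symm) (extChartAt I q y) u +
        connMatrix D e q y u (a y)) := by
  rw [h.deriv_sum D hyU ha, map_add, connMatrix_apply, frameSum_frameCoef (h.bij y hyU),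
    mvfderiv_coordField hy ha]

lemma contMDiffAt_connMatrix [T2Space M] (hsm : D.ContMDiffCovariantDerivative ∞)
    (h : SmoothFrame I F e U) {y : M} (hyU : y ∈ U)
    (hy : y ∈ (chartAt H q).source) :
    ContMDiffAt I 𝓘(ℝ, EM →L[ℝ] ((ι → ℝ) →L[ℝ] (ι → ℝ))) ∞ (connMatrix D e q) y := by
  refine contMDiffAt_clm_of_apply fun u ↦ contMDiffAt_clm_of_apply fun c ↦ ?_
  simp only [connMatrix_apply]
  refine h.contMDiffAt_coef hyU (SmoothAt.sum _ fun i _ ↦ SmoothAt.const_smul _ ?_)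
  exact (formSmoothAt_covariantDerivative hsm h.isOpen hyU (h.smooth i)).apply
    (contMDiffAt_coordField hy u)

/-- The structure equation `dA + A ∧ A = 0`: the curvature is evaluated on constant combinations of
the frame along coordinate fields, which commute. -/
lemma connMatrix_flat [T2Space M] (hsm : D.ContMDiffCovariantDerivative ∞)
    (hfl : IsFlatOn F D univ) (h : SmoothFrame I F e U) {y : M} (hyU : y ∈ U)
    (hy : y ∈ (chartAt H q).source) (u v : EM) :
    fderiv ℝ (connMatrix D e q ∘ (extChartAt I q).symm) (extChartAt I q y) u v +
      connMatrix D e q y u * connMatrix D e q y v =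
    fderiv ℝ (connMatrix D e q ∘ (extChartAt I q).symm) (extChartAt I q y) v u +
      connMatrix D e q y v * connMatrix D e q y u := by
  have hU' : IsOpen (U ∩ (chartAt H q).source) := h.isOpen.inter (chartAt H q).open_source
  have hdA : DifferentiableAt ℝ (connMatrix D e q ∘ (extChartAt I q).symm) (extChartAt I q y) :=
    (contDiffAt_comp_extChartAt_symm hy (contMDiffAt_connMatrix hsm h hyU hy)).differentiableAt
      (by simp)
  refine ContinuousLinearMap.ext fun c ↦ ?_
  have hcs : ∀ z ∈ U ∩ (chartAt H q).source,
      SmoothAt I F (fun y ↦ frameSum (fun i ↦ e i y) c) z :=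
    fun z hz ↦ h.smoothAt_sum hz.1 contMDiffAt_const
  have h0 := curvature_eq_zero_of_isFlatOn hsm hfl hU' ⟨hyU, hy⟩ hcs
    (fun z hz ↦ contMDiffAt_coordField hz.2 u) (fun z hz ↦ contMDiffAt_coordField hz.2 v)
  have hAc : ∀ w, ContMDiffAt I 𝓘(ℝ, ι → ℝ) ∞ (fun z ↦ connMatrix D e q z w c) y := fun w ↦
    ((contMDiffAt_connMatrix hsm h hyU hy).clm_apply contMDiffAt_const).clm_apply contMDiffAt_const
  have key : ∀ w w', D (fun z ↦ D (fun y ↦ frameSum (fun i ↦ e i y) c) z (coordField I q w z)) y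
      (coordField I q w' y) = frameSum (fun i ↦ e i y)
        (fderiv ℝ (connMatrix D e q ∘ (extChartAt I q).symm) (extChartAt I q y) w' w c +
          connMatrix D e q y w' (connMatrix D e q y w c)) := by
    intro w w'
    have e1 : D (fun z ↦ D (fun y ↦ frameSum (fun i ↦ e i y) c) z (coordField I q w z)) y =
        D (fun z ↦ frameSum (fun i ↦ e i z) (connMatrix D e q z w c)) y := by
      refine D.congr_of_eventuallyEq (h.smoothAt_sum hyU (hAc w)).mdiff ?_
      filter_upwards [hU'.mem_nhds ⟨hyU, hy⟩] with z hz
      rw [h.deriv_coordField hz.1 hz.2 mdifferentiableAt_const]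
      congr 1
      have : (fun _ : M ↦ c) ∘ (extChartAt I q).symm = fun _ ↦ c := rfl
      rw [this]
      simp
    rw [e1, h.deriv_coordField hyU hy ((hAc w).mdifferentiableAt (by simp))]
    congr 2
    exact fderiv_apply_clm hdA (ContinuousLinearMap.apply ℝ (ι → ℝ) c) w w'
  rw [key, key, mlieBracket_coordField hy, map_zero, sub_zero, ← map_sub] at h0
  have h1 := (h.bij y hyU).1 (h0.trans (map_zero _).symm)
  exact sub_eq_zero.1 h1

end Connection

set_option synthInstance.maxHeartbeats 200000 in
set_option maxHeartbeats 1000000 in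
/-- A smooth flat connection has parallel frames. -/
theorem exists_flatFrame [T2Space M] [ContMDiffVectorBundle ∞ F V I] {D : CovariantDerivative I F V}
    (hsm : D.ContMDiffCovariantDerivative ∞) (hfl : IsFlatOn F D univ) (q : M) :
    ∃ (U : Set M) (e : Fin (Module.finrank ℝ F) → Π x : M, V x), q ∈ U ∧ FlatFrame D e U := by
  obtain ⟨U, e, hqU, h⟩ := exists_smoothFrame (I := I) (F := F) (V := V) q
  let φ := extChartAt I q
  let z₀ : EM := φ q
  let A : EM → EM →L[ℝ] ((Fin (Module.finrank ℝ F) → ℝ) →L[ℝ] (Fin (Module.finrank ℝ F) → ℝ)) :=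
    connMatrix D e q ∘ φ.symm
  -- The chart is translated so that `q` sits at the origin, where `exists_parallel` works.
  let Ω : Set EM := {z | z₀ + z ∈ φ.target ∩ φ.symm ⁻¹' U}
  have hOpen : IsOpen (φ.target ∩ φ.symm ⁻¹' U) :=
    (continuousOn_extChartAt_symm q).isOpen_inter_preimage (isOpen_extChartAt_target q) h.isOpen
  have hΩo : IsOpen Ω := hOpen.preimage (by fun_prop)
  have h0Ω : (0 : EM) ∈ Ω := by
    show z₀ + 0 ∈ φ.target ∩ φ.symm ⁻¹' U
    rw [add_zero]
    refine ⟨mem_extChartAt_target (I := I) q, ?_⟩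
    show φ.symm (φ q) ∈ U
    rwa [φ.left_inv (mem_extChartAt_source q)]
  have hΩm : ∀ z ∈ Ω, φ.symm (z₀ + z) ∈ U ∧ φ.symm (z₀ + z) ∈ (chartAt H q).source ∧
      φ (φ.symm (z₀ + z)) = z₀ + z := fun z hz ↦
    ⟨hz.2, by simpa only [φ, extChartAt_source] using φ.map_target hz.1, φ.right_inv hz.1⟩
  have hAs : ∀ z ∈ Ω, ContDiffAt ℝ ∞ A (z₀ + z) := by
    intro z hz
    obtain ⟨h1, h2, h3⟩ := hΩm z hz
    rw [← h3]
    exact contDiffAt_comp_extChartAt_symm h2 (contMDiffAt_connMatrix hsm h h1 h2)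
  have hAfl : ∀ z ∈ Ω, ∀ u v, fderiv ℝ (fun z ↦ A (z₀ + z)) z u v + A (z₀ + z) u * A (z₀ + z) v =
      fderiv ℝ (fun z ↦ A (z₀ + z)) z v u + A (z₀ + z) v * A (z₀ + z) u := by
    intro z hz u v
    obtain ⟨h1, h2, h3⟩ := hΩm z hz
    have := connMatrix_flat hsm hfl h h1 h2 u v
    rw [h3] at this
    have e5 : fderiv ℝ (fun z ↦ A (z₀ + z)) z = fderiv ℝ A (z₀ + z) :=
      fderiv_comp_add_left (𝕜 := ℝ) (f := A) z₀
    rw [e5]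
    exact this
  have hAsm : ContDiffOn ℝ ∞ (fun z ↦ A (z₀ + z)) Ω := fun z hz ↦
    (ContDiffAt.comp z (f := fun z ↦ z₀ + z) (g := A) (hAs z hz) (by fun_prop)).contDiffWithinAt
  obtain ⟨ρ, hρ, hex⟩ := exists_parallel (A := fun z ↦ A (z₀ + z)) (hΩo.mem_nhds h0Ω)
    hAsm hAfl
  -- The matrix solution with value `1` at the origin; its columns are the coefficients of parallel
  -- sections.
  obtain ⟨f, hf0, hfs, hfd⟩ := hex 1
  have hfc : ContinuousOn f (Metric.ball 0 ρ) := hfs.continuousOn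
  -- The columns form a frame only where `f` is invertible, an open condition that holds at the
  -- origin.
  let N : Set EM := (Metric.ball 0 ρ ∩ f ⁻¹' {L | IsUnit L}) ∩ Ω
  have hN : IsOpen N :=
    (hfc.isOpen_inter_preimage Metric.isOpen_ball Units.isOpen).inter hΩo
  let U' : Set M := φ.source ∩ φ ⁻¹' ((fun z ↦ z - z₀) ⁻¹' N)
  have hU'o : IsOpen U' := (continuousOn_extChartAt q).isOpen_inter_preimage
    (isOpen_extChartAt_source q) (hN.preimage (by fun_prop))
  have hU' : ∀ y ∈ U', y ∈ U ∧ y ∈ (chartAt H q).source ∧ φ y - z₀ ∈ Metric.ball (0 : EM) ρ ∧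
      IsUnit (f (φ y - z₀)) := by
    intro y hy
    have h1 := (hΩm _ hy.2.2).1
    rw [add_sub_cancel, φ.left_inv hy.1] at h1
    exact ⟨h1, by simpa only [φ, extChartAt_source] using hy.1, hy.2.1.1, hy.2.1.2⟩
  let a : Fin (Module.finrank ℝ F) → M → Fin (Module.finrank ℝ F) → ℝ :=
    fun j y ↦ f (φ y - z₀) (Pi.single j 1)
  have hfat : ∀ y ∈ U', ContDiffAt ℝ ∞ (fun z ↦ f (z - z₀)) (φ y) := fun y hy ↦
    ContDiffAt.comp (φ y) (f := fun z ↦ z - z₀) (g := f)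
      (hfs.contDiffAt (Metric.isOpen_ball.mem_nhds (hU' y hy).2.2.1)) (by fun_prop)
  have has : ∀ j, ∀ y ∈ U', ContMDiffAt I 𝓘(ℝ, Fin (Module.finrank ℝ F) → ℝ) ∞ (a j) y :=
    fun j y hy ↦ contMDiffAt_comp_extChartAt (f := fun z ↦ f (z - z₀) (Pi.single j 1))
      (hU' y hy).2.1 ((hfat y hy).clm_apply contDiffAt_const)
  refine ⟨U', fun j y ↦ frameSum (fun i ↦ e i y) (a j y), ⟨mem_extChartAt_source q, ?_⟩,
    ⟨hU'o, fun j y hy ↦ h.smoothAt_sum (hU' y hy).1 (has j y hy), fun y hy ↦ ?_⟩,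
    fun j y hy ↦ ?_⟩
  · show φ q - z₀ ∈ N
    rw [sub_self]
    refine ⟨⟨Metric.mem_ball_self hρ, ?_⟩, h0Ω⟩
    show IsUnit (f 0)
    rw [hf0]
    exact isUnit_one
  · have e1 : ⇑(frameSum fun j ↦ frameSum (fun i ↦ e i y) (a j y)) =
        frameSum (fun i ↦ e i y) ∘ f (φ y - z₀) := by
      funext c
      simp only [Function.comp_apply, a]
      rw [frameSum_apply]
      simp only [← map_smul, ← map_sum]
      congr 2
      conv_rhs => rw [pi_eq_sum_univ' c]
    rw [e1]
    exact (h.bij y (hU' y hy).1).comp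
      (ContinuousLinearMap.isUnit_iff_bijective.1 (hU' y hy).2.2.2)
  · obtain ⟨hyU, hyc, hyb, -⟩ := hU' y hy
    refine clm_ext_coordField hyc fun u ↦ ?_
    rw [h.deriv_coordField hyU hyc ((has j y hy).mdifferentiableAt (by simp))]
    have hd1 : HasFDerivAt (fun z ↦ f (z - z₀))
        (-((ContinuousLinearMap.mul ℝ _).flip (f (φ y - z₀))).comp (A (z₀ + (φ y - z₀)))) (φ y) :=
      (hasFDerivAt_comp_sub (f := f) (x := φ y) z₀).2 (hfd _ hyb)
    let ev := ContinuousLinearMap.apply ℝ (Fin (Module.finrank ℝ F) → ℝ)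
      (Pi.single j 1 : Fin (Module.finrank ℝ F) → ℝ)
    have hd2 := ev.hasFDerivAt.comp _ hd1
    have e2 : (a j ∘ φ.symm) =ᶠ[𝓝 (φ y)] ev ∘ fun z ↦ f (z - z₀) := by
      filter_upwards [(isOpen_extChartAt_target q).mem_nhds (φ.map_source hy.1)] with z hz
      show f (φ (φ.symm z) - z₀) (Pi.single j 1) = f (z - z₀) (Pi.single j 1)
      rw [φ.right_inv hz]
    have hd3 := e2.fderiv_eq.trans hd2.fderiv
    have hA : A (z₀ + (φ y - z₀)) = connMatrix D e q y := by
      show connMatrix D e q (φ.symm _) = _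
      rw [add_sub_cancel, φ.left_inv hy.1]
    rw [hA] at hd3
    have hd4 : fderiv ℝ (a j ∘ φ.symm) (φ y) u = -(connMatrix D e q y u (a j y)) :=
      congrArg (fun L : EM →L[ℝ] (Fin (Module.finrank ℝ F) → ℝ) ↦ L u) hd3
    have hd5 : fderiv ℝ (a j ∘ φ.symm) (φ y) u + connMatrix D e q y u (a j y) = 0 := by
      rw [hd4, neg_add_cancel]
    exact (congrArg _ hd5).trans (map_zero _)

end FlatFrameExistence
end

/-! ### The exterior covariant derivative and the Poincaré lemma for one-forms. -/

noncomputable section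
section ExteriorDerivative

variable {EM : Type*} [NormedAddCommGroup EM] [NormedSpace ℝ EM] [FiniteDimensional ℝ EM]
  {H : Type*} [TopologicalSpace H] {I : ModelWithCorners ℝ EM H} [I.Boundaryless]
  {M : Type*} [TopologicalSpace M] [ChartedSpace H M] [IsManifold I ∞ M]
  {F : Type*} [NormedAddCommGroup F] [NormedSpace ℝ F] [FiniteDimensional ℝ F]
  {V : M → Type*} [TopologicalSpace (TotalSpace F V)]
  [∀ x, AddCommGroup (V x)] [∀ x, Module ℝ (V x)] [∀ x, TopologicalSpace (V x)]
  [∀ x, IsTopologicalAddGroup (V x)] [∀ x, ContinuousSMul ℝ (V x)]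
  [FiberBundle F V] [VectorBundle ℝ F V]

/-- The exterior covariant derivative of a not necessarily smooth one-form. -/
def extD (D : CovariantDerivative I F V) (ξ : Π x : M, TangentSpace I x →L[ℝ] V x)
    (X Y : Π x : M, TangentSpace I x) (x : M) : V x :=
  D (fun y ↦ ξ y (Y y)) x (X x) - D (fun y ↦ ξ y (X y)) x (Y x) -
    ξ x (VectorField.mlieBracket I X Y x)

variable {D : CovariantDerivative I F V} {ξ η : Π x : M, TangentSpace I x →L[ℝ] V x}
  {X X' Y Y' : Π x : M, TangentSpace I x} {x : M}

lemma extD_swap : extD D ξ Y X x = - extD D ξ X Y x := by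
  unfold extD
  rw [VectorField.mlieBracket_swap_apply, map_neg]
  abel

lemma extD_congr (hξ : FormSmoothAt I F ξ x) (h : ∀ᶠ y in 𝓝 x, η y = ξ y) (hX : SmoothAt I EM X x)
    (hY : SmoothAt I EM Y x) : extD D η X Y x = extD D ξ X Y x := by
  have e : ∀ {Z : Π x : M, TangentSpace I x}, SmoothAt I EM Z x →
      D (fun y ↦ η y (Z y)) x = D (fun y ↦ ξ y (Z y)) x :=
    fun hZ ↦ D.congr_of_eventuallyEq (hξ.apply hZ).mdiff (h.mono fun y hy ↦ by rw [hy])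
  unfold extD
  rw [e hX, e hY, h.self_of_nhds]

lemma extD_add (hξ : FormSmoothAt I F ξ x) (hη : FormSmoothAt I F η x) (hX : SmoothAt I EM X x)
    (hY : SmoothAt I EM Y x) :
    extD D (fun y ↦ ξ y + η y) X Y x = extD D ξ X Y x + extD D η X Y x := by
  have e : ∀ {Z : Π x : M, TangentSpace I x}, SmoothAt I EM Z x →
      D (fun y ↦ (ξ y + η y) (Z y)) x = D (fun y ↦ ξ y (Z y)) x + D (fun y ↦ η y (Z y)) x :=
    fun hZ ↦ D.isCovariantDerivativeOnUniv.add (hξ.apply hZ).mdiff (hη.apply hZ).mdiff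
  unfold extD
  rw [e hX, e hY]
  simp only [add_apply]
  abel

lemma extD_smul (c : ℝ) (hξ : FormSmoothAt I F ξ x) (hX : SmoothAt I EM X x)
    (hY : SmoothAt I EM Y x) :
    extD D (fun y ↦ c • ξ y) X Y x = c • extD D ξ X Y x := by
  have e : ∀ {Z : Π x : M, TangentSpace I x}, SmoothAt I EM Z x →
      D (fun y ↦ (c • ξ y) (Z y)) x = c • D (fun y ↦ ξ y (Z y)) x :=
    fun hZ ↦ D.isCovariantDerivativeOnUniv.smul_const c (hξ.apply hZ).mdiff
  unfold extD
  rw [e hX, e hY]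
  simp only [smul_apply, smul_sub]

lemma FormSmoothAt.mdiff_apply (hξ : FormSmoothAt I F ξ x)
    (hX : MDifferentiableAt I (I.prod 𝓘(ℝ, EM)) (fun y ↦ TotalSpace.mk' EM y (X y)) x) :
    MDifferentiableAt I (I.prod 𝓘(ℝ, F)) (fun y ↦ TotalSpace.mk' F y (ξ y (X y))) x :=
  MDifferentiableAt.clm_bundle_apply (SmoothAt.mdiff hξ) hX

/-- The derivative of `f` produced by the Leibniz rule for `ξ (f X)` cancels the one produced by the
bracket of `f X` with `Y`. -/
lemma tensorialAt_extD_left (hξ : FormSmoothAt I F ξ x) :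
    TensorialAt I EM (fun X ↦ extD D ξ X Y x) x where
  smul := by
    intro f X hf hX
    have h1 := D.isCovariantDerivativeOnUniv.leibniz (hξ.mdiff_apply hX) hf
    have h2 : D (fun y ↦ ξ y ((f • X) y)) x =
        D (f • fun y ↦ ξ y (X y)) x := by
      congr 1
      funext y
      exact map_smul (ξ y) (f y) (X y)
    have h3 := VectorField.mlieBracket_smul_left (W := Y) hf hX
    simp only [extD]
    rw [h2, h1, h3]
    simp only [Pi.smul_apply', map_smul, map_add, map_neg, neg_smul, add_apply, smul_apply,
      ContinuousLinearMap.smulRight_apply, smul_sub]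
    abel
  add := by
    intro X X' hX hX'
    have h1 := D.isCovariantDerivativeOnUniv.add (hξ.mdiff_apply hX) (hξ.mdiff_apply hX')
    have h2 : D (fun y ↦ ξ y ((X + X') y)) x =
        D ((fun y ↦ ξ y (X y)) + fun y ↦ ξ y (X' y)) x := by
      congr 1
      funext y
      exact map_add (ξ y) (X y) (X' y)
    have h3 := VectorField.mlieBracket_add_left (W := Y) hX hX'
    simp only [extD]
    rw [h2, h1, h3]
    simp only [Pi.add_apply, map_add, add_apply]
    abel

lemma extD_pointwise (hξ : FormSmoothAt I F ξ x) (hX : SmoothAt I EM X x) (hX' : SmoothAt I EM X' x)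
    (hY : SmoothAt I EM Y x) (hY' : SmoothAt I EM Y' x) (h : X x = X' x) (h' : Y x = Y' x) :
    extD D ξ X Y x = extD D ξ X' Y' x := by
  refine ((tensorialAt_extD_left hξ).pointwise hX.mdiff hX'.mdiff h).trans ?_
  show extD D ξ X' Y x = extD D ξ X' Y' x
  rw [extD_swap, extD_swap (X := Y')]
  exact congrArg _ ((tensorialAt_extD_left hξ).pointwise hY.mdiff hY'.mdiff h')

/-- Closed forms are characterised by the coordinate fields. -/
lemma mem_closedForms_iff [T2Space M] {ξ : OneForm I F V} : ξ ∈ closedForms D ↔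
    ∀ (X Y : Π x : M, TangentSpace I x) (x : M), SmoothAt I EM X x → SmoothAt I EM Y x →
      extD D ξ X Y x = 0 := by
  refine ⟨fun h X Y x hX hY ↦ ?_, fun h X Y x ↦ h X Y x (X.smoothAt x) (Y.smoothAt x)⟩
  -- Every tangent vector is the value of a global smooth field, and by tensoriality only values at
  -- `x` matter.
  have hc : ∀ w : TangentSpace I x, ∃ Z : VField I M, Z x = w := by
    intro w
    obtain ⟨Z, hZ⟩ := exists_smoothSec_eventuallyEq (chartAt H x).open_source
      (mem_chart_source H x) (fun y hy ↦ contMDiffAt_coordField (I := I) hy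
        (mfderiv I 𝓘(ℝ, EM) (extChartAt I x) x w))
    exact ⟨Z, hZ.self_of_nhds.trans (coordField_mfderiv (mem_chart_source H x) w)⟩
  obtain ⟨X', hX'⟩ := hc (X x)
  obtain ⟨Y', hY'⟩ := hc (Y x)
  rw [extD_pointwise (ξ.smoothAt x) hX (X'.smoothAt x) hY (Y'.smoothAt x) hX'.symm hY'.symm]
  exact h X' Y' x

section Frame

variable {ι : Type*} [Fintype ι] {e : ι → Π x : M, V x} {U : Set M}

lemma FlatFrame.extD_deriv (h : FlatFrame D e U) (hx : x ∈ U) {v : Π x, V x}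
    (hv : ∀ᶠ y in 𝓝 x, SmoothAt I F v y) (hX : SmoothAt I EM X x) (hY : SmoothAt I EM Y x) :
    extD D (fun y ↦ D v y) X Y x = 0 :=
  h.curvature_eq_zero hx hv hX hY

variable (I) in
/-- The coefficients of a form in a frame and a chart. -/
def formCoef (e : ι → Π x : M, V x) (q : M) (ξ : Π x : M, TangentSpace I x →L[ℝ] V x) (y : M) :
    EM →L[ℝ] (ι → ℝ) :=
  LinearMap.toContinuousLinearMap
    { toFun := fun u ↦ frameCoef (fun i ↦ e i y) (ξ y (coordField I q u y))
      map_add' := fun u v ↦ by rw [coordField_add, map_add, map_add]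
      map_smul' := fun c u ↦ by rw [coordField_smul, map_smul, map_smul]; rfl }

lemma formCoef_apply {q : M} (y : M) (u : EM) :
    formCoef I e q ξ y u = frameCoef (fun i ↦ e i y) (ξ y (coordField I q u y)) := rfl

lemma SmoothFrame.contMDiffAt_formCoef (h : SmoothFrame I F e U) (hx : x ∈ U) {q : M}
    (hq : x ∈ (chartAt H q).source) (hξ : FormSmoothAt I F ξ x) :
    ContMDiffAt I 𝓘(ℝ, EM →L[ℝ] (ι → ℝ)) ∞ (formCoef I e q ξ) x :=
  contMDiffAt_clm_of_apply fun u ↦ h.contMDiffAt_coef hx (hξ.apply (contMDiffAt_coordField hq u))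

/-- The exterior derivative in a parallel frame. -/
lemma FlatFrame.extD_coordField (h : FlatFrame D e U) (hx : x ∈ U) {q : M}
    (hq : x ∈ (chartAt H q).source) (hξ : FormSmoothAt I F ξ x) (u v : EM) :
    extD D ξ (coordField I q u) (coordField I q v) x = frameSum (fun i ↦ e i x)
      (fderiv ℝ (formCoef I e q ξ ∘ (extChartAt I q).symm) (extChartAt I q x) u v -
        fderiv ℝ (formCoef I e q ξ ∘ (extChartAt I q).symm) (extChartAt I q x) v u) := by
  have hd := (contDiffAt_comp_extChartAt_symm hq
    (h.contMDiffAt_formCoef hx hq hξ)).differentiableAt (by simp)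
  have key : ∀ u v : EM, D (fun y ↦ ξ y (coordField I q v y)) x (coordField I q u x) =
      frameSum (fun i ↦ e i x)
        (fderiv ℝ (formCoef I e q ξ ∘ (extChartAt I q).symm) (extChartAt I q x) u v) := by
    intro u v
    have hs := hξ.apply (contMDiffAt_coordField hq v)
    rw [h.deriv_eq hx hs, mvfderiv_coordField hq
      ((h.contMDiffAt_coef hx hs).mdifferentiableAt (by simp))]
    congr 1
    exact fderiv_apply_clm hd (ContinuousLinearMap.id ℝ _) v u
  unfold extD
  rw [key, key, mlieBracket_coordField hq, map_zero, sub_zero, map_sub]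

/-- An open set inside a chart, convex in the chart, with a parallel frame. -/
structure IsNice (D : CovariantDerivative I F V) (e : ι → Π x : M, V x) (q : M) (U : Set M) : Prop
    extends FlatFrame D e U where
  subset : U ⊆ (chartAt H q).source
  convex : Convex ℝ (extChartAt I q '' U)

lemma isOpen_extChartAt_image {q : M} (hU : IsOpen U) (hs : U ⊆ (chartAt H q).source) :
    IsOpen (extChartAt I q '' U) := by
  rw [(extChartAt I q).image_eq_target_inter_inv_preimage (by rwa [extChartAt_source])]
  exact (continuousOn_extChartAt_symm q).isOpen_inter_preimage (isOpen_extChartAt_target q) hU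

/-- The Poincaré lemma for closed one-forms with values in a flat bundle. -/
theorem IsNice.exists_primitive {q : M} (h : IsNice D e q U)
    (hξ : ∀ y ∈ U, FormSmoothAt I F ξ y)
    (hc : ∀ y ∈ U, ∀ u v : EM, extD D ξ (coordField I q u) (coordField I q v) y = 0) :
    ∃ v : Π x, V x, (∀ y ∈ U, SmoothAt I F v y) ∧ ∀ y ∈ U, D v y = ξ y := by
  let φ := extChartAt I q
  let α : EM → EM →L[ℝ] (ι → ℝ) := formCoef I e q ξ ∘ φ.symm
  have hUs : ∀ y ∈ U, y ∈ φ.source := fun y hy ↦ by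
    simpa only [φ, extChartAt_source] using h.subset hy
  have ho : IsOpen (φ '' U) := isOpen_extChartAt_image h.isOpen h.subset
  have hα : ContDiffOn ℝ ∞ α (φ '' U) := by
    rintro _ ⟨y, hy, rfl⟩
    exact (contDiffAt_comp_extChartAt_symm (h.subset hy)
      (h.contMDiffAt_formCoef hy (h.subset hy) (hξ y hy))).contDiffWithinAt
  -- In a parallel frame closedness says that the derivative of the coefficient matrix is symmetric;
  -- on a convex open set this suffices for a primitive.
  obtain ⟨f, hf⟩ := h.convex.exists_forall_hasFDerivAt_of_fderiv_symmetric ho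
    (hα.differentiableOn (by simp)) (by
      rintro _ ⟨y, hy, rfl⟩ u v
      have h1 := hc y hy u v
      rw [h.extD_coordField hy (h.subset hy) (hξ y hy)] at h1
      exact sub_eq_zero.1 ((h.bij y hy).1 (h1.trans (map_zero _).symm)))
  have hfs : ContDiffOn ℝ ∞ f (φ '' U) :=
    (contDiffOn_infty_iff_fderiv_of_isOpen ho).2
      ⟨fun z hz ↦ (hf z hz).differentiableAt.differentiableWithinAt,
        hα.congr fun z hz ↦ (hf z hz).fderiv⟩
  have hfy : ∀ y ∈ U, ContMDiffAt I 𝓘(ℝ, ι → ℝ) ∞ (fun y ↦ f (φ y)) y := fun y hy ↦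
    contMDiffAt_comp_extChartAt (h.subset hy)
      (hfs.contDiffAt (ho.mem_nhds (mem_image_of_mem φ hy)))
  refine ⟨fun y ↦ frameSum (fun i ↦ e i y) (f (φ y)), fun y hy ↦ h.smoothAt_sum hy (hfy y hy),
    fun y hy ↦ clm_ext_coordField (h.subset hy) fun u ↦ ?_⟩
  rw [h.deriv_sum hy ((hfy y hy).mdifferentiableAt (by simp)),
    mvfderiv_coordField (h.subset hy) ((hfy y hy).mdifferentiableAt (by simp))]
  have e1 : (fun y ↦ f (φ y)) ∘ φ.symm =ᶠ[𝓝 (φ y)] f := by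
    filter_upwards [(isOpen_extChartAt_target q).mem_nhds (φ.map_source (hUs y hy))] with z hz
    show f (φ (φ.symm z)) = f z
    rw [φ.right_inv hz]
  have e2 : fderiv ℝ ((fun y ↦ f (φ y)) ∘ φ.symm) (φ y) u = α (φ y) u :=
    congrArg (fun L : EM →L[ℝ] (ι → ℝ) ↦ L u)
      (e1.fderiv_eq.trans (hf _ (mem_image_of_mem φ hy)).fderiv)
  refine (congrArg _ e2).trans ?_
  show frameSum (fun i ↦ e i y) (formCoef I e q ξ (φ.symm (φ y)) u) = _
  rw [φ.left_inv (hUs y hy), formCoef_apply, frameSum_frameCoef (h.bij y hy)]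

/-- The set is the chart preimage of a small ball about the image of `x`. -/
lemma FlatFrame.exists_isNice (h : FlatFrame D e U) (hx : x ∈ U) {U' : Set M} (hU' : U' ∈ 𝓝 x) :
    ∃ O ⊆ U', x ∈ O ∧ IsNice D e x O := by
  let φ := extChartAt I x
  have h1 : U ∩ U' ∩ φ.source ∈ 𝓝 x := Filter.inter_mem (Filter.inter_mem (h.isOpen.mem_nhds hx) hU')
    (extChartAt_source_mem_nhds x)
  have h2 : φ.target ∩ φ.symm ⁻¹' interior (U ∩ U' ∩ φ.source) ∈ 𝓝 (φ x) := by
    refine ((continuousOn_extChartAt_symm x).isOpen_inter_preimage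
      (isOpen_extChartAt_target x) isOpen_interior).mem_nhds ⟨mem_extChartAt_target x, ?_⟩
    show φ.symm (φ x) ∈ interior (U ∩ U' ∩ φ.source)
    rw [φ.left_inv (mem_extChartAt_source x)]
    exact mem_interior_iff_mem_nhds.2 h1
  obtain ⟨r, hr, hb⟩ := Metric.mem_nhds_iff.1 h2
  have hO : IsOpen (φ.source ∩ φ ⁻¹' Metric.ball (φ x) r) :=
    (continuousOn_extChartAt x).isOpen_inter_preimage (isOpen_extChartAt_source x)
      Metric.isOpen_ball
  have hsub : φ.source ∩ φ ⁻¹' Metric.ball (φ x) r ⊆ U ∩ U' ∩ φ.source := by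
    intro y hy
    have := interior_subset (hb hy.2).2
    rwa [φ.left_inv hy.1] at this
  refine ⟨φ.source ∩ φ ⁻¹' Metric.ball (φ x) r, fun y hy ↦ (hsub hy).1.2,
    ⟨mem_extChartAt_source x, Metric.mem_ball_self hr⟩,
    { h.mono hO fun y hy ↦ (hsub hy).1.1 with
      subset := fun y hy ↦ by simpa only [φ, extChartAt_source] using hy.1
      convex := ?_ }⟩
  have : φ '' (φ.source ∩ φ ⁻¹' Metric.ball (φ x) r) = Metric.ball (φ x) r := by
    refine Subset.antisymm (by rintro _ ⟨y, hy, rfl⟩; exact hy.2) fun z hz ↦ ?_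
    have hz' := (hb hz).1
    refine ⟨φ.symm z, ⟨φ.map_target hz', ?_⟩, φ.right_inv hz'⟩
    show φ (φ.symm z) ∈ Metric.ball (φ x) r
    rwa [φ.right_inv hz']
  rw [this]
  exact convex_ball _ _

end Frame

end ExteriorDerivative
end

/-! ### Parallel sections and parallel families of subspaces. -/

noncomputable section
section ParallelFamilies

variable {EM : Type*} [NormedAddCommGroup EM] [NormedSpace ℝ EM] [FiniteDimensional ℝ EM]
  {H : Type*} [TopologicalSpace H] {I : ModelWithCorners ℝ EM H} [I.Boundaryless]
  {M : Type*} [TopologicalSpace M] [ChartedSpace H M] [IsManifold I ∞ M]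
  {F : Type*} [NormedAddCommGroup F] [NormedSpace ℝ F] [FiniteDimensional ℝ F]
  {V : M → Type*} [TopologicalSpace (TotalSpace F V)]
  [∀ x, AddCommGroup (V x)] [∀ x, Module ℝ (V x)] [∀ x, TopologicalSpace (V x)]
  [∀ x, IsTopologicalAddGroup (V x)] [∀ x, ContinuousSMul ℝ (V x)]
  [FiberBundle F V] [VectorBundle ℝ F V]
  {D : CovariantDerivative I F V} {ι : Type*} [Fintype ι] {e : ι → Π x : M, V x} {q : M} {U : Set M}

/-- Parallel sections have constant coefficients in a parallel frame. -/
lemma IsNice.coef_const (h : IsNice D e q U) {s : Π x, V x} (hs : ∀ y ∈ U, SmoothAt I F s y)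
    (hD : ∀ y ∈ U, D s y = 0) {x y : M} (hx : x ∈ U) (hy : y ∈ U) :
    frameCoef (fun i ↦ e i x) (s x) = frameCoef (fun i ↦ e i y) (s y) := by
  let φ := extChartAt I q
  let a : M → ι → ℝ := fun y ↦ frameCoef (fun i ↦ e i y) (s y)
  have hUs : ∀ y ∈ U, y ∈ φ.source := fun y hy ↦ by
    simpa only [φ, extChartAt_source] using h.subset hy
  have ho : IsOpen (φ '' U) := isOpen_extChartAt_image h.isOpen h.subset
  have ha : ∀ y ∈ U, ContMDiffAt I 𝓘(ℝ, ι → ℝ) ∞ a y := fun y hy ↦ h.contMDiffAt_coef hy (hs y hy)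
  have hd : ∀ y ∈ U, fderiv ℝ (a ∘ φ.symm) (φ y) = 0 := by
    intro y hy
    refine ContinuousLinearMap.ext fun u ↦ ?_
    have h1 := h.deriv_eq hy (hs y hy) (coordField I q u y)
    rw [hD y hy, mvfderiv_coordField (h.subset hy) ((ha y hy).mdifferentiableAt (by simp))] at h1
    exact (h.bij y hy).1 (h1.symm.trans (map_zero _).symm)
  have hc := ho.is_const_of_fderiv_eq_zero (𝕜 := ℝ) (f := a ∘ φ.symm) h.convex.isPreconnected
    (by
      rintro _ ⟨y, hy, rfl⟩
      exact ((contDiffAt_comp_extChartAt_symm (h.subset hy) (ha y hy)).differentiableAt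
        (by simp)).differentiableWithinAt)
    (by
      rintro _ ⟨y, hy, rfl⟩
      exact hd y hy) (mem_image_of_mem φ hx) (mem_image_of_mem φ hy)
  have h2 : a (φ.symm (φ x)) = a (φ.symm (φ y)) := hc
  rwa [φ.left_inv (hUs x hx), φ.left_inv (hUs y hy)] at h2

/-- A parallel section of a flat bundle is locally a constant combination of a parallel frame. -/
lemma IsNice.eq_frameSum (h : IsNice D e q U) {s : Π x, V x} (hs : ∀ y ∈ U, SmoothAt I F s y)
    (hD : ∀ y ∈ U, D s y = 0) : ∃ a : ι → ℝ, ∀ y ∈ U, s y = frameSum (fun i ↦ e i y) a := by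
  rcases U.eq_empty_or_nonempty with hU | ⟨x, hx⟩
  · exact ⟨0, by simp [hU]⟩
  · refine ⟨frameCoef (fun i ↦ e i x) (s x), fun y hy ↦ ?_⟩
    rw [h.coef_const hs hD hx hy, frameSum_frameCoef (h.bij y hy)]

/-- Smooth sections near a point extend to smooth sections, by means of a cut-off function. -/
lemma exists_smoothSec_cutoff [T2Space M] {s : Π x, V x} {x : M} (hU : IsOpen U)
    (hx : x ∈ U) (hs : ∀ y ∈ U, SmoothAt I F s y) :
    ∃ (s' : SmoothSec I F V) (f : M → ℝ), (∀ y ∉ U, f y = 0) ∧ (∀ᶠ y in 𝓝 x, f y = 1) ∧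
      ∀ y, s' y = f y • s y := by
  obtain ⟨f, -, hf⟩ := (SmoothBumpFunction.nhds_basis_tsupport (I := I) x).mem_iff.1
    (hU.mem_nhds hx)
  refine ⟨⟨fun y ↦ f y • s y, fun y ↦ ?_⟩, f,
    fun y hy ↦ image_eq_zero_of_notMem_tsupport fun h ↦ hy (hf h), f.eventuallyEq_one,
    fun y ↦ rfl⟩
  by_cases hy : y ∈ tsupport f
  · exact SmoothAt.smul f.contMDiffAt (hs y (hf hy))
  · refine SmoothAt.congr (s := fun y ↦ (0 : V y)) SmoothAt.zero ?_
    filter_upwards [(isClosed_tsupport f).isOpen_compl.mem_nhds hy] with z hz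
    rw [image_eq_zero_of_notMem_tsupport hz, zero_smul]

/-- A family of subspaces which is constant in suitable parallel frames. -/
def IsParallelFamily (D : CovariantDerivative I F V) (W : Π x, Submodule ℝ (V x)) : Prop :=
  ∀ x, ∃ (U : Set M) (n : ℕ) (e : Fin n → Π x : M, V x) (W₀ : Submodule ℝ (Fin n → ℝ)),
    x ∈ U ∧ FlatFrame D e U ∧ ∀ y ∈ U, W y = W₀.map (frameSum fun i ↦ e i y)

/-- Constancy in parallel frames provides all that irreducibility asks of a subbundle: locally
constant, hence constant, dimension; sections through every vector by cut-off; and invariance under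
the connection. -/
lemma IsParallelFamily.eq_bot_or_eq_top [T2Space M] [PreconnectedSpace M]
    {W : Π x, Submodule ℝ (V x)} (hW : IsParallelFamily D W) (hD : IsIrreducibleConn D) :
    (∀ x, W x = ⊥) ∨ ∀ x, W x = ⊤ := by
  refine hD W ?_ ?_ ?_
  · have hl : IsLocallyConstant fun x ↦ Module.finrank ℝ (W x) := by
      rw [IsLocallyConstant.iff_eventually_eq]
      intro x
      obtain ⟨U, n, e, W₀, hx, h, hWU⟩ := hW x
      have hr : ∀ y ∈ U, Module.finrank ℝ (W y) = Module.finrank ℝ W₀ := fun y hy ↦ by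
        rw [hWU y hy]
        exact (LinearEquiv.finrank_eq (Submodule.equivMapOfInjective _ (h.bij y hy).1 W₀)).symm
      filter_upwards [h.isOpen.mem_nhds hx] with y hy
      rw [hr y hy, hr x hx]
    rcases isEmpty_or_nonempty M with hM | ⟨⟨x₀⟩⟩
    · exact ⟨0, fun x ↦ (hM.false x).elim⟩
    · exact ⟨_, fun x ↦ hl.apply_eq_of_preconnectedSpace x x₀⟩
  · intro x w hw
    obtain ⟨U, n, e, W₀, hx, h, hWU⟩ := hW x
    rw [hWU x hx] at hw
    obtain ⟨a, ha, rfl⟩ := hw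
    obtain ⟨s, f, hf0, hf1, hs⟩ := exists_smoothSec_cutoff (s := fun y ↦ frameSum (fun i ↦ e i y) a)
      h.isOpen hx fun y hy ↦ h.smoothAt_sum hy contMDiffAt_const
    refine ⟨s, by rw [hs, hf1.self_of_nhds, one_smul], fun y ↦ ?_⟩
    rw [hs]
    by_cases hy : y ∈ U
    · rw [hWU y hy]
      exact Submodule.smul_mem _ _ (Submodule.mem_map_of_mem ha)
    · rw [hf0 y hy, zero_smul]
      exact zero_mem _
  · intro s hs x u
    obtain ⟨U, n, e, W₀, hx, h, hWU⟩ := hW x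
    rw [h.deriv_eq hx (s.smoothAt x), hWU x hx]
    refine Submodule.mem_map_of_mem ?_
    let a : M → Fin n → ℝ := fun y ↦ frameCoef (fun i ↦ e i y) (s y)
    have ha : ∀ y ∈ U, a y ∈ W₀ := by
      intro y hy
      have h1 := hs y
      rw [hWU y hy] at h1
      obtain ⟨b, hb, hb'⟩ := h1
      show frameCoef (fun i ↦ e i y) (s y) ∈ W₀
      rw [← hb', frameCoef_frameSum (h.bij y hy)]
      exact hb
    -- A function with values in `W₀` has its derivative in `W₀`. This is tested on the functionals
    -- that vanish on `W₀`.
    rw [← Subspace.forall_mem_dualAnnihilator_apply_eq_zero_iff]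
    intro f hf
    rw [Submodule.mem_dualAnnihilator] at hf
    have had : MDifferentiableAt I 𝓘(ℝ, Fin n → ℝ) a x :=
      (h.contMDiffAt_coef hx (s.smoothAt x)).mdifferentiableAt (by simp)
    let L : (Fin n → ℝ) →L[ℝ] ℝ := LinearMap.toContinuousLinearMap f
    have h6 := (L.hasMFDerivAt (x := a x)).comp x had.hasMFDerivAt
    have h7 : (fun y ↦ L (a y)) =ᶠ[𝓝 x] fun _ ↦ (0 : ℝ) := by
      filter_upwards [h.isOpen.mem_nhds hx] with y hy using hf _ (ha y hy)
    have h8 : mfderiv I 𝓘(ℝ, ℝ) (fun y ↦ L (a y)) x = 0 := by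
      rw [h7.mfderiv_eq]
      exact mfderiv_const
    have h9 := h6.mfderiv.symm.trans h8
    exact congrArg (fun L : EM →L[ℝ] ℝ ↦ L u) h9

/-- An irreducible flat connection on a bundle of rank at least two has no parallel sections. -/
lemma eq_zero_of_parallel [T2Space M] [PreconnectedSpace M] (hD : IsIrreducibleConn D)
    (hfr : ∀ x, ∃ (U : Set M) (n : ℕ) (e : Fin n → Π x : M, V x), 1 < n ∧ x ∈ U ∧ FlatFrame D e U)
    {s : Π x, V x} (hs : ∀ y, SmoothAt I F s y) (hDs : ∀ y, D s y = 0) (x : M) : s x = 0 := by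
  -- The span of a parallel section is a parallel family, and its dimension, at most one, is too
  -- small to be everything.
  have hW : IsParallelFamily D fun x ↦ Submodule.span ℝ {s x} := by
    intro x
    obtain ⟨U, n, e, -, hx, h⟩ := hfr x
    obtain ⟨O, hOU, hxO, hO⟩ := h.exists_isNice hx Filter.univ_mem
    obtain ⟨a, ha⟩ := hO.eq_frameSum (fun y _ ↦ hs y) fun y _ ↦ hDs y
    refine ⟨O, n, e, Submodule.span ℝ {a}, hxO, hO.toFlatFrame, fun y hy ↦ ?_⟩
    rw [Submodule.map_span, image_singleton, ← ha y hy]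
  rcases hW.eq_bot_or_eq_top hD with h0 | h1
  · exact Submodule.span_singleton_eq_bot.1 (h0 x)
  · obtain ⟨U, n, e, hn, hx, h⟩ := hfr x
    have e1 : Module.finrank ℝ (V x) = n := by
      have := (LinearEquiv.ofBijective _ (h.bij x hx)).finrank_eq
      simpa using this.symm
    have e2 : Module.finrank ℝ (Submodule.span ℝ {s x}) ≤ 1 := (finrank_span_le_card {s x}).trans (by simp)
    rw [h1 x, finrank_top, e1] at e2
    omega

end ParallelFamilies
end

/-! ### Real eigenvalues in odd dimension. -/

noncomputable section
section OddRoots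

/-- In odd degree both `p(x)` and `-p(-x)` tend to infinity, so `p` takes both signs and the
intermediate value theorem applies. -/
lemma Polynomial.exists_isRoot_real_of_odd {p : Polynomial ℝ} (hp : p.Monic)
    (ho : Odd p.natDegree) : ∃ x, p.IsRoot x := by
  have hd : 0 < p.degree := Polynomial.natDegree_pos_iff_degree_pos.1 ho.pos
  have h1 : Filter.Tendsto (fun x ↦ p.eval x) Filter.atTop Filter.atTop :=
    p.tendsto_atTop_of_leadingCoeff_nonneg hd (by rw [hp]; exact zero_le_one)
  let r : Polynomial ℝ := -(p.comp (-Polynomial.X))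
  have hrd : r.natDegree = p.natDegree := by
    simp [r, Polynomial.natDegree_comp]
  have hrl : 0 ≤ r.leadingCoeff := by
    have : (p.comp (-Polynomial.X)).leadingCoeff = -1 := by
      rw [Polynomial.leadingCoeff_comp (by simp), hp]
      simp [ho.neg_one_pow]
    simp [r, this]
  have h2 : Filter.Tendsto (fun x ↦ r.eval x) Filter.atTop Filter.atTop :=
    r.tendsto_atTop_of_leadingCoeff_nonneg
      (Polynomial.natDegree_pos_iff_degree_pos.1 (by rw [hrd]; exact ho.pos)) hrl
  obtain ⟨a, ha⟩ := (h1.eventually_ge_atTop 0).exists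
  obtain ⟨b, hb⟩ := (h2.eventually_ge_atTop 0).exists
  have hb' : p.eval (-b) ≤ 0 := by
    simpa [r] using hb
  obtain ⟨c, hc⟩ := mem_range_of_exists_le_of_exists_ge p.continuous ⟨_, hb'⟩ ⟨_, ha⟩
  exact ⟨c, hc⟩

lemma exists_eigenvalue_of_odd {W : Type*} [AddCommGroup W] [Module ℝ W] [FiniteDimensional ℝ W]
    (h : Odd (Module.finrank ℝ W)) (A : W →ₗ[ℝ] W) : ∃ (c : ℝ) (w : W), w ≠ 0 ∧ A w = c • w := by
  obtain ⟨c, hc⟩ := Polynomial.exists_isRoot_real_of_odd A.charpoly_monic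
    (by rwa [A.charpoly_natDegree])
  obtain ⟨w, hw⟩ := ((Module.End.hasEigenvalue_iff_isRoot_charpoly A c).2 hc).exists_hasEigenvector
  exact ⟨c, w, hw.2, hw.apply_eq_smul⟩

end OddRoots

/-! ### Endomorphisms commuting with the connection, and parallel frames on the cylinder. -/

section Commuting

variable {EM : Type*} [NormedAddCommGroup EM] [NormedSpace ℝ EM] [FiniteDimensional ℝ EM]
  {H : Type*} [TopologicalSpace H] {I : ModelWithCorners ℝ EM H} [I.Boundaryless]
  {M : Type*} [TopologicalSpace M] [ChartedSpace H M] [IsManifold I ∞ M]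
  {F : Type*} [NormedAddCommGroup F] [NormedSpace ℝ F] [FiniteDimensional ℝ F]
  {V : M → Type*} [TopologicalSpace (TotalSpace F V)]
  [∀ x, AddCommGroup (V x)] [∀ x, Module ℝ (V x)] [∀ x, TopologicalSpace (V x)]
  [∀ x, IsTopologicalAddGroup (V x)] [∀ x, ContinuousSMul ℝ (V x)]
  [FiberBundle F V] [VectorBundle ℝ F V]
  {D : CovariantDerivative I F V} {ι : Type*} [Fintype ι] {e : ι → Π x : M, V x} {q : M} {U : Set M}

/-- Every point has a parallel frame of length `n` near it. -/
def HasFlatFrames (D : CovariantDerivative I F V) (n : ℕ) : Prop :=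
  ∀ x, ∃ (U : Set M) (e : Fin n → Π x : M, V x), x ∈ U ∧ FlatFrame D e U

lemma FlatFrame.finrank_eq (h : FlatFrame D e U) {x : M} (hx : x ∈ U) :
    Module.finrank ℝ (V x) = Fintype.card ι := by
  have := (LinearEquiv.ofBijective _ (h.bij x hx)).finrank_eq
  simpa using this.symm

lemma FlatFrame.finiteDimensional (h : FlatFrame D e U) {x : M} (hx : x ∈ U) :
    FiniteDimensional ℝ (V x) :=
  (LinearEquiv.ofBijective _ (h.bij x hx)).finiteDimensional

/-- An endomorphism commuting with the connection has constant coefficients in a parallel frame. -/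
lemma IsNice.exists_matrix [T2Space M] (h : IsNice D e q U) (A : EndSec I F V)
    (hA : ∀ (s : SmoothSec I F V) (x : M), D (fun y ↦ A y (s y)) x = (A x).comp (D s x)) :
    ∃ T : (ι → ℝ) →ₗ[ℝ] (ι → ℝ), ∀ y ∈ U, ∀ a,
      A y (frameSum (fun i ↦ e i y) a) = frameSum (fun i ↦ e i y) (T a) := by
  have hAs : ∀ {s : Π x, V x} {y : M}, SmoothAt I F s y → SmoothAt I F (fun y ↦ A y (s y)) y :=
    fun hs ↦ ContMDiffAt.clm_bundle_apply (A.contMDiff _) hs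
  have h1 : ∀ j, ∃ c : ι → ℝ, ∀ y ∈ U, A y (e j y) = frameSum (fun i ↦ e i y) c := by
    intro j
    -- Commuting with the connection makes the image of a parallel section parallel, so its
    -- coefficients are constant.
    refine h.eq_frameSum (s := fun y ↦ A y (e j y)) (fun y hy ↦ hAs (h.smooth j y hy))
      fun y hy ↦ ?_
    obtain ⟨s, hs⟩ := exists_smoothSec_eventuallyEq h.isOpen hy (h.smooth j)
    have e1 := hA s y
    rw [D.congr_of_eventuallyEq (h.smooth j y hy).mdiff hs, h.flat j y hy,
      D.congr_of_eventuallyEq (hAs (h.smooth j y hy)).mdiff (hs.mono fun z hz ↦ by rw [hz])] at e1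
    rw [e1, ContinuousLinearMap.comp_zero]
  choose c hc using h1
  refine ⟨frameSum c, fun y hy a ↦ ?_⟩
  rw [frameSum_apply (fun i ↦ e i y) a, frameSum_apply c a, map_sum, map_sum]
  refine Finset.sum_congr rfl fun j _ ↦ ?_
  rw [map_smul, map_smul, hc j y hy]

section Cyl

lemma CylBundle.smoothAt_pullback {s : Π x, V x} {p : M × ℝ} (hs : SmoothAt I F s p.1) :
    SmoothAt (I.prod 𝓘(ℝ, ℝ)) F (V := CylBundle I V) (fun p ↦ s p.1) p := by
  refine (contMDiffAt_section _).2 ?_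
  have h1 : ContMDiffAt I 𝓘(ℝ, F) ∞ (fun q ↦ (trivializationAt F V p.1 ⟨q, s q⟩).2) p.1 :=
    (contMDiffAt_section _).1 hs
  exact h1.comp p contMDiffAt_fst

lemma CylBundle.smoothAt_slice {σ : Π p, CylBundle I V p} {x : M} {t : ℝ}
    (hσ : SmoothAt (I.prod 𝓘(ℝ, ℝ)) F σ (x, t)) : SmoothAt I F (CylBundle.slice σ t) x := by
  refine (contMDiffAt_section (F := F) (E := V) (s := CylBundle.slice σ t) _).2 ?_
  have h1 : ContMDiffAt (I.prod 𝓘(ℝ, ℝ)) 𝓘(ℝ, F) ∞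
      (fun q : M × ℝ ↦ (trivializationAt F V x ⟨q.1, σ q⟩).2) (x, t) :=
    (contMDiffAt_section _).1 hσ
  exact h1.comp (f := fun y : M ↦ (y, t)) x (contMDiffAt_id.prodMk contMDiffAt_const)

lemma cylinder_apply (D : CovariantDerivative I F V) (σ : Π p, CylBundle I V p) (p : M × ℝ)
    (w : TangentSpace (I.prod 𝓘(ℝ, ℝ)) p) : D.cylinder σ p w =
      (D (CylBundle.slice σ p.2) p.1 (show EM × ℝ from w).1 +
        (show EM × ℝ from w).2 • CylBundle.vertDeriv F σ p : V p.1) := rfl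

lemma CylBundle.vertDeriv_pullback (s : Π x, V x) (p : M × ℝ) :
    CylBundle.vertDeriv F (I := I) (fun p : M × ℝ ↦ s p.1) p = 0 := by
  unfold CylBundle.vertDeriv
  simp

lemma FlatFrame.cylinder (h : FlatFrame D e U) :
    FlatFrame D.cylinder (fun i (p : M × ℝ) ↦ (e i p.1 : CylBundle I V p)) (U ×ˢ univ) where
  isOpen := h.isOpen.prod isOpen_univ
  smooth i p hp := CylBundle.smoothAt_pullback (h.smooth i p.1 hp.1)
  bij p hp := h.bij p.1 hp.1
  flat i p hp := by
    refine ContinuousLinearMap.ext fun w ↦ ?_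
    refine (cylinder_apply D _ p w).trans ?_
    have h1 : D (CylBundle.slice (I := I) (fun p : M × ℝ ↦ (e i p.1 : CylBundle I V p)) p.2) p.1 = 0 :=
      h.flat i p.1 hp.1
    rw [h1]
    have h2 := CylBundle.vertDeriv_pullback (I := I) (F := F) (e i) p
    refine (congrArg₂ (· + ·) rfl (congrArg _ h2)).trans ?_
    rw [smul_zero]
    exact add_zero (0 : V p.1)

/-- The whole line is kept as second factor. Parallel sections over a nice set of the base times `ℝ`
then have constant coefficients along all of the line at once. -/
lemma IsNice.cylinder (h : IsNice D e q U) (t : ℝ) :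
    IsNice D.cylinder (fun i (p : M × ℝ) ↦ (e i p.1 : CylBundle I V p)) (q, t) (U ×ˢ univ) where
  toFlatFrame := h.toFlatFrame.cylinder
  subset := by
    rintro p ⟨hp, -⟩
    exact ⟨h.subset hp, mem_univ _⟩
  convex := by
    have : extChartAt (I.prod 𝓘(ℝ, ℝ)) (q, t) '' (U ×ˢ univ) = (extChartAt I q '' U) ×ˢ univ := by
      rw [extChartAt_prod, PartialEquiv.prod_coe]
      ext ⟨z, s⟩
      constructor
      · rintro ⟨p, ⟨hp, -⟩, hp'⟩
        exact ⟨⟨p.1, hp, congrArg Prod.fst hp'⟩, mem_univ _⟩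
      · rintro ⟨⟨y, hy, hy'⟩, -⟩
        exact ⟨(y, s), ⟨hy, mem_univ _⟩, Prod.ext hy' rfl⟩
    rw [this]
    exact h.convex.prod convex_univ

lemma HasFlatFrames.exists_isNice {n : ℕ} (h : HasFlatFrames D n) (x : M) {U' : Set M}
    (hU' : U' ∈ 𝓝 x) : ∃ (O : Set M) (e : Fin n → Π x : M, V x), O ⊆ U' ∧ x ∈ O ∧ IsNice D e x O := by
  obtain ⟨U, e, hx, he⟩ := h x
  obtain ⟨O, hO, hxO, hn⟩ := he.exists_isNice hx hU'
  exact ⟨O, e, hO, hxO, hn⟩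

lemma HasFlatFrames.cylinder {n : ℕ} (h : HasFlatFrames D n) : HasFlatFrames D.cylinder n := by
  intro p
  obtain ⟨U, e, hx, he⟩ := h p.1
  exact ⟨U ×ˢ univ, fun i p ↦ e i p.1, ⟨hx, mem_univ _⟩, he.cylinder⟩

/-- An endomorphism of the pull-back of an irreducible flat bundle of odd rank that commutes with
the connection is a scalar. -/
theorem exists_scalar_of_commute [T2Space M] [PreconnectedSpace M] [Nonempty M] {n : ℕ}
    (hn : Odd n) (hfr : HasFlatFrames D n) (hD : IsIrreducibleConn D)
    (A : EndSec (I.prod 𝓘(ℝ, ℝ)) F (CylBundle I V))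
    (hA : ∀ (s : SmoothSec (I.prod 𝓘(ℝ, ℝ)) F (CylBundle I V)) (x : M × ℝ),
      D.cylinder (fun y ↦ A y (s y)) x = (A x).comp (D.cylinder s x)) :
    ∃ c : ℝ, ∀ p w, A p w = c • w := by
  obtain ⟨x₀⟩ := ‹Nonempty M›
  -- Irreducibility concerns the base, so the endomorphism is first restricted to the slice at
  -- height zero.
  let A₀ : ∀ x : M, V x →ₗ[ℝ] V x := fun x ↦
    { toFun := fun v ↦ (A (x, 0) (show CylBundle I V (x, 0) from v) : V x)
      map_add' := fun v w ↦ map_add (A (x, 0)) _ _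
      map_smul' := fun c v ↦ map_smul (A (x, 0)) _ _ }
  -- Odd rank gives a real eigenvalue at a single point; the rest of the proof spreads it over the
  -- manifold.
  obtain ⟨c, w, hw0, hw⟩ : ∃ (c : ℝ) (w : V x₀), w ≠ 0 ∧ A₀ x₀ w = c • w := by
    obtain ⟨U, e, hx, he⟩ := hfr x₀
    have := he.finiteDimensional hx
    exact exists_eigenvalue_of_odd (by rwa [he.finrank_eq hx, Fintype.card_fin]) _
  have hloc : ∀ x, ∃ (O : Set M) (e : Fin n → Π x : M, V x)
      (T : (Fin n → ℝ) →ₗ[ℝ] (Fin n → ℝ)), x ∈ O ∧ FlatFrame D e O ∧ ∀ y ∈ O, ∀ t a,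
        A (y, t) (frameSum (fun i ↦ e i y) a : V y) = (frameSum (fun i ↦ e i y) (T a) : V y) := by
    intro x
    obtain ⟨O, e, -, hxO, hO⟩ := hfr.exists_isNice x Filter.univ_mem
    obtain ⟨T, hT⟩ := (hO.cylinder 0).exists_matrix A hA
    exact ⟨O, e, T, hxO, hO.toFlatFrame, fun y hy t a ↦ hT (y, t) ⟨hy, mem_univ _⟩ a⟩
  -- In a parallel frame the endomorphism is a constant matrix `T`, so its eigenspaces for `c` are
  -- constant there too.
  have hW : IsParallelFamily D fun x ↦ LinearMap.ker (A₀ x - c • LinearMap.id) := by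
    intro x
    obtain ⟨O, e, T, hxO, hO, hT⟩ := hloc x
    refine ⟨O, n, e, LinearMap.ker (T - c • LinearMap.id), hxO, hO, fun y hy ↦ ?_⟩
    ext v
    have hv := frameSum_frameCoef (hO.bij y hy) v
    have key : ∀ a, A₀ y (frameSum (fun i ↦ e i y) a) = frameSum (fun i ↦ e i y) (T a) :=
      fun a ↦ hT y hy 0 a
    constructor
    · intro h1
      refine ⟨frameCoef (fun i ↦ e i y) v, ?_, hv⟩
      refine (hO.bij y hy).1 ?_
      rw [map_zero]
      rw [← hv] at h1
      simpa [key, map_sub] using h1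
    · rintro ⟨a, ha, rfl⟩
      have h2 := congrArg (frameSum fun i ↦ e i y) (LinearMap.mem_ker.1 ha)
      simpa [key, map_sub] using h2
  rcases hW.eq_bot_or_eq_top hD with h0 | h1
  · refine absurd ?_ hw0
    have : w ∈ LinearMap.ker (A₀ x₀ - c • LinearMap.id) := by simp [hw]
    rw [h0 x₀] at this
    exact (Submodule.mem_bot ℝ).1 this
  · refine ⟨c, fun p v ↦ ?_⟩
    obtain ⟨O, e, T, hxO, hO, hT⟩ := hloc p.1
    have hTc : ∀ a, T a = c • a := by
      intro a
      have h2 : frameSum (fun i ↦ e i p.1) a ∈ LinearMap.ker (A₀ p.1 - c • LinearMap.id) := by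
        rw [h1 p.1]; trivial
      have h3 : A₀ p.1 (frameSum (fun i ↦ e i p.1) a) = c • frameSum (fun i ↦ e i p.1) a := by
        simpa [sub_eq_zero] using h2
      have h4 : A₀ p.1 (frameSum (fun i ↦ e i p.1) a) = frameSum (fun i ↦ e i p.1) (T a) :=
        hT p.1 hxO 0 a
      refine (hO.bij p.1 hxO).1 ?_
      rw [← h4, h3, map_smul]
    -- The matrix `T` is the same at all heights, so the result on the slice extends to the
    -- cylinder.
    have h5 := hT p.1 hxO p.2 (frameCoef (fun i ↦ e i p.1) (v : V p.1))
    rw [hTc, map_smul] at h5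
    have h6 : (frameSum (fun i ↦ e i p.1) (frameCoef (fun i ↦ e i p.1) (v : V p.1)) : V p.1) = v :=
      frameSum_frameCoef (hO.bij p.1 hxO) _
    exact (congrArg (A p) h6.symm).trans (h5.trans (congrArg (c • ·) h6))

end Cyl

end Commuting
end

/-! ### Gauge classes, equivalence classes of singular metrics, and cohomology. -/

noncomputable section
section GaugeAndMetric

variable {EM : Type*} [NormedAddCommGroup EM] [NormedSpace ℝ EM] [FiniteDimensional ℝ EM]
  {H : Type*} [TopologicalSpace H] {I : ModelWithCorners ℝ EM H} [I.Boundaryless]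
  {M : Type*} [TopologicalSpace M] [ChartedSpace H M] [IsManifold I ∞ M]
  {F : Type*} [NormedAddCommGroup F] [NormedSpace ℝ F] [FiniteDimensional ℝ F]
  {V : M → Type*} [TopologicalSpace (TotalSpace F V)]
  [∀ x, AddCommGroup (V x)] [∀ x, Module ℝ (V x)] [∀ x, TopologicalSpace (V x)]
  [∀ x, IsTopologicalAddGroup (V x)] [∀ x, ContinuousSMul ℝ (V x)]
  [FiberBundle F V] [VectorBundle ℝ F V]
  {D : CovariantDerivative I F V}

lemma HasFlatFrames.extD_deriv {n : ℕ} (h : HasFlatFrames D n) {x : M} {v : Π x, V x}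
    (hv : ∀ᶠ y in 𝓝 x, SmoothAt I F v y) {X Y : Π x : M, TangentSpace I x}
    (hX : SmoothAt I EM X x) (hY : SmoothAt I EM Y x) :
    extD D (fun y ↦ D v y) X Y x = 0 := by
  obtain ⟨U, e, hx, he⟩ := h x
  exact he.extD_deriv hx hv hX hY

lemma HasFlatFrames.formSmoothAt_deriv {n : ℕ} (h : HasFlatFrames D n) {x : M} {v : Π x, V x}
    (hv : ∀ᶠ y in 𝓝 x, SmoothAt I F v y) : FormSmoothAt I F (fun y ↦ D v y) x := by
  obtain ⟨U, e, hx, he⟩ := h x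
  exact he.formSmoothAt_deriv hx hv

/-- Flatness of `∇ + ξ` is the closedness of `ξ`. -/
theorem addTranslation_isFlat_iff [T2Space M] {n : ℕ} (h : HasFlatFrames D n)
    (ξ : OneForm I F V) : (D.addTranslation ξ).IsFlat ↔ ξ ∈ closedForms D := by
  -- The curvature of `D + ξ` on `s` is the curvature of `D` on `s` plus the exterior derivative of
  -- `ξ`, and the first summand vanishes.
  have key : ∀ (X Y : VField I M) (s : SmoothSec I F V) (x : M),
      D (fun y ↦ (D s y + ξ y) (Y y)) x (X x) - D (fun y ↦ (D s y + ξ y) (X y)) x (Y x) -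
        (D s x + ξ x) (VectorField.mlieBracket I X Y x) = extCovDeriv D ξ X Y x := by
    intro X Y s x
    have h1 := extD_add (D := D) (h.formSmoothAt_deriv (v := s)
      (Filter.Eventually.of_forall s.smoothAt)) (ξ.smoothAt x) (X.smoothAt x) (Y.smoothAt x)
    rw [h.extD_deriv (v := s) (Filter.Eventually.of_forall s.smoothAt) (X.smoothAt x)
      (Y.smoothAt x), zero_add] at h1
    exact h1
  constructor
  · intro hf X Y x
    exact (key X Y 0 x).symm.trans (hf X Y 0 x)
  · intro hc X Y s x
    exact (key X Y s x).trans (hc X Y x)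

lemma addTranslation_injective {ξ η : OneForm I F V}
    (h : D.addTranslation ξ = D.addTranslation η) : ξ = η := by
  ext x : 1
  have h1 := congrArg (fun A : AffineConnection I F V ↦ A.toFun 0 x) h
  exact add_left_cancel h1

variable (D) in
/-- All endomorphisms of the bundle commuting with the connection are scalars. -/
def HasScalarCommutant : Prop :=
  ∀ A : EndSec I F V,
    (∀ (s : SmoothSec I F V) (x : M), D (fun y ↦ A y (s y)) x = (A x).comp (D s x)) →
    ∃ c : ℝ, ∀ p w, A p w = c • w

/-- The gauge transformation is the translation by a primitive `v`, with identity linear part. -/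
lemma gaugeEquiv_of_exact {b : Π x, V x → V x → ℝ} {ξ η : OneForm I F V}
    [ContMDiffVectorBundle ∞ F V I]
    (h : ξ - η ∈ exactForms D) :
    AffineConnection.GaugeEquiv b (D.addTranslation ξ) (D.addTranslation η) := by
  obtain ⟨v, hv⟩ := h
  refine ⟨⟨fun y ↦ ContinuousLinearMap.id ℝ (V y), fun x ↦ SmoothAt.id⟩, v, fun x ↦ ?_,
    fun s x ↦ ?_⟩
  · exact ⟨fun u w ↦ rfl, LinearMap.det_id, fun u hu ↦ hu⟩
  · have h1 := D.isCovariantDerivativeOnUniv.add (s.smoothAt x).mdiff (v.smoothAt x).mdiff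
    have h2 : ξ x - η x = D v x := hv x
    show D (fun y ↦ s y + v y) x + η x = (ContinuousLinearMap.id ℝ (V x)).comp (D s x + ξ x)
    rw [ContinuousLinearMap.id_comp]
    refine (congrArg (· + η x) h1).trans ?_
    rw [← h2]
    abel

/-- Evaluation on the zero section gives `Dv + η = G ξ`. Subtracting this from the identity for
general sections leaves `G` commuting with `D`; so `G` is a scalar, equal to one, and `v` is a
primitive of `ξ - η`. -/
lemma exact_of_gaugeEquiv {b : Π x, V x → V x → ℝ} {ξ η : OneForm I F V}
    {n : ℕ} (hn : Odd n) (hfr : HasFlatFrames D n) (hsc : HasScalarCommutant D) [Nonempty M]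
    (h : AffineConnection.GaugeEquiv b (D.addTranslation ξ) (D.addTranslation η)) :
    ξ - η ∈ exactForms D := by
  obtain ⟨G, v, hG, hGv⟩ := h
  have hG' : ∀ (s : SmoothSec I F V) (x : M),
      D (fun y ↦ G y (s y)) x + D v x + η x = (G x).comp (D s x + ξ x) := by
    intro s x
    have h1 := D.isCovariantDerivativeOnUniv.add
      (SmoothAt.mdiff (ContMDiffAt.clm_bundle_apply (G.contMDiff x) (s.contMDiff x)))
      (v.smoothAt x).mdiff
    exact (congrArg (· + η x) h1).symm.trans (hGv s x)
  have h0 : ∀ x, D v x + η x = (G x).comp (ξ x) := by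
    intro x
    have h1 := hG' 0 x
    have h2 : D (fun y ↦ G y ((0 : SmoothSec I F V) y)) x = 0 := by
      have : (fun y ↦ G y ((0 : SmoothSec I F V) y)) = (0 : Π x, V x) := by
        funext y; exact map_zero (G y)
      rw [this]
      exact D.isCovariantDerivativeOnUniv.zero
    have h3 : D (0 : SmoothSec I F V) x = 0 := D.isCovariantDerivativeOnUniv.zero
    rwa [h2, h3, zero_add, zero_add] at h1
  obtain ⟨c, hc⟩ := hsc G fun s x ↦ by
    have h1 := hG' s x
    rw [add_assoc, h0 x, ContinuousLinearMap.comp_add] at h1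
    exact add_right_cancel h1
  -- The determinant gives `cⁿ = 1`, and odd powers are injective on the reals.
  have hc1 : c = 1 := by
    obtain ⟨x⟩ := ‹Nonempty M›
    obtain ⟨U, e, hx, he⟩ := hfr x
    have h1 := (hG x).2.1
    have h2 : (G x : V x →ₗ[ℝ] V x) = c • LinearMap.id := LinearMap.ext fun w ↦ hc x w
    rw [h2, LinearMap.det_smul, LinearMap.det_id, mul_one, he.finrank_eq hx, Fintype.card_fin] at h1
    exact (hn.strictMono_pow.injective) (h1.trans (one_pow n).symm)
  refine ⟨v, fun x ↦ ?_⟩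
  have h1 : (G x).comp (ξ x) = ξ x := by
    ext w
    rw [ContinuousLinearMap.comp_apply, hc, hc1, one_smul]
  have h2 := h0 x
  rw [h1] at h2
  show ξ x - η x = D v x
  rw [← h2, add_sub_cancel_right]

lemma cohClass_eq_iff {ξ η : closedForms D} :
    cohClass D ξ = cohClass D η ↔ ξ.1 - η.1 ∈ exactForms D := by
  rw [cohClass, cohClass, Submodule.Quotient.eq]
  rfl

/-- The first cohomology as the set of gauge equivalence classes of flat affine connections. -/
theorem exists_gaugeClasses_equiv [T2Space M] [Nonempty M] [ContMDiffVectorBundle ∞ F V I]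
    {b : Π x, V x → V x → ℝ} {n : ℕ} (hn : Odd n)
    (hfr : HasFlatFrames D n) (hsc : HasScalarCommutant D) (hb : IsMetricOn F D b univ) :
    ∃ (_ : AddCommGroup (GaugeClasses D b)) (_ : Module ℝ (GaugeClasses D b))
      (Φ : TwistedH1 D ≃ₗ[ℝ] GaugeClasses D b),
      ∀ (ξ : closedForms D) (A : FlatISOConnection D b),
        A.1 = D.addTranslation ξ.1 → Φ (cohClass D ξ) = Quot.mk _ A := by
  let mk : closedForms D → FlatISOConnection D b := fun ξ ↦
    ⟨D.addTranslation ξ.1, hb, (addTranslation_isFlat_iff hfr ξ.1).2 ξ.2, ξ.1, rfl⟩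
  have hmk : ∀ A : FlatISOConnection D b, ∃ ξ, mk ξ = A := by
    rintro ⟨A, hA, hA', ξ, rfl⟩
    exact ⟨⟨ξ, (addTranslation_isFlat_iff hfr ξ).1 hA'⟩, rfl⟩
  let f : TwistedH1 D → GaugeClasses D b := Quotient.lift (fun ξ ↦ Quot.mk _ (mk ξ)) (by
    intro ξ η h
    refine Quot.sound (gaugeEquiv_of_exact ?_)
    exact cohClass_eq_iff.1 (Quotient.sound h))
  let g : FlatISOConnection D b → closedForms D := fun A ↦ (hmk A).choose
  have hg : ∀ A, mk (g A) = A := fun A ↦ (hmk A).choose_spec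
  have hgm : ∀ ξ, g (mk ξ) = ξ := fun ξ ↦
    Subtype.ext (addTranslation_injective (congrArg Subtype.val (hg (mk ξ))))
  let k : GaugeClasses D b → TwistedH1 D := Quot.lift (fun A ↦ cohClass D (g A)) (by
    intro A A' h
    rw [cohClass_eq_iff]
    refine exact_of_gaugeEquiv (b := b) hn hfr hsc ?_
    have h1 : D.addTranslation (g A).1 = A.1 := congrArg Subtype.val (hg A)
    have h2 : D.addTranslation (g A').1 = A'.1 := congrArg Subtype.val (hg A')
    rwa [h1, h2])
  let E : GaugeClasses D b ≃ TwistedH1 D :=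
    { toFun := k
      invFun := f
      left_inv := by
        rintro ⟨A⟩
        exact congrArg (Quot.mk _) (hg A)
      right_inv := by
        rintro ⟨ξ⟩
        exact congrArg (cohClass D) (hgm ξ) }
  -- The vector space structure on gauge classes is the one transported from the cohomology, so that
  -- linearity holds by construction.
  refine ⟨E.addCommGroup, E.module ℝ, ?_⟩
  let := E.addCommGroup
  let := E.module ℝ
  refine ⟨(E.linearEquiv ℝ).symm, fun ξ A hA ↦ ?_⟩
  have h1 : mk ξ = A := Subtype.ext hA.symm
  exact congrArg (Quot.mk _) h1

section Lorentz

/-- A Lorentzian form on the fibres of a bundle, compatible with the connection. -/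
structure IsParallelLorentz (D : CovariantDerivative I F V) (b : Π x, V x → V x → ℝ) : Prop where
  bilin : ∀ x, ∃ B : V x →ₗ[ℝ] V x →ₗ[ℝ] ℝ, ∀ u w, b x u w = B u w
  lorentz : ∀ x, IsLorentzForm (b x)
  metric : ∀ (s s' : Π x, V x) (x : M), SmoothAt I F s x → SmoothAt I F s' x →
    ∀ u : TangentSpace I x, mvfderiv I (fun y ↦ b y (s y) (s' y)) x u =
      b x (D s x u) (s' x) + b x (s x) (D s' x u)

variable {b : Π x, V x → V x → ℝ}

lemma IsParallelLorentz.isMetricOn (h : IsParallelLorentz D b) : IsMetricOn F D b univ :=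
  fun s s' hs hs' x _ u ↦ h.metric s s' x (hs.contMDiffAt Filter.univ_mem)
    (hs'.contMDiffAt Filter.univ_mem) u

lemma IsLorentzForm.exists_neg {W : Type*} [AddCommGroup W] {b : W → W → ℝ}
    (h : IsLorentzForm b) : ∃ e, b e e < 0 := ⟨h.2.choose, h.2.choose_spec.1⟩

/-- Lorentzian forms are nondegenerate. -/
lemma IsLorentzForm.eq_zero_of_forall {W : Type*} [AddCommGroup W] [Module ℝ W]
    {B : W →ₗ[ℝ] W →ₗ[ℝ] ℝ} (h : IsLorentzForm fun u w ↦ B u w) {u : W} (hu : ∀ w, B u w = 0) :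
    u = 0 := by
  obtain ⟨hs, e, he, hpos⟩ := h
  by_contra hne
  have h1 := hpos u hne ((hs e u).trans (hu e))
  exact absurd (hu u) h1.ne'

/-- An isometry commuting with the connection is a scalar `c`, and comparing squares of one timelike
vector gives `c² = 1`. -/
lemma sameMetric_iff [Nonempty M] [ContMDiffVectorBundle ∞ F V I] (hb : IsParallelLorentz D b)
    (hsc : HasScalarCommutant D) {ξ ξ' : OneForm I F V} :
    SameMetric D b ξ ξ' ↔ ξ' = ξ ∨ ξ' = -ξ := by
  have hid : ∀ ε : ℝ, ε * ε = 1 → (∀ x, ξ' x = ε • ξ x) → SameMetric D b ξ ξ' := by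
    intro ε hε h
    refine ⟨⟨fun y ↦ ε • ContinuousLinearMap.id ℝ (V y), fun x ↦ SmoothAt.const_smul ε SmoothAt.id⟩,
      fun x u w ↦ ?_, fun s x ↦ ?_, fun x ↦ ?_⟩
    · obtain ⟨B, hB⟩ := hb.bilin x
      show b x (ε • u) (ε • w) = b x u w
      rw [hB, hB, map_smul, map_smul, LinearMap.smul_apply, smul_smul, hε, one_smul]
    · show D (fun y ↦ ε • s y) x = (ε • ContinuousLinearMap.id ℝ (V x)).comp (D s x)
      rw [ContinuousLinearMap.smul_comp, ContinuousLinearMap.id_comp]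
      exact D.isCovariantDerivativeOnUniv.smul_const ε (s.smoothAt x).mdiff
    · show ξ' x = (ε • ContinuousLinearMap.id ℝ (V x)).comp (ξ x)
      rw [ContinuousLinearMap.smul_comp, ContinuousLinearMap.id_comp, h x]
  constructor
  · rintro ⟨A, hA, hAD, hAξ⟩
    obtain ⟨c, hc⟩ := hsc A hAD
    obtain ⟨x⟩ := ‹Nonempty M›
    obtain ⟨B, hB⟩ := hb.bilin x
    obtain ⟨e, he⟩ := (hb.lorentz x).exists_neg
    have h1 := hA x e e
    rw [hc, hB, hB, map_smul, map_smul, LinearMap.smul_apply, smul_smul, smul_eq_mul] at h1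
    rw [hB] at he
    have h2 : c * c = 1 := by
      have : (c * c - 1) * B e e = 0 := by linear_combination h1
      rcases mul_eq_zero.1 this with h | h
      · linarith
      · exact absurd h he.ne
    have h3 : ∀ x, ξ' x = c • ξ x := fun x ↦ by
      rw [hAξ x]; ext w; exact hc x _
    rcases mul_self_eq_one_iff.1 h2 with rfl | rfl
    · left; ext x : 1; rw [h3, one_smul]
    · right; ext x : 1; rw [h3]; exact neg_one_smul ℝ _
  · rintro (rfl | rfl)
    · exact hid 1 (one_mul 1) fun x ↦ (one_smul ℝ _).symm
    · exact hid (-1) (by norm_num) fun x ↦ (neg_one_smul ℝ _).symm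

lemma pulledMetric_neg (hb : IsParallelLorentz D b) (ξ : OneForm I F V) :
    pulledMetric b (-ξ) = pulledMetric b ξ := by
  funext x u w
  obtain ⟨B, hB⟩ := hb.bilin x
  show b x (-(ξ x u)) (-(ξ x w)) = b x (ξ x u) (ξ x w)
  rw [hB, hB, map_neg, map_neg, LinearMap.neg_apply, neg_neg]

/-- The classes of singular metrics with a property that every cohomology class can realise. -/
theorem exists_metricClasses_equiv [T2Space M] [Nonempty M] [ContMDiffVectorBundle ∞ F V I]
    (hb : IsParallelLorentz D b) (hsc : HasScalarCommutant D)
    {P : (Π x : M, TangentSpace I x → TangentSpace I x → ℝ) → Prop}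
    (hP : ∀ ξ : closedForms D, ∃ η : closedForms D, ξ.1 - η.1 ∈ exactForms D ∧
      P (pulledMetric b η.1)) :
    ∃ Ψ : MulAction.orbitRel.Quotient ℤˣ (TwistedH1 D) ≃ MetricClasses D b P,
      ∀ ξ : {ξ : closedForms D // P (pulledMetric b ξ.1)},
        Ψ (Quotient.mk _ (cohClass D ξ.1)) = Quot.mk _ ξ := by
  have horb : ∀ x y : TwistedH1 D, (Quotient.mk _ x : MulAction.orbitRel.Quotient ℤˣ (TwistedH1 D))
      = Quotient.mk _ y ↔ x = y ∨ x = -y := by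
    intro x y
    rw [Quotient.eq, MulAction.orbitRel_apply, MulAction.mem_orbit_iff]
    constructor
    · rintro ⟨u, hu⟩
      rcases Int.units_eq_one_or u with rfl | rfl
      · left; rw [← hu, one_smul]
      · right; rw [← hu, Units.smul_def]; simp
    · rintro (rfl | rfl)
      · exact ⟨1, one_smul _ _⟩
      · exact ⟨-1, by rw [Units.smul_def]; simp⟩
  -- The map is built from metrics to cohomology and inverted at the end. It respects the generating
  -- relations: forms presenting the same metric differ by a sign, and equivalent forms are
  -- cohomologous.
  let k : MetricClasses D b P → MulAction.orbitRel.Quotient ℤˣ (TwistedH1 D) :=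
    Quot.lift (fun ξ ↦ Quotient.mk _ (cohClass D ξ.1)) (by
      rintro ξ ξ' (h | h)
      · refine (horb _ _).2 ?_
        rcases (sameMetric_iff hb hsc).1 h with h | h
        · left; rw [Subtype.ext h]
        · right
          have : ξ.1 = - ξ'.1 := Subtype.ext (by
            show ξ.1.1 = -ξ'.1.1
            rw [h, neg_neg])
          rw [this]; rfl
      · congr 1
        exact (cohClass_eq_iff.2 h).symm)
  have hk : Function.Bijective k := by
    constructor
    · rintro ⟨ξ⟩ ⟨ξ'⟩ h
      rcases (horb _ _).1 h with h | h
      · have h2 : (Quot.mk _ ξ' : MetricClasses D b P) = Quot.mk _ ξ :=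
          Quot.sound (Or.inr (cohClass_eq_iff.1 h))
        exact h2.symm
      -- The form `-ξ'` links the two classes: it has the same metric as `ξ'`, hence property `P`,
      -- and it is cohomologous to `ξ`.
      · let ζ : {ξ : closedForms D // P (pulledMetric b ξ.1)} :=
          ⟨-ξ'.1, by
            show P (pulledMetric b (-ξ'.1.1))
            rw [pulledMetric_neg hb]
            exact ξ'.2⟩
        have h1 : Quot.mk _ ξ' = (Quot.mk _ ζ : MetricClasses D b P) :=
          Quot.sound (Or.inl ((sameMetric_iff hb hsc).2 (Or.inr rfl)))
        have h2 : Quot.mk _ ζ = (Quot.mk _ ξ : MetricClasses D b P) :=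
          Quot.sound (Or.inr (cohClass_eq_iff.1 h))
        exact (h1.trans h2).symm
    · rintro ⟨⟨ξ⟩⟩
      -- Surjectivity is where a representative with property `P` is needed in each class.
      obtain ⟨η, hη, hPη⟩ := hP ξ
      exact ⟨Quot.mk _ ⟨η, hPη⟩, congrArg (Quotient.mk _) (cohClass_eq_iff.2 hη).symm⟩
  refine ⟨(Equiv.ofBijective k hk).symm, fun ξ ↦ ?_⟩
  rw [Equiv.symm_apply_eq]
  rfl

end Lorentz

end GaugeAndMetric
end

/-! ### Parallel Lorentzian metrics and their pull-back to the cylinder. -/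

noncomputable section
section ParallelMetrics

variable {EM : Type*} [NormedAddCommGroup EM] [NormedSpace ℝ EM] [FiniteDimensional ℝ EM]
  {H : Type*} [TopologicalSpace H] {I : ModelWithCorners ℝ EM H} [I.Boundaryless]
  {M : Type*} [TopologicalSpace M] [ChartedSpace H M] [IsManifold I ∞ M]
  {F : Type*} [NormedAddCommGroup F] [NormedSpace ℝ F] [FiniteDimensional ℝ F]
  {V : M → Type*} [TopologicalSpace (TotalSpace F V)]
  [∀ x, AddCommGroup (V x)] [∀ x, Module ℝ (V x)] [∀ x, TopologicalSpace (V x)]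
  [∀ x, IsTopologicalAddGroup (V x)] [∀ x, ContinuousSMul ℝ (V x)]
  [FiberBundle F V] [VectorBundle ℝ F V]
  {D : CovariantDerivative I F V} {ι : Type*} [Fintype ι] {e : ι → Π x : M, V x} {q : M} {U : Set M}

lemma eq_of_mvfderiv_eq_zero {G : Type*} [NormedAddCommGroup G] [NormedSpace ℝ G] (hU : IsOpen U)
    (hs : U ⊆ (chartAt H q).source) (hc : Convex ℝ (extChartAt I q '' U)) {f : M → G}
    (hf : ∀ y ∈ U, MDifferentiableAt I 𝓘(ℝ, G) f y)
    (h : ∀ y ∈ U, ∀ u : TangentSpace I y, mvfderiv I f y u = 0) {x y : M} (hx : x ∈ U)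
    (hy : y ∈ U) : f x = f y := by
  let φ := extChartAt I q
  have hUs : ∀ y ∈ U, y ∈ φ.source := fun y hy ↦ by
    simpa only [φ, extChartAt_source] using hs hy
  have hc' := (isOpen_extChartAt_image hU hs).is_const_of_fderiv_eq_zero (𝕜 := ℝ)
    (f := f ∘ φ.symm) hc.isPreconnected
    (by
      rintro _ ⟨y, hy, rfl⟩
      have h2 : MDifferentiableAt 𝓘(ℝ, EM) I φ.symm (φ y) :=
        ((contMDiffOn_extChartAt_symm (n := ∞) q).contMDiffAt
          (extChartAt_target_mem_nhds'' (φ.map_source (hUs y hy)))).mdifferentiableAt (by simp)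
      have h3 : MDifferentiableAt I 𝓘(ℝ, G) f (φ.symm (φ y)) := by
        rw [φ.left_inv (hUs y hy)]; exact hf y hy
      exact (mdifferentiableAt_iff_differentiableAt.1
        (MDifferentiableAt.comp _ h3 h2)).differentiableWithinAt)
    (by
      rintro _ ⟨y, hy, rfl⟩
      refine ContinuousLinearMap.ext fun u ↦ ?_
      rw [← mvfderiv_coordField (hs hy) (hf y hy)]
      exact h y hy _) (mem_image_of_mem φ hx) (mem_image_of_mem φ hy)
  have h2 : f (φ.symm (φ x)) = f (φ.symm (φ y)) := hc'
  rwa [φ.left_inv (hUs x hx), φ.left_inv (hUs y hy)] at h2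

lemma hasMFDerivAt_fun_sum {n : ℕ} {f : Fin n → M → ℝ} {x : M} {f' : Fin n → TangentSpace I x →L[ℝ] ℝ}
    (h : ∀ i, HasMFDerivAt I 𝓘(ℝ, ℝ) (f i) x (f' i)) :
    HasMFDerivAt I 𝓘(ℝ, ℝ) (fun y ↦ ∑ i, f i y) x (∑ i, f' i) := by
  have h1 := HasMFDerivAt.sum (f := f) (f' := f') (t := Finset.univ) fun i _ ↦ h i
  have e : (∑ i, f i) = fun y ↦ ∑ i, f i y := by ext y; exact Finset.sum_apply _ _ _
  rwa [e] at h1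

/-- A bilinear form with constant coefficients in parallel frames is parallel. -/
lemma isParallelLorentz_of_gram {b : Π x, V x → V x → ℝ}
    (hb : ∀ x, ∃ B : V x →ₗ[ℝ] V x →ₗ[ℝ] ℝ, ∀ u w, b x u w = B u w)
    (hl : ∀ x, IsLorentzForm (b x)) {n : ℕ}
    (h : ∀ x, ∃ (U : Set M) (e : Fin n → Π x : M, V x) (C : Fin n → Fin n → ℝ), x ∈ U ∧
      FlatFrame D e U ∧ ∀ y ∈ U, ∀ i j, b y (e i y) (e j y) = C i j) :
    IsParallelLorentz D b where
  bilin := hb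
  lorentz := hl
  metric s s' x hs hs' u := by
    obtain ⟨U, e, C, hx, he, hC⟩ := h x
    -- With a constant Gram matrix the form is a fixed bilinear polynomial in the coefficients, so
    -- compatibility is the product rule.
    have hsum : ∀ y ∈ U, ∀ a a' : Fin n → ℝ, b y (frameSum (fun i ↦ e i y) a)
        (frameSum (fun i ↦ e i y) a') = ∑ i, ∑ j, a i * a' j * C i j := by
      intro y hy a a'
      obtain ⟨B, hB⟩ := hb y
      rw [hB, frameSum_apply, frameSum_apply, map_sum, Finset.sum_comm]
      refine Finset.sum_congr rfl fun j _ ↦ ?_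
      rw [map_sum, LinearMap.sum_apply]
      refine Finset.sum_congr rfl fun i _ ↦ ?_
      rw [map_smul, map_smul, LinearMap.smul_apply, ← hB, hC y hy, smul_eq_mul, smul_eq_mul]
      ring
    let a : M → Fin n → ℝ := fun y ↦ frameCoef (fun i ↦ e i y) (s y)
    let a' : M → Fin n → ℝ := fun y ↦ frameCoef (fun i ↦ e i y) (s' y)
    have ha : ∀ i, MDifferentiableAt I 𝓘(ℝ, ℝ) (fun y ↦ a y i) x := fun i ↦
      (contMDiffAt_pi_space.1 (he.contMDiffAt_coef hx hs) i).mdifferentiableAt (by simp)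
    have ha' : ∀ i, MDifferentiableAt I 𝓘(ℝ, ℝ) (fun y ↦ a' y i) x := fun i ↦
      (contMDiffAt_pi_space.1 (he.contMDiffAt_coef hx hs') i).mdifferentiableAt (by simp)
    have e1 : (fun y ↦ b y (s y) (s' y)) =ᶠ[𝓝 x] fun y ↦ ∑ i, ∑ j, a y i * a' y j * C i j := by
      filter_upwards [he.isOpen.mem_nhds hx] with y hy
      rw [← hsum y hy, frameSum_frameCoef (he.bij y hy), frameSum_frameCoef (he.bij y hy)]
    have hp : ∀ {c : M → Fin n → ℝ}, MDifferentiableAt I 𝓘(ℝ, Fin n → ℝ) c x → ∀ i,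
        mvfderiv I c x u i = mvfderiv I (fun y ↦ c y i) x u := by
      intro c hc i
      have h2 := mfderiv_comp x (I' := 𝓘(ℝ, Fin n → ℝ)) (I'' := 𝓘(ℝ, ℝ))
        (g := fun c : Fin n → ℝ ↦ c i)
        (ContinuousLinearMap.proj (R := ℝ) (φ := fun _ : Fin n ↦ ℝ) i).mdifferentiableAt hc
      have h3 : mfderiv 𝓘(ℝ, Fin n → ℝ) 𝓘(ℝ, ℝ) (fun c : Fin n → ℝ ↦ c i) (c x) =
        ContinuousLinearMap.proj (R := ℝ) (φ := fun _ : Fin n ↦ ℝ) i := by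
        rw [mfderiv_eq_fderiv]
        exact (ContinuousLinearMap.proj (R := ℝ) (φ := fun _ : Fin n ↦ ℝ) i).fderiv
      rw [h3] at h2
      exact (congrArg (fun L : TangentSpace I x →L[ℝ] ℝ ↦ L u) h2).symm
    have ea : s x = frameSum (fun i ↦ e i x) (a x) := (frameSum_frameCoef (he.bij x hx) _).symm
    have ea' : s' x = frameSum (fun i ↦ e i x) (a' x) := (frameSum_frameCoef (he.bij x hx) _).symm
    rw [he.deriv_eq hx hs, he.deriv_eq hx hs', ea, ea', hsum x hx, hsum x hx]
    have hm := (he.contMDiffAt_coef hx hs).mdifferentiableAt (by simp)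
    have hm' := (he.contMDiffAt_coef hx hs').mdifferentiableAt (by simp)
    have h4 : HasMFDerivAt I 𝓘(ℝ, ℝ) (fun y ↦ ∑ i, ∑ j, a y i * a' y j * C i j) x
        (∑ i, ∑ j, C i j • (a x i • mvfderiv I (fun y ↦ a' y j) x +
          a' x j • mvfderiv I (fun y ↦ a y i) x)) := by
      refine hasMFDerivAt_fun_sum fun i ↦ hasMFDerivAt_fun_sum fun j ↦ ?_
      have h5 := ((ha i).hasMFDerivAt.mul (ha' j).hasMFDerivAt).const_smul (C i j)
      refine h5.congr_of_eventuallyEq (Filter.Eventually.of_forall fun y ↦ ?_) |>.congr_mfderiv ?_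
      · show _ = C i j * (a y i * a' y j)
        ring
      · rfl
    have h6 : mvfderiv I (fun y ↦ b y (s y) (s' y)) x u =
        (∑ i, ∑ j, C i j • (a x i • mvfderiv I (fun y ↦ a' y j) x +
          a' x j • mvfderiv I (fun y ↦ a y i) x)) u := by
      rw [mvfderiv_congr e1]
      exact congrArg (fun L : TangentSpace I x →L[ℝ] ℝ ↦ L u) h4.mfderiv
    rw [h6, ← Finset.sum_add_distrib]
    simp only [sum_apply]
    refine Finset.sum_congr rfl fun i _ ↦ ?_
    rw [← Finset.sum_add_distrib]
    refine Finset.sum_congr rfl fun j _ ↦ ?_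
    rw [hp hm, hp hm']
    simp only [smul_apply, add_apply, smul_eq_mul]
    simp only [a, a']
    ring

lemma LorentzMetric.contMDiffAt_form (h : LorentzMetric I F V) {s s' : Π x, V x} {x : M}
    (hs : SmoothAt I F s x) (hs' : SmoothAt I F s' x) :
    ContMDiffAt I 𝓘(ℝ, ℝ) ∞ (fun y ↦ h.form y (s y) (s' y)) x := by
  have h1 := ContMDiffAt.clm_bundle_apply₂ (E₃ := Bundle.Trivial M ℝ) (h.contMDiff x) hs hs'
  exact (contMDiffAt_section (F := ℝ) (E := Bundle.Trivial M ℝ) _).1 h1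

/-- The coefficients of a parallel metric are constant in a parallel frame. -/
lemma LorentzMetric.exists_gram [T2Space M] (h : LorentzMetric I F V)
    (hm : IsMetricOn F D h.form univ) (he : IsNice D e q U) (i j : ι) :
    ∃ C : ℝ, ∀ y ∈ U, h.form y (e i y) (e j y) = C := by
  rcases U.eq_empty_or_nonempty with hU | ⟨x, hx⟩
  · exact ⟨0, by simp [hU]⟩
  refine ⟨h.form x (e i x) (e j x), fun y hy ↦ ?_⟩
  refine eq_of_mvfderiv_eq_zero (f := fun y ↦ h.form y (e i y) (e j y)) he.isOpen he.subset
    he.convex (fun z hz ↦ (h.contMDiffAt_form (he.smooth i z hz) (he.smooth j z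
      hz)).mdifferentiableAt (by simp)) (fun z hz u ↦ ?_) hy hx
  obtain ⟨s, hs⟩ := exists_smoothSec_eventuallyEq he.isOpen hz (he.smooth i)
  obtain ⟨s', hs'⟩ := exists_smoothSec_eventuallyEq he.isOpen hz (he.smooth j)
  have h1 := hm s s' s.contMDiff.contMDiffOn s'.contMDiff.contMDiffOn z (mem_univ z) u
  have e1 : (fun y ↦ h.form y (e i y) (e j y)) =ᶠ[𝓝 z] fun y ↦ h.form y (s y) (s' y) := by
    filter_upwards [hs, hs'] with y h2 h3
    rw [h2, h3]
  rw [mvfderiv_congr e1, h1, D.congr_of_eventuallyEq (he.smooth i z hz).mdiff hs,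
    D.congr_of_eventuallyEq (he.smooth j z hz).mdiff hs', he.flat i z hz, he.flat j z hz]
  show h.inner z 0 (s' z) + h.inner z (s z) 0 = 0
  rw [map_zero, map_zero, zero_apply, add_zero]

/-- The pull-back of a parallel Lorentzian metric is parallel. -/
theorem LorentzMetric.isParallelLorentz_cylForm [T2Space M] (h : LorentzMetric I F V)
    (hm : IsMetricOn F D h.form univ) {n : ℕ} (hfr : HasFlatFrames D n) :
    IsParallelLorentz D.cylinder h.cylForm := by
  refine isParallelLorentz_of_gram (n := n) (fun p ↦ ?_) (fun p ↦ h.isLorentz p.1) fun p ↦ ?_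
  · refine ⟨LinearMap.mk₂ ℝ (fun u w : V p.1 ↦ h.inner p.1 u w) ?_ ?_ ?_ ?_, fun _ _ ↦ rfl⟩
    · intro u v w; exact congrArg (fun L : V p.1 →L[ℝ] ℝ ↦ L w) (map_add (h.inner p.1) u v)
    · intro c u w; exact congrArg (fun L : V p.1 →L[ℝ] ℝ ↦ L w) (map_smul (h.inner p.1) c u)
    · intro u v w; exact map_add _ _ _
    · intro c u w; exact map_smul _ _ _
  -- The Gram matrix, constant over `O`, serves unchanged over `O × ℝ`.
  · obtain ⟨O, e, -, hx, he⟩ := hfr.exists_isNice p.1 Filter.univ_mem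
    choose C hC using fun i j ↦ h.exists_gram hm he i j
    exact ⟨O ×ˢ univ, fun i p ↦ e i p.1, C, ⟨hx, mem_univ _⟩, he.toFlatFrame.cylinder,
      fun y hy i j ↦ hC i j y.1 hy.1⟩

end ParallelMetrics
end

/-! ### Invertible closed forms: the flat metric and its uniqueness. -/

noncomputable section
section InvertibleForms

variable {EM : Type*} [NormedAddCommGroup EM] [NormedSpace ℝ EM] [FiniteDimensional ℝ EM]
  {H : Type*} [TopologicalSpace H] {I : ModelWithCorners ℝ EM H} [I.Boundaryless]
  {M : Type*} [TopologicalSpace M] [ChartedSpace H M] [IsManifold I ∞ M]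
  {F : Type*} [NormedAddCommGroup F] [NormedSpace ℝ F] [FiniteDimensional ℝ F]
  {V : M → Type*} [TopologicalSpace (TotalSpace F V)]
  [∀ x, AddCommGroup (V x)] [∀ x, Module ℝ (V x)] [∀ x, TopologicalSpace (V x)]
  [∀ x, IsTopologicalAddGroup (V x)] [∀ x, ContinuousSMul ℝ (V x)]
  [FiberBundle F V] [VectorBundle ℝ F V]
  {D : CovariantDerivative I F V} {b : Π x, V x → V x → ℝ} {n : ℕ}

lemma OneForm.formSmoothAt (ξ : OneForm I F V) (x : M) : FormSmoothAt I F ξ x := ξ.contMDiff x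

/-- Continuity of the inverse is automatic: a trivialization identifies the fibre with the
finite-dimensional model `F`. -/
lemma isInvertible_iff_bijective {ξ : OneForm I F V} {x : M} :
    (ξ x).IsInvertible ↔ Function.Bijective (ξ x) := by
  let L := ξ x
  show L.IsInvertible ↔ Function.Bijective L
  constructor
  · rintro ⟨e, he⟩
    rw [← he]
    exact e.bijective
  · intro h
    let t := (trivializationAt F V x).continuousLinearEquivAt ℝ x
      (mem_baseSet_trivializationAt F V x)
    let A : EM →ₗ[ℝ] F := (t : V x →L[ℝ] F).toLinearMap ∘ₗ L.toLinearMap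
    have hA : Function.Bijective A := t.bijective.comp h
    let A' : EM ≃L[ℝ] F := (LinearEquiv.ofBijective A hA).toContinuousLinearEquiv
    refine ⟨(show TangentSpace I x ≃L[ℝ] F from A').trans t.symm, ?_⟩
    refine ContinuousLinearMap.ext fun u ↦ ?_
    show t.symm (t (L u)) = L u
    exact t.symm_apply_apply _

lemma inverse_apply_self {x : M} {L : TangentSpace I x →L[ℝ] V x} (h : L.IsInvertible)
    (u : TangentSpace I x) : L.inverse (L u) = u := by
  obtain ⟨e, rfl⟩ := h
  rw [ContinuousLinearMap.inverse_equiv]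
  exact e.symm_apply_apply u

lemma self_apply_inverse {x : M} {L : TangentSpace I x →L[ℝ] V x} (h : L.IsInvertible)
    (v : V x) : L (L.inverse v) = v := by
  obtain ⟨e, rfl⟩ := h
  rw [ContinuousLinearMap.inverse_equiv]
  exact e.apply_symm_apply v

lemma coordField_bijective {q y : M} (hy : y ∈ (chartAt H q).source) :
    Function.Bijective fun u ↦ coordField I q u y :=
  ⟨fun u w h ↦ by
    have h1 := congrArg (mfderiv I 𝓘(ℝ, EM) (extChartAt I q) y) h
    dsimp only at h1
    rwa [mfderiv_extChartAt_coordField hy, mfderiv_extChartAt_coordField hy] at h1,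
    fun w ↦ ⟨_, coordField_mfderiv hy w⟩⟩

lemma SmoothFrame.frameCoef_bijective {ι : Type*} [Fintype ι] {e : ι → Π x : M, V x} {U : Set M}
    (h : SmoothFrame I F e U) {y : M} (hy : y ∈ U) :
    Function.Bijective (frameCoef fun i ↦ e i y) :=
  Function.bijective_iff_has_inverse.2 ⟨frameSum fun i ↦ e i y,
    frameSum_frameCoef (h.bij y hy), frameCoef_frameSum (h.bij y hy)⟩

/-- The set where a smooth form is invertible is open. -/
lemma isOpen_isInvertible (hfr : HasFlatFrames D n) (ξ : OneForm I F V) :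
    IsOpen {x | (ξ x).IsInvertible} := by
  rw [isOpen_iff_mem_nhds]
  intro x hx
  obtain ⟨U, e, hxU, he⟩ := hfr x
  -- Invertibility is read off from the coefficients in a frame and a chart, which take values in a
  -- fixed operator space whose invertible elements form an open set.
  have hiff : ∀ y ∈ U ∩ (chartAt H x).source,
      (ξ y).IsInvertible ↔ (formCoef I e x ξ y).IsInvertible := by
    rintro y ⟨hy, hyc⟩
    rw [isInvertible_iff_bijective]
    have h1 : ⇑(formCoef I e x ξ y) = (frameCoef fun i ↦ e i y) ∘ (ξ y ∘
        fun u ↦ coordField I x u y) := rfl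
    have h2 : Function.Bijective (formCoef I e x ξ y) ↔ Function.Bijective (ξ y) := by
      rw [h1, Function.Bijective.of_comp_iff' (he.frameCoef_bijective hy),
        Function.Bijective.of_comp_iff _ (coordField_bijective hyc)]
    rw [← h2]
    constructor
    · intro h
      exact ⟨(LinearEquiv.ofBijective (formCoef I e x ξ y).toLinearMap h).toContinuousLinearEquiv,
        rfl⟩
    · rintro ⟨E, hE⟩
      rw [← hE]
      exact E.bijective
  have hc : ContinuousAt (formCoef I e x ξ) x :=
    (he.contMDiffAt_formCoef hxU (mem_chart_source H x) (ξ.smoothAt x)).continuousAt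
  have ho : IsOpen {L : EM →L[ℝ] (Fin n → ℝ) | L.IsInvertible} := ContinuousLinearEquiv.isOpen
  have hm := hc.preimage_mem_nhds (ho.mem_nhds
    ((hiff x ⟨hxU, mem_chart_source H x⟩).1 hx))
  filter_upwards [hm, he.isOpen.mem_nhds hxU,
    (chartAt H x).open_source.mem_nhds (mem_chart_source H x)] with y h1 h2 h3
  exact (hiff y ⟨h2, h3⟩).2 h1

/-- Where the closed form `ξ` is invertible, the metric `b ∘ (ξ × ξ)` is flat and Lorentzian, with
Levi-Civita connection `ξ⁻¹ ∘ ∇ ∘ ξ`. -/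
theorem isFlatLorentzOn_pulledMetric [T2Space M] (hfr : HasFlatFrames D n)
    (hb : IsParallelLorentz D b) {ξ : OneForm I F V} (hξ : ξ ∈ closedForms D) :
    IsFlatLorentzOn (pulledMetric b ξ) (pulledConnection D ξ) {x | (ξ x).IsInvertible} := by
  have ho := isOpen_isInvertible hfr ξ
  have hat : ∀ {X : Π x : M, TangentSpace I x} {U : Set M} {x : M},
      ContMDiffOn I (I.prod 𝓘(ℝ, EM)) ∞ (fun x ↦ TotalSpace.mk' EM x (X x)) U → IsOpen U → x ∈ U →
      SmoothAt I EM X x := fun h hU hx ↦ h.contMDiffAt (hU.mem_nhds hx)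
  refine ⟨ho, ?_, ⟨?_, ?_⟩, ?_, ?_, ?_⟩
  · intro x hx
    have hx : (ξ x).IsInvertible := hx
    obtain ⟨hs, e, he, hp⟩ := hb.lorentz x
    refine ⟨fun u w ↦ hs _ _, (ξ x).inverse e, ?_, fun u hu h0 ↦ ?_⟩
    · show b x (ξ x _) (ξ x _) < 0
      rwa [self_apply_inverse hx]
    · refine hp _ (fun h ↦ hu ?_) ?_
      · rw [← inverse_apply_self hx u, h, map_zero]
      · rw [← self_apply_inverse hx e]
        exact h0
  · intro X Y x hX hY hx
    have h1 := D.isCovariantDerivativeOnUniv.add ((OneForm.formSmoothAt ξ x).mdiff_apply hX)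
      ((OneForm.formSmoothAt ξ x).mdiff_apply hY)
    have h2 : D (fun y ↦ ξ y ((X + Y) y)) x = D (fun y ↦ ξ y (X y)) x + D (fun y ↦ ξ y (Y y)) x := by
      rw [← h1]
      congr 1
      funext y
      exact map_add (ξ y) _ _
    unfold pulledConnection
    rw [h2, ContinuousLinearMap.comp_add]
  · intro X f x hX hf hx
    have hx : (ξ x).IsInvertible := hx
    have h1 := D.isCovariantDerivativeOnUniv.leibniz ((OneForm.formSmoothAt ξ x).mdiff_apply hX) hf
    have h2 : D (fun y ↦ ξ y ((f • X) y)) x = D (f • fun y ↦ ξ y (X y)) x := by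
      congr 1
      funext y
      exact map_smul (ξ y) _ _
    refine ContinuousLinearMap.ext fun u ↦ ?_
    show (ξ x).inverse (D (fun y ↦ ξ y ((f • X) y)) x u) = _
    rw [h2, h1]
    show (ξ x).inverse (f x • D (fun y ↦ ξ y (X y)) x u + mvfderiv I f x u • ξ x (X x)) = _
    rw [map_add, map_smul, map_smul, inverse_apply_self hx]
    rfl
  · intro X Y hX hY x hx u
    have hx' : (ξ x).IsInvertible := hx
    have h1 := hb.metric _ _ x ((OneForm.formSmoothAt ξ x).apply (hat hX ho hx))
      ((OneForm.formSmoothAt ξ x).apply (hat hY ho hx)) u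
    refine h1.trans ?_
    show _ = b x (ξ x ((ξ x).inverse _)) _ + b x _ (ξ x ((ξ x).inverse _))
    rw [self_apply_inverse hx', self_apply_inverse hx']
    rfl
  · intro X Y hX hY x hx
    have hx' : (ξ x).IsInvertible := hx
    -- The torsion is `ξ⁻¹` of the exterior derivative of `ξ`, up to moving the bracket term across.
    have h1 := mem_closedForms_iff.1 hξ X Y x (hat hX ho hx) (hat hY ho hx)
    show (ξ x).inverse _ - (ξ x).inverse _ = _
    rw [← map_sub]
    refine Eq.trans ?_ (inverse_apply_self hx' _)
    exact congrArg _ (sub_eq_zero.1 h1)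
  · intro X Y s hX hY hs x hx
    have hx' : (ξ x).IsInvertible := hx
    obtain ⟨U, e, hxU, he⟩ := hfr x
    have hs' : ∀ᶠ y in 𝓝 x, SmoothAt I F (fun y ↦ ξ y (s y)) y := by
      filter_upwards [ho.mem_nhds hx] with y hy
      exact (OneForm.formSmoothAt ξ y).apply (hat hs ho hy)
    -- The factors `ξ` and `ξ⁻¹` cancel between successive derivatives, so the curvature is
    -- conjugate to that of `D`.
    have key : ∀ {Z : Π x : M, TangentSpace I x}, SmoothAt I EM Z x →
        D (fun y ↦ ξ y (pulledConnection D ξ s y (Z y))) x =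
          D (fun y ↦ D (fun y ↦ ξ y (s y)) y (Z y)) x := by
      intro Z hZ
      refine D.congr_of_eventuallyEq (he.smoothAt_deriv_apply hxU hs' hZ).mdiff ?_
      filter_upwards [ho.mem_nhds hx] with y hy
      exact self_apply_inverse hy _
    have hcurv := he.curvature_eq_zero hxU hs' (hat hX ho hx) (hat hY ho hx)
    show (ξ x).inverse (D (fun y ↦ ξ y (pulledConnection D ξ s y (Y y))) x (X x)) -
      (ξ x).inverse (D (fun y ↦ ξ y (pulledConnection D ξ s y (X y))) x (Y x)) -
      (ξ x).inverse _ = 0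
    rw [key (hat hX ho hx), key (hat hY ho hx), ← map_sub, ← map_sub]
    exact (congrArg _ hcurv).trans (map_zero _)

/-- An invertible form maps coordinate fields to a frame. -/
lemma smoothFrame_of_isInvertible {ι : Type*} [Fintype ι] (c : Module.Basis ι ℝ EM)
    {ξ : OneForm I F V} {q : M} {U : Set M} (hU : IsOpen U) (hs : U ⊆ (chartAt H q).source)
    (hξ : ∀ y ∈ U, (ξ y).IsInvertible) :
    SmoothFrame I F (fun i y ↦ ξ y (coordField I q (c i) y)) U where
  isOpen := hU
  smooth i y hy := (OneForm.formSmoothAt ξ y).apply (contMDiffAt_coordField (hs hy) _)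
  bij y hy := by
    have h1 : ⇑(frameSum fun i ↦ ξ y (coordField I q (c i) y)) =
        ξ y ∘ (fun u ↦ coordField I q u y) ∘ c.equivFun.symm := by
      funext a
      rw [frameSum_apply]
      simp only [Function.comp_apply]
      let L : EM →ₗ[ℝ] V y :=
        { toFun := fun u ↦ ξ y (coordField I q u y)
          map_add' := fun u v ↦ by rw [coordField_add, map_add]
          map_smul' := fun c u ↦ by rw [coordField_smul, map_smul]; rfl }
      show ∑ i, a i • L (c i) = L _
      rw [c.equivFun_symm_apply, map_sum]
      simp only [map_smul]
    rw [h1]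
    exact ((isInvertible_iff_bijective).1 (hξ y hy)).comp
      ((coordField_bijective (hs hy)).comp c.equivFun.symm.bijective)

/-- The coefficients of `s` in the frame of images of coordinate fields are those of `ξ⁻¹ s` in the
coordinate fields themselves. -/
lemma smoothAt_inverse_apply {ξ : OneForm I F V} (hξ : ∀ y, (ξ y).IsInvertible) {s : Π x, V x}
    {x : M} (hs : SmoothAt I F s x) : SmoothAt I EM (fun y ↦ (ξ y).inverse (s y)) x := by
  let c := Module.finBasis ℝ EM
  have hf := smoothFrame_of_isInvertible c (ξ := ξ) (chartAt H x).open_source (subset_refl _)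
    fun y _ ↦ hξ y
  have hx := mem_chart_source H x
  have h1 := contMDiffAt_pi_space.1 (hf.contMDiffAt_coef hx hs)
  refine SmoothAt.congr (SmoothAt.sum Finset.univ fun i _ ↦ SmoothAt.smul (h1 i)
    (contMDiffAt_coordField hx (c i))) ?_
  filter_upwards [(chartAt H x).open_source.mem_nhds hx] with y hy
  conv_lhs => rw [← frameSum_frameCoef (hf.bij y hy) (s y), frameSum_apply, map_sum]
  refine Finset.sum_congr rfl fun i _ ↦ ?_
  rw [map_smul, inverse_apply_self (hξ y)]

/-- A trilinear expression symmetric in the first two and antisymmetric in the last two arguments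
vanishes. -/
lemma eq_zero_of_symm_of_antisymm {W : Type*} {T : W → W → W → ℝ} (h1 : ∀ u v w, T u v w = T v u w)
    (h2 : ∀ u v w, T u v w = - T u w v) (u v w : W) : T u v w = 0 := by
  linarith [h2 u v w, h1 u w v, h2 w u v, h1 w v u, h2 v w u, h1 v u w]

/-- Two closed forms, the first of them invertible, that define the same metric differ by a
parallel isometry. -/
theorem sameMetric_of_pulledMetric_eq [T2Space M] [ContMDiffVectorBundle ∞ F V I]
    (hb : IsParallelLorentz D b) {ξ ξ' : OneForm I F V} (hξ : ξ ∈ closedForms D)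
    (hξ' : ξ' ∈ closedForms D) (hinv : ∀ p, (ξ p).IsInvertible)
    (h : pulledMetric b ξ = pulledMetric b ξ') : SameMetric D b ξ ξ' := by
  have hm : ∀ x (u w : TangentSpace I x), b x (ξ' x u) (ξ' x w) = b x (ξ x u) (ξ x w) :=
    fun x u w ↦ (congrFun (congrFun (congrFun h x) u) w).symm
  -- A vector in the kernel of `ξ'` lies in the radical of the common metric, which is nondegenerate
  -- because `ξ` is invertible.
  have hinj : ∀ x, Function.Injective (ξ' x) := by
    intro x
    rw [injective_iff_map_eq_zero]
    intro u hu
    obtain ⟨B, hB⟩ := hb.bilin x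
    have hl := hb.lorentz x
    have h0 : ξ x u = 0 := by
      refine IsLorentzForm.eq_zero_of_forall (B := B) (by simpa only [← hB] using hl) fun w ↦ ?_
      rw [← self_apply_inverse (hinv x) w, ← hB, ← hm, hu, hB, map_zero, LinearMap.zero_apply]
    rw [← inverse_apply_self (hinv x) u, h0, map_zero]
  have hinv' : ∀ x, (ξ' x).IsInvertible := by
    intro x
    rw [isInvertible_iff_bijective]
    refine ⟨hinj x, ?_⟩
    have e := LinearEquiv.ofBijective (ξ x).toLinearMap
      ((isInvertible_iff_bijective).1 (hinv x))
    have : FiniteDimensional ℝ (TangentSpace I x) := inferInstanceAs (FiniteDimensional ℝ EM)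
    have : FiniteDimensional ℝ (V x) := e.finiteDimensional
    exact ((ξ' x).toLinearMap.injective_iff_surjective_of_finrank_eq_finrank e.finrank_eq).1
      (hinj x)
  -- The only possible candidate is `ξ' ∘ ξ⁻¹`; equality of the metrics makes it an isometry.
  let A : EndSec I F V := ⟨fun y ↦ (ξ' y).comp (ξ y).inverse, fun x ↦
    smoothAt_hom_of_apply fun σ hσ ↦
      (OneForm.formSmoothAt ξ' x).apply (smoothAt_inverse_apply hinv hσ)⟩
  have hA : ∀ y u, A y (ξ y u) = ξ' y u := fun y u ↦
    congrArg (ξ' y) (inverse_apply_self (hinv y) u)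
  have hiso : ∀ x (u w : V x), b x (A x u) (A x w) = b x u w := by
    intro x u w
    rw [← self_apply_inverse (hinv x) u, ← self_apply_inverse (hinv x) w, hA, hA, hm]
  refine ⟨A, hiso, fun s x ↦ ?_, fun x ↦ ContinuousLinearMap.ext fun u ↦ (hA x u).symm⟩
  obtain ⟨B, hB⟩ := hb.bilin x
  have hxs := mem_chart_source H x
  let X : EM → Π y : M, TangentSpace I y := fun u ↦ coordField I x u
  have hX : ∀ u, SmoothAt I EM (X u) x := fun u ↦ contMDiffAt_coordField hxs u
  have hsym : ∀ {η : OneForm I F V}, η ∈ closedForms D → ∀ u v,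
      D (fun y ↦ η y (X v y)) x (X u x) = D (fun y ↦ η y (X u y)) x (X v x) := by
    intro η hη u v
    have h1 := mem_closedForms_iff.1 hη (X u) (X v) x (hX u) (hX v)
    unfold extD at h1
    have h2 : VectorField.mlieBracket I (X u) (X v) x = 0 := mlieBracket_coordField hxs u v
    rw [h2, map_zero, sub_zero] at h1
    exact sub_eq_zero.1 h1
  -- Uniqueness of the Levi-Civita connection: `T` is the difference of the two sets of Christoffel
  -- symbols. It is symmetric in the first two arguments since both forms are closed, and
  -- antisymmetric in the last two since the metric coefficients agree.
  have hkos := eq_zero_of_symm_of_antisymm (W := EM)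
    (T := fun u v w ↦ b x (D (fun y ↦ ξ' y (X v y)) x (X u x)) (ξ' x (X w x)) -
      b x (D (fun y ↦ ξ y (X v y)) x (X u x)) (ξ x (X w x)))
    (fun u v w ↦ by rw [hsym hξ, hsym hξ'])
    (fun u v w ↦ by
      have h1 := hb.metric _ _ x ((OneForm.formSmoothAt ξ x).apply (hX v)) ((OneForm.formSmoothAt ξ x).apply (hX w)) (X u x)
      have h2 := hb.metric _ _ x ((OneForm.formSmoothAt ξ' x).apply (hX v)) ((OneForm.formSmoothAt ξ' x).apply (hX w))
        (X u x)
      have h3 : (fun y ↦ b y (ξ' y (X v y)) (ξ' y (X w y))) =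
        fun y ↦ b y (ξ y (X v y)) (ξ y (X w y)) := funext fun y ↦ hm y _ _
      rw [h3, h1] at h2
      have hs := (hb.lorentz x).1
      rw [hs (ξ x (X v x)), hs (ξ' x (X v x))] at h2
      linarith)
  have hcomm : ∀ u v, A x (D (fun y ↦ ξ y (X v y)) x (X u x)) =
      D (fun y ↦ ξ' y (X v y)) x (X u x) := by
    intro u v
    have hl := hb.lorentz x
    rw [← sub_eq_zero]
    refine IsLorentzForm.eq_zero_of_forall (B := B) (by simpa only [← hB] using hl) fun w ↦ ?_
    obtain ⟨w', rfl⟩ := ((isInvertible_iff_bijective).1 (hinv' x)).2 w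
    obtain ⟨w', rfl⟩ := (coordField_bijective hxs).2 w'
    have h1 := hkos u v w'
    rw [map_sub, LinearMap.sub_apply, ← hB, ← hB]
    have h2 := hiso x (D (fun y ↦ ξ y (X v y)) x (X u x)) (ξ x (X w' x))
    rw [hA] at h2
    rw [h2]
    linarith
  -- Commutation is known for images of coordinate fields. These form a frame, and the Leibniz rule
  -- carries it to all sections.
  let c := Module.finBasis ℝ EM
  have hf := smoothFrame_of_isInvertible c (ξ := ξ) (chartAt H x).open_source (subset_refl _)
    fun y _ ↦ hinv y
  have hf' := smoothFrame_of_isInvertible c (ξ := ξ') (chartAt H x).open_source (subset_refl _)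
    fun y _ ↦ hinv' y
  have ha := hf.contMDiffAt_coef hxs (s.smoothAt x)
  have hA' : ∀ y (a : Fin (Module.finrank ℝ EM) → ℝ),
      A y (frameSum (fun i ↦ ξ y (coordField I x (c i) y)) a) =
      frameSum (fun i ↦ ξ' y (coordField I x (c i) y)) a := by
    intro y a
    rw [frameSum_apply, frameSum_apply, map_sum]
    exact Finset.sum_congr rfl fun i _ ↦ by rw [map_smul, hA]
  have e1 : ∀ᶠ y in 𝓝 x, s y = frameSum (fun i ↦ ξ y (coordField I x (c i) y))
      (frameCoef (fun i ↦ ξ y (coordField I x (c i) y)) (s y)) := by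
    filter_upwards [(chartAt H x).open_source.mem_nhds hxs] with y hy
    exact (frameSum_frameCoef (hf.bij y hy) _).symm
  have e2 : ∀ᶠ y in 𝓝 x, A y (s y) = frameSum (fun i ↦ ξ' y (coordField I x (c i) y))
      (frameCoef (fun i ↦ ξ y (coordField I x (c i) y)) (s y)) := by
    filter_upwards [e1] with y hy
    rw [← hA', ← hy]
  rw [D.congr_of_eventuallyEq (hf'.smoothAt_sum hxs ha).mdiff e2,
    D.congr_of_eventuallyEq (hf.smoothAt_sum hxs ha).mdiff e1]
  refine ContinuousLinearMap.ext fun w ↦ ?_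
  obtain ⟨u, rfl⟩ := (coordField_bijective hxs).2 w
  have hmd := ha.mdifferentiableAt (by simp)
  show _ = A x _
  refine (hf'.deriv_sum D hxs hmd _).trans ?_
  refine Eq.trans ?_ (congrArg (A x) (hf.deriv_sum D hxs hmd _).symm)
  rw [map_add, hA', map_sum]
  refine congrArg _ (Finset.sum_congr rfl fun i _ ↦ ?_)
  rw [map_smul]
  exact congrArg _ (hcomm u (c i)).symm

/-- For an invertible closed form, the metric determines the form up to sign. -/
theorem pulledMetric_eq_iff [T2Space M] [Nonempty M] [ContMDiffVectorBundle ∞ F V I]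
    (hb : IsParallelLorentz D b) (hsc : HasScalarCommutant D) {ξ ξ' : OneForm I F V}
    (hξ : ξ ∈ closedForms D) (hξ' : ξ' ∈ closedForms D) (hinv : ∀ p, (ξ p).IsInvertible) :
    (pulledMetric b ξ = pulledMetric b ξ' ↔ ξ' = ξ ∨ ξ' = -ξ) ∧
      (pulledMetric b ξ = pulledMetric b ξ' ↔ SameMetric D b ξ ξ') := by
  have h : pulledMetric b ξ = pulledMetric b ξ' ↔ SameMetric D b ξ ξ' := by
    refine ⟨sameMetric_of_pulledMetric_eq hb hξ hξ' hinv, ?_⟩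
    rintro ⟨A, hA, -, hAξ⟩
    funext x u w
    show b x (ξ x u) (ξ x w) = b x (ξ' x u) (ξ' x w)
    rw [hAξ]
    exact (hA x _ _).symm
  exact ⟨h.trans (sameMetric_iff hb hsc), h⟩

end InvertibleForms
end

/-! ### Cohomology of the cylinder and inextensibility of pulled-back metrics. -/

noncomputable section
section CylinderCohomology

variable {EM : Type*} [NormedAddCommGroup EM] [NormedSpace ℝ EM] [FiniteDimensional ℝ EM]
  {H : Type*} [TopologicalSpace H] {I : ModelWithCorners ℝ EM H} [I.Boundaryless]
  {M : Type*} [TopologicalSpace M] [ChartedSpace H M] [IsManifold I ∞ M]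
  {F : Type*} [NormedAddCommGroup F] [NormedSpace ℝ F] [FiniteDimensional ℝ F]
  {V : M → Type*} [TopologicalSpace (TotalSpace F V)]
  [∀ x, AddCommGroup (V x)] [∀ x, Module ℝ (V x)] [∀ x, TopologicalSpace (V x)]
  [∀ x, IsTopologicalAddGroup (V x)] [∀ x, ContinuousSMul ℝ (V x)]
  [FiberBundle F V] [VectorBundle ℝ F V]
  {D : CovariantDerivative I F V} {n : ℕ}

/-- Closed forms are locally exact. -/
lemma HasFlatFrames.exists_local_primitive [T2Space M] (hfr : HasFlatFrames D n)
    {ξ : OneForm I F V} (hξ : ξ ∈ closedForms D) (x : M) :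
    ∃ (O : Set M) (e : Fin n → Π x : M, V x) (v : Π x, V x), x ∈ O ∧ IsNice D e x O ∧
      (∀ y ∈ O, SmoothAt I F v y) ∧ ∀ y ∈ O, D v y = ξ y := by
  obtain ⟨O, e, -, hx, he⟩ := hfr.exists_isNice x Filter.univ_mem
  obtain ⟨v, hv, hD⟩ := he.exists_primitive (fun y _ ↦ OneForm.formSmoothAt ξ y) fun y hy u w ↦
    mem_closedForms_iff.1 hξ _ _ y (contMDiffAt_coordField (he.subset hy) u)
      (contMDiffAt_coordField (he.subset hy) w)
  exact ⟨O, e, v, hx, he, hv, hD⟩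

/-- A form which is locally exact is smooth and closed. -/
lemma HasFlatFrames.mem_closedForms_of_local [T2Space M] (hfr : HasFlatFrames D n)
    {ξ : Π x : M, TangentSpace I x →L[ℝ] V x}
    (h : ∀ x, ∃ v : Π x, V x, ∀ᶠ y in 𝓝 x, SmoothAt I F v y ∧ D v y = ξ y) :
    ∃ η : closedForms D, ∀ x, η.1 x = ξ x := by
  have hs : ∀ x, FormSmoothAt I F ξ x := by
    intro x
    obtain ⟨v, hv⟩ := h x
    exact (hfr.formSmoothAt_deriv (hv.mono fun y hy ↦ hy.1)).congr
      (hv.mono fun y hy ↦ hy.2.symm)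
  refine ⟨⟨⟨ξ, hs⟩, mem_closedForms_iff.2 fun X Y x hX hY ↦ ?_⟩, fun x ↦ rfl⟩
  obtain ⟨v, hv⟩ := h x
  have hv1 := hv.mono fun y hy ↦ hy.1
  refine (extD_congr (hfr.formSmoothAt_deriv hv1) (hv.mono fun y hy ↦ hy.2.symm) hX hY).trans ?_
  exact hfr.extD_deriv hv1 hX hY

/-- The pull-back of a one-form to the cylinder. -/
def cylPull (ξ : Π x : M, TangentSpace I x →L[ℝ] V x) (p : M × ℝ) :
    TangentSpace (I.prod 𝓘(ℝ, ℝ)) p →L[ℝ] CylBundle I V p :=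
  ((ξ p.1 : EM →L[ℝ] V p.1).comp (ContinuousLinearMap.fst ℝ EM ℝ) : EM × ℝ →L[ℝ] V p.1)

lemma cylinder_pullback (v : Π x, V x) (p : M × ℝ) :
    D.cylinder (fun p : M × ℝ ↦ (v p.1 : CylBundle I V p)) p = cylPull (fun x ↦ D v x) p := by
  refine ContinuousLinearMap.ext fun w ↦ ?_
  refine (cylinder_apply D _ p w).trans ?_
  rw [CylBundle.vertDeriv_pullback, smul_zero, add_zero]
  rfl

lemma cylinder_slice (σ : Π p, CylBundle I V p) (x : M) (t : ℝ) (u : TangentSpace I x) :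
    D.cylinder σ (x, t) (show EM × ℝ from (u, 0)) = (D (CylBundle.slice σ t) x u : V x) := by
  refine (cylinder_apply D _ _ _).trans ?_
  show D (CylBundle.slice σ t) x u + (0 : ℝ) • _ = _
  rw [zero_smul, add_zero]

/-- Locally the pull-back is the derivative of the pulled-back primitive, so it is smooth and closed
without computing its exterior derivative. -/
lemma exists_cylPull [T2Space M] (hfr : HasFlatFrames D n) (ξ : closedForms D) :
    ∃ η : closedForms D.cylinder, ∀ p, η.1 p = cylPull (fun x ↦ ξ.1 x) p := by
  refine hfr.cylinder.mem_closedForms_of_local fun p ↦ ?_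
  obtain ⟨O, e, v, hx, he, hv, hD⟩ := hfr.exists_local_primitive ξ.2 p.1
  refine ⟨fun p ↦ v p.1, ?_⟩
  have hO : O ×ˢ univ ∈ 𝓝 p := (he.isOpen.prod isOpen_univ).mem_nhds ⟨hx, mem_univ _⟩
  filter_upwards [hO] with y hy
  refine ⟨CylBundle.smoothAt_pullback (hv y.1 hy.1), ?_⟩
  rw [cylinder_pullback]
  exact ContinuousLinearMap.ext fun u ↦ congrArg
    (fun L : TangentSpace I y.1 →L[ℝ] V y.1 ↦ L (show EM × ℝ from u).1) (hD y.1 hy.1)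

/-- The pull-back of closed forms to the cylinder. -/
def closedForms.cylinder [T2Space M] (hfr : HasFlatFrames D n) :
    closedForms D →ₗ[ℝ] closedForms D.cylinder where
  toFun ξ := (exists_cylPull hfr ξ).choose
  map_add' ξ η := Subtype.ext <| ContMDiffSection.ext fun p ↦ by
    refine ((exists_cylPull hfr (ξ + η)).choose_spec p).trans ?_
    refine Eq.trans ?_ (congrArg₂ (· + ·) ((exists_cylPull hfr ξ).choose_spec p).symm
      ((exists_cylPull hfr η).choose_spec p).symm)
    rfl
  map_smul' c ξ := Subtype.ext <| ContMDiffSection.ext fun p ↦ by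
    refine ((exists_cylPull hfr (c • ξ)).choose_spec p).trans ?_
    refine Eq.trans ?_ (congrArg (c • ·) ((exists_cylPull hfr ξ).choose_spec p).symm)
    rfl

lemma closedForms.cylinder_apply [T2Space M] (hfr : HasFlatFrames D n) (ξ : closedForms D)
    (p : M × ℝ) : (closedForms.cylinder hfr ξ).1 p = cylPull (fun x ↦ ξ.1 x) p :=
  (exists_cylPull hfr ξ).choose_spec p

/-- Every closed form on the cylinder is cohomologous to a pull-back. -/
theorem exists_cohomologous_cylPull [T2Space M] (hfr : HasFlatFrames D n)
    (ξ : closedForms D.cylinder) :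
    ∃ η : closedForms D, ξ.1 - (closedForms.cylinder hfr η).1 ∈ exactForms D.cylinder := by
  -- A nice base set times the whole line is still convex in its chart, so primitives exist along
  -- entire lines.
  have hloc : ∀ x : M, ∃ (O : Set M) (v : Π p, CylBundle I V p), IsOpen O ∧ x ∈ O ∧
      (∀ p, p.1 ∈ O → SmoothAt (I.prod 𝓘(ℝ, ℝ)) F v p) ∧ ∀ p, p.1 ∈ O → D.cylinder v p = ξ.1 p := by
    intro x
    obtain ⟨O, e, -, hx, he⟩ := hfr.exists_isNice x Filter.univ_mem
    have he' := he.cylinder 0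
    obtain ⟨v, hv, hD⟩ := he'.exists_primitive (fun y _ ↦ OneForm.formSmoothAt ξ.1 y)
      fun y hy u w ↦ mem_closedForms_iff.1 ξ.2 _ _ y (contMDiffAt_coordField (he'.subset hy) u)
        (contMDiffAt_coordField (he'.subset hy) w)
    exact ⟨O, v, he.isOpen, hx, fun p hp ↦ hv p ⟨hp, mem_univ _⟩, fun p hp ↦ hD p ⟨hp, mem_univ _⟩⟩
  choose O v hO hxO hv hD using hloc
  -- Two primitives differ by a parallel section, whose coefficients do not depend on the height.
  have hdiff : ∀ x y, y ∈ O x → ∀ t, (v x (y, t) - v y (y, t) : V y) = v x (y, 0) - v y (y, 0) := by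
    intro x y hy t
    obtain ⟨Q, e, hQ, hyQ, he⟩ := hfr.exists_isNice y
      (((hO x).inter (hO y)).mem_nhds ⟨hy, hxO y⟩)
    obtain ⟨a, ha⟩ := (he.cylinder 0).eq_frameSum (s := fun p ↦ v x p - v y p)
      (fun p hp ↦ (hv x p (hQ hp.1).1).sub (hv y p (hQ hp.1).2)) (fun p hp ↦ by
        have h1 := D.cylinder.isCovariantDerivativeOnUniv.add
          (((hv x p (hQ hp.1).1).sub (hv y p (hQ hp.1).2))).mdiff (hv y p (hQ hp.1).2).mdiff
        have h2 : ((fun p ↦ v x p - v y p) + v y) = v x := by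
          funext p
          exact sub_add_cancel _ _
        rw [h2, hD x p (hQ hp.1).1, hD y p (hQ hp.1).2] at h1
        exact right_eq_add.1 h1)
    exact (ha (y, t) ⟨hyQ, mem_univ _⟩).trans (ha (y, 0) ⟨hyQ, mem_univ _⟩).symm
  -- Subtracting the value at height zero removes the ambiguity of the primitive, so `w` is globally
  -- defined.
  let w : Π p, CylBundle I V p := fun p ↦
    (CylBundle.slice (v p.1) p.2 p.1 - CylBundle.slice (v p.1) 0 p.1 : V p.1)
  have hw : ∀ x (p : M × ℝ), p.1 ∈ O x →
      w p = (CylBundle.slice (v x) p.2 p.1 - CylBundle.slice (v x) 0 p.1 : V p.1) := by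
    intro x p hp
    have h1 : CylBundle.slice (v x) p.2 p.1 - CylBundle.slice (v p.1) p.2 p.1 =
      CylBundle.slice (v x) 0 p.1 - CylBundle.slice (v p.1) 0 p.1 := hdiff x p.1 hp p.2
    show CylBundle.slice (v p.1) p.2 p.1 - CylBundle.slice (v p.1) 0 p.1 = _
    rw [sub_eq_sub_iff_add_eq_add] at h1 ⊢
    rw [add_comm, ← h1, add_comm]
  have hsl : ∀ x p, p.1 ∈ O x → SmoothAt (I.prod 𝓘(ℝ, ℝ)) F (V := CylBundle I V)
      (fun p ↦ CylBundle.slice (v x) 0 p.1) p := fun x p hp ↦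
    CylBundle.smoothAt_pullback (CylBundle.smoothAt_slice (hv x (p.1, 0) hp))
  have hOn : ∀ x (p : M × ℝ), p.1 ∈ O x → ∀ᶠ p' in 𝓝 p, p'.1 ∈ O x := fun x p hp ↦
    continuous_fst.continuousAt.eventually ((hO x).mem_nhds hp)
  have hws : ∀ p, SmoothAt (I.prod 𝓘(ℝ, ℝ)) F w p := by
    intro p
    refine ((hv p.1 p (hxO _)).sub (hsl p.1 p (hxO _))).congr ?_
    filter_upwards [hOn p.1 p (hxO _)] with p' hp' using hw _ _ hp'
  have hDw : ∀ x p, p.1 ∈ O x → D.cylinder w p =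
      ξ.1 p - cylPull (fun y ↦ D (CylBundle.slice (v x) 0) y) p := by
    intro x p hp
    have h1 := D.cylinder.isCovariantDerivativeOnUniv.add (hws p).mdiff (hsl x p hp).mdiff
    let s₀ : Π p, CylBundle I V p := fun p ↦ CylBundle.slice (v x) 0 p.1
    have h2 : D.cylinder (w + s₀) p =
        D.cylinder (v x) p := by
      refine D.cylinder.congr_of_eventuallyEq (hv x p hp).mdiff ?_
      filter_upwards [hOn x p hp] with p' hp'
      refine (congrArg (fun z : V p'.1 ↦ z + CylBundle.slice (v x) 0 p'.1) (hw x p' hp')).trans ?_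
      exact sub_add_cancel _ _
    have h3 : D.cylinder s₀ p = cylPull (fun y ↦ D (CylBundle.slice (v x) 0) y) p :=
      cylinder_pullback _ _
    have h1 := h2.symm.trans h1
    rw [hD x p hp, h3] at h1
    exact eq_sub_of_add_eq h1.symm
  have hη : ∀ x, ∀ y ∈ O x, D (CylBundle.slice (v x) 0) y = D (CylBundle.slice (v y) 0) y := by
    intro x y hy
    refine ContinuousLinearMap.ext fun u ↦ ?_
    refine (cylinder_slice (v x) y 0 u).symm.trans (Eq.trans ?_ (cylinder_slice (v y) y 0 u))
    rw [hD x (y, 0) hy, hD y (y, 0) (hxO y)]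
  -- What the derivative of `w` misses is the derivative of the primitives at height zero; these
  -- forms agree on overlaps and are locally exact, so they define a closed form on the base.
  obtain ⟨η, hη'⟩ := hfr.mem_closedForms_of_local
    (ξ := fun y ↦ D (CylBundle.slice (v y) 0) y) fun x ↦ ⟨CylBundle.slice (v x) 0, by
      filter_upwards [(hO x).mem_nhds (hxO x)] with y hy
      exact ⟨CylBundle.smoothAt_slice (hv x (y, 0) hy), hη x y hy⟩⟩
  refine ⟨η, ⟨w, hws⟩, fun p ↦ ?_⟩
  refine Eq.trans ?_ (hDw p.1 p (hxO _)).symm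
  refine congrArg (ξ.1 p - ·) ((closedForms.cylinder_apply hfr η p).trans ?_)
  refine ContinuousLinearMap.ext fun u ↦ ?_
  exact congrArg (fun L : TangentSpace I p.1 →L[ℝ] V p.1 ↦ L (show EM × ℝ from u).1) (hη' p.1)

/-- The projection of the cylinder to its base induces an isomorphism of cohomology. -/
theorem nonempty_twistedH1_cylinder_equiv [T2Space M] (hfr : HasFlatFrames D n) :
    Nonempty (TwistedH1 D ≃ₗ[ℝ] TwistedH1 D.cylinder) := by
  let f : closedForms D →ₗ[ℝ] TwistedH1 D.cylinder :=
    (Submodule.mkQ _).comp (closedForms.cylinder hfr)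
  have hf : Function.Surjective f := by
    rintro ⟨ξ⟩
    obtain ⟨η, hη⟩ := exists_cohomologous_cylPull hfr ξ
    exact ⟨η, (cohClass_eq_iff.2 hη).symm⟩
  have hk : LinearMap.ker f = (exactForms D).submoduleOf (closedForms D) := by
    ext η
    rw [LinearMap.mem_ker]
    have h1 : f η = 0 ↔ (closedForms.cylinder hfr η).1 ∈ exactForms D.cylinder :=
      (Submodule.Quotient.mk_eq_zero _).trans Iff.rfl
    refine h1.trans ?_
    show _ ↔ η.1 ∈ exactForms D
    constructor
    -- A primitive of the pull-back restricts at height zero to a primitive on the base.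
    · rintro ⟨w, hw⟩
      refine ⟨⟨CylBundle.slice w 0, fun x ↦ CylBundle.smoothAt_slice (w.smoothAt (x, 0))⟩,
        fun x ↦ ContinuousLinearMap.ext fun u ↦ ?_⟩
      refine Eq.trans ?_ (cylinder_slice w x 0 u)
      rw [← hw, closedForms.cylinder_apply]
      rfl
    · rintro ⟨v, hv⟩
      refine ⟨⟨fun p ↦ v p.1, fun p ↦ CylBundle.smoothAt_pullback (v.smoothAt p.1)⟩, fun p ↦ ?_⟩
      refine Eq.trans ?_ (cylinder_pullback (D := D) v p).symm
      rw [closedForms.cylinder_apply]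
      exact ContinuousLinearMap.ext fun u ↦ congrArg
        (fun L : TangentSpace I p.1 →L[ℝ] V p.1 ↦ L (show EM × ℝ from u).1) (hv p.1)
  exact ⟨(Submodule.quotEquivOfEq _ _ hk.symm).trans (f.quotKerEquivOfSurjective hf)⟩

/-- The degenerate metrics defined by pull-backs from the base are inextensible. -/
lemma isInextensible_cylPull [T2Space M] [Nonempty M] (hfr : HasFlatFrames D n)
    {b : Π p, CylBundle I V p → CylBundle I V p → ℝ} (hb : IsParallelLorentz D.cylinder b)
    (η : closedForms D) : IsInextensible (pulledMetric b (closedForms.cylinder hfr η).1) := by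
  intro N _ _ _ _ _ _ k j hj hinj hiso
  exfalso
  obtain ⟨x⟩ := ‹Nonempty M›
  let p : M × ℝ := (x, 0)
  let e := hj.mfderivToContinuousLinearEquiv (by simp) p
  -- The unit vector along the line is annihilated by a pulled-back form. An isometric local
  -- diffeomorphism would carry it to a non-zero radical vector of a Lorentzian form, so there is no
  -- such map at all.
  let u : TangentSpace (I.prod 𝓘(ℝ, ℝ)) p := show EM × ℝ from (0, 1)
  have h1 : ∀ w, k.form (j p) (e u) (e w) = 0 := by
    intro w
    refine (hiso p u w).trans ?_
    obtain ⟨B, hB⟩ := hb.bilin p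
    show b p ((closedForms.cylinder hfr η).1 p u) _ = 0
    have h2 : (closedForms.cylinder hfr η).1 p u = 0 := by
      rw [closedForms.cylinder_apply]
      exact map_zero (η.1 x)
    rw [h2, hB, map_zero, LinearMap.zero_apply]
  have h3 : e u = 0 := by
    refine IsLorentzForm.eq_zero_of_forall
      (B := LinearMap.mk₂ ℝ (fun u w ↦ k.inner (j p) u w) ?_ ?_ ?_ ?_) (k.isLorentz (j p))
      fun w ↦ ?_
    · intro u v w; exact congrArg (fun L ↦ L w) (map_add (k.inner (j p)) u v)
    · intro c u w; exact congrArg (fun L ↦ L w) (map_smul (k.inner (j p)) c u)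
    · intro u v w; exact map_add _ _ _
    · intro c u w; exact map_smul _ _ _
    · obtain ⟨w, rfl⟩ := e.surjective w
      exact h1 w
  have h4 : u = 0 := e.injective (h3.trans (map_zero e).symm)
  exact one_ne_zero (congrArg (fun z : EM × ℝ ↦ z.2) h4)

end CylinderCohomology
end

/-! ### Mayer–Vietoris sequences for complexes of fine sheaves. -/

noncomputable section
section FineSheaves

variable {EM : Type*} [NormedAddCommGroup EM] [NormedSpace ℝ EM]
  {H : Type*} [TopologicalSpace H] {I : ModelWithCorners ℝ EM H}
  {M : Type*} [TopologicalSpace M] [ChartedSpace H M]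

variable (I M) in
/-- A fine sheaf: sections of a family of vector spaces subject to a local smoothness condition. -/
structure FineSheaf where
  X : M → Type*
  [addCommGroup : ∀ x, AddCommGroup (X x)]
  [module : ∀ x, Module ℝ (X x)]
  smooth : (Π x, X x) → M → Prop
  smooth_congr : ∀ {s t : Π x, X x} {x}, smooth s x → (∀ᶠ y in 𝓝 x, t y = s y) → smooth t x
  smooth_zero : ∀ x, smooth 0 x
  smooth_add : ∀ {s t : Π x, X x} {x}, smooth s x → smooth t x → smooth (s + t) x
  smooth_mul : ∀ {f : M → ℝ} {s : Π x, X x} {x}, ContMDiffAt I 𝓘(ℝ, ℝ) ∞ f x → smooth s x →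
    smooth (fun y ↦ f y • s y) x

attribute [instance] FineSheaf.addCommGroup FineSheaf.module

namespace FineSheaf

lemma smooth_smul (Φ : FineSheaf I M) (c : ℝ) {s : Π x, Φ.X x} {x : M} (h : Φ.smooth s x) :
    Φ.smooth (c • s) x := Φ.smooth_mul contMDiffAt_const h

lemma smooth_sub (Φ : FineSheaf I M) {s t : Π x, Φ.X x} {x : M} (h : Φ.smooth s x)
    (h' : Φ.smooth t x) : Φ.smooth (s - t) x := by
  have h1 := Φ.smooth_add h (Φ.smooth_smul (-1) h')
  rwa [neg_one_smul, ← sub_eq_add_neg] at h1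

variable (I M) in
/-- The zero sheaf. -/
def zero : FineSheaf I M where
  X _ := PUnit.{1}
  smooth _ _ := True
  smooth_congr _ _ := trivial
  smooth_zero _ := trivial
  smooth_add _ _ := trivial
  smooth_mul _ _ := trivial

end FineSheaf

/-- A differential operator between fine sheaves. -/
structure SheafOp (Φ Ψ : FineSheaf I M) where
  toFun : (Π x, Φ.X x) → Π x, Ψ.X x
  map_add : ∀ {s t x}, Φ.smooth s x → Φ.smooth t x → toFun (s + t) x = toFun s x + toFun t x
  map_smul : ∀ (c : ℝ) {s x}, Φ.smooth s x → toFun (c • s) x = c • toFun s x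
  map_congr : ∀ {s t x}, Φ.smooth s x → (∀ᶠ y in 𝓝 x, t y = s y) → toFun t x = toFun s x
  smooth_map : ∀ {s x}, (∀ᶠ y in 𝓝 x, Φ.smooth s y) → Ψ.smooth (toFun s) x

namespace SheafOp

variable {Φ Ψ Χ : FineSheaf I M}

instance : CoeFun (SheafOp Φ Ψ) fun _ ↦ (Π x, Φ.X x) → Π x, Ψ.X x := ⟨toFun⟩

lemma map_zero (d : SheafOp Φ Ψ) (x : M) : d 0 x = 0 := by
  have h := d.map_smul 0 (Φ.smooth_zero x)
  rwa [zero_smul, zero_smul] at h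

lemma map_sub (d : SheafOp Φ Ψ) {s t : Π x, Φ.X x} {x : M} (h : Φ.smooth s x)
    (h' : Φ.smooth t x) : d (s - t) x = d s x - d t x := by
  rw [sub_eq_add_neg, ← neg_one_smul ℝ t, d.map_add h (Φ.smooth_smul _ h'), d.map_smul _ h',
    neg_one_smul, sub_eq_add_neg]

variable (Φ Ψ) in
/-- The zero operator. -/
def zero : SheafOp Φ Ψ where
  toFun _ := 0
  map_add _ _ := (add_zero _).symm
  map_smul _ _ _ _ := (smul_zero _).symm
  map_congr _ _ := rfl
  smooth_map _ := Ψ.smooth_zero _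

/-- Sections over `U` (with arbitrary values elsewhere) killed by an operator. -/
def ker (d : SheafOp Φ Ψ) (U : Set M) : Submodule ℝ (Π x, Φ.X x) where
  carrier := {s | ∀ x ∈ U, Φ.smooth s x ∧ d s x = 0}
  add_mem' hs ht x hx := ⟨Φ.smooth_add (hs x hx).1 (ht x hx).1, by
    rw [d.map_add (hs x hx).1 (ht x hx).1, (hs x hx).2, (ht x hx).2, add_zero]⟩
  zero_mem' x _ := ⟨Φ.smooth_zero x, d.map_zero x⟩
  smul_mem' c s hs x hx := ⟨Φ.smooth_smul c (hs x hx).1, by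
    rw [d.map_smul c (hs x hx).1, (hs x hx).2, smul_zero]⟩

/-- Sections over `U` (with arbitrary values elsewhere) in the image of an operator. -/
def im (p : SheafOp Φ Ψ) (U : Set M) : Submodule ℝ (Π x, Ψ.X x) where
  carrier := {s | ∃ t, ∀ x ∈ U, Φ.smooth t x ∧ s x = p t x}
  add_mem' := by
    rintro s s' ⟨t, ht⟩ ⟨t', ht'⟩
    refine ⟨t + t', fun x hx ↦ ⟨Φ.smooth_add (ht x hx).1 (ht' x hx).1, ?_⟩⟩
    rw [p.map_add (ht x hx).1 (ht' x hx).1, ← (ht x hx).2, ← (ht' x hx).2]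
    rfl
  zero_mem' := ⟨0, fun x _ ↦ ⟨Φ.smooth_zero x, (p.map_zero x).symm⟩⟩
  smul_mem' := by
    rintro c s ⟨t, ht⟩
    refine ⟨c • t, fun x hx ↦ ⟨Φ.smooth_smul c (ht x hx).1, ?_⟩⟩
    rw [p.map_smul c (ht x hx).1, ← (ht x hx).2]
    rfl

lemma ker_mono (d : SheafOp Φ Ψ) {U U' : Set M} (h : U' ⊆ U) : d.ker U ≤ d.ker U' :=
  fun _ hs x hx ↦ hs x (h hx)

lemma im_mono (p : SheafOp Φ Ψ) {U U' : Set M} (h : U' ⊆ U) : p.im U ≤ p.im U' :=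
  fun _ ⟨t, ht⟩ ↦ ⟨t, fun x hx ↦ ht x (h hx)⟩

/-- The cohomology over `U` at the middle of two operators. -/
abbrev coh (p : SheafOp Φ Ψ) (d : SheafOp Ψ Χ) (U : Set M) : Type _ :=
  d.ker U ⧸ (p.im U).submoduleOf (d.ker U)

/-- The class of a section. -/
abbrev cls (p : SheafOp Φ Ψ) (d : SheafOp Ψ Χ) (U : Set M) (s : d.ker U) : coh p d U :=
  Submodule.Quotient.mk s

lemma cls_eq_zero {p : SheafOp Φ Ψ} {d : SheafOp Ψ Χ} {U : Set M} {s : d.ker U} :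
    cls p d U s = 0 ↔ s.1 ∈ p.im U :=
  (Submodule.Quotient.mk_eq_zero _).trans Iff.rfl

lemma cls_eq {p : SheafOp Φ Ψ} {d : SheafOp Ψ Χ} {U : Set M} {s t : d.ker U} :
    cls p d U s = cls p d U t ↔ s.1 - t.1 ∈ p.im U :=
  (Submodule.Quotient.eq _).trans Iff.rfl

/-- Restriction to a smaller set. -/
def res (p : SheafOp Φ Ψ) (d : SheafOp Ψ Χ) {U U' : Set M} (h : U' ⊆ U) :
    coh p d U →ₗ[ℝ] coh p d U' :=
  Submodule.mapQ _ _ (Submodule.inclusion (d.ker_mono h)) fun _ hs ↦ p.im_mono h hs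

/-- The composition of two operators vanishes. -/
def IsComplex (p : SheafOp Φ Ψ) (d : SheafOp Ψ Χ) : Prop :=
  ∀ s x, (∀ᶠ y in 𝓝 x, Φ.smooth s y) → d (p s) x = 0

/-- A function that separates the differences of two sets. -/
structure _root_.IsCutoff (I : ModelWithCorners ℝ EM H) (ρ : M → ℝ) (A B : Set M) : Prop where
  smooth : ∀ x ∈ A ∪ B, ContMDiffAt I 𝓘(ℝ, ℝ) ∞ ρ x
  zero : ∀ x ∈ A, x ∉ B → ∀ᶠ y in 𝓝 x, ρ y = 0
  one : ∀ x ∈ B, x ∉ A → ∀ᶠ y in 𝓝 x, ρ y = 1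

variable {A B : Set M} {ρ : M → ℝ}

/-- Near points of `A` outside `B` the cut-off vanishes, so `ρ s` extends over `A`; likewise `(ρ -
1) s` over `B`. This decomposition `s = ρ s - (ρ - 1) s` is all that exactness needs. -/
lemma _root_.IsCutoff.smooth_left (hρ : IsCutoff I ρ A B) {s : Π x, Φ.X x}
    (hs : ∀ x ∈ A ∩ B, Φ.smooth s x) : ∀ x ∈ A, Φ.smooth (fun y ↦ ρ y • s y) x := by
  intro x hx
  by_cases hB : x ∈ B
  · exact Φ.smooth_mul (hρ.smooth x (Or.inl hx)) (hs x ⟨hx, hB⟩)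
  · refine Φ.smooth_congr (Φ.smooth_zero x) ?_
    filter_upwards [hρ.zero x hx hB] with y hy
    rw [hy, zero_smul]; rfl

lemma _root_.IsCutoff.smooth_right (hρ : IsCutoff I ρ A B) {s : Π x, Φ.X x}
    (hs : ∀ x ∈ A ∩ B, Φ.smooth s x) : ∀ x ∈ B, Φ.smooth (fun y ↦ (ρ y - 1) • s y) x := by
  intro x hx
  by_cases hA : x ∈ A
  · exact Φ.smooth_mul ((hρ.smooth x (Or.inl hA)).sub contMDiffAt_const) (hs x ⟨hA, hx⟩)
  · refine Φ.smooth_congr (Φ.smooth_zero x) ?_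
    filter_upwards [hρ.one x hx hA] with y hy
    rw [hy, sub_self, zero_smul]; rfl

open Classical in
/-- Two sections which agree on an intersection of open sets glue. -/
lemma exists_glue (hA : IsOpen A) (hB : IsOpen B) {s t : Π x, Φ.X x}
    (hs : ∀ x ∈ A, Φ.smooth s x) (ht : ∀ x ∈ B, Φ.smooth t x) (h : ∀ x ∈ A ∩ B, s x = t x) :
    ∃ r : Π x, Φ.X x, (∀ x ∈ A, r x = s x) ∧ (∀ x ∈ B, r x = t x) ∧
      ∀ x ∈ A ∪ B, Φ.smooth r x := by
  have h1 : ∀ x ∈ A, (if x ∈ A then s x else t x) = s x := fun x hx ↦ if_pos hx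
  have h2 : ∀ x ∈ B, (if x ∈ A then s x else t x) = t x := fun x hx ↦ by
    split_ifs with hxA
    · exact h x ⟨hxA, hx⟩
    · rfl
  refine ⟨fun x ↦ if x ∈ A then s x else t x, h1, h2, ?_⟩
  rintro x (hx | hx)
  · exact Φ.smooth_congr (hs x hx) (Filter.mem_of_superset (hA.mem_nhds hx) h1)
  · exact Φ.smooth_congr (ht x hx) (Filter.mem_of_superset (hB.mem_nhds hx) h2)

lemma apply_eq_of_eqOn (d : SheafOp Φ Ψ) (hA : IsOpen A) {s t : Π x, Φ.X x}
    (hs : ∀ x ∈ A, Φ.smooth s x) (h : ∀ x ∈ A, t x = s x) {x : M} (hx : x ∈ A) : d t x = d s x :=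
  d.map_congr (hs x hx) (Filter.mem_of_superset (hA.mem_nhds hx) h)

/-- On the intersection, the two halves of a cut off section differ by the section. -/
lemma apply_cutoff_sub (hρ : IsCutoff I ρ A B) (d : SheafOp Φ Ψ) {s : Π x, Φ.X x}
    (hs : ∀ x ∈ A ∩ B, Φ.smooth s x) {x : M} (hx : x ∈ A ∩ B) :
    d (fun y ↦ ρ y • s y) x - d (fun y ↦ (ρ y - 1) • s y) x = d s x := by
  rw [← d.map_sub (hρ.smooth_left hs x hx.1) (hρ.smooth_right hs x hx.2)]
  congr 1
  funext y
  show ρ y • s y - (ρ y - 1) • s y = s y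
  rw [sub_smul, one_smul, sub_sub_cancel]

variable {Ω : FineSheaf I M} {p : SheafOp Φ Ψ} {d : SheafOp Ψ Χ} {d' : SheafOp Χ Ω}

open Classical in
/-- The connecting map on sections. -/
def deltaFun (d : SheafOp Ψ Χ) (ρ : M → ℝ) (A B : Set M) (s : Π x, Ψ.X x) (x : M) : Χ.X x :=
  if x ∈ A ∩ B then d (fun y ↦ ρ y • s y) x else 0

lemma deltaFun_left (hρ : IsCutoff I ρ A B) {s : Π x, Ψ.X x} {x : M} (hx : x ∈ A) :
    deltaFun d ρ A B s x = d (fun y ↦ ρ y • s y) x := by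
  by_cases hB : x ∈ B
  · exact if_pos ⟨hx, hB⟩
  · refine (if_neg fun h ↦ hB h.2).trans ?_
    rw [d.map_congr (s := 0) (Ψ.smooth_zero x), d.map_zero]
    filter_upwards [hρ.zero x hx hB] with y hy
    rw [hy, zero_smul]; rfl

/-- On the overlap the two descriptions differ by `d s`, which is zero for a cocycle. -/
lemma deltaFun_right (hρ : IsCutoff I ρ A B) {s : Π x, Ψ.X x}
    (hs : s ∈ d.ker (A ∩ B)) {x : M} (hx : x ∈ B) :
    deltaFun d ρ A B s x = d (fun y ↦ (ρ y - 1) • s y) x := by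
  by_cases hA : x ∈ A
  · refine (if_pos ⟨hA, hx⟩).trans ?_
    rw [← sub_eq_zero, apply_cutoff_sub hρ d (fun y hy ↦ (hs y hy).1) ⟨hA, hx⟩]
    exact (hs x ⟨hA, hx⟩).2
  · refine (if_neg fun h ↦ hA h.1).trans ?_
    rw [d.map_congr (s := 0) (Ψ.smooth_zero x), d.map_zero]
    filter_upwards [hρ.one x hx hA] with y hy
    rw [hy, sub_self, zero_smul]; rfl

/-- On each of the two open sets the connecting map is `d` of a smooth section, so the next operator
kills it. -/
lemma deltaFun_mem (hc : IsComplex d d') (hρ : IsCutoff I ρ A B) (hA : IsOpen A) (hB : IsOpen B)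
    {s : Π x, Ψ.X x} (hs : s ∈ d.ker (A ∩ B)) : deltaFun d ρ A B s ∈ d'.ker (A ∪ B) := by
  have h1 := hρ.smooth_left fun y hy ↦ (hs y hy).1
  have h2 := hρ.smooth_right fun y hy ↦ (hs y hy).1
  have key : ∀ {C : Set M} {t : Π x, Ψ.X x}, IsOpen C → (∀ x ∈ C, Ψ.smooth t x) →
      (∀ x ∈ C, deltaFun d ρ A B s x = d t x) → ∀ x ∈ C,
      Χ.smooth (deltaFun d ρ A B s) x ∧ d' (deltaFun d ρ A B s) x = 0 := by
    intro C t hC ht h x hx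
    have h3 : ∀ᶠ y in 𝓝 x, Ψ.smooth t y := Filter.mem_of_superset (hC.mem_nhds hx) ht
    have h4 := d.smooth_map h3
    have h5 := Filter.mem_of_superset (hC.mem_nhds hx) h
    exact ⟨Χ.smooth_congr h4 h5, (d'.map_congr h4 h5).trans (hc t x h3)⟩
  rintro x (hx | hx)
  · exact key hA h1 (fun y hy ↦ deltaFun_left hρ hy) x hx
  · exact key hB h2 (fun y hy ↦ deltaFun_right hρ hs hy) x hx

/-- The connecting map on cocycles. -/
def deltaKer (hc : IsComplex d d') (hρ : IsCutoff I ρ A B) (hA : IsOpen A) (hB : IsOpen B) :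
    d.ker (A ∩ B) →ₗ[ℝ] d'.ker (A ∪ B) where
  toFun s := ⟨deltaFun d ρ A B s.1, deltaFun_mem hc hρ hA hB s.2⟩
  map_add' s t := Subtype.ext <| funext fun x ↦ by
    show deltaFun d ρ A B (s.1 + t.1) x = deltaFun d ρ A B s.1 x + deltaFun d ρ A B t.1 x
    unfold deltaFun
    split_ifs with hx
    · rw [← d.map_add (Ψ.smooth_mul (hρ.smooth x (Or.inl hx.1)) (s.2 x hx).1)
        (Ψ.smooth_mul (hρ.smooth x (Or.inl hx.1)) (t.2 x hx).1)]
      congr 1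
      funext y
      exact smul_add _ _ _
    · exact (add_zero _).symm
  map_smul' c s := Subtype.ext <| funext fun x ↦ by
    show deltaFun d ρ A B (c • s.1) x = c • deltaFun d ρ A B s.1 x
    unfold deltaFun
    split_ifs with hx
    · rw [← d.map_smul c (Ψ.smooth_mul (hρ.smooth x (Or.inl hx.1)) (s.2 x hx).1)]
      congr 1
      funext y
      exact smul_comm _ _ _
    · exact (smul_zero _).symm

lemma im_le_ker (hc : IsComplex p d) {U : Set M} (hU : IsOpen U) : p.im U ≤ d.ker U := by
  rintro s ⟨t, ht⟩ x hx
  have h3 : ∀ᶠ y in 𝓝 x, Φ.smooth t y :=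
    Filter.mem_of_superset (hU.mem_nhds hx) fun y hy ↦ (ht y hy).1
  have h5 : ∀ᶠ y in 𝓝 x, s y = p t y :=
    Filter.mem_of_superset (hU.mem_nhds hx) fun y hy ↦ (ht y hy).2
  exact ⟨Ψ.smooth_congr (p.smooth_map h3) h5, (d.map_congr (p.smooth_map h3) h5).trans (hc t x h3)⟩

/-- The vanishing of the connecting map. -/
lemma deltaFun_mem_im_iff (hρ : IsCutoff I ρ A B) (hA : IsOpen A)
    (hB : IsOpen B) {s : Π x, Ψ.X x} (hs : s ∈ d.ker (A ∩ B)) :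
    deltaFun d ρ A B s ∈ d.im (A ∪ B) ↔
      ∃ a ∈ d.ker A, ∃ b ∈ d.ker B, ∀ x ∈ A ∩ B, s x = a x - b x := by
  have h1 := hρ.smooth_left fun y hy ↦ (hs y hy).1
  have h2 := hρ.smooth_right fun y hy ↦ (hs y hy).1
  constructor
  · rintro ⟨t, ht⟩
    -- A global primitive `t` corrects the two halves of `s` to cocycles without changing their
    -- difference.
    refine ⟨(fun y ↦ ρ y • s y) - t, fun x hx ↦ ?_, (fun y ↦ (ρ y - 1) • s y) - t, fun x hx ↦ ?_,
      fun x _ ↦ ?_⟩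
    · obtain ⟨h3, h4⟩ := ht x (Or.inl hx)
      rw [deltaFun_left hρ hx] at h4
      exact ⟨Ψ.smooth_sub (h1 x hx) h3, by rw [d.map_sub (h1 x hx) h3, h4, sub_self]⟩
    · obtain ⟨h3, h4⟩ := ht x (Or.inr hx)
      rw [deltaFun_right hρ hs hx] at h4
      exact ⟨Ψ.smooth_sub (h2 x hx) h3, by rw [d.map_sub (h2 x hx) h3, h4, sub_self]⟩
    · show s x = ρ x • s x - t x - ((ρ x - 1) • s x - t x)
      rw [sub_smul, one_smul]
      abel
  · rintro ⟨a, ha, b, hb, hab⟩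
    obtain ⟨t, htA, htB, ht⟩ := exists_glue hA hB
      (fun x hx ↦ Ψ.smooth_sub (h1 x hx) (ha x hx).1)
      (fun x hx ↦ Ψ.smooth_sub (h2 x hx) (hb x hx).1) (fun x hx ↦ by
        show ρ x • s x - a x = (ρ x - 1) • s x - b x
        rw [sub_smul, one_smul, hab x hx]
        abel)
    refine ⟨t, fun x hx ↦ ⟨ht x hx, ?_⟩⟩
    rcases hx with hx | hx
    · rw [deltaFun_left hρ hx, d.apply_eq_of_eqOn hA (fun x hx ↦ Ψ.smooth_sub (h1 x hx)
        (ha x hx).1) htA hx, d.map_sub (h1 x hx) (ha x hx).1, (ha x hx).2, sub_zero]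
    · rw [deltaFun_right hρ hs hx, d.apply_eq_of_eqOn hB (fun x hx ↦ Ψ.smooth_sub (h2 x hx)
        (hb x hx).1) htB hx, d.map_sub (h2 x hx) (hb x hx).1, (hb x hx).2, sub_zero]

/-- The connecting map of the Mayer–Vietoris sequence. -/
def delta (p : SheafOp Φ Ψ) (hp : IsComplex p d) (hc : IsComplex d d') (hρ : IsCutoff I ρ A B)
    (hA : IsOpen A) (hB : IsOpen B) : coh p d (A ∩ B) →ₗ[ℝ] coh d d' (A ∪ B) :=
  Submodule.mapQ _ _ (deltaKer hc hρ hA hB) fun s hs ↦ by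
    -- A coboundary `p t` splits as the difference of `p (ρ t)` and `p ((ρ - 1) t)`, which are
    -- cocycles on `A` and on `B`.
    refine (deltaFun_mem_im_iff hρ hA hB s.2).2 ?_
    obtain ⟨t, ht⟩ : s.1 ∈ p.im (A ∩ B) := hs
    have h1 := hρ.smooth_left fun y hy ↦ (ht y hy).1
    have h2 := hρ.smooth_right fun y hy ↦ (ht y hy).1
    refine ⟨p fun y ↦ ρ y • t y, im_le_ker hp hA ⟨_, fun x hx ↦ ⟨h1 x hx, rfl⟩⟩,
      p fun y ↦ (ρ y - 1) • t y, im_le_ker hp hB ⟨_, fun x hx ↦ ⟨h2 x hx, rfl⟩⟩, fun x hx ↦ ?_⟩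
    rw [apply_cutoff_sub hρ p (fun y hy ↦ (ht y hy).1) hx]
    exact (ht x hx).2

lemma delta_cls (hp : IsComplex p d) (hc : IsComplex d d') (hρ : IsCutoff I ρ A B)
    (hA : IsOpen A) (hB : IsOpen B) (s : d.ker (A ∩ B)) :
    delta p hp hc hρ hA hB (cls p d _ s) =
      cls d d' _ ⟨deltaFun d ρ A B s.1, deltaFun_mem hc hρ hA hB s.2⟩ := rfl

/-- The restriction to two sets. -/
def resPair (p : SheafOp Φ Ψ) (d : SheafOp Ψ Χ) (A B : Set M) :
    coh p d (A ∪ B) →ₗ[ℝ] coh p d A × coh p d B :=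
  (res p d subset_union_left).prod (res p d subset_union_right)

/-- The difference of restrictions to the intersection. -/
def resDiff (p : SheafOp Φ Ψ) (d : SheafOp Ψ Χ) (A B : Set M) :
    coh p d A × coh p d B →ₗ[ℝ] coh p d (A ∩ B) :=
  (res p d inter_subset_left).coprod (-res p d inter_subset_right)

lemma resDiff_cls (a : d.ker A) (b : d.ker B) : resDiff p d A B (cls p d A a, cls p d B b) =
    cls p d (A ∩ B) ⟨a.1 - b.1, sub_mem (d.ker_mono inter_subset_left a.2)
      (d.ker_mono inter_subset_right b.2)⟩ := by
  refine (LinearMap.coprod_apply _ _ _).trans ?_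
  rw [LinearMap.neg_apply, ← sub_eq_add_neg]
  rfl

/-- Exactness of the Mayer–Vietoris sequence at the middle. -/
theorem exact_resPair_resDiff (hp : IsComplex p d) (hρ : IsCutoff I ρ A B) (hA : IsOpen A)
    (hB : IsOpen B) : Function.Exact (resPair p d A B) (resDiff p d A B) := by
  rintro ⟨⟨a⟩, ⟨b⟩⟩
  have h0 : resDiff p d A B (cls p d A a, cls p d B b) = 0 ↔ a.1 - b.1 ∈ p.im (A ∩ B) := by
    rw [resDiff_cls, cls_eq_zero]
  refine h0.trans ⟨?_, ?_⟩
  · rintro ⟨t, ht⟩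
    have h1 := hρ.smooth_left fun y hy ↦ (ht y hy).1
    have h2 := hρ.smooth_right fun y hy ↦ (ht y hy).1
    -- Changing the two cocycles within their classes by the halves of `t` makes them agree on the
    -- overlap, so that they glue.
    have ha : a.1 - p (fun y ↦ ρ y • t y) ∈ d.ker A :=
      sub_mem a.2 (im_le_ker hp hA ⟨_, fun x hx ↦ ⟨h1 x hx, rfl⟩⟩)
    have hb : b.1 - p (fun y ↦ (ρ y - 1) • t y) ∈ d.ker B :=
      sub_mem b.2 (im_le_ker hp hB ⟨_, fun x hx ↦ ⟨h2 x hx, rfl⟩⟩)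
    obtain ⟨r, hrA, hrB, hr⟩ := exists_glue hA hB (fun x hx ↦ (ha x hx).1)
      (fun x hx ↦ (hb x hx).1) (fun x hx ↦ by
        show a.1 x - _ = b.1 x - _
        have h3 : a.1 x - b.1 x = _ := (ht x hx).2
        rw [← apply_cutoff_sub hρ p (fun y hy ↦ (ht y hy).1) hx] at h3
        rw [sub_eq_sub_iff_sub_eq_sub, h3])
    have hrk : r ∈ d.ker (A ∪ B) := by
      intro x hx
      refine ⟨hr x hx, ?_⟩
      rcases hx with hx | hx
      · rw [d.apply_eq_of_eqOn hA (fun x hx ↦ (ha x hx).1) hrA hx, (ha x hx).2]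
      · rw [d.apply_eq_of_eqOn hB (fun x hx ↦ (hb x hx).1) hrB hx, (hb x hx).2]
    refine ⟨cls p d _ ⟨r, hrk⟩, Prod.ext ?_ ?_⟩
    · refine (cls_eq (s := ⟨r, d.ker_mono subset_union_left hrk⟩) (t := a)).2 ?_
      refine ⟨0 - fun y ↦ ρ y • t y, fun x hx ↦ ⟨Φ.smooth_sub (Φ.smooth_zero x) (h1 x hx), ?_⟩⟩
      rw [p.map_sub (Φ.smooth_zero x) (h1 x hx), p.map_zero]
      show r x - a.1 x = _
      rw [hrA x hx]
      show a.1 x - _ - a.1 x = _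
      abel
    · refine (cls_eq (s := ⟨r, d.ker_mono subset_union_right hrk⟩) (t := b)).2 ?_
      refine ⟨0 - fun y ↦ (ρ y - 1) • t y, fun x hx ↦
        ⟨Φ.smooth_sub (Φ.smooth_zero x) (h2 x hx), ?_⟩⟩
      rw [p.map_sub (Φ.smooth_zero x) (h2 x hx), p.map_zero]
      show r x - b.1 x = _
      rw [hrB x hx]
      show b.1 x - _ - b.1 x = _
      abel
  · rintro ⟨⟨r⟩, hr⟩
    have h1 : r.1 - a.1 ∈ p.im A := cls_eq.1 (congrArg Prod.fst hr)
    have h2 : r.1 - b.1 ∈ p.im B := cls_eq.1 (congrArg Prod.snd hr)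
    have h3 := sub_mem (p.im_mono inter_subset_right h2) (p.im_mono inter_subset_left h1)
    rwa [sub_sub_sub_cancel_left] at h3

/-- Exactness of the Mayer–Vietoris sequence at the intersection. -/
theorem exact_resDiff_delta (hp : IsComplex p d) (hc : IsComplex d d') (hρ : IsCutoff I ρ A B)
    (hA : IsOpen A) (hB : IsOpen B) :
    Function.Exact (resDiff p d A B) (delta p hp hc hρ hA hB) := by
  rintro ⟨s⟩
  have h0 : delta p hp hc hρ hA hB (cls p d _ s) = 0 ↔ deltaFun d ρ A B s.1 ∈ d.im (A ∪ B) := by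
    rw [delta_cls, cls_eq_zero]
  refine (h0.trans (deltaFun_mem_im_iff hρ hA hB s.2)).trans ⟨?_, ?_⟩
  · rintro ⟨a, ha, b, hb, hab⟩
    refine ⟨(cls p d A ⟨a, ha⟩, cls p d B ⟨b, hb⟩), ?_⟩
    rw [resDiff_cls]
    refine cls_eq.2 ⟨0, fun x hx ↦ ⟨Φ.smooth_zero x, ?_⟩⟩
    rw [p.map_zero]
    exact sub_eq_zero.2 (hab x hx).symm
  · rintro ⟨⟨⟨a⟩, ⟨b⟩⟩, hab⟩
    have h1 := (resDiff_cls (p := p) a b).symm.trans hab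
    obtain ⟨t, ht⟩ := cls_eq.1 h1
    have h2 := hρ.smooth_left fun y hy ↦ (ht y hy).1
    have h3 := hρ.smooth_right fun y hy ↦ (ht y hy).1
    refine ⟨a.1 - p (fun y ↦ ρ y • t y), sub_mem a.2 (im_le_ker hp hA
      ⟨_, fun x hx ↦ ⟨h2 x hx, rfl⟩⟩), b.1 - p (fun y ↦ (ρ y - 1) • t y), sub_mem b.2
      (im_le_ker hp hB ⟨_, fun x hx ↦ ⟨h3 x hx, rfl⟩⟩), fun x hx ↦ ?_⟩
    have h4 : a.1 x - b.1 x - s.1 x = p t x := (ht x hx).2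
    rw [← apply_cutoff_sub hρ p (fun y hy ↦ (ht y hy).1) hx] at h4
    show s.1 x = a.1 x - _ - (b.1 x - _)
    rw [sub_sub_sub_comm, ← h4]
    abel

/-- Exactness of the Mayer–Vietoris sequence at the union. -/
theorem exact_delta_resPair (hp : IsComplex p d) (hc : IsComplex d d') (hρ : IsCutoff I ρ A B)
    (hA : IsOpen A) (hB : IsOpen B) :
    Function.Exact (delta p hp hc hρ hA hB) (resPair d d' A B) := by
  rintro ⟨r⟩
  have h0 : resPair d d' A B (cls d d' _ r) = 0 ↔ r.1 ∈ d.im A ∧ r.1 ∈ d.im B := by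
    rw [Prod.ext_iff]
    exact and_congr (cls_eq_zero (s := ⟨r.1, d'.ker_mono subset_union_left r.2⟩))
      (cls_eq_zero (s := ⟨r.1, d'.ker_mono subset_union_right r.2⟩))
  refine h0.trans ⟨?_, ?_⟩
  · rintro ⟨⟨a, ha⟩, ⟨b, hb⟩⟩
    -- Two primitives of the same section differ on the overlap by a cocycle; its image under the
    -- connecting map is the class of `r`.
    have hs : a - b ∈ d.ker (A ∩ B) := by
      intro x hx
      refine ⟨Ψ.smooth_sub (ha x hx.1).1 (hb x hx.2).1, ?_⟩
      rw [d.map_sub (ha x hx.1).1 (hb x hx.2).1, ← (ha x hx.1).2, ← (hb x hx.2).2, sub_self]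
    have h1 := hρ.smooth_left fun y hy ↦ (hs y hy).1
    have h2 := hρ.smooth_right fun y hy ↦ (hs y hy).1
    refine ⟨cls p d _ ⟨a - b, hs⟩, (delta_cls hp hc hρ hA hB _).trans (cls_eq.2 ?_)⟩
    obtain ⟨t, htA, htB, ht⟩ := exists_glue hA hB
      (fun x hx ↦ Ψ.smooth_sub (h1 x hx) (ha x hx).1)
      (fun x hx ↦ Ψ.smooth_sub (h2 x hx) (hb x hx).1) (fun x hx ↦ by
        show ρ x • (a x - b x) - a x = (ρ x - 1) • (a x - b x) - b x
        rw [sub_smul, one_smul]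
        abel)
    refine ⟨t, fun x hx ↦ ⟨ht x hx, ?_⟩⟩
    show deltaFun d ρ A B (a - b) x - r.1 x = d t x
    rcases hx with hx | hx
    · rw [deltaFun_left hρ hx, d.apply_eq_of_eqOn hA (fun x hx ↦ Ψ.smooth_sub (h1 x hx)
        (ha x hx).1) htA hx, d.map_sub (h1 x hx) (ha x hx).1, (ha x hx).2]
    · rw [deltaFun_right hρ hs hx, d.apply_eq_of_eqOn hB (fun x hx ↦ Ψ.smooth_sub (h2 x hx)
        (hb x hx).1) htB hx, d.map_sub (h2 x hx) (hb x hx).1, (hb x hx).2]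
  · rintro ⟨⟨s⟩, hs⟩
    have h1 := cls_eq.1 ((delta_cls hp hc hρ hA hB s).symm.trans hs)
    have h2 := hρ.smooth_left fun y hy ↦ (s.2 y hy).1
    have h3 := hρ.smooth_right fun y hy ↦ (s.2 y hy).1
    -- Over `A` the image of the connecting map has the primitive `ρ s`, and over `B` the primitive
    -- `(ρ - 1) s`.
    have h4 : deltaFun d ρ A B s.1 ∈ d.im A :=
      ⟨_, fun x hx ↦ ⟨h2 x hx, deltaFun_left hρ hx⟩⟩
    have h5 : deltaFun d ρ A B s.1 ∈ d.im B :=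
      ⟨_, fun x hx ↦ ⟨h3 x hx, deltaFun_right hρ s.2 hx⟩⟩
    constructor
    · have := sub_mem h4 (d.im_mono subset_union_left h1)
      rwa [sub_sub_cancel] at this
    · have := sub_mem h5 (d.im_mono subset_union_right h1)
      rwa [sub_sub_cancel] at this

end SheafOp
end FineSheaves
end

/-! ### Additivity of Euler characteristics. -/

noncomputable section
section EulerCharacteristic

section Ranks

variable {X Y Z : Type*} [AddCommGroup X] [Module ℝ X] [AddCommGroup Y] [Module ℝ Y]
  [AddCommGroup Z] [Module ℝ Z] {f : X →ₗ[ℝ] Y} {g : Y →ₗ[ℝ] Z}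

lemma Function.Exact.finite (h : Function.Exact f g) [Module.Finite ℝ X] [Module.Finite ℝ Z] :
    Module.Finite ℝ Y := by
  have h1 : Module.Finite ℝ (LinearMap.ker g) := by
    rw [LinearMap.exact_iff.1 h]; infer_instance
  have h2 : Module.Finite ℝ (Y ⧸ LinearMap.ker g) :=
    Module.Finite.equiv g.quotKerEquivRange.symm
  exact Module.Finite.of_submodule_quotient (LinearMap.ker g)

lemma Function.Exact.finrank_eq (h : Function.Exact f g) [Module.Finite ℝ Y] :
    Module.finrank ℝ Y = Module.finrank ℝ (LinearMap.range f) +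
      Module.finrank ℝ (LinearMap.range g) := by
  rw [← g.finrank_range_add_finrank_ker, LinearMap.exact_iff.1 h, add_comm]

end Ranks

variable {EM : Type*} [NormedAddCommGroup EM] [NormedSpace ℝ EM]
  {H : Type*} [TopologicalSpace H] {I : ModelWithCorners ℝ EM H}
  {M : Type*} [TopologicalSpace M] [ChartedSpace H M] {A₀ A₁ A₂ : FineSheaf I M}
  {d₀ : SheafOp A₀ A₁} {d₁ : SheafOp A₁ A₂}

namespace SheafOp

variable (d₀ d₁) in
/-- The cohomology in degree zero of a complex with three terms. -/
abbrev coh₀ (U : Set M) : Type _ := coh (zero (FineSheaf.zero I M) A₀) d₀ U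

variable (d₁) in
/-- The cohomology in degree two of a complex with three terms. -/
abbrev coh₂ (U : Set M) : Type _ := coh d₁ (zero A₂ (FineSheaf.zero I M)) U

variable (d₀ d₁) in
/-- The cohomology of a complex with three terms over `U` is finite-dimensional, with Euler
characteristic `c`. -/
structure HasEuler (U : Set M) (c : ℤ) : Prop where
  finite₀ : Module.Finite ℝ (coh₀ d₀ U)
  finite₁ : Module.Finite ℝ (coh d₀ d₁ U)
  finite₂ : Module.Finite ℝ (coh₂ d₁ U)
  eq : (Module.finrank ℝ (coh₀ d₀ U) : ℤ) - Module.finrank ℝ (coh d₀ d₁ U) +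
    Module.finrank ℝ (coh₂ d₁ U) = c

lemma isComplex_zero_left {Φ Ψ Χ : FineSheaf I M} (d : SheafOp Ψ Χ) : IsComplex (zero Φ Ψ) d :=
  fun _ x _ ↦ d.map_zero x

lemma isComplex_zero_right {Φ Ψ Χ : FineSheaf I M} (d : SheafOp Φ Ψ) : IsComplex d (zero Ψ Χ) :=
  fun _ _ _ ↦ rfl

instance subsingleton_coh_zero {Φ Χ : FineSheaf I M} (p : SheafOp Φ (FineSheaf.zero I M))
    (d : SheafOp (FineSheaf.zero I M) Χ) (U : Set M) : Subsingleton (coh p d U) := by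
  refine ⟨?_⟩
  rintro ⟨s⟩ ⟨t⟩
  have : s = t := Subtype.ext (funext fun x ↦ rfl)
  rw [this]

lemma finrank_range_of_subsingleton {X Y : Type*} [AddCommGroup X] [Module ℝ X] [AddCommGroup Y]
    [Module ℝ Y] (f : X →ₗ[ℝ] Y) (h : Subsingleton X ∨ Subsingleton Y) :
    Module.finrank ℝ (LinearMap.range f) = 0 := by
  have : f = 0 := by
    rcases h with h | h
    · ext x; rw [Subsingleton.elim x 0, _root_.map_zero, _root_.map_zero]
    · ext x; exact Subsingleton.elim _ _
  rw [this, LinearMap.range_zero, finrank_bot]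

variable {A B : Set M} {ρ : M → ℝ}

/-- The Euler characteristic is additive. -/
theorem HasEuler.union (hc : IsComplex d₀ d₁) (hρ : IsCutoff I ρ A B) (hA : IsOpen A)
    (hB : IsOpen B) {a b c : ℤ} (ha : HasEuler d₀ d₁ A a) (hb : HasEuler d₀ d₁ B b)
    (hab : HasEuler d₀ d₁ (A ∩ B) c) : HasEuler d₀ d₁ (A ∪ B) (a + b - c) := by
  obtain ⟨fa0, fa1, fa2, ea⟩ := ha
  obtain ⟨fb0, fb1, fb2, eb⟩ := hb
  obtain ⟨fc0, fc1, fc2, ec⟩ := hab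
  have hz := isComplex_zero_left (Φ := FineSheaf.zero I M) d₀
  have hz' := isComplex_zero_right (Χ := FineSheaf.zero I M) d₁
  have hzz := isComplex_zero_left (Φ := FineSheaf.zero I M) (zero (FineSheaf.zero I M) A₀)
  have hzz' := isComplex_zero_right (Χ := FineSheaf.zero I M) (zero A₂ (FineSheaf.zero I M))
  -- The sequence from degree zero of the union to degree two of the intersection. Padding the
  -- complex with zero sheaves yields both ends as further instances of the same exactness
  -- statements.
  have e1 := exact_delta_resPair hzz hz hρ hA hB
  have e2 := exact_resPair_resDiff hz hρ hA hB
  have e3 := exact_resDiff_delta hz hc hρ hA hB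
  have e4 := exact_delta_resPair hz hc hρ hA hB
  have e5 := exact_resPair_resDiff hc hρ hA hB
  have e6 := exact_resDiff_delta hc hz' hρ hA hB
  have e7 := exact_delta_resPair hc hz' hρ hA hB
  have e8 := exact_resPair_resDiff hz' hρ hA hB
  have e9 := exact_resDiff_delta hz' hzz' hρ hA hB
  have f0 := e1.finite
  have f1 := e4.finite
  have f2 := e7.finite
  refine ⟨f0, f1, f2, ?_⟩
  -- Each dimension is the sum of the ranks of the two adjacent maps; in the alternating sum
  -- everything telescopes.
  have r1 := e1.finrank_eq
  have r2 := e2.finrank_eq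
  have r3 := e3.finrank_eq
  have r4 := e4.finrank_eq
  have r5 := e5.finrank_eq
  have r6 := e6.finrank_eq
  have r7 := e7.finrank_eq
  have r8 := e8.finrank_eq
  have r9 := e9.finrank_eq
  rw [finrank_range_of_subsingleton _ (Or.inl inferInstance)] at r1
  rw [finrank_range_of_subsingleton (delta _ hz' _ _ _ _) (Or.inr inferInstance)] at r9
  rw [Module.finrank_prod] at r2 r5 r8
  simp only [coh₀, coh₂] at *
  omega

lemma subsingleton_coh_empty {Φ Ψ Χ : FineSheaf I M} (p : SheafOp Φ Ψ) (d : SheafOp Ψ Χ) :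
    Subsingleton (coh p d ∅) := by
  refine ⟨?_⟩
  rintro ⟨s⟩ ⟨t⟩
  exact cls_eq.2 ⟨0, fun x hx ↦ hx.elim⟩

lemma hasEuler_empty : HasEuler d₀ d₁ ∅ 0 := by
  have h0 := subsingleton_coh_empty (zero (FineSheaf.zero I M) A₀) d₀
  have h1 := subsingleton_coh_empty d₀ d₁
  have h2 := subsingleton_coh_empty d₁ (zero A₂ (FineSheaf.zero I M))
  refine ⟨inferInstance, inferInstance, inferInstance, ?_⟩
  rw [Module.finrank_zero_of_subsingleton, Module.finrank_zero_of_subsingleton,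
    Module.finrank_zero_of_subsingleton]
  simp

variable {B₀ B₁ B₂ : FineSheaf I M} {d₀' : SheafOp B₀ B₁} {d₁' : SheafOp B₁ B₂}

/-- The Euler characteristics of two complexes over a finite union are proportional if they are so
over all intersections. -/
theorem exists_hasEuler_biUnion (hc : IsComplex d₀ d₁) (hc' : IsComplex d₀' d₁')
    (hcut : ∀ A B : Set M, IsOpen A → IsOpen B → ∃ ρ, IsCutoff I ρ A B) (n : ℤ) {ι : Type*}
    [DecidableEq ι] (s : Finset ι) : ∀ U : ι → Set M, (∀ i, IsOpen (U i)) →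
    (∀ J : Finset ι, J.Nonempty → ∃ c, HasEuler d₀ d₁ (⋂ i ∈ J, U i) (n * c) ∧
      HasEuler d₀' d₁' (⋂ i ∈ J, U i) c) →
    ∃ c, HasEuler d₀ d₁ (⋃ i ∈ s, U i) (n * c) ∧ HasEuler d₀' d₁' (⋃ i ∈ s, U i) c := by
  induction s using Finset.induction_on with
  | empty =>
    intro U _ _
    refine ⟨0, ?_⟩
    simp only [Finset.notMem_empty, iUnion_of_empty, iUnion_empty, mul_zero]
    exact ⟨hasEuler_empty, hasEuler_empty⟩
  | insert i s hi ih =>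
    intro U hU hJ
    obtain ⟨a, ha, ha'⟩ := ih U hU hJ
    obtain ⟨b, hb, hb'⟩ := hJ {i} (Finset.singleton_nonempty i)
    simp only [Finset.mem_singleton, iInter_iInter_eq_left] at hb hb'
    -- The induction ranges over all families, so it also covers the traces on `U i`, whose
    -- intersections are again intersections of the original sets.
    obtain ⟨c, hc1, hc1'⟩ := ih (fun j ↦ U j ∩ U i) (fun j ↦ (hU j).inter (hU i)) fun J hJne ↦ by
      have : ⋂ j ∈ J, U j ∩ U i = ⋂ j ∈ insert i J, U j := by
        ext x
        simp only [mem_iInter, Finset.mem_insert, mem_inter_iff, forall_eq_or_imp]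
        obtain ⟨j, hj⟩ := hJne
        exact ⟨fun h ↦ ⟨(h j hj).2, fun k hk ↦ (h k hk).1⟩, fun h k hk ↦ ⟨h.2 k hk, h.1⟩⟩
      rw [this]
      exact hJ _ (Finset.insert_nonempty i J)
    have e : ⋃ j ∈ s, U j ∩ U i = (⋃ j ∈ s, U j) ∩ U i := by
      rw [iUnion₂_inter]
    have e' : ⋃ j ∈ insert i s, U j = (⋃ j ∈ s, U j) ∪ U i := by
      rw [Finset.set_biUnion_insert, union_comm]
    rw [e] at hc1 hc1'
    rw [e']
    have ho : IsOpen (⋃ j ∈ s, U j) := isOpen_biUnion fun j _ ↦ hU j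
    obtain ⟨ρ, hρ⟩ := hcut _ _ ho (hU i)
    refine ⟨a + b - c, ?_, ha'.union hc' hρ ho (hU i) hb' hc1'⟩
    have := ha.union hc hρ ho (hU i) hb hc1
    rwa [← mul_add, ← mul_sub] at this

end SheafOp

/-- On a manifold with partitions of unity, the differences of two open sets can be separated. -/
lemma exists_isCutoff [FiniteDimensional ℝ EM] [I.Boundaryless] [IsManifold I ∞ M] [T2Space M]
    [SigmaCompactSpace M] {A B : Set M} (hA : IsOpen A) (hB : IsOpen B) :
    ∃ ρ, IsCutoff I ρ A B := by
  obtain ⟨f, hfs, hf, hf0⟩ := IsOpen.exists_contMDiff_support_eq I hA (n := ⊤)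
  obtain ⟨g, hgs, hg, hg0⟩ := IsOpen.exists_contMDiff_support_eq I hB (n := ⊤)
  have hpos : ∀ x ∈ A ∪ B, 0 < f x + g x := by
    rintro x (hx | hx)
    · have : 0 < f x := (hf0 x).lt_of_ne' (by rwa [← hfs] at hx)
      linarith [hg0 x]
    · have : 0 < g x := (hg0 x).lt_of_ne' (by rwa [← hgs] at hx)
      linarith [hf0 x]
  -- The value is `-1` on `A \ B` and `2` on `B \ A`. Both lie strictly outside `[0, 1]`, so the
  -- smooth transition function is locally constant near these points.
  let r : M → ℝ := fun x ↦ 3 * (g x / (f x + g x)) - 1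
  have hr : ∀ x ∈ A ∪ B, ContMDiffAt I 𝓘(ℝ, ℝ) ∞ r x := fun x hx ↦ by
    refine (contMDiffAt_const.mul (ContMDiffAt.div₀ hg.contMDiffAt
      (hf.contMDiffAt.add hg.contMDiffAt) (hpos x hx).ne')).sub contMDiffAt_const
  refine ⟨fun x ↦ Real.smoothTransition (r x), fun x hx ↦ ?_, fun x hxA hxB ↦ ?_,
    fun x hxB hxA ↦ ?_⟩
  · exact Real.smoothTransition.contDiff.contMDiff.contMDiffAt.comp x (hr x hx)
  · have h0 : g x = 0 := by by_contra h; exact hxB (hgs ▸ h)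
    have h1 : r x = -1 := by simp [r, h0]
    filter_upwards [(hr x (Or.inl hxA)).continuousAt.eventually_lt continuousAt_const
      (show r x < 0 by rw [h1]; norm_num)] with y hy
    exact Real.smoothTransition.zero_of_nonpos hy.le
  · have h0 : f x = 0 := by by_contra h; exact hxA (hfs ▸ h)
    have h1 : r x = 2 := by
      have h2 := (hpos x (Or.inr hxB)).ne'
      simp only [r, h0, zero_add] at h2 ⊢
      rw [div_self h2]
      norm_num
    filter_upwards [continuousAt_const.eventually_lt (hr x (Or.inr hxB)).continuousAt
      (show 1 < r x by rw [h1]; norm_num)] with y hy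
    exact Real.smoothTransition.one_of_one_le hy.le

end EulerCharacteristic
end

/-! ### The twisted de Rham complex as a complex of fine sheaves. -/

noncomputable section
section TwistedComplex

variable {EM : Type*} [NormedAddCommGroup EM] [NormedSpace ℝ EM] [FiniteDimensional ℝ EM]
  {H : Type*} [TopologicalSpace H] {I : ModelWithCorners ℝ EM H} [I.Boundaryless]
  {M : Type*} [TopologicalSpace M] [ChartedSpace H M] [IsManifold I ∞ M]
  {F : Type*} [NormedAddCommGroup F] [NormedSpace ℝ F] [FiniteDimensional ℝ F]
  {V : M → Type*} [TopologicalSpace (TotalSpace F V)]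
  [∀ x, AddCommGroup (V x)] [∀ x, Module ℝ (V x)] [∀ x, TopologicalSpace (V x)]
  [∀ x, IsTopologicalAddGroup (V x)] [∀ x, ContinuousSMul ℝ (V x)]
  [FiberBundle F V] [VectorBundle ℝ F V]
  {D : CovariantDerivative I F V} {n : ℕ}

variable (I F V) in
/-- The sheaf of sections of `V`. -/
def secSheaf : FineSheaf I M where
  X := V
  smooth s x := SmoothAt I F s x
  smooth_congr h e := h.congr e
  smooth_zero _ := SmoothAt.zero
  smooth_add h h' := h.add h'
  smooth_mul h h' := SmoothAt.smul h h'

variable (I F V) in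
/-- The sheaf of one-forms with values in `V`. -/
def formSheaf : FineSheaf I M where
  X x := TangentSpace I x →L[ℝ] V x
  smooth ξ x := FormSmoothAt I F ξ x
  smooth_congr h e := SmoothAt.congr h e
  smooth_zero _ := SmoothAt.zero
  smooth_add h h' := SmoothAt.add h h'
  smooth_mul h h' := SmoothAt.smul h h'

/-- A map is bilinear and alternating. -/
def IsAlt {T W : Type*} [AddCommGroup T] [Module ℝ T] [AddCommGroup W] [Module ℝ W]
    (w : T → T → W) : Prop :=
  ∃ B : T →ₗ[ℝ] T →ₗ[ℝ] W, (∀ u, B u u = 0) ∧ ∀ u v, w u v = B u v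

variable (I F V) in
/-- The sheaf of two-forms with values in `V`. -/
def twoSheaf : FineSheaf I M where
  X x := TangentSpace I x → TangentSpace I x → V x
  smooth w x := IsAlt (w x) ∧ ∀ q, x ∈ (chartAt H q).source → ∀ u v,
    SmoothAt I F (fun y ↦ w y (coordField I q u y) (coordField I q v y)) x
  smooth_congr h e := ⟨by rw [e.self_of_nhds]; exact h.1, fun q hq u v ↦
    (h.2 q hq u v).congr (e.mono fun y hy ↦ by rw [hy])⟩
  smooth_zero _ := ⟨⟨0, fun _ ↦ rfl, fun _ _ ↦ rfl⟩, fun _ _ _ _ ↦ SmoothAt.zero⟩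
  smooth_add := by
    rintro s t x ⟨⟨B, hB, hs⟩, h⟩ ⟨⟨B', hB', ht⟩, h'⟩
    refine ⟨⟨B + B', fun u ↦ ?_, fun u v ↦ ?_⟩, fun q hq u v ↦ (h q hq u v).add (h' q hq u v)⟩
    · rw [LinearMap.add_apply, LinearMap.add_apply, hB, hB', add_zero]
    · rw [LinearMap.add_apply, LinearMap.add_apply, ← hs, ← ht]
      rfl
  smooth_mul := by
    rintro f s x hf ⟨⟨B, hB, hs⟩, h⟩
    refine ⟨⟨f x • B, fun u ↦ ?_, fun u v ↦ ?_⟩, fun q hq u v ↦ SmoothAt.smul hf (h q hq u v)⟩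
    · rw [LinearMap.smul_apply, LinearMap.smul_apply, hB, smul_zero]
    · rw [LinearMap.smul_apply, LinearMap.smul_apply, ← hs]
      rfl

/-- The covariant derivative of sections as an operator between sheaves. -/
def derivOp (hfr : HasFlatFrames D n) : SheafOp (secSheaf I F V) (formSheaf I F V) where
  toFun s x := D s x
  map_add hs ht := D.isCovariantDerivativeOnUniv.add (SmoothAt.mdiff hs) (SmoothAt.mdiff ht)
  map_smul c _ _ hs := D.isCovariantDerivativeOnUniv.smul_const c (SmoothAt.mdiff hs)
  map_congr hs h := D.congr_of_eventuallyEq (SmoothAt.mdiff hs) h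
  smooth_map hs := hfr.formSmoothAt_deriv hs

variable (D) in
/-- The exterior derivative of a one-form as a pointwise two-form. -/
def extTwo (ξ : Π x : M, TangentSpace I x →L[ℝ] V x) (x : M) (u v : TangentSpace I x) : V x :=
  extD D ξ (coordField I x (mfderiv I 𝓘(ℝ, EM) (extChartAt I x) x u))
    (coordField I x (mfderiv I 𝓘(ℝ, EM) (extChartAt I x) x v)) x

/-- By tensoriality the coordinate extensions used to define `extTwo` may be replaced by any smooth
extensions. -/
lemma extTwo_apply {ξ : Π x : M, TangentSpace I x →L[ℝ] V x} {x : M} (hξ : FormSmoothAt I F ξ x)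
    {X Y : Π x : M, TangentSpace I x} (hX : SmoothAt I EM X x) (hY : SmoothAt I EM Y x) :
    extTwo D ξ x (X x) (Y x) = extD D ξ X Y x :=
  extD_pointwise hξ (contMDiffAt_coordField (mem_chart_source H x) _) hX
    (contMDiffAt_coordField (mem_chart_source H x) _) hY
    (coordField_mfderiv (mem_chart_source H x) _) (coordField_mfderiv (mem_chart_source H x) _)

/-- In a parallel frame and a chart it is the antisymmetrised derivative of the coefficient matrix.
-/
lemma isAlt_extTwo (hfr : HasFlatFrames D n) {ξ : Π x : M, TangentSpace I x →L[ℝ] V x} {x : M}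
    (hξ : FormSmoothAt I F ξ x) : IsAlt (extTwo D ξ x) := by
  obtain ⟨U, e, hx, he⟩ := hfr x
  let L : TangentSpace I x →ₗ[ℝ] EM := (mfderiv I 𝓘(ℝ, EM) (extChartAt I x) x).toLinearMap
  let A : EM →ₗ[ℝ] EM →ₗ[ℝ] (Fin n → ℝ) := ContinuousLinearMap.toLinearMap₁₂
    (fderiv ℝ (formCoef I e x ξ ∘ (extChartAt I x).symm) (extChartAt I x x))
  let S : (Fin n → ℝ) →ₗ[ℝ] V x := frameSum fun i ↦ e i x
  refine ⟨((A - A.flip).compr₂ S).compl₁₂ L L, fun u ↦ ?_, fun u v ↦ ?_⟩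
  · show S (A (L u) (L u) - A (L u) (L u)) = 0
    rw [sub_self, map_zero]
  · exact he.extD_coordField hx (mem_chart_source H x) hξ _ _

lemma smoothAt_extD (hfr : HasFlatFrames D n) {ξ : Π x : M, TangentSpace I x →L[ℝ] V x} {x q : M}
    (hξ : ∀ᶠ y in 𝓝 x, FormSmoothAt I F ξ y) (hq : x ∈ (chartAt H q).source) (u v : EM) :
    SmoothAt I F (extD D ξ (coordField I q u) (coordField I q v)) x := by
  obtain ⟨U, e, hx, he⟩ := hfr x
  have hqn := (chartAt H q).open_source.mem_nhds hq
  have h1 : ∀ u : EM, ∀ᶠ y in 𝓝 x, SmoothAt I F (fun y ↦ ξ y (coordField I q u y)) y := by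
    intro u
    filter_upwards [hξ, hqn] with y hy hyq using hy.apply (contMDiffAt_coordField hyq u)
  have h2 := (he.smoothAt_deriv_apply hx (h1 v) (contMDiffAt_coordField hq u)).sub
    (he.smoothAt_deriv_apply hx (h1 u) (contMDiffAt_coordField hq v))
  refine h2.congr ?_
  filter_upwards [hqn] with y hy
  unfold extD
  rw [mlieBracket_coordField hy, map_zero, sub_zero]

/-- The exterior covariant derivative of one-forms as an operator between sheaves. -/
def extOp (hfr : HasFlatFrames D n) : SheafOp (formSheaf I F V) (twoSheaf I F V) where
  toFun ξ x := extTwo D ξ x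
  map_add {ξ η x} hξ hη := funext fun u ↦ funext fun v ↦
    extD_add hξ hη (contMDiffAt_coordField (mem_chart_source H x) _)
      (contMDiffAt_coordField (mem_chart_source H x) _)
  map_smul c {ξ x} hξ := funext fun u ↦ funext fun v ↦
    extD_smul c hξ (contMDiffAt_coordField (mem_chart_source H x) _)
      (contMDiffAt_coordField (mem_chart_source H x) _)
  map_congr {ξ η x} hξ h := funext fun u ↦ funext fun v ↦
    extD_congr hξ h (contMDiffAt_coordField (mem_chart_source H x) _)
      (contMDiffAt_coordField (mem_chart_source H x) _)
  smooth_map {ξ x} hξ := by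
    refine ⟨isAlt_extTwo hfr hξ.self_of_nhds, fun q hq u v ↦
      (smoothAt_extD hfr hξ hq u v).congr ?_⟩
    filter_upwards [hξ, (chartAt H q).open_source.mem_nhds hq] with y hy hyq
    exact extTwo_apply hy (contMDiffAt_coordField hyq u) (contMDiffAt_coordField hyq v)

lemma isComplex_twisted (hfr : HasFlatFrames D n) :
    SheafOp.IsComplex (derivOp hfr) (extOp hfr) := fun _ x hs ↦
  funext fun _ ↦ funext fun _ ↦ hfr.extD_deriv hs (contMDiffAt_coordField (mem_chart_source H x) _)
    (contMDiffAt_coordField (mem_chart_source H x) _)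

/-- The twisted cohomology as the global cohomology of the complex of sheaves. -/
theorem nonempty_twistedH1_equiv_coh [T2Space M] (hfr : HasFlatFrames D n) :
    Nonempty (TwistedH1 D ≃ₗ[ℝ] SheafOp.coh (derivOp hfr) (extOp hfr) univ) := by
  let f₀ : closedForms D →ₗ[ℝ] (extOp hfr).ker univ :=
    { toFun := fun ξ ↦ ⟨fun x ↦ ξ.1 x, fun x _ ↦ ⟨OneForm.formSmoothAt ξ.1 x,
        funext fun u ↦ funext fun v ↦ mem_closedForms_iff.1 ξ.2 _ _ x
          (contMDiffAt_coordField (mem_chart_source H x) _)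
          (contMDiffAt_coordField (mem_chart_source H x) _)⟩⟩
      map_add' := fun _ _ ↦ rfl
      map_smul' := fun _ _ ↦ rfl }
  let f : closedForms D →ₗ[ℝ] SheafOp.coh (derivOp hfr) (extOp hfr) univ :=
    (Submodule.mkQ _).comp f₀
  have hf : Function.Surjective f := by
    rintro ⟨⟨ξ, hξ⟩⟩
    have hs : ∀ x, FormSmoothAt I F ξ x := fun x ↦ (hξ x (mem_univ x)).1
    refine ⟨⟨⟨ξ, hs⟩, mem_closedForms_iff.2 fun X Y x hX hY ↦ ?_⟩, rfl⟩
    refine (extTwo_apply (hs x) hX hY).symm.trans ?_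
    have h : extTwo D ξ x = 0 := (hξ x (mem_univ x)).2
    rw [h]
    rfl
  have hk : LinearMap.ker f = (exactForms D).submoduleOf (closedForms D) := by
    ext ξ
    rw [LinearMap.mem_ker]
    have h1 : f ξ = 0 ↔ (fun x ↦ ξ.1 x) ∈ (derivOp hfr).im univ := SheafOp.cls_eq_zero
    refine h1.trans ?_
    show _ ↔ ξ.1 ∈ exactForms D
    constructor
    · rintro ⟨v, hv⟩
      exact ⟨⟨v, fun x ↦ (hv x (mem_univ x)).1⟩, fun x ↦ (hv x (mem_univ x)).2⟩
    · rintro ⟨v, hv⟩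
      exact ⟨v, fun x _ ↦ ⟨v.smoothAt x, hv x⟩⟩
  exact ⟨(Submodule.quotEquivOfEq _ _ hk.symm).trans (f.quotKerEquivOfSurjective hf)⟩

end TwistedComplex
end

/-! ### Integrals depending smoothly on a parameter. -/

noncomputable section
section ParametricIntegral

variable {E : Type} [NormedAddCommGroup E] [NormedSpace ℝ E] [FiniteDimensional ℝ E]

/-- Differentiation under the integral sign. -/
lemma hasFDerivAt_integral_of_contDiffAt {G : Type} [NormedAddCommGroup G] [NormedSpace ℝ G]
    [CompleteSpace G] {f : ℝ × E → G} {Ω : Set E} (hΩ : IsOpen Ω)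
    (hf : ∀ t ∈ Icc (0 : ℝ) 1, ∀ z ∈ Ω, ContDiffAt ℝ ∞ f (t, z)) {z : E} (hz : z ∈ Ω) :
    HasFDerivAt (fun z ↦ ∫ t in (0 : ℝ)..1, f (t, z))
      (∫ t in (0 : ℝ)..1, (fderiv ℝ f (t, z)).comp (.inr ℝ ℝ E)) z := by
  have hI : uIoc (0 : ℝ) 1 ⊆ Icc 0 1 := by
    rw [uIoc_of_le zero_le_one]; exact Ioc_subset_Icc_self
  obtain ⟨r, hr, hb⟩ := Metric.nhds_basis_closedBall.mem_iff.1 (hΩ.mem_nhds hz)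
  have hg : ∀ t ∈ Icc (0 : ℝ) 1, ∀ z ∈ Ω, ContDiffAt ℝ ∞
      (fun p : ℝ × E ↦ (fderiv ℝ f p).comp (.inr ℝ ℝ E)) (t, z) := fun t ht z hz ↦
    ((hf t ht z hz).fderiv_right (m := ∞) (by simp)).clm_comp contDiffAt_const
  have hcont : ∀ {G' : Type} [NormedAddCommGroup G'] [NormedSpace ℝ G'] {g : ℝ × E → G'},
      (∀ t ∈ Icc (0 : ℝ) 1, ∀ z ∈ Ω, ContDiffAt ℝ ∞ g (t, z)) → ∀ z ∈ Ω,
      ContinuousOn (fun t ↦ g (t, z)) (Icc 0 1) := fun hg z hz t ht ↦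
    ((hg t ht z hz).continuousAt.comp (f := fun t : ℝ ↦ (t, z))
      (by fun_prop)).continuousWithinAt
  -- Compactness of the interval times a closed ball yields a constant dominating function.
  obtain ⟨C, hC⟩ := ((isCompact_Icc (a := (0 : ℝ)) (b := 1)).prod
    (isCompact_closedBall z r)).exists_bound_of_continuousOn
    (f := fun p : ℝ × E ↦ (fderiv ℝ f p).comp (.inr ℝ ℝ E)) fun p hp ↦
      (hg p.1 hp.1 p.2 (hb hp.2)).continuousAt.continuousWithinAt
  have hm : ∀ {G' : Type} [NormedAddCommGroup G'] [NormedSpace ℝ G'] {g : ℝ → G'},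
      ContinuousOn g (Icc 0 1) → MeasureTheory.AEStronglyMeasurable g
        (MeasureTheory.volume.restrict (uIoc (0 : ℝ) 1)) := fun h ↦
    (h.mono hI).aestronglyMeasurable measurableSet_uIoc
  refine intervalIntegral.hasFDerivAt_integral_of_dominated_of_fderiv_le
    (F := fun z t ↦ f (t, z)) (F' := fun z t ↦ (fderiv ℝ f (t, z)).comp (.inr ℝ ℝ E))
    (bound := fun _ ↦ C) (Metric.closedBall_mem_nhds z hr) ?_ ?_ ?_ ?_ ?_ ?_
  · filter_upwards [hΩ.mem_nhds hz] with y hy using hm (hcont hf y hy)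
  · exact ContinuousOn.intervalIntegrable (by rw [uIcc_of_le zero_le_one]; exact hcont hf z hz)
  · exact hm (hcont hg z hz)
  · exact Filter.Eventually.of_forall fun t ht y hy ↦ hC (t, y) ⟨hI ht, hy⟩
  · exact intervalIntegrable_const
  · refine Filter.Eventually.of_forall fun t ht y hy ↦ ?_
    have h1 := ((hf t (hI ht) y (hb hy)).differentiableAt (by simp)).hasFDerivAt
    exact h1.comp y (hasFDerivAt_prodMk_right t y)

/-- Smoothness of integrals depending on a parameter. -/
theorem contDiffOn_integral {G : Type} [NormedAddCommGroup G] [NormedSpace ℝ G]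
    [CompleteSpace G] {f : ℝ × E → G} {Ω : Set E} (hΩ : IsOpen Ω)
    (hf : ∀ t ∈ Icc (0 : ℝ) 1, ∀ z ∈ Ω, ContDiffAt ℝ ∞ f (t, z)) :
    ContDiffOn ℝ ∞ (fun z ↦ ∫ t in (0 : ℝ)..1, f (t, z)) Ω := by
  rw [contDiffOn_infty]
  intro n
  -- The derivative of the integral is again such an integral, with values in a space of operators.
  induction n generalizing G with
  | zero =>
    rw [Nat.cast_zero, contDiffOn_zero]
    exact fun z hz ↦ (hasFDerivAt_integral_of_contDiffAt hΩ hf hz).continuousAt.continuousWithinAt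
  | succ n ih =>
    rw [Nat.cast_succ, contDiffOn_succ_iff_fderiv_of_isOpen hΩ]
    refine ⟨fun z hz ↦
      (hasFDerivAt_integral_of_contDiffAt hΩ hf hz).differentiableAt.differentiableWithinAt,
      fun h ↦ by simp at h, ?_⟩
    refine (ih (f := fun p : ℝ × E ↦ (fderiv ℝ f p).comp (.inr ℝ ℝ E)) fun t ht z hz ↦
      ((hf t ht z hz).fderiv_right (m := ∞) (by simp)).clm_comp contDiffAt_const).congr
      fun z hz ↦ (hasFDerivAt_integral_of_contDiffAt hΩ hf hz).fderiv

end ParametricIntegral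

/-! ### The Poincaré lemma for two-forms in the plane. -/

section PoincareTwo

/-- Functions on a convex open subset of the plane are exterior derivatives of one-forms. -/
theorem exists_curl_eq {G : Type} [NormedAddCommGroup G] [NormedSpace ℝ G] [CompleteSpace G]
    {Ω : Set ℂ} (hΩ : IsOpen Ω) (hc : Convex ℝ Ω) {c : ℂ → G} (hs : ContDiffOn ℝ ∞ c Ω) :
    ∃ α : ℂ → ℂ →L[ℝ] G, ContDiffOn ℝ ∞ α Ω ∧ ∀ z ∈ Ω,
      fderiv ℝ α z 1 Complex.I - fderiv ℝ α z Complex.I 1 = c z := by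
  rcases Ω.eq_empty_or_nonempty with rfl | ⟨p, hp⟩
  · exact ⟨0, contDiff_const.contDiffOn, by simp⟩
  -- The radial homotopy formula: a weight `t`, integrated along the segment from the base point
  -- `p`.
  let f : ℝ × ℂ → G := fun q ↦ q.1 • c (p + q.1 • (q.2 - p))
  have hmem : ∀ t ∈ Icc (0 : ℝ) 1, ∀ z ∈ Ω, p + t • (z - p) ∈ Ω := fun t ht z hz ↦
    hc.add_smul_sub_mem hp hz ht
  have hcs : ∀ t ∈ Icc (0 : ℝ) 1, ∀ z ∈ Ω, ContDiffAt ℝ ∞ c (p + t • (z - p)) := fun t ht z hz ↦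
    hs.contDiffAt (hΩ.mem_nhds (hmem t ht z hz))
  have hf : ∀ t ∈ Icc (0 : ℝ) 1, ∀ z ∈ Ω, ContDiffAt ℝ ∞ f (t, z) := by
    intro t ht z hz
    refine contDiffAt_fst.smul (ContDiffAt.comp (t, z) (f := fun q : ℝ × ℂ ↦ p + q.1 • (q.2 - p))
      (hcs t ht z hz) (ContDiff.contDiffAt (by fun_prop)))
  let g : ℂ → G := fun z ↦ ∫ t in (0 : ℝ)..1, f (t, z)
  have hg : ContDiffOn ℝ ∞ g Ω := contDiffOn_integral hΩ hf
  -- The integrand on the left is the derivative in `t` of `t² c(p + t(z - p))`, whose values at the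
  -- ends are `0` and `c z`.
  have hgd : ∀ z ∈ Ω, (2 : ℝ) • g z + fderiv ℝ g z (z - p) = c z := by
    intro z hz
    have h1 := hasFDerivAt_integral_of_contDiffAt hΩ hf hz
    have hcg : ContinuousOn (fun t : ℝ ↦ (fderiv ℝ f (t, z)).comp (.inr ℝ ℝ ℂ)) (Icc 0 1) :=
      fun t ht ↦ (ContinuousAt.comp (f := fun t : ℝ ↦ (t, z))
        (((hf t ht z hz).fderiv_right (m := ∞) (by simp)).clm_comp contDiffAt_const).continuousAt
        (by fun_prop)).continuousWithinAt
    have hcf : ContinuousOn (fun t : ℝ ↦ f (t, z)) (Icc 0 1) := fun t ht ↦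
      (ContinuousAt.comp (f := fun t : ℝ ↦ (t, z)) (hf t ht z hz).continuousAt
        (by fun_prop)).continuousWithinAt
    rw [← uIcc_of_le (zero_le_one' ℝ)] at hcg hcf
    have hcg' : ContinuousOn (fun t : ℝ ↦ (fderiv ℝ f (t, z)).comp (.inr ℝ ℝ ℂ) (z - p))
      (uIcc 0 1) := hcg.clm_apply continuousOn_const
    have hev := ContinuousLinearMap.intervalIntegral_apply
      (hcg.intervalIntegrable (μ := MeasureTheory.volume)) (z - p)
    rw [h1.fderiv, hev]
    have hsm := intervalIntegral.integral_smul (μ := MeasureTheory.volume) (a := 0) (b := 1)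
      (2 : ℝ) fun t ↦ f (t, z)
    refine (congrArg (· + _) hsm.symm).trans ?_
    have hcf2 : ContinuousOn (fun t ↦ (2 : ℝ) • f (t, z)) (uIcc 0 1) := hcf.const_smul (2 : ℝ)
    rw [← intervalIntegral.integral_add hcf2.intervalIntegrable hcg'.intervalIntegrable]
    have hder : ∀ t ∈ uIcc (0 : ℝ) 1, HasDerivAt (fun t : ℝ ↦ t ^ 2 • c (p + t • (z - p)))
        ((2 : ℝ) • f (t, z) + (fderiv ℝ f (t, z)).comp (.inr ℝ ℝ ℂ) (z - p)) t := by
      intro t ht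
      rw [uIcc_of_le zero_le_one] at ht
      have hct := ((hcs t ht z hz).differentiableAt (by simp)).hasFDerivAt
      have hl : HasDerivAt (fun t : ℝ ↦ p + t • (z - p)) (z - p) t := by
        simpa using ((hasDerivAt_id t).smul_const (z - p)).const_add p
      have h2 := (hasDerivAt_pow 2 t).smul (hct.comp_hasDerivAt t hl)
      have h3 : HasFDerivAt (fun z ↦ f (t, z)) ((fderiv ℝ f (t, z)).comp (.inr ℝ ℝ ℂ)) z :=
        ((hf t ht z hz).differentiableAt (by simp)).hasFDerivAt.comp z
          (hasFDerivAt_prodMk_right t z)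
      have hl' : HasFDerivAt (fun z : ℂ ↦ p + t • (z - p)) (t • ContinuousLinearMap.id ℝ ℂ) z :=
        ((hasFDerivAt_id z).sub_const p).const_smul t |>.const_add p
      have h4 : HasFDerivAt (fun z ↦ f (t, z)) (t • (fderiv ℝ c (p + t • (z - p))).comp
        (t • ContinuousLinearMap.id ℝ ℂ)) z := (hct.comp z hl').const_smul t
      rw [h3.unique h4]
      refine h2.congr_deriv ?_
      show _ = (2 : ℝ) • t • c (p + t • (z - p)) + t • fderiv ℝ c (p + t • (z - p)) (t • (z - p))
      rw [map_smul, smul_smul, smul_smul, add_comm]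
      simp [sq]
    rw [intervalIntegral.integral_eq_sub_of_hasDerivAt hder
      (hcf2.add hcg').intervalIntegrable]
    simp
  -- The form `x dy - y dx` centred at `p`. Its exterior derivative is twice the area form, so `g β`
  -- has exterior derivative `2 g + Dg (z - p)` times the area form.
  let β : ℂ → ℂ →L[ℝ] ℝ := fun z ↦ (z - p).re • Complex.imCLM - (z - p).im • Complex.reCLM
  have hβ : ∀ z, HasFDerivAt β (Complex.reCLM.smulRight Complex.imCLM -
      Complex.imCLM.smulRight Complex.reCLM) z := by
    intro z
    have h1 : HasFDerivAt (fun z : ℂ ↦ (z - p).re) Complex.reCLM z :=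
      Complex.reCLM.hasFDerivAt.comp z ((hasFDerivAt_id z).sub_const p)
    have h2 : HasFDerivAt (fun z : ℂ ↦ (z - p).im) Complex.imCLM z :=
      Complex.imCLM.hasFDerivAt.comp z ((hasFDerivAt_id z).sub_const p)
    exact HasFDerivAt.sub (h1.smul_const (Complex.imCLM : ℂ →L[ℝ] ℝ))
      (h2.smul_const (Complex.reCLM : ℂ →L[ℝ] ℝ))
  have hβs : ContDiff ℝ ∞ β := by
    have h1 : ContDiff ℝ ∞ fun z : ℂ ↦ (z - p).re :=
      Complex.reCLM.contDiff.comp (contDiff_id.sub contDiff_const)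
    have h2 : ContDiff ℝ ∞ fun z : ℂ ↦ (z - p).im :=
      Complex.imCLM.contDiff.comp (contDiff_id.sub contDiff_const)
    exact (h1.smul contDiff_const).sub (h2.smul contDiff_const)
  refine ⟨fun z ↦ (β z).smulRight (g z), hβs.contDiffOn.smulRight hg, fun z hz ↦ ?_⟩
  have hgz := ((hg.contDiffAt (hΩ.mem_nhds hz)).differentiableAt (by simp)).hasFDerivAt
  have key : ∀ u v, fderiv ℝ (fun z ↦ (β z).smulRight (g z)) z u v =
      (u.re * v.im - u.im * v.re) • g z + β z v • fderiv ℝ g z u := by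
    intro u v
    have h2 : HasFDerivAt (fun z ↦ β z v • g z) (β z v • fderiv ℝ g z +
        ((((ContinuousLinearMap.apply ℝ ℝ v).comp (Complex.reCLM.smulRight Complex.imCLM -
      Complex.imCLM.smulRight Complex.reCLM)).smulRight (g z)))) z :=
      HasFDerivAt.smul ((ContinuousLinearMap.apply ℝ ℝ v).hasFDerivAt.comp z (hβ z)) hgz
    have h3 : HasFDerivAt (fun z ↦ (β z).smulRight (g z) v)
        ((ContinuousLinearMap.apply ℝ G v).comp (fderiv ℝ (fun z ↦ (β z).smulRight (g z)) z)) z :=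
      (ContinuousLinearMap.apply ℝ G v).hasFDerivAt.comp z
        (((hβs.contDiffOn.smulRight hg).contDiffAt (hΩ.mem_nhds hz)).differentiableAt
          (by simp)).hasFDerivAt
    have h4 := congrArg (fun L : ℂ →L[ℝ] G ↦ L u) (h3.unique h2)
    refine h4.trans ?_
    simp [add_comm]
  rw [key, key, ← hgd z hz]
  have hzp : z - p = (z - p).re • (1 : ℂ) + (z - p).im • Complex.I := by
    simpa using (Complex.re_add_im (z - p)).symm
  conv_rhs => rw [hzp, map_add, map_smul, map_smul]
  simp only [β, Complex.one_re, Complex.one_im, Complex.I_re, Complex.I_im, sub_apply, smul_apply,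
    Complex.reCLM_apply, Complex.imCLM_apply, smul_eq_mul]
  module

end PoincareTwo
end

/-! ### Cohomology over small convex sets of a surface. -/

noncomputable section
section NiceCohomology

variable {S : Type*} [TopologicalSpace S] [ChartedSpace ℂ S] [IsManifold 𝓘(ℝ, ℂ) ∞ S]
  {F : Type*} [NormedAddCommGroup F] [NormedSpace ℝ F] [FiniteDimensional ℝ F]
  {V : S → Type*} [TopologicalSpace (TotalSpace F V)]
  [∀ x, AddCommGroup (V x)] [∀ x, Module ℝ (V x)] [∀ x, TopologicalSpace (V x)]
  [∀ x, IsTopologicalAddGroup (V x)] [∀ x, ContinuousSMul ℝ (V x)]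
  [FiberBundle F V] [VectorBundle ℝ F V]
  {D : CovariantDerivative 𝓘(ℝ, ℂ) F V} {n : ℕ}

/-- Two-forms on a surface are determined by one coefficient. -/
lemma IsAlt.apply_eq {W : Type*} [AddCommGroup W] [Module ℝ W] {q y : S}
    {w : TangentSpace 𝓘(ℝ, ℂ) y → TangentSpace 𝓘(ℝ, ℂ) y → W} (hw : IsAlt w) (a b : ℂ) :
    w (coordField 𝓘(ℝ, ℂ) q a y) (coordField 𝓘(ℝ, ℂ) q b y) = (a.re * b.im - a.im * b.re) •
      w (coordField 𝓘(ℝ, ℂ) q 1 y) (coordField 𝓘(ℝ, ℂ) q Complex.I y) := by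
  obtain ⟨B, hB, hw⟩ := hw
  have hd : ∀ a : ℂ, coordField 𝓘(ℝ, ℂ) q a y = a.re • coordField 𝓘(ℝ, ℂ) q 1 y +
      a.im • coordField 𝓘(ℝ, ℂ) q Complex.I y := by
    intro a
    rw [← coordField_smul, ← coordField_smul, ← coordField_add]
    congr 1
    simp
  have hs : B (coordField 𝓘(ℝ, ℂ) q Complex.I y) (coordField 𝓘(ℝ, ℂ) q 1 y) =
      - B (coordField 𝓘(ℝ, ℂ) q 1 y) (coordField 𝓘(ℝ, ℂ) q Complex.I y) := by
    have h := hB (coordField 𝓘(ℝ, ℂ) q 1 y + coordField 𝓘(ℝ, ℂ) q Complex.I y)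
    simp only [map_add, LinearMap.add_apply, hB, zero_add, add_zero] at h
    exact eq_neg_of_add_eq_zero_left h
  rw [hw, hw, hd a, hd b]
  simp only [map_add, LinearMap.add_apply, map_smul, LinearMap.smul_apply, hB, hs]
  module

lemma IsAlt.ext_coordField {W : Type*} [AddCommGroup W] [Module ℝ W] {q y : S}
    (hy : y ∈ (chartAt ℂ q).source)
    {w w' : TangentSpace 𝓘(ℝ, ℂ) y → TangentSpace 𝓘(ℝ, ℂ) y → W} (hw : IsAlt w) (hw' : IsAlt w')
    (h : w (coordField 𝓘(ℝ, ℂ) q 1 y) (coordField 𝓘(ℝ, ℂ) q Complex.I y) =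
      w' (coordField 𝓘(ℝ, ℂ) q 1 y) (coordField 𝓘(ℝ, ℂ) q Complex.I y)) : w = w' := by
  funext u v
  have key : ∀ a b : ℂ, w (coordField 𝓘(ℝ, ℂ) q a y) (coordField 𝓘(ℝ, ℂ) q b y) =
      w' (coordField 𝓘(ℝ, ℂ) q a y) (coordField 𝓘(ℝ, ℂ) q b y) := fun a b ↦ by
    rw [hw.apply_eq, hw'.apply_eq, h]
  have h1 := key (mfderiv 𝓘(ℝ, ℂ) 𝓘(ℝ, ℂ) (extChartAt 𝓘(ℝ, ℂ) q) y u)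
    (mfderiv 𝓘(ℝ, ℂ) 𝓘(ℝ, ℂ) (extChartAt 𝓘(ℝ, ℂ) q) y v)
  rwa [coordField_mfderiv hy u, coordField_mfderiv hy v] at h1

open SheafOp

/-- The one-form with given coefficients in a frame and a chart. -/
def frameForm {ι : Type*} [Fintype ι] (e : ι → Π x : S, V x) (q : S) (α : ℂ → ℂ →L[ℝ] (ι → ℝ))
    (y : S) : TangentSpace 𝓘(ℝ, ℂ) y →L[ℝ] V y :=
  (LinearMap.toContinuousLinearMap (E := ι → ℝ) (frameSum fun i ↦ e i y)).comp
    ((α (extChartAt 𝓘(ℝ, ℂ) q y)).comp (mfderiv 𝓘(ℝ, ℂ) 𝓘(ℝ, ℂ) (extChartAt 𝓘(ℝ, ℂ) q) y))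

section

variable {ι : Type} [Fintype ι] {e : ι → Π x : S, V x} {q : S} {U : Set S}

lemma frameForm_coordField {α : ℂ → ℂ →L[ℝ] (ι → ℝ)} {y : S} (hy : y ∈ (chartAt ℂ q).source)
    (u : ℂ) : frameForm e q α y (coordField 𝓘(ℝ, ℂ) q u y) =
      frameSum (fun i ↦ e i y) (α (extChartAt 𝓘(ℝ, ℂ) q y) u) :=
  congrArg (fun v ↦ frameSum (fun i ↦ e i y) (α (extChartAt 𝓘(ℝ, ℂ) q y) v))
    (mfderiv_extChartAt_coordField hy u)

lemma SmoothFrame.formSmoothAt_frameForm (h : SmoothFrame 𝓘(ℝ, ℂ) F e U)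
    {α : ℂ → ℂ →L[ℝ] (ι → ℝ)} {y : S} (hy : y ∈ U) (hq : y ∈ (chartAt ℂ q).source)
    (hα : ContDiffAt ℝ ∞ α (extChartAt 𝓘(ℝ, ℂ) q y)) :
    FormSmoothAt 𝓘(ℝ, ℂ) F (frameForm e q α) y := by
  refine formSmoothAt_of_coordField hq fun u ↦ ?_
  have h1 : ContDiffAt ℝ ∞ (fun z ↦ α z u) (extChartAt 𝓘(ℝ, ℂ) q y) :=
    hα.clm_apply contDiffAt_const
  refine (h.smoothAt_sum hy (contMDiffAt_comp_extChartAt hq h1)).congr ?_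
  filter_upwards [(chartAt ℂ q).open_source.mem_nhds hq] with z hz using frameForm_coordField hz u

lemma FlatFrame.extTwo_frameForm (h : FlatFrame D e U)
    {α : ℂ → ℂ →L[ℝ] (ι → ℝ)} {y : S} (hy : y ∈ U) (hq : y ∈ (chartAt ℂ q).source)
    (hα : ContDiffAt ℝ ∞ α (extChartAt 𝓘(ℝ, ℂ) q y)) (u v : ℂ) :
    extTwo D (frameForm e q α) y (coordField 𝓘(ℝ, ℂ) q u y) (coordField 𝓘(ℝ, ℂ) q v y) =
      frameSum (fun i ↦ e i y) (fderiv ℝ α (extChartAt 𝓘(ℝ, ℂ) q y) u v -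
        fderiv ℝ α (extChartAt 𝓘(ℝ, ℂ) q y) v u) := by
  have hs := h.formSmoothAt_frameForm hy hq hα
  rw [extTwo_apply hs (contMDiffAt_coordField hq u) (contMDiffAt_coordField hq v),
    h.extD_coordField hy hq hs]
  have e1 : formCoef 𝓘(ℝ, ℂ) e q (frameForm e q α) ∘ (extChartAt 𝓘(ℝ, ℂ) q).symm
      =ᶠ[𝓝 (extChartAt 𝓘(ℝ, ℂ) q y)] α := by
    have hy' : y ∈ (extChartAt 𝓘(ℝ, ℂ) q).source := by rwa [extChartAt_source]
    have hc := (continuousAt_extChartAt_symm' (I := 𝓘(ℝ, ℂ)) hy')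
    have hU : U ∈ 𝓝 ((extChartAt 𝓘(ℝ, ℂ) q).symm (extChartAt 𝓘(ℝ, ℂ) q y)) := by
      rw [(extChartAt 𝓘(ℝ, ℂ) q).left_inv hy']
      exact h.isOpen.mem_nhds hy
    filter_upwards [hc.preimage_mem_nhds hU, (isOpen_extChartAt_target q).mem_nhds
      ((extChartAt 𝓘(ℝ, ℂ) q).map_source hy')] with z hz hzt
    have hzs := (extChartAt 𝓘(ℝ, ℂ) q).map_target hzt
    rw [extChartAt_source] at hzs
    refine ContinuousLinearMap.ext fun u ↦ ?_
    show frameCoef _ (frameForm e q α _ _) = α z u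
    rw [frameForm_coordField hzs, frameCoef_frameSum (h.bij _ hz),
      (extChartAt 𝓘(ℝ, ℂ) q).right_inv hzt]
  rw [e1.fderiv_eq]

/-- Two-forms on a nice open subset of a surface are exact. -/
theorem IsNice.exists_extTwo_eq (h : IsNice D e q U)
    {w : Π x : S, TangentSpace 𝓘(ℝ, ℂ) x → TangentSpace 𝓘(ℝ, ℂ) x → V x}
    (hfr : HasFlatFrames D n) (hw : ∀ y ∈ U, (twoSheaf 𝓘(ℝ, ℂ) F V).smooth w y) :
    ∃ ξ : Π x : S, TangentSpace 𝓘(ℝ, ℂ) x →L[ℝ] V x, ∀ y ∈ U, FormSmoothAt 𝓘(ℝ, ℂ) F ξ y ∧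
      w y = extTwo D ξ y := by
  let φ := extChartAt 𝓘(ℝ, ℂ) q
  let c : S → ι → ℝ := fun y ↦ frameCoef (fun i ↦ e i y)
    (w y (coordField 𝓘(ℝ, ℂ) q 1 y) (coordField 𝓘(ℝ, ℂ) q Complex.I y))
  have ho : IsOpen (φ '' U) := isOpen_extChartAt_image h.isOpen h.subset
  have hc : ContDiffOn ℝ ∞ (c ∘ φ.symm) (φ '' U) := by
    rintro _ ⟨y, hy, rfl⟩
    exact (contDiffAt_comp_extChartAt_symm (h.subset hy)
      (h.contMDiffAt_coef hy ((hw y hy).2 q (h.subset hy) _ _))).contDiffWithinAt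
  obtain ⟨α, hα, hαc⟩ := exists_curl_eq ho h.convex hc
  have hαy : ∀ y ∈ U, ContDiffAt ℝ ∞ α (φ y) := fun y hy ↦
    hα.contDiffAt (ho.mem_nhds (mem_image_of_mem φ hy))
  refine ⟨frameForm e q α, fun y hy ↦ ?_⟩
  have hs := h.formSmoothAt_frameForm hy (h.subset hy) (hαy y hy)
  refine ⟨hs, (hw y hy).1.ext_coordField (h.subset hy) (isAlt_extTwo hfr hs) ?_⟩
  rw [h.extTwo_frameForm hy (h.subset hy) (hαy y hy), hαc _ (mem_image_of_mem φ hy)]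
  show _ = frameSum (fun i ↦ e i y) (c (φ.symm (φ y)))
  rw [φ.left_inv (by simpa only [φ, extChartAt_source] using h.subset hy),
    frameSum_frameCoef (h.bij y hy)]

end

variable {e : Fin n → Π x : S, V x} {q : S} {U : Set S}

/-- The cohomology of a flat bundle over a nice open subset of a surface. -/
theorem IsNice.hasEuler {m : ℕ} (hfr : HasFlatFrames D m) (h : IsNice D e q U) (hU : U.Nonempty) :
    HasEuler (derivOp hfr) (extOp hfr) U n := by
  have h1 : Subsingleton (coh (derivOp hfr) (extOp hfr) U) := by
    refine subsingleton_of_forall_eq 0 ?_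
    rintro ⟨s⟩
    refine cls_eq_zero.2 ?_
    obtain ⟨v, hv, hv'⟩ := h.exists_primitive (fun y hy ↦ (s.2 y hy).1) fun y hy u v ↦ by
      refine (extTwo_apply (s.2 y hy).1 (contMDiffAt_coordField (h.subset hy) u)
        (contMDiffAt_coordField (h.subset hy) v)).symm.trans ?_
      have h0 : extTwo D s.1 y = 0 := (s.2 y hy).2
      rw [h0]
      rfl
    exact ⟨v, fun y hy ↦ ⟨hv y hy, (hv' y hy).symm⟩⟩
  have h2 : Subsingleton (coh₂ (extOp hfr) U) := by
    refine subsingleton_of_forall_eq 0 ?_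
    rintro ⟨s⟩
    refine cls_eq_zero.2 ?_
    obtain ⟨ξ, hξ⟩ := h.exists_extTwo_eq hfr fun y hy ↦ (s.2 y hy).1
    exact ⟨ξ, hξ⟩
  let f₀ : (Fin n → ℝ) →ₗ[ℝ] (derivOp hfr).ker U :=
    { toFun := fun a ↦ ⟨fun y ↦ frameSum (fun i ↦ e i y) a, fun y hy ↦
        ⟨h.smoothAt_sum hy contMDiffAt_const, by
          refine ContinuousLinearMap.ext fun u ↦ ?_
          refine (h.deriv_sum hy mdifferentiableAt_const u).trans ?_
          have : mvfderiv 𝓘(ℝ, ℂ) (fun _ : S ↦ a) y u = 0 := by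
            rw [mvfderiv_const]
            rfl
          exact (congrArg _ this).trans (_root_.map_zero _)⟩⟩
      map_add' := fun a b ↦ Subtype.ext (funext fun y ↦ map_add _ a b)
      map_smul' := fun c a ↦ Subtype.ext (funext fun y ↦ map_smul _ c a) }
  let f : (Fin n → ℝ) →ₗ[ℝ] coh₀ (derivOp hfr) U := (Submodule.mkQ _).comp f₀
  have hf : Function.Bijective f := by
    constructor
    · rw [← LinearMap.ker_eq_bot, LinearMap.ker_eq_bot']
      intro a ha
      obtain ⟨t, ht⟩ := cls_eq_zero.1 ha
      obtain ⟨y, hy⟩ := hU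
      exact (h.bij y hy).1 ((ht y hy).2.trans (_root_.map_zero _).symm)
    · rintro ⟨s⟩
      obtain ⟨a, ha⟩ := h.eq_frameSum (fun y hy ↦ (s.2 y hy).1) fun y hy ↦ (s.2 y hy).2
      refine ⟨a, cls_eq.2 ⟨0, fun y hy ↦ ⟨trivial, ?_⟩⟩⟩
      exact sub_eq_zero.2 (ha y hy).symm
  let E := LinearEquiv.ofBijective f hf
  have e0 : Module.finrank ℝ (coh₀ (derivOp hfr) U) = n :=
    E.finrank_eq.symm.trans (Module.finrank_fin_fun ℝ)
  have e1 : Module.finrank ℝ (coh (derivOp hfr) (extOp hfr) U) = 0 :=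
    Module.finrank_zero_of_subsingleton
  have e2 : Module.finrank ℝ (coh₂ (extOp hfr) U) = 0 := Module.finrank_zero_of_subsingleton
  exact ⟨Module.Finite.equiv E, Module.Finite.of_finite, Module.Finite.of_finite, by
    rw [e0, e1, e2]
    simp⟩

end NiceCohomology
end

/-! ### Good covers from a Euclidean embedding. -/

noncomputable section
section GoodCovers

/-- Small balls of an embedded manifold are convex in charts. -/
theorem exists_convex_norm_sub_lt {E N : Type*} [NormedAddCommGroup E] [NormedSpace ℝ E]
    [FiniteDimensional ℝ E] [NormedAddCommGroup N] [InnerProductSpace ℝ N] {f : E → N} {p : E}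
    (hf : ContDiffAt ℝ ∞ f p) (hi : Function.Injective (fderiv ℝ f p)) {U : Set E} (hU : U ∈ 𝓝 p) :
    ∃ ρ > 0, Metric.ball p ρ ⊆ U ∧ ∀ a ∈ Metric.ball (f p) ρ, ∀ r,
      Convex ℝ {z ∈ Metric.ball p ρ | ‖f z - a‖ < r} := by
  obtain ⟨C, hC0, hC⟩ := (fderiv ℝ f p).exists_antilipschitzWith (LinearMap.ker_eq_bot.2 hi)
  have hC0' : (0 : ℝ) < C := hC0
  -- The factor `2` leaves room: the differential expands by at least `2 c`, so `f` itself still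
  -- expands by `c` near `p`.
  set c : ℝ := 1 / (2 * C) with hcdef
  have hc : 0 < c := by positivity
  have hlow : ∀ v, 2 * c * ‖v‖ ≤ ‖fderiv ℝ f p v‖ := by
    intro v
    have h1 := hC.le_mul_dist v 0
    simp only [map_zero, dist_zero_right] at h1
    have h2 : 2 * c * ‖v‖ = ‖v‖ / C := by rw [hcdef]; field_simp
    rw [h2, div_le_iff₀ hC0', mul_comm]
    exact h1
  have hd : ContDiffAt ℝ ∞ (fderiv ℝ f) p := hf.fderiv_right (m := ∞) (by simp)
  obtain ⟨K, T, hT, hK⟩ := (hd.of_le (m := 1) (by simp)).exists_lipschitzOnWith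
  have hdiff : ∀ᶠ z in 𝓝 p, DifferentiableAt ℝ f z := by
    filter_upwards [(hf.of_le (m := 1) (by simp)).eventually (by simp)] with z hz using
      hz.differentiableAt (by simp)
  have hstr : ∀ᶠ q : E × E in 𝓝 (p, p), ‖f q.1 - f q.2 - fderiv ℝ f p (q.1 - q.2)‖ ≤
      c * ‖q.1 - q.2‖ :=
    ((hf.hasStrictFDerivAt (by simp)).isLittleO.def hc)
  rw [nhds_prod_eq] at hstr
  obtain ⟨T', hT', hT''⟩ := Filter.eventually_prod_self_iff'.1 hstr
  -- Chosen so that `2 ε K ≤ c²`: at distance at most `ε` from `a`, the curvature of the image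
  -- cannot outweigh the growth of the squared distance.
  set ε : ℝ := c ^ 2 / (2 * (K + 1)) with hε
  have hε0 : 0 < ε := by positivity
  have hcont : ∀ᶠ z in 𝓝 p, f z ∈ Metric.ball (f p) (ε / 2) :=
    hf.continuousAt (Metric.ball_mem_nhds _ (by positivity))
  obtain ⟨ρ', hρ', hsub⟩ := Metric.mem_nhds_iff.1
    (Filter.inter_mem hU (Filter.inter_mem hT (Filter.inter_mem hdiff
      (Filter.inter_mem hT' hcont))))
  refine ⟨min ρ' (ε / 2), by positivity, fun z hz ↦
    (hsub (Metric.ball_subset_ball (min_le_left _ _) hz)).1, fun a ha r ↦ ?_⟩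
  set B := Metric.ball p (min ρ' (ε / 2)) with hB
  have hBs : ∀ z ∈ B, _ := fun z hz ↦ hsub (Metric.ball_subset_ball (min_le_left _ _) hz)
  have hBc : Convex ℝ B := convex_ball _ _
  have hquad : ∀ z ∈ B, ∀ x ∈ B, ‖f x - f z - fderiv ℝ f z (x - z)‖ ≤ K * ‖x - z‖ * ‖x - z‖ := by
    intro z hz x hx
    refine Convex.norm_image_sub_le_of_norm_hasFDerivWithin_le' (f' := fun w ↦ fderiv ℝ f w)
      (s := B ∩ Metric.closedBall z ‖x - z‖)
      (fun w hw ↦ ((hBs w hw.1).2.2.1).hasFDerivAt.hasFDerivWithinAt) (fun w hw ↦ ?_)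
      (hBc.inter (convex_closedBall _ _)) ⟨hz, Metric.mem_closedBall_self (norm_nonneg _)⟩
      ⟨hx, by rw [Metric.mem_closedBall, dist_eq_norm]⟩
    have h1 := hK.dist_le_mul w (hBs w hw.1).2.1 z (hBs z hz).2.1
    rw [dist_eq_norm] at h1
    exact h1.trans (mul_le_mul_of_nonneg_left hw.2 K.2)
  have hanti : ∀ x ∈ B, ∀ y ∈ B, c * ‖x - y‖ ≤ ‖f x - f y‖ := by
    intro x hx y hy
    have h1 := hT'' x (hBs x hx).2.2.2.1 y (hBs y hy).2.2.2.1
    have h2 := hlow (x - y)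
    have h3 := norm_sub_norm_le (fderiv ℝ f p (x - y)) (fderiv ℝ f p (x - y) - (f x - f y))
    rw [sub_sub_cancel, norm_sub_rev] at h3
    rw [norm_sub_rev] at h1
    have h4 := norm_sub_rev (f x - f y) (fderiv ℝ f p (x - y))
    rw [norm_sub_rev] at h1
    dsimp only at h1
    linarith
  -- The squared Euclidean norm gains `α β ‖f x - f y‖²`, at least `α β c² ‖x - y‖²`. The
  -- non-linearity of `f` costs at most `2 ε ‖δ‖` with `‖δ‖ ≤ K α β ‖x - y‖²`.
  have hconv : ConvexOn ℝ B fun z ↦ ‖f z - a‖ ^ 2 := by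
    refine ⟨hBc, fun x hx y hy α β hα hβ hαβ ↦ ?_⟩
    set z := α • x + β • y with hz
    have hzB : z ∈ B := hBc hx hy hα hβ hαβ
    have hxz : x - z = β • (x - y) := by
      rw [hz, eq_sub_of_add_eq hαβ]; module
    have hyz : y - z = -(α • (x - y)) := by
      rw [hz, eq_sub_of_add_eq' hαβ]; module
    set δ : N := α • (f x - f z - fderiv ℝ f z (x - z)) + β • (f y - f z - fderiv ℝ f z (y - z))
      with hδ
    have hδ' : α • (f x - a) + β • (f y - a) = (f z - a) + δ := by
      have h0 : α • fderiv ℝ f z (x - z) + β • fderiv ℝ f z (y - z) = 0 := by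
        rw [hxz, hyz, map_neg, map_smul, map_smul]; module
      have h1 : f z - a = (α + β) • (f z - a) := by rw [hαβ, one_smul]
      have h2 : δ = α • (f x - f z) + β • (f y - f z) -
          (α • fderiv ℝ f z (x - z) + β • fderiv ℝ f z (y - z)) := by rw [hδ]; module
      rw [h1, h2, h0]; module
    have hδn : ‖δ‖ ≤ K * (α * β) * ‖x - y‖ ^ 2 := by
      have h1 := hquad z hzB x hx
      have h2 := hquad z hzB y hy
      rw [hxz, norm_smul, Real.norm_of_nonneg hβ, ← hxz] at h1
      rw [hyz, norm_neg, norm_smul, Real.norm_of_nonneg hα, ← hyz] at h2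
      calc ‖δ‖ ≤ α * (K * (β * ‖x - y‖) * (β * ‖x - y‖)) +
            β * (K * (α * ‖x - y‖) * (α * ‖x - y‖)) := by
            refine (norm_add_le _ _).trans (add_le_add ?_ ?_)
            · rw [norm_smul, Real.norm_of_nonneg hα]
              exact mul_le_mul_of_nonneg_left h1 hα
            · rw [norm_smul, Real.norm_of_nonneg hβ]
              exact mul_le_mul_of_nonneg_left h2 hβ
        _ = K * (α * β) * ‖x - y‖ ^ 2 * (α + β) := by ring
        _ = _ := by rw [hαβ, mul_one]
    have hQ : ‖f z - a‖ ≤ ε := by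
      have h1 : dist (f z) (f p) < ε / 2 := (hBs z hzB).2.2.2.2
      have h2 : dist a (f p) < ε / 2 := lt_of_lt_of_le ha (min_le_right _ _)
      rw [← dist_eq_norm]
      have := dist_triangle_right (f z) a (f p)
      linarith
    have hxy := hanti x hx y hy
    have hid : ∀ X Y : N, α * ‖X‖ ^ 2 + β * ‖Y‖ ^ 2 =
        ‖α • X + β • Y‖ ^ 2 + α * β * ‖X - Y‖ ^ 2 := by
      intro X Y
      rw [norm_add_sq_real, norm_sub_sq_real, norm_smul, norm_smul, real_inner_smul_left,
        real_inner_smul_right, Real.norm_of_nonneg hα, Real.norm_of_nonneg hβ,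
        eq_sub_of_add_eq' hαβ]
      ring
    have hlow2 : ‖f z - a‖ ^ 2 - 2 * (‖f z - a‖ * ‖δ‖) ≤ ‖(f z - a) + δ‖ ^ 2 := by
      rw [norm_add_sq_real]
      have := (abs_le.1 (abs_real_inner_le_norm (f z - a) δ)).1
      nlinarith [sq_nonneg ‖δ‖]
    have hxy2 : (c * ‖x - y‖) ^ 2 ≤ ‖f x - f y‖ ^ 2 := pow_le_pow_left₀ (by positivity) hxy 2
    have hεK : 2 * ε * K ≤ c ^ 2 := by
      have h1 : ε * (2 * (K + 1)) = c ^ 2 := by rw [hε]; field_simp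
      nlinarith
    have hab : 0 ≤ α * β := mul_nonneg hα hβ
    have hm : ‖f z - a‖ * ‖δ‖ ≤ ε * (K * (α * β) * ‖x - y‖ ^ 2) :=
      mul_le_mul hQ hδn (norm_nonneg _) hε0.le
    have hfin : 2 * (ε * (K * (α * β) * ‖x - y‖ ^ 2)) ≤ α * β * ‖f x - f y‖ ^ 2 := by
      calc 2 * (ε * (K * (α * β) * ‖x - y‖ ^ 2)) = α * β * (2 * ε * K * ‖x - y‖ ^ 2) := by ring
        _ ≤ α * β * (c ^ 2 * ‖x - y‖ ^ 2) := by gcongr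
        _ = α * β * (c * ‖x - y‖) ^ 2 := by ring
        _ ≤ _ := by gcongr
    simp only [smul_eq_mul]
    rw [hid, hδ', sub_sub_sub_cancel_right]
    linarith
  rcases le_or_gt r 0 with hr | hr
  · have : {z ∈ B | ‖f z - a‖ < r} = ∅ := by
      ext z
      simp only [mem_ofPred_eq, mem_empty_iff_false, iff_false, not_and, not_lt]
      exact fun _ ↦ hr.trans (norm_nonneg _)
    rw [this]
    exact convex_empty
  · have : {z ∈ B | ‖f z - a‖ < r} = {z ∈ B | ‖f z - a‖ ^ 2 < r ^ 2} := by
      ext z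
      simp only [mem_ofPred_eq, and_congr_right_iff]
      exact fun _ ↦ (pow_lt_pow_iff_left₀ (norm_nonneg _) hr.le two_ne_zero).symm
    rw [this]
    exact hconv.convex_lt (r ^ 2)

variable {EM : Type*} [NormedAddCommGroup EM] [NormedSpace ℝ EM] [FiniteDimensional ℝ EM]
  {H : Type*} [TopologicalSpace H] {I : ModelWithCorners ℝ EM H} [I.Boundaryless]
  {M : Type*} [TopologicalSpace M] [ChartedSpace H M] [IsManifold I ∞ M]

variable (I) in
/-- Finite covers by small open sets all of whose intersections are convex in charts. -/
theorem exists_good_cover [T2Space M] [CompactSpace M] {O : M → Set M} (hO : ∀ x, O x ∈ 𝓝 x) :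
    ∃ (s : Finset M) (U : M → Set M), (∀ x, IsOpen (U x)) ∧ ⋃ x ∈ s, U x = univ ∧
      ∀ J : Finset M, J.Nonempty → ∃ p, ⋂ x ∈ J, U x ⊆ O p ∩ (chartAt H p).source ∧
        Convex ℝ (extChartAt I p '' ⋂ x ∈ J, U x) := by
  obtain ⟨n, f, hf, hfe, hfi⟩ := exists_embedding_euclidean_of_compact (I := I) (M := M)
  have h1 : ∀ p : M, ∃ ρ > 0, Metric.ball (extChartAt I p p) ρ ⊆
      (extChartAt I p).target ∩ (extChartAt I p).symm ⁻¹' (O p) ∧ ∀ a ∈ Metric.ball (f p) ρ, ∀ r,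
      Convex ℝ {z ∈ Metric.ball (extChartAt I p p) ρ | ‖f ((extChartAt I p).symm z) - a‖ < r} := by
    intro p
    have hs := contDiffAt_comp_extChartAt_symm (I := I) (mem_chart_source H p)
      (hf.contMDiffAt (x := p))
    have hinj : Function.Injective (fderiv ℝ (f ∘ (extChartAt I p).symm) (extChartAt I p p)) := by
      have h2 := mvfderiv_coordField (I := I) (mem_chart_source H p)
        ((hf.contMDiffAt (x := p)).mdifferentiableAt (by simp))
      intro u v huv
      have h3 : mfderiv I 𝓘(ℝ, EuclideanSpace ℝ (Fin n)) f p (coordField I p u p) =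
          mfderiv I 𝓘(ℝ, EuclideanSpace ℝ (Fin n)) f p (coordField I p v p) :=
        (h2 u).trans (huv.trans (h2 v).symm)
      have h4 := congrArg (mfderiv I 𝓘(ℝ, EM) (extChartAt I p) p) (hfi p h3)
      exact (mfderiv_extChartAt_coordField (mem_chart_source H p) u).symm.trans
        (h4.trans (mfderiv_extChartAt_coordField (mem_chart_source H p) v))
    obtain ⟨ρ, hρ, hρs, hc⟩ := exists_convex_norm_sub_lt hs hinj
      (Filter.inter_mem (extChartAt_target_mem_nhds (I := I) p)
        ((continuousAt_extChartAt_symm (I := I) p).preimage_mem_nhds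
          (by rw [extChartAt_to_inv]; exact hO p)))
    refine ⟨ρ, hρ, hρs, fun a ha r ↦ hc a ?_ r⟩
    show a ∈ Metric.ball (f ((extChartAt I p).symm (extChartAt I p p))) ρ
    rwa [extChartAt_to_inv]
  choose ρ hρ hρs hc using h1
  let B : M → Set M := fun p ↦ (extChartAt I p).source ∩
    extChartAt I p ⁻¹' Metric.ball (extChartAt I p p) (ρ p)
  have hB : ∀ p, B p ∈ 𝓝 p := fun p ↦ Filter.inter_mem (extChartAt_source_mem_nhds p)
    ((continuousAt_extChartAt p).preimage_mem_nhds (Metric.ball_mem_nhds _ (hρ p)))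
  -- Because `f` is an embedding, points whose images are close to `f p` lie in the chart ball of
  -- `p`.
  have h2 : ∀ p, ∃ r > 0, r ≤ ρ p ∧ ∀ y, f y ∈ Metric.ball (f p) r → y ∈ B p := by
    intro p
    have h3 := hB p
    rw [hfe.isInducing.nhds_eq_comap, Filter.mem_comap] at h3
    obtain ⟨T, hT, hTB⟩ := h3
    obtain ⟨r, hr, hrT⟩ := Metric.mem_nhds_iff.1 hT
    exact ⟨min r (ρ p), lt_min hr (hρ p), min_le_right _ _, fun y hy ↦
      hTB (hrT (Metric.ball_subset_ball (min_le_left _ _) hy))⟩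
  choose r hr hrρ hrB using h2
  -- A Lebesgue number makes the cover uniform, so one chart can serve a whole intersection.
  obtain ⟨δ, hδ, hL⟩ := lebesgue_number_lemma_of_metric (isCompact_range hf.continuous)
    (c := fun p ↦ Metric.ball (f p) (r p)) (fun _ ↦ Metric.isOpen_ball) (by
      rintro _ ⟨y, rfl⟩
      exact mem_iUnion.2 ⟨y, Metric.mem_ball_self (hr y)⟩)
  let U : M → Set M := fun x ↦ f ⁻¹' Metric.ball (f x) (δ / 2)
  have hUo : ∀ x, IsOpen (U x) := fun x ↦ Metric.isOpen_ball.preimage hf.continuous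
  obtain ⟨s, hs⟩ := CompactSpace.elim_nhds_subcover U fun x ↦ (hUo x).mem_nhds
    (Metric.mem_ball_self (half_pos hδ))
  refine ⟨s, U, hUo, hs, fun J ⟨i, hi⟩ ↦ ?_⟩
  rcases (⋂ x ∈ J, U x).eq_empty_or_nonempty with hJ | ⟨y₀, hy₀⟩
  · refine ⟨i, ?_⟩
    rw [hJ, image_empty]
    exact ⟨empty_subset _, convex_empty⟩
  obtain ⟨p, hp⟩ := hL (f i) (mem_range_self i)
  have hJB : ∀ y ∈ ⋂ x ∈ J, U x, y ∈ B p := fun y hy ↦ hrB p y (hp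
    (Metric.ball_subset_ball (half_le_self hδ.le) (mem_iInter₂.1 hy i hi)))
  -- The radius is `δ / 2`, so a common point puts all centres within `δ` of `f i`, hence close
  -- enough to `f p` for the convexity statement at `p`.
  have hJp : ∀ j ∈ J, f j ∈ Metric.ball (f p) (ρ p) := by
    intro j hj
    refine Metric.ball_subset_ball (hrρ p) (hp ?_)
    have h3 : dist (f y₀) (f j) < δ / 2 := mem_iInter₂.1 hy₀ j hj
    have h4 : dist (f y₀) (f i) < δ / 2 := mem_iInter₂.1 hy₀ i hi
    have := dist_triangle_left (f j) (f i) (f y₀)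
    rw [Metric.mem_ball]
    linarith
  refine ⟨p, fun y hy ↦ ⟨?_, ?_⟩, ?_⟩
  · have h3 := (hρs p (hJB y hy).2).2
    rwa [mem_preimage, (extChartAt I p).left_inv (hJB y hy).1] at h3
  · have h3 := (hJB y hy).1
    rwa [extChartAt_source] at h3
  · have h3 : extChartAt I p '' ⋂ x ∈ J, U x = ⋂ x ∈ J, {z ∈ Metric.ball (extChartAt I p p) (ρ p) |
        ‖f ((extChartAt I p).symm z) - f x‖ < δ / 2} := by
      ext z
      constructor
      · rintro ⟨y, hy, rfl⟩
        refine mem_iInter₂.2 fun x hx ↦ ⟨(hJB y hy).2, ?_⟩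
        rw [(extChartAt I p).left_inv (hJB y hy).1, ← dist_eq_norm]
        exact mem_iInter₂.1 hy x hx
      · intro hz
        rw [mem_iInter₂] at hz
        have hzt := (hρs p (hz i hi).1).1
        refine ⟨(extChartAt I p).symm z, mem_iInter₂.2 fun x hx ↦ ?_, (extChartAt I p).right_inv hzt⟩
        show dist _ _ < _
        rw [dist_eq_norm]
        exact (hz x hx).2
    rw [h3]
    exact convex_iInter₂ fun x hx ↦ hc p _ (hJp x hx) _

end GoodCovers
end

/-! ### Compactly supported functions in a box and their integrals. -/

noncomputable section
section CompactlySupported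

/-- Smoothness of integrals with a variable end point and a parameter. -/
lemma contDiff_intervalIntegral {E G : Type} [NormedAddCommGroup E] [NormedSpace ℝ E]
    [FiniteDimensional ℝ E] [NormedAddCommGroup G] [NormedSpace ℝ G] [CompleteSpace G]
    {f : ℝ → E → G} (hf : ContDiff ℝ ∞ fun p : ℝ × E ↦ f p.1 p.2) (a : ℝ) {u : E → ℝ}
    (hu : ContDiff ℝ ∞ u) : ContDiff ℝ ∞ fun z ↦ ∫ s in a..u z, f s z := by
  -- A linear substitution moves the variable end point into the integrand.
  have h1 : (fun z ↦ ∫ s in a..u z, f s z) = fun z ↦ (u z - a) •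
      ∫ t in (0 : ℝ)..1, (fun q : ℝ × E ↦ f (a + (u q.2 - a) * q.1) q.2) (t, z) := by
    funext z
    have h2 := intervalIntegral.smul_integral_comp_add_mul (a := 0) (b := 1)
      (fun s ↦ f s z) (u z - a) a
    rw [mul_zero, mul_one, add_zero, add_sub_cancel] at h2
    exact h2.symm
  rw [h1]
  refine (hu.sub contDiff_const).smul (contDiffOn_univ.1 (contDiffOn_integral
    (f := fun q : ℝ × E ↦ f (a + (u q.2 - a) * q.1) q.2) isOpen_univ ?_))
  intro t _ z _
  have h3 : ContDiff ℝ ∞ fun q : ℝ × E ↦ (a + (u q.2 - a) * q.1, q.2) :=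
    (contDiff_const.add (((hu.comp contDiff_snd).sub contDiff_const).mul contDiff_fst)).prodMk
      contDiff_snd
  exact (hf.comp h3).contDiffAt

variable {G : Type} [NormedAddCommGroup G] [NormedSpace ℝ G] [CompleteSpace G]

/-- The iterated integral over a box in the plane. -/
def boxIntegral (a b c d : ℝ) (g : ℂ → G) : G := ∫ y in c..d, ∫ x in a..b, g ⟨x, y⟩

lemma contDiff_complex_mk {E : Type*} [NormedAddCommGroup E] [NormedSpace ℝ E] {u v : E → ℝ}
    (hu : ContDiff ℝ ∞ u) (hv : ContDiff ℝ ∞ v) : ContDiff ℝ ∞ fun z ↦ (⟨u z, v z⟩ : ℂ) := by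
  have h : (fun z ↦ (⟨u z, v z⟩ : ℂ)) = fun z ↦ Complex.equivRealProdCLM.symm (u z, v z) := by
    funext z
    apply Complex.ext <;> simp
  rw [h]
  exact Complex.equivRealProdCLM.symm.contDiff.comp (hu.prodMk hv)

lemma contDiff_im : ContDiff ℝ ∞ Complex.im := Complex.imCLM.contDiff

lemma contDiff_re : ContDiff ℝ ∞ Complex.re := Complex.reCLM.contDiff

lemma exists_bump_Ioo {a b : ℝ} (hab : a < b) : ∃ φ : ℝ → ℝ, ContDiff ℝ ∞ φ ∧
    (∀ x, φ x ≠ 0 → x ∈ Ioo a b) ∧ (∀ x, 0 ≤ φ x) ∧ ∀ a' ≤ a, ∀ b' ≥ b, ∫ x in a'..b', φ x = 1 := by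
  let f : ContDiffBump ((a + b) / 2) := ⟨(b - a) / 4, (b - a) / 2, by linarith, by linarith⟩
  have hs : ∀ x, f.normed MeasureTheory.volume x ≠ 0 → x ∈ Ioo a b := by
    intro x hx
    have h1 : x ∈ Function.support (f.normed MeasureTheory.volume) := hx
    rw [f.support_normed_eq, Real.ball_eq_Ioo] at h1
    simp only [f] at h1
    constructor <;> linarith [h1.1, h1.2]
  refine ⟨f.normed MeasureTheory.volume, f.contDiff_normed, hs, f.nonneg_normed, fun a' ha' b' hb' ↦ ?_⟩
  rw [intervalIntegral.integral_eq_integral_of_support_subset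
    (fun x hx ↦ ⟨ha'.trans_lt (hs x hx).1, (hs x hx).2.le.trans hb'⟩)]
  exact f.integral_normed

variable {a b c d : ℝ} {g : ℂ → G}

lemma hasDerivAt_intervalIntegral {h : ℝ → G} (hh : Continuous h) (a x : ℝ) :
    HasDerivAt (fun x ↦ ∫ s in a..x, h s) (h x) x :=
  (hh.integral_hasStrictDerivAt a x).hasDerivAt

/-- A primitive in the horizontal direction. -/
lemma exists_fderiv_one_eq (hg : ContDiff ℝ ∞ g)
    (hs : ∀ z, g z ≠ 0 → z ∈ Ioo a b ×ℂ Ioo c d) (hI : ∀ y, ∫ x in a..b, g ⟨x, y⟩ = 0) :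
    ∃ P : ℂ → G, ContDiff ℝ ∞ P ∧ (∀ z, P z ≠ 0 → z ∈ Ioo a b ×ℂ Ioo c d) ∧
      ∀ z, fderiv ℝ P z 1 = g z := by
  have hg0 : ∀ x y : ℝ, ¬ (x ∈ Ioo a b ∧ y ∈ Ioo c d) → g ⟨x, y⟩ = 0 := fun x y h ↦ by
    by_contra h1
    exact h (Complex.mem_reProdIm.1 (hs _ h1))
  have hgc : ∀ y : ℝ, Continuous fun x : ℝ ↦ g ⟨x, y⟩ := fun y ↦
    hg.continuous.comp (contDiff_complex_mk contDiff_id contDiff_const).continuous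
  -- To the right of the box the primitive vanishes precisely because the integral over each
  -- horizontal line does.
  let P : ℂ → G := fun z ↦ ∫ x in a..z.re, g ⟨x, z.im⟩
  have hP : ContDiff ℝ ∞ P := contDiff_intervalIntegral (f := fun x (z : ℂ) ↦ g ⟨x, z.im⟩)
    (hg.comp (contDiff_complex_mk contDiff_fst (contDiff_im.comp contDiff_snd))) a contDiff_re
  refine ⟨P, hP, fun z hz ↦ ?_, fun z ↦ ?_⟩
  · by_contra hz'
    refine hz ?_
    rw [Complex.mem_reProdIm] at hz'
    have hz0 : ∀ {x₀ x₁ : ℝ}, (∀ x ∈ uIcc x₀ x₁, ¬ (x ∈ Ioo a b ∧ z.im ∈ Ioo c d)) →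
        ∫ x in x₀..x₁, g ⟨x, z.im⟩ = 0 := fun h ↦ by
      rw [intervalIntegral.integral_congr (g := fun _ ↦ (0 : G)) fun x hx ↦ hg0 _ _ (h x hx)]
      simp
    by_cases him : z.im ∈ Ioo c d
    · rcases le_or_gt z.re a with h1 | h1
      · refine hz0 fun x hx hx' ↦ ?_
        rw [uIcc_of_ge h1] at hx
        exact absurd hx'.1.1 (not_lt.2 hx.2)
      · have h2 : b ≤ z.re := by
          by_contra h2
          exact hz' ⟨⟨h1, not_le.1 h2⟩, him⟩
        show ∫ x in a..z.re, g ⟨x, z.im⟩ = 0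
        rw [← intervalIntegral.integral_add_adjacent_intervals (b := b)
          ((hgc _).intervalIntegrable _ _) ((hgc _).intervalIntegrable _ _), hI, zero_add]
        refine hz0 fun x hx hx' ↦ ?_
        rw [uIcc_of_le h2] at hx
        exact absurd hx'.1.2 (not_lt.2 hx.1)
    · exact hz0 fun x _ hx' ↦ him hx'.2
  · have h1 : HasDerivAt (fun r : ℝ ↦ (⟨r, z.im⟩ : ℂ)) 1 z.re := by
      have h2 : (fun r : ℝ ↦ (⟨r, z.im⟩ : ℂ)) = fun r : ℝ ↦ (r : ℂ) + z.im * Complex.I := by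
        funext r
        apply Complex.ext <;> simp
      rw [h2]
      exact Complex.ofRealCLM.hasDerivAt.add_const _
    have h3 := (hP.differentiable (by simp) z).hasFDerivAt.comp_hasDerivAt z.re
      (f := fun r : ℝ ↦ (⟨r, z.im⟩ : ℂ)) h1
    exact h3.unique (hasDerivAt_intervalIntegral (hgc z.im) a z.re)

/-- Compactly supported functions on a box with vanishing integral are divergences. -/
theorem exists_divergence_eq (hab : a < b) (hg : ContDiff ℝ ∞ g)
    (hs : ∀ z, g z ≠ 0 → z ∈ Ioo a b ×ℂ Ioo c d) (hI : boxIntegral a b c d g = 0) :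
    ∃ P Q : ℂ → G, ContDiff ℝ ∞ P ∧ ContDiff ℝ ∞ Q ∧ (∀ z, P z ≠ 0 → z ∈ Ioo a b ×ℂ Ioo c d) ∧
      (∀ z, Q z ≠ 0 → z ∈ Ioo a b ×ℂ Ioo c d) ∧
      ∀ z, fderiv ℝ P z 1 + fderiv ℝ Q z Complex.I = g z := by
  obtain ⟨φ, hφ, hφs, -, hφ1⟩ := exists_bump_Ioo hab
  have hg0 : ∀ x y : ℝ, ¬ (x ∈ Ioo a b ∧ y ∈ Ioo c d) → g ⟨x, y⟩ = 0 := fun x y h ↦ by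
    by_contra h1
    exact h (Complex.mem_reProdIm.1 (hs _ h1))
  -- The horizontal integrals `h` obstruct a horizontal primitive. They are moved into `φ(x) h(y)`,
  -- which is a vertical derivative because the total integral of `h` is zero.
  let h : ℝ → G := fun y ↦ ∫ x in a..b, g ⟨x, y⟩
  have hh : ContDiff ℝ ∞ h := contDiff_intervalIntegral (f := fun x (y : ℝ) ↦ g ⟨x, y⟩)
    (hg.comp (contDiff_complex_mk contDiff_fst contDiff_snd)) a contDiff_const
  have hh0 : ∀ y, y ∉ Ioo c d → h y = 0 := fun y hy ↦ by
    show ∫ x in a..b, g ⟨x, y⟩ = 0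
    rw [intervalIntegral.integral_congr (g := fun _ ↦ (0 : G)) fun x _ ↦
      hg0 _ _ fun hx ↦ hy hx.2]
    simp
  let R : ℝ → G := fun y ↦ ∫ s in c..y, h s
  have hR : ContDiff ℝ ∞ R := contDiff_intervalIntegral (f := fun s (_ : ℝ) ↦ h s)
    (hh.comp contDiff_fst) c contDiff_id
  have hR0 : ∀ y, y ∉ Ioo c d → R y = 0 := by
    intro y hy
    have hz0 : ∀ {y₀ y₁ : ℝ}, (∀ s ∈ uIcc y₀ y₁, s ∉ Ioo c d) → ∫ s in y₀..y₁, h s = 0 := fun h ↦ by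
      rw [intervalIntegral.integral_congr (g := fun _ ↦ (0 : G)) fun s hs ↦ hh0 _ (h s hs)]
      simp
    rcases le_or_gt y c with h1 | h1
    · refine hz0 fun x hx hx' ↦ ?_
      rw [uIcc_of_ge h1] at hx
      exact absurd hx'.1 (not_lt.2 hx.2)
    · have h2 : d ≤ y := by
        by_contra h2
        exact hy ⟨h1, not_le.1 h2⟩
      show ∫ s in c..y, h s = 0
      rw [← intervalIntegral.integral_add_adjacent_intervals (b := d)
        (hh.continuous.intervalIntegrable _ _) (hh.continuous.intervalIntegrable _ _)]
      refine (congrArg₂ (· + ·) hI (hz0 fun x hx hx' ↦ ?_)).trans (add_zero 0)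
      rw [uIcc_of_le h2] at hx
      exact absurd hx'.2 (not_lt.2 hx.1)
  have hφre : ContDiff ℝ ∞ fun z : ℂ ↦ φ z.re := hφ.comp contDiff_re
  obtain ⟨P, hP, hPs, hPd⟩ := exists_fderiv_one_eq (a := a) (b := b) (c := c) (d := d)
    (g := fun z ↦ g z - φ z.re • h z.im)
    (hg.sub (hφre.smul (hh.comp contDiff_im))) (fun z hz ↦ by
      by_contra hz'
      refine hz ?_
      have h1 : g z = 0 := by
        by_contra h1
        exact hz' (hs z h1)
      rw [Complex.mem_reProdIm, not_and_or] at hz'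
      rcases hz' with hz' | hz'
      · have h2 : φ z.re = 0 := by
          by_contra h2
          exact hz' (hφs _ h2)
        simp only [h1, h2, zero_smul, sub_zero]
      · simp only [h1, hh0 _ hz', smul_zero, sub_zero])
    (fun y ↦ by
      have h1 : IntervalIntegrable (fun x : ℝ ↦ g ⟨x, y⟩) MeasureTheory.volume a b :=
        (hg.continuous.comp
          (contDiff_complex_mk contDiff_id contDiff_const).continuous).intervalIntegrable _ _
      have h2 : IntervalIntegrable (fun x : ℝ ↦ φ x • h y) MeasureTheory.volume a b :=
        (hφ.continuous.smul continuous_const).intervalIntegrable _ _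
      show ∫ x in a..b, (g ⟨x, y⟩ - φ x • h y) = 0
      rw [intervalIntegral.integral_sub h1 h2, intervalIntegral.integral_smul_const, hφ1 a le_rfl b le_rfl,
        one_smul]
      exact sub_self _)
  have hQ : ContDiff ℝ ∞ fun z : ℂ ↦ φ z.re • R z.im := hφre.smul (hR.comp contDiff_im)
  refine ⟨P, fun z ↦ φ z.re • R z.im, hP, hQ, hPs,
    fun z hz ↦ ?_, fun z ↦ ?_⟩
  · rw [smul_ne_zero_iff] at hz
    refine Complex.mem_reProdIm.2 ⟨hφs _ hz.1, ?_⟩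
    by_contra h1
    exact hz.2 (hR0 _ h1)
  · have h1 : HasDerivAt (fun r : ℝ ↦ (⟨z.re, r⟩ : ℂ)) Complex.I z.im := by
      have h2 : (fun r : ℝ ↦ (⟨z.re, r⟩ : ℂ)) = fun r : ℝ ↦ (r : ℂ) * Complex.I + z.re := by
        funext r
        apply Complex.ext <;> simp
      rw [h2]
      simpa using ((Complex.ofRealCLM.hasDerivAt (x := z.im)).mul_const Complex.I).add_const
        (z.re : ℂ)
    have h3 := (hQ.differentiable (by simp) z).hasFDerivAt.comp_hasDerivAt z.im
      (f := fun r : ℝ ↦ (⟨z.re, r⟩ : ℂ)) h1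
    have h4 := h3.unique ((hasDerivAt_intervalIntegral hh.continuous c z.im).const_smul (φ z.re))
    rw [hPd, h4, sub_add_cancel]

lemma exists_box_subset {Ω : Set ℂ} (hΩ : IsOpen Ω) {z : ℂ} (hz : z ∈ Ω) : ∃ a b c d : ℝ,
    a < b ∧ c < d ∧ z ∈ Ioo a b ×ℂ Ioo c d ∧ Icc a b ×ℂ Icc c d ⊆ Ω := by
  obtain ⟨r, hr, hrs⟩ := Metric.isOpen_iff.1 hΩ z hz
  refine ⟨z.re - r / 4, z.re + r / 4, z.im - r / 4, z.im + r / 4, by linarith, by linarith,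
    ⟨⟨by linarith, by linarith⟩, ⟨by linarith, by linarith⟩⟩, fun w hw ↦ hrs ?_⟩
  obtain ⟨h1, h2⟩ := hw
  rw [Metric.mem_ball, dist_eq_norm]
  refine (Complex.norm_le_abs_re_add_abs_im _).trans_lt ?_
  have h3 : |(w - z).re| ≤ r / 4 := abs_le.2 ⟨by
    rw [Complex.sub_re]; linarith [h1.1], by rw [Complex.sub_re]; linarith [h1.2]⟩
  have h4 : |(w - z).im| ≤ r / 4 := abs_le.2 ⟨by
    rw [Complex.sub_im]; linarith [h2.1], by rw [Complex.sub_im]; linarith [h2.2]⟩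
  linarith

/-- Bump functions with prescribed integral. -/
lemma exists_boxIntegral_eq {a' b' c' d' : ℝ} (hab : a' < b') (hcd : c' < d') :
    ∃ φ : ℂ → ℝ, ContDiff ℝ ∞ φ ∧ (∀ z, φ z ≠ 0 → z ∈ Ioo a' b' ×ℂ Ioo c' d') ∧
      (∀ z, 0 ≤ φ z) ∧ ∀ {a b c d : ℝ}, a ≤ a' → b' ≤ b → c ≤ c' → d' ≤ d → ∀ v : G,
        boxIntegral a b c d (fun z ↦ φ z • v) = v := by
  obtain ⟨φ, hφ, hφs, hφ0, hφ1⟩ := exists_bump_Ioo hab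
  obtain ⟨ψ, hψ, hψs, hψ0, hψ1⟩ := exists_bump_Ioo hcd
  refine ⟨fun z ↦ φ z.re * ψ z.im, (hφ.comp contDiff_re).mul (hψ.comp contDiff_im),
    fun z hz ↦ ?_, fun z ↦ mul_nonneg (hφ0 _) (hψ0 _), fun ha hb hc hd v ↦ ?_⟩
  · rw [mul_ne_zero_iff] at hz
    exact ⟨hφs _ hz.1, hψs _ hz.2⟩
  · simp only [boxIntegral, mul_smul, intervalIntegral.integral_smul_const, hφ1 _ ha _ hb,
      hψ1 _ hc _ hd, one_smul]

lemma boxIntegral_sub {f : ℂ → G} (hg : Continuous g) (hf : Continuous f) :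
    boxIntegral a b c d (fun z ↦ g z - f z) = boxIntegral a b c d g - boxIntegral a b c d f := by
  have h1 : ∀ {g : ℂ → G}, Continuous g → Continuous fun p : ℝ × ℝ ↦ g ⟨p.2, p.1⟩ := fun hg ↦
    hg.comp (contDiff_complex_mk contDiff_snd contDiff_fst).continuous
  have h2 : ∀ {g : ℂ → G}, Continuous g → ∀ y, Continuous fun x : ℝ ↦ g ⟨x, y⟩ := fun hg y ↦
    hg.comp (contDiff_complex_mk contDiff_id contDiff_const).continuous
  have h3 : ∀ {g : ℂ → G}, Continuous g → Continuous fun y : ℝ ↦ ∫ x in a..b, g ⟨x, y⟩ := fun hg ↦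
    intervalIntegral.continuous_parametric_intervalIntegral_of_continuous' (h1 hg) a b
  unfold boxIntegral
  rw [← intervalIntegral.integral_sub ((h3 hg).intervalIntegrable _ _)
    ((h3 hf).intervalIntegrable _ _)]
  congr 1
  funext y
  exact intervalIntegral.integral_sub ((h2 hg y).intervalIntegrable _ _)
    ((h2 hf y).intervalIntegrable _ _)

end CompactlySupported
end

/-! ### Extension by zero. -/

noncomputable section
section ExtensionByZero

variable {EM : Type*} [NormedAddCommGroup EM] [NormedSpace ℝ EM]
  {H : Type*} [TopologicalSpace H] {I : ModelWithCorners ℝ EM H}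
  {M : Type*} [TopologicalSpace M] [ChartedSpace H M]

open Classical in
/-- Extension by zero. -/
def extendZero {X : M → Type*} [∀ x, AddCommGroup (X x)] (O : Set M) (s : Π x, X x) (y : M) : X y :=
  if y ∈ O then s y else 0

section

variable {X : M → Type*} [∀ x, AddCommGroup (X x)] {O K : Set M} {s : Π x, X x} {y : M}

lemma extendZero_of_mem (hy : y ∈ O) : extendZero O s y = s y := if_pos hy

lemma extendZero_of_notMem (hy : y ∉ O) : extendZero O s y = 0 := if_neg hy

lemma extendZero_eventuallyEq (hO : IsOpen O) (hy : y ∈ O) : ∀ᶠ z in 𝓝 y, extendZero O s z = s z :=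
  Filter.Eventually.mono (hO.mem_nhds hy) fun _ hz ↦ extendZero_of_mem hz

lemma extendZero_eventually_eq_zero (hK : IsClosed K) (hKO : K ⊆ O)
    (h0 : ∀ y ∈ O, y ∉ K → s y = 0) (hy : y ∉ O) : ∀ᶠ z in 𝓝 y, extendZero O s z = 0 := by
  filter_upwards [hK.isOpen_compl.mem_nhds fun h ↦ hy (hKO h)] with z hz
  by_cases hzO : z ∈ O
  · rw [extendZero_of_mem hzO, h0 z hzO hz]
  · exact extendZero_of_notMem hzO

end

variable {Φ Ψ : FineSheaf I M} {O K : Set M} {s : Π x, Φ.X x}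

/-- Vanishing off a closed `K` inside `O` is what matters: a point outside `O` has a neighbourhood
missing `K`, where the extension is zero. -/
lemma FineSheaf.smooth_extendZero (hO : IsOpen O) (hK : IsClosed K) (hKO : K ⊆ O)
    (hs : ∀ y ∈ O, Φ.smooth s y) (h0 : ∀ y ∈ O, y ∉ K → s y = 0) (y : M) :
    Φ.smooth (extendZero O s) y := by
  by_cases hy : y ∈ O
  · exact Φ.smooth_congr (hs y hy) (extendZero_eventuallyEq hO hy)
  · exact Φ.smooth_congr (Φ.smooth_zero y) (extendZero_eventually_eq_zero hK hKO h0 hy)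

lemma SheafOp.map_extendZero (d : SheafOp Φ Ψ) (hO : IsOpen O) (hK : IsClosed K) (hKO : K ⊆ O)
    (hs : ∀ y ∈ O, Φ.smooth s y) (h0 : ∀ y ∈ O, y ∉ K → s y = 0) (y : M) :
    d (extendZero O s) y = extendZero O (d s) y := by
  by_cases hy : y ∈ O
  · rw [extendZero_of_mem hy]
    exact d.map_congr (hs y hy) (extendZero_eventuallyEq hO hy)
  · rw [extendZero_of_notMem hy]
    exact (d.map_congr (Φ.smooth_zero y) (extendZero_eventually_eq_zero hK hKO h0 hy)).trans
      (d.map_zero y)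

end ExtensionByZero

/-! ### Two-forms supported in a coordinate box. -/

section TopDegree

variable {S : Type*} [TopologicalSpace S] [ChartedSpace ℂ S] [IsManifold 𝓘(ℝ, ℂ) ∞ S]
  {F : Type*} [NormedAddCommGroup F] [NormedSpace ℝ F] [FiniteDimensional ℝ F]
  {V : S → Type*} [TopologicalSpace (TotalSpace F V)]
  [∀ x, AddCommGroup (V x)] [∀ x, Module ℝ (V x)] [∀ x, TopologicalSpace (V x)]
  [∀ x, IsTopologicalAddGroup (V x)] [∀ x, ContinuousSMul ℝ (V x)]
  [FiberBundle F V] [VectorBundle ℝ F V]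
  {D : CovariantDerivative 𝓘(ℝ, ℂ) F V} {n : ℕ}
  {ι : Type} [Fintype ι] {e : ι → Π x : S, V x} {q : S} {O : Set S} {a b c d : ℝ}

lemma mem_closedBox {z : ℂ} (hz : z ∈ Ioo a b ×ℂ Ioo c d) : z ∈ Icc a b ×ℂ Icc c d :=
  ⟨Ioo_subset_Icc_self hz.1, Ioo_subset_Icc_self hz.2⟩

/-- The two-form with given coefficient in a frame and a chart. -/
def frameTwoForm (e : ι → Π x : S, V x) (q : S) (γ : ℂ → ι → ℝ) (y : S) :
    TangentSpace 𝓘(ℝ, ℂ) y → TangentSpace 𝓘(ℝ, ℂ) y → V y :=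
  let L : TangentSpace 𝓘(ℝ, ℂ) y → ℂ := mvfderiv 𝓘(ℝ, ℂ) (extChartAt 𝓘(ℝ, ℂ) q) y
  fun u v ↦ frameSum (fun i ↦ e i y)
    (((L u).re * (L v).im - (L u).im * (L v).re) • γ (extChartAt 𝓘(ℝ, ℂ) q y))

lemma frameTwoForm_coordField {γ : ℂ → ι → ℝ} {y : S} (hy : y ∈ (chartAt ℂ q).source) :
    frameTwoForm e q γ y (coordField 𝓘(ℝ, ℂ) q 1 y) (coordField 𝓘(ℝ, ℂ) q Complex.I y) =
      frameSum (fun i ↦ e i y) (γ (extChartAt 𝓘(ℝ, ℂ) q y)) := by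
  have h : ∀ u : ℂ, mvfderiv 𝓘(ℝ, ℂ) (extChartAt 𝓘(ℝ, ℂ) q) y (coordField 𝓘(ℝ, ℂ) q u y) = u :=
    mfderiv_extChartAt_coordField hy
  unfold frameTwoForm
  rw [h, h]
  simp

lemma isAlt_frameTwoForm (γ : ℂ → ι → ℝ) (y : S) : IsAlt (frameTwoForm e q γ y) := by
  let L : TangentSpace 𝓘(ℝ, ℂ) y →ₗ[ℝ] ℂ :=
    (mvfderiv 𝓘(ℝ, ℂ) (extChartAt 𝓘(ℝ, ℂ) q) y).toLinearMap
  let A : ℂ →ₗ[ℝ] ℂ →ₗ[ℝ] ℝ := LinearMap.mk₂ ℝ (fun z w ↦ z.re * w.im - z.im * w.re)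
    (fun _ _ _ ↦ by simp only [Complex.add_re, Complex.add_im]; ring)
    (fun _ _ _ ↦ by simp only [Complex.smul_re, Complex.smul_im, smul_eq_mul]; ring)
    (fun _ _ _ ↦ by simp only [Complex.add_re, Complex.add_im]; ring)
    (fun _ _ _ ↦ by simp only [Complex.smul_re, Complex.smul_im, smul_eq_mul]; ring)
  let T : ℝ →ₗ[ℝ] V y := (frameSum fun i ↦ e i y).comp
    (LinearMap.toSpanSingleton ℝ (ι → ℝ) (γ (extChartAt 𝓘(ℝ, ℂ) q y)))
  refine ⟨(A.compr₂ T).compl₁₂ L L, fun u ↦ ?_, fun u v ↦ rfl⟩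
  show T ((L u).re * (L u).im - (L u).im * (L u).re) = 0
  rw [mul_comm, sub_self, map_zero]

lemma SmoothFrame.smooth_frameTwoForm (h : SmoothFrame 𝓘(ℝ, ℂ) F e O) {γ : ℂ → ι → ℝ}
    (hγ : ContDiff ℝ ∞ γ) (hO : O ⊆ (chartAt ℂ q).source) {y : S} (hy : y ∈ O) :
    (twoSheaf 𝓘(ℝ, ℂ) F V).smooth (frameTwoForm e q γ) y := by
  refine ⟨isAlt_frameTwoForm γ y, fun q' hq' u v ↦ h.smoothAt_sum hy ?_⟩
  have h1 : ∀ u : ℂ, ContMDiffAt 𝓘(ℝ, ℂ) 𝓘(ℝ, ℂ) ∞ (fun y ↦ mvfderiv 𝓘(ℝ, ℂ)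
      (extChartAt 𝓘(ℝ, ℂ) q) y (coordField 𝓘(ℝ, ℂ) q' u y)) y := fun u ↦
    contMDiffAt_mvfderiv_apply (contMDiffAt_extChartAt' (hO hy)) (contMDiffAt_coordField hq' u)
  have h2 : ContDiff ℝ ∞ fun p : ℂ × ℂ ↦ p.1.re * p.2.im - p.1.im * p.2.re :=
    ((contDiff_re.comp contDiff_fst).mul (contDiff_im.comp contDiff_snd)).sub
      ((contDiff_im.comp contDiff_fst).mul (contDiff_re.comp contDiff_snd))
  exact (h2.contMDiff.contMDiffAt.comp y ((h1 u).prodMk_space (h1 v))).smul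
    (contMDiffAt_comp_extChartAt (hO hy) hγ.contDiffAt)

variable (D e q O a b c d) in
/-- A nice set with a closed box in its chart. -/
structure IsBox : Prop extends IsNice D e q O where
  lt₁ : a < b
  lt₂ : c < d
  box_subset : Icc a b ×ℂ Icc c d ⊆ extChartAt 𝓘(ℝ, ℂ) q '' O

variable (q O a b c d) in
/-- The part of a nice set over an open box. -/
def boxPart : Set S := O ∩ extChartAt 𝓘(ℝ, ℂ) q ⁻¹' (Ioo a b ×ℂ Ioo c d)

namespace IsBox

variable (h : IsBox D e q O a b c d)
include h

lemma mem_source {y : S} (hy : y ∈ O) : y ∈ (extChartAt 𝓘(ℝ, ℂ) q).source := by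
  rw [extChartAt_source]
  exact h.subset hy

lemma isOpen_boxPart : IsOpen (boxPart q O a b c d) :=
  ((continuousOn_extChartAt q).mono fun _ hy ↦ h.mem_source hy).isOpen_inter_preimage h.isOpen
    (isOpen_Ioo.reProdIm isOpen_Ioo)

/-- The set over the closed box is compact, hence closed in the Hausdorff surface. -/
lemma exists_closed [T2Space S] : ∃ K : Set S, IsClosed K ∧ K ⊆ O ∧ ∀ y ∈ O, y ∉ K →
    extChartAt 𝓘(ℝ, ℂ) q y ∉ Icc a b ×ℂ Icc c d := by
  have hK : IsCompact ((extChartAt 𝓘(ℝ, ℂ) q).symm '' (Icc a b ×ℂ Icc c d)) := by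
    refine (isCompact_Icc.reProdIm isCompact_Icc).image_of_continuousOn
      ((continuousOn_extChartAt_symm q).mono fun z hz ↦ ?_)
    obtain ⟨y, hy, rfl⟩ := h.box_subset hz
    exact (extChartAt 𝓘(ℝ, ℂ) q).map_source (h.mem_source hy)
  refine ⟨_, hK.isClosed, ?_, fun y hy hyK hz ↦ hyK ⟨_, hz,
    (extChartAt 𝓘(ℝ, ℂ) q).left_inv (h.mem_source hy)⟩⟩
  rintro _ ⟨z, hz, rfl⟩
  obtain ⟨y, hy, rfl⟩ := h.box_subset hz
  rwa [(extChartAt 𝓘(ℝ, ℂ) q).left_inv (h.mem_source hy)]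

lemma smooth_boxForm [T2Space S] {γ : ℂ → ι → ℝ} (hγ : ContDiff ℝ ∞ γ)
    (hs : ∀ z, γ z ≠ 0 → z ∈ Ioo a b ×ℂ Ioo c d) (y : S) :
    (twoSheaf 𝓘(ℝ, ℂ) F V).smooth (extendZero O (frameTwoForm e q γ)) y := by
  obtain ⟨K, hK, hKO, hK0⟩ := h.exists_closed
  refine (twoSheaf 𝓘(ℝ, ℂ) F V).smooth_extendZero h.isOpen hK hKO
    (fun y hy ↦ h.smooth_frameTwoForm hγ h.subset hy) (fun y hy hyK ↦ ?_) y
  have h1 : γ (extChartAt 𝓘(ℝ, ℂ) q y) = 0 := by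
    by_contra h1
    exact hK0 y hy hyK (mem_closedBox (hs _ h1))
  funext u v
  unfold frameTwoForm
  rw [h1, smul_zero, map_zero]
  rfl

/-- Compactly supported two-forms with vanishing integral are exact. -/
theorem exists_extTwo_eq_boxForm [T2Space S] (hfr : HasFlatFrames D n) {γ : ℂ → ι → ℝ}
    (hγ : ContDiff ℝ ∞ γ) (hs : ∀ z, γ z ≠ 0 → z ∈ Ioo a b ×ℂ Ioo c d)
    (hI : boxIntegral a b c d γ = 0) :
    ∃ ξ : Π x : S, TangentSpace 𝓘(ℝ, ℂ) x →L[ℝ] V x, ∀ y, FormSmoothAt 𝓘(ℝ, ℂ) F ξ y ∧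
      extendZero O (frameTwoForm e q γ) y = extTwo D ξ y := by
  obtain ⟨P, Q, hP, hQ, hPs, hQs, hd⟩ := exists_divergence_eq h.lt₁ hγ hs hI
  obtain ⟨K, hK, hKO, hK0⟩ := h.exists_closed
  -- The form `P dy - Q dx`, whose exterior derivative is the divergence of `(P, Q)` times the area
  -- form.
  let α : ℂ → ℂ →L[ℝ] (ι → ℝ) := fun z ↦
    Complex.imCLM.smulRight (P z) - Complex.reCLM.smulRight (Q z)
  have hα : ContDiff ℝ ∞ α := (contDiff_const.smulRight hP).sub (contDiff_const.smulRight hQ)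
  have hαd : ∀ z, fderiv ℝ α z 1 Complex.I - fderiv ℝ α z Complex.I 1 = γ z := by
    intro z
    have h1 : ∀ v : ℂ, HasFDerivAt (fun z ↦ v.im • P z - v.re • Q z)
        ((ContinuousLinearMap.apply ℝ (ι → ℝ) v).comp (fderiv ℝ α z)) z := fun v ↦
      (ContinuousLinearMap.apply ℝ (ι → ℝ) v).hasFDerivAt.comp z
        (hα.differentiable (by simp) z).hasFDerivAt
    have h2 : ∀ v : ℂ, HasFDerivAt (fun z ↦ v.im • P z - v.re • Q z)
        (v.im • fderiv ℝ P z - v.re • fderiv ℝ Q z) z := fun v ↦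
      ((hP.differentiable (by simp) z).hasFDerivAt.const_smul v.im).sub
        ((hQ.differentiable (by simp) z).hasFDerivAt.const_smul v.re)
    have h3 : ∀ u v : ℂ, fderiv ℝ α z u v = v.im • fderiv ℝ P z u - v.re • fderiv ℝ Q z u :=
      fun u v ↦ congrArg (fun T : ℂ →L[ℝ] (ι → ℝ) ↦ T u) ((h1 v).unique (h2 v))
    rw [h3, h3, ← hd z]
    simp
  have hsm : ∀ y ∈ O, FormSmoothAt 𝓘(ℝ, ℂ) F (frameForm e q α) y := fun y hy ↦
    h.formSmoothAt_frameForm hy (h.subset hy) hα.contDiffAt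
  have h0 : ∀ y ∈ O, y ∉ K → frameForm e q α y = 0 := by
    intro y hy hyK
    have hPQ : ∀ {R : ℂ → ι → ℝ}, (∀ z, R z ≠ 0 → z ∈ Ioo a b ×ℂ Ioo c d) →
        R (extChartAt 𝓘(ℝ, ℂ) q y) = 0 := fun hR ↦ by
      by_contra h1
      exact hK0 y hy hyK (mem_closedBox (hR _ h1))
    have h1 : α (extChartAt 𝓘(ℝ, ℂ) q y) = 0 := by
      ext v
      simp only [α, hPQ hPs, hPQ hQs]
      simp
    refine ContinuousLinearMap.ext fun u ↦ ?_
    exact (congrArg (fun T : ℂ →L[ℝ] (ι → ℝ) ↦ frameSum (fun i ↦ e i y)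
      (T (mfderiv 𝓘(ℝ, ℂ) 𝓘(ℝ, ℂ) (extChartAt 𝓘(ℝ, ℂ) q) y u))) h1).trans (map_zero _)
  have hfin : ∀ y, extendZero O (frameTwoForm e q γ) y =
      extendZero O (extTwo D (frameForm e q α)) y := by
    intro y
    by_cases hy : y ∈ O
    · rw [extendZero_of_mem hy, extendZero_of_mem hy]
      refine (isAlt_frameTwoForm γ y).ext_coordField (h.subset hy) (isAlt_extTwo hfr (hsm y hy)) ?_
      rw [frameTwoForm_coordField (h.subset hy), h.extTwo_frameForm hy (h.subset hy) hα.contDiffAt,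
        hαd]
    · rw [extendZero_of_notMem hy, extendZero_of_notMem hy]
  exact ⟨extendZero O (frameForm e q α), fun y ↦ ⟨(formSheaf 𝓘(ℝ, ℂ) F V).smooth_extendZero
    h.isOpen hK hKO hsm h0 y,
    (hfin y).trans ((extOp hfr).map_extendZero h.isOpen hK hKO hsm h0 y).symm⟩⟩

/-- Two-forms supported in a box. -/
lemma exists_eq_boxForm [T2Space S]
    {w : Π x : S, TangentSpace 𝓘(ℝ, ℂ) x → TangentSpace 𝓘(ℝ, ℂ) x → V x}
    (hw : ∀ y, (twoSheaf 𝓘(ℝ, ℂ) F V).smooth w y) (h0 : ∀ y ∉ boxPart q O a b c d, w y = 0) :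
    ∃ γ : ℂ → ι → ℝ, ContDiff ℝ ∞ γ ∧ (∀ z, γ z ≠ 0 → z ∈ Ioo a b ×ℂ Ioo c d) ∧
      (∀ y, w y = extendZero O (frameTwoForm e q γ) y) ∧ ∀ z, γ z ≠ 0 → ∃ y ∈ O,
        γ z = frameCoef (fun i ↦ e i y)
          (w y (coordField 𝓘(ℝ, ℂ) q 1 y) (coordField 𝓘(ℝ, ℂ) q Complex.I y)) := by
  let φ := extChartAt 𝓘(ℝ, ℂ) q
  let cw : S → ι → ℝ := fun y ↦ frameCoef (fun i ↦ e i y)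
    (w y (coordField 𝓘(ℝ, ℂ) q 1 y) (coordField 𝓘(ℝ, ℂ) q Complex.I y))
  let γ : ℂ → ι → ℝ := (φ '' O).indicator (cw ∘ φ.symm)
  have ho : IsOpen (φ '' O) := isOpen_extChartAt_image h.isOpen h.subset
  have hγy : ∀ y ∈ O, γ (φ y) = cw y := fun y hy ↦ by
    exact (indicator_of_mem (mem_image_of_mem φ hy) _).trans
      (congrArg cw (φ.left_inv (h.mem_source hy)))
  have hγs : ∀ z, γ z ≠ 0 → z ∈ Ioo a b ×ℂ Ioo c d := by
    intro z hz
    obtain ⟨y, hy, rfl⟩ := mem_of_indicator_ne_zero hz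
    by_contra h1
    refine hz ((hγy y hy).trans ?_)
    have h2 := h0 y fun h2 ↦ h1 h2.2
    simp only [cw, h2]
    exact map_zero _
  have hbox : IsClosed (Icc a b ×ℂ Icc c d) := isClosed_Icc.reProdIm isClosed_Icc
  refine ⟨γ, contDiff_iff_contDiffAt.2 fun z ↦ ?_, hγs, fun y ↦ ?_, fun z hz ↦ ?_⟩
  · by_cases hz : z ∈ φ '' O
    · obtain ⟨y, hy, rfl⟩ := hz
      refine (contDiffAt_comp_extChartAt_symm (h.subset hy)
        (h.contMDiffAt_coef hy ((hw y).2 q (h.subset hy) 1 Complex.I))).congr_of_eventuallyEq ?_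
      filter_upwards [ho.mem_nhds (mem_image_of_mem φ hy)] with z hz using indicator_of_mem hz _
    -- Outside the image of the nice set a neighbourhood misses the closed box, which contains the
    -- support.
    · refine (contDiffAt_const (c := 0)).congr_of_eventuallyEq ?_
      filter_upwards [hbox.isOpen_compl.mem_nhds fun hz' ↦ hz (h.box_subset hz')] with w hw
      by_contra h1
      exact hw (mem_closedBox (hγs _ h1))
  · by_cases hy : y ∈ O
    · rw [extendZero_of_mem hy]
      refine (hw y).1.ext_coordField (h.subset hy) (isAlt_frameTwoForm γ y) ?_
      rw [frameTwoForm_coordField (h.subset hy)]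
      refine Eq.trans ?_ (congrArg _ (hγy y hy).symm)
      exact (frameSum_frameCoef (h.bij y hy) _).symm
    · rw [extendZero_of_notMem hy]
      exact h0 y fun h2 ↦ hy h2.1
  · obtain ⟨y, hy, rfl⟩ := mem_of_indicator_ne_zero hz
    exact ⟨y, hy, hγy y hy⟩

end IsBox

end TopDegree
end

/-! ### Top degree classes supported in a box. -/

noncomputable section
section TopDegreeClasses

variable {S : Type*} [TopologicalSpace S] [ChartedSpace ℂ S] [IsManifold 𝓘(ℝ, ℂ) ∞ S] [T2Space S]
  {F : Type*} [NormedAddCommGroup F] [NormedSpace ℝ F] [FiniteDimensional ℝ F]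
  {V : S → Type*} [TopologicalSpace (TotalSpace F V)]
  [∀ x, AddCommGroup (V x)] [∀ x, Module ℝ (V x)] [∀ x, TopologicalSpace (V x)]
  [∀ x, IsTopologicalAddGroup (V x)] [∀ x, ContinuousSMul ℝ (V x)]
  [FiberBundle F V] [VectorBundle ℝ F V]
  {D : CovariantDerivative 𝓘(ℝ, ℂ) F V} {n : ℕ} (hfr : HasFlatFrames D n)
  {ι : Type} [Fintype ι] {e : ι → Π x : S, V x} {q : S} {O : Set S} {a b c d : ℝ}

open SheafOp

/-- The class of a two-form. -/
def twoClass (w : Π x, (twoSheaf 𝓘(ℝ, ℂ) F V).X x)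
    (hw : ∀ y, (twoSheaf 𝓘(ℝ, ℂ) F V).smooth w y) : coh₂ (extOp hfr) univ :=
  cls (extOp hfr) (SheafOp.zero _ (FineSheaf.zero 𝓘(ℝ, ℂ) S)) univ ⟨w, fun x _ ↦ ⟨hw x, rfl⟩⟩

variable {hfr}

lemma twoClass_eq {w w' : Π x, (twoSheaf 𝓘(ℝ, ℂ) F V).X x}
    {hw : ∀ y, (twoSheaf 𝓘(ℝ, ℂ) F V).smooth w y} {hw' : ∀ y, (twoSheaf 𝓘(ℝ, ℂ) F V).smooth w' y}
    {ξ : Π x : S, TangentSpace 𝓘(ℝ, ℂ) x →L[ℝ] V x}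
    (h : ∀ y, FormSmoothAt 𝓘(ℝ, ℂ) F ξ y ∧ w y - w' y = extTwo D ξ y) :
    twoClass hfr w hw = twoClass hfr w' hw' :=
  cls_eq.2 ⟨ξ, fun y _ ↦ h y⟩

lemma twoClass_congr {w w' : Π x, (twoSheaf 𝓘(ℝ, ℂ) F V).X x}
    {hw : ∀ y, (twoSheaf 𝓘(ℝ, ℂ) F V).smooth w y} {hw' : ∀ y, (twoSheaf 𝓘(ℝ, ℂ) F V).smooth w' y}
    (h : ∀ y, w y = w' y) : twoClass hfr w hw = twoClass hfr w' hw' := by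
  obtain rfl : w = w' := funext h
  rfl

lemma extendZero_frameTwoForm_add (γ γ' : ℂ → ι → ℝ) (y : S) :
    extendZero O (frameTwoForm e q fun z ↦ γ z + γ' z) y =
      extendZero O (frameTwoForm e q γ) y + extendZero O (frameTwoForm e q γ') y := by
  by_cases hy : y ∈ O
  · rw [extendZero_of_mem hy, extendZero_of_mem hy, extendZero_of_mem hy]
    funext u v
    exact (congrArg (frameSum fun i ↦ e i y) (smul_add _ _ _)).trans (_root_.map_add _ _ _)
  · rw [extendZero_of_notMem hy, extendZero_of_notMem hy, extendZero_of_notMem hy, add_zero]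

lemma extendZero_frameTwoForm_smul (r : ℝ) (γ : ℂ → ι → ℝ) (y : S) :
    extendZero O (frameTwoForm e q fun z ↦ r • γ z) y =
      r • extendZero O (frameTwoForm e q γ) y := by
  by_cases hy : y ∈ O
  · rw [extendZero_of_mem hy, extendZero_of_mem hy]
    funext u v
    exact (congrArg (frameSum fun i ↦ e i y) (smul_comm _ _ _)).trans (_root_.map_smul _ _ _)
  · rw [extendZero_of_notMem hy, extendZero_of_notMem hy, smul_zero]

/-- The class of a two-form supported in a box depends linearly on its integral. -/
theorem IsBox.exists_class (h : IsBox D e q O a b c d) (hfr : HasFlatFrames D n) :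
    ∃ T : (ι → ℝ) →ₗ[ℝ] coh₂ (extOp hfr) univ, ∀ (γ : ℂ → ι → ℝ) (hγ : ContDiff ℝ ∞ γ)
      (hs : ∀ z, γ z ≠ 0 → z ∈ Ioo a b ×ℂ Ioo c d),
      twoClass hfr (extendZero O (frameTwoForm e q γ)) (h.smooth_boxForm hγ hs) =
        T (boxIntegral a b c d γ) := by
  obtain ⟨φ, hφ, hφs, -, hφI⟩ := exists_boxIntegral_eq (G := ι → ℝ) h.lt₁ h.lt₂
  have h1 : ∀ v : ι → ℝ, ContDiff ℝ ∞ fun z ↦ φ z • v := fun v ↦ hφ.smul contDiff_const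
  have h2 : ∀ (v : ι → ℝ) (z : ℂ), φ z • v ≠ 0 → z ∈ Ioo a b ×ℂ Ioo c d := fun v z hz ↦
    hφs z (smul_ne_zero_iff.1 hz).1
  let T : (ι → ℝ) →ₗ[ℝ] coh₂ (extOp hfr) univ :=
    { toFun := fun v ↦ twoClass hfr (extendZero O (frameTwoForm e q fun z ↦ φ z • v))
        (h.smooth_boxForm (h1 v) (h2 v))
      map_add' := fun v v' ↦ by
        refine congrArg (cls (extOp hfr) _ univ) (Subtype.ext (funext fun y ↦ ?_))
        exact (congrArg (fun γ ↦ extendZero O (frameTwoForm e q γ) y)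
          (funext fun z ↦ smul_add _ _ _)).trans (extendZero_frameTwoForm_add _ _ y)
      map_smul' := fun r v ↦ by
        refine congrArg (cls (extOp hfr) _ univ) (Subtype.ext (funext fun y ↦ ?_))
        exact (congrArg (fun γ ↦ extendZero O (frameTwoForm e q γ) y)
          (funext fun z ↦ smul_comm _ _ _)).trans (extendZero_frameTwoForm_smul r _ y) }
  refine ⟨T, fun γ hγ hs ↦ ?_⟩
  -- Subtracting the bump of integral one times `v` leaves a coefficient of integral zero, hence an
  -- exact form.
  let v := boxIntegral a b c d γ
  obtain ⟨ξ, hξ⟩ := h.exists_extTwo_eq_boxForm hfr (hγ.sub (h1 v)) (fun z hz ↦ by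
      by_contra hz'
      refine hz ?_
      have e1 : γ z = 0 := by
        by_contra h3
        exact hz' (hs z h3)
      have e2 : φ z • v = 0 := by
        by_contra h3
        exact hz' (h2 v z h3)
      exact (congrArg₂ (· - ·) e1 e2).trans (sub_zero 0))
    ((boxIntegral_sub hγ.continuous (h1 v).continuous).trans
      (sub_eq_zero.2 (hφI le_rfl le_rfl le_rfl le_rfl v).symm))
  refine twoClass_eq (hw' := h.smooth_boxForm (h1 v) (h2 v)) (ξ := ξ) fun y ↦ ⟨(hξ y).1, ?_⟩
  refine Eq.trans ?_ (hξ y).2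
  refine sub_eq_of_eq_add ?_
  exact (congrArg (fun γ ↦ extendZero O (frameTwoForm e q γ) y)
    (funext fun z ↦ (sub_add_cancel (γ z) (φ z • v)).symm)).trans
      (extendZero_frameTwoForm_add _ _ y)

lemma FlatFrame.deriv_const (h : FlatFrame D e O) {y : S} (hy : y ∈ O) (v : ι → ℝ) :
    D (fun y ↦ frameSum (fun i ↦ e i y) v) y = 0 := by
  refine ContinuousLinearMap.ext fun u ↦ ?_
  refine (h.deriv_sum hy mdifferentiableAt_const u).trans ?_
  have : mvfderiv 𝓘(ℝ, ℂ) (fun _ : S ↦ v) y u = 0 := by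
    rw [mvfderiv_const]
    rfl
  exact (congrArg _ this).trans (_root_.map_zero _)

variable (hfr) in
/-- A functional on top degree classes vanishes on the two-forms supported near `x` and proportional
to the parallel extension of `v`. -/
def KilledAt (L : coh₂ (extOp hfr) univ →ₗ[ℝ] ℝ) (x : S) (v : V x) : Prop :=
  ∃ N ∈ 𝓝 x, ∃ s : Π x, V x, (∀ y ∈ N, SmoothAt 𝓘(ℝ, ℂ) F s y ∧ D s y = 0) ∧ s x = v ∧
    ∀ (w : Π x, (twoSheaf 𝓘(ℝ, ℂ) F V).X x) (hw : ∀ y, (twoSheaf 𝓘(ℝ, ℂ) F V).smooth w y),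
      (∀ y ∉ N, w y = 0) →
      (∀ y ∈ N, ∀ u u' : TangentSpace 𝓘(ℝ, ℂ) y, ∃ t : ℝ, w y u u' = t • s y) →
      L (twoClass hfr w hw) = 0

variable {L : coh₂ (extOp hfr) univ →ₗ[ℝ] ℝ} {T : (ι → ℝ) →ₗ[ℝ] coh₂ (extOp hfr) univ}

/-- A form in the box proportional to the parallel section has coefficient `t(z) a₀`. Its integral
is a multiple of `a₀`, and its class a multiple of `T a₀`. -/
lemma IsBox.killedAt_of (h : IsBox D e q O a b c d)
    (hT : ∀ (γ : ℂ → ι → ℝ) (hγ : ContDiff ℝ ∞ γ) (hs : ∀ z, γ z ≠ 0 → z ∈ Ioo a b ×ℂ Ioo c d),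
      twoClass hfr (extendZero O (frameTwoForm e q γ)) (h.smooth_boxForm hγ hs) =
        T (boxIntegral a b c d γ)) {y : S} (hy : y ∈ boxPart q O a b c d) {a₀ : ι → ℝ}
    (hL : L (T a₀) = 0) : KilledAt hfr L y (frameSum (fun i ↦ e i y) a₀) := by
  refine ⟨_, h.isOpen_boxPart.mem_nhds hy, fun y ↦ frameSum (fun i ↦ e i y) a₀,
    fun z hz ↦ ⟨h.smoothAt_sum hz.1 contMDiffAt_const, h.deriv_const hz.1 a₀⟩, rfl,
    fun w hw h0 ht ↦ ?_⟩
  obtain ⟨γ, hγ, hγs, hwγ, hγ'⟩ := h.exists_eq_boxForm hw h0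
  have h1 : ∀ z, ∃ t : ℝ, γ z = t • a₀ := by
    intro z
    by_cases hz : γ z = 0
    · exact ⟨0, hz.trans (zero_smul ℝ a₀).symm⟩
    · obtain ⟨y', hy', hz'⟩ := hγ' z hz
      by_cases hb : y' ∈ boxPart q O a b c d
      · obtain ⟨t, ht'⟩ := ht y' hb (coordField 𝓘(ℝ, ℂ) q 1 y')
          (coordField 𝓘(ℝ, ℂ) q Complex.I y')
        refine ⟨t, hz'.trans ((congrArg _ ht').trans ?_)⟩
        rw [_root_.map_smul, frameCoef_frameSum (h.bij y' hy')]
      · refine ⟨0, hz'.trans ?_⟩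
        rw [h0 y' hb, zero_smul]
        exact _root_.map_zero _
  choose t ht' using h1
  have h2 : boxIntegral a b c d γ = boxIntegral a b c d t • a₀ := by
    simp only [boxIntegral, ht', intervalIntegral.integral_smul_const]
  rw [twoClass_congr (hw' := h.smooth_boxForm hγ hγs) hwγ, hT γ hγ hγs, h2, _root_.map_smul,
    _root_.map_smul, hL, smul_zero]

/-- The functional is tested on a bump times `a₀` in a smaller box inside the neighbourhood that
witnesses the killing. There the given parallel section has coefficients `a₀`, and the class is `T
a₀`. -/
lemma IsBox.of_killedAt (h : IsBox D e q O a b c d)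
    (hT : ∀ (γ : ℂ → ι → ℝ) (hγ : ContDiff ℝ ∞ γ) (hs : ∀ z, γ z ≠ 0 → z ∈ Ioo a b ×ℂ Ioo c d),
      twoClass hfr (extendZero O (frameTwoForm e q γ)) (h.smooth_boxForm hγ hs) =
        T (boxIntegral a b c d γ)) {y : S} (hy : y ∈ boxPart q O a b c d) {a₀ : ι → ℝ}
    (hk : KilledAt hfr L y (frameSum (fun i ↦ e i y) a₀)) : L (T a₀) = 0 := by
  obtain ⟨N, hN, s, hs, hsy, hw⟩ := hk
  obtain ⟨O', hO', hyO', hn⟩ := h.toFlatFrame.exists_isNice hy.1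
    (Filter.inter_mem (h.isOpen_boxPart.mem_nhds hy) hN)
  have hsO : ∀ z ∈ O', s z = frameSum (fun i ↦ e i z) a₀ := by
    intro z hz
    have h1 := hn.coef_const (fun z hz ↦ (hs z (hO' hz).2).1) (fun z hz ↦ (hs z (hO' hz).2).2)
      hz hyO'
    rw [hsy, frameCoef_frameSum (hn.bij y hyO')] at h1
    rw [← h1, frameSum_frameCoef (hn.bij z hz)]
  let φ := extChartAt 𝓘(ℝ, ℂ) q
  have hΩ : IsOpen (φ '' O') := isOpen_extChartAt_image hn.isOpen
    fun z hz ↦ h.subset (hO' hz).1.1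
  obtain ⟨a', b', c', d', hab, hcd, -, hsub⟩ := exists_box_subset hΩ (mem_image_of_mem φ hyO')
  have hbox : ∀ z ∈ Icc a' b' ×ℂ Icc c' d', z ∈ Ioo a b ×ℂ Ioo c d := by
    intro z hz
    obtain ⟨y', hy', rfl⟩ := hsub hz
    exact (hO' hy').1.2
  obtain ⟨φ', hφ', hφs, -, hφI⟩ := exists_boxIntegral_eq (G := ι → ℝ) hab hcd
  have h1 : ContDiff ℝ ∞ fun z ↦ φ' z • a₀ := hφ'.smul contDiff_const
  have h2 : ∀ z, φ' z • a₀ ≠ 0 → z ∈ Icc a' b' ×ℂ Icc c' d' := fun z hz ↦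
    mem_closedBox (hφs z (smul_ne_zero_iff.1 hz).1)
  have hlo := hbox ⟨a', c'⟩ ⟨left_mem_Icc.2 hab.le, left_mem_Icc.2 hcd.le⟩
  have hhi := hbox ⟨b', d'⟩ ⟨right_mem_Icc.2 hab.le, right_mem_Icc.2 hcd.le⟩
  have h3 := hT _ h1 fun z hz ↦ hbox z (h2 z hz)
  rw [hφI hlo.1.1.le hhi.1.2.le hlo.2.1.le hhi.2.2.le a₀] at h3
  rw [← h3]
  have h4 : ∀ z ∉ O', extendZero O (frameTwoForm e q fun z ↦ φ' z • a₀) z = 0 := by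
    intro z hz
    by_cases hzO : z ∈ O
    · rw [extendZero_of_mem hzO]
      have h5 : φ' (φ z) • a₀ = 0 := by
        by_contra h5
        obtain ⟨y', hy', hyz⟩ := hsub (h2 _ h5)
        exact hz (φ.injOn (h.mem_source (hO' hy').1.1) (h.mem_source hzO) hyz ▸ hy')
      funext u v
      exact (congrArg (fun r ↦ frameSum (fun i ↦ e i z) (_ • r)) h5).trans
        ((congrArg _ (smul_zero _)).trans (_root_.map_zero _))
    · exact extendZero_of_notMem hzO
  refine hw _ _ (fun z hz ↦ h4 z fun hz' ↦ hz (hO' hz').2) fun z hz u u' ↦ ?_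
  by_cases hzO : z ∈ O'
  · have h5 : extendZero O (frameTwoForm e q fun z ↦ φ' z • a₀) z =
        frameTwoForm e q (fun z ↦ φ' z • a₀) z := extendZero_of_mem (hO' hzO).1.1
    rw [hsO z hzO]
    exact ⟨_, (congrFun (congrFun h5 u) u').trans
      ((congrArg (frameSum fun i ↦ e i z) (smul_smul _ _ _)).trans (_root_.map_smul _ _ _))⟩
  · exact ⟨0, (congrFun (congrFun (h4 z hzO) u) u').trans (zero_smul ℝ (s z)).symm⟩

end TopDegreeClasses
end

/-! ### Bounds for the second cohomology by irreducibility. -/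

noncomputable section
section TopDegreeVanishing

variable {S : Type*} [TopologicalSpace S] [ChartedSpace ℂ S] [IsManifold 𝓘(ℝ, ℂ) ∞ S] [T2Space S]
  {F : Type*} [NormedAddCommGroup F] [NormedSpace ℝ F] [FiniteDimensional ℝ F]
  {V : S → Type*} [TopologicalSpace (TotalSpace F V)]
  [∀ x, AddCommGroup (V x)] [∀ x, Module ℝ (V x)] [∀ x, TopologicalSpace (V x)]
  [∀ x, IsTopologicalAddGroup (V x)] [∀ x, ContinuousSMul ℝ (V x)]
  [FiberBundle F V] [VectorBundle ℝ F V]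
  {D : CovariantDerivative 𝓘(ℝ, ℂ) F V} {n : ℕ} {hfr : HasFlatFrames D n}

open SheafOp

lemma HasFlatFrames.exists_isBox (hfr : HasFlatFrames D n) (x : S) :
    ∃ (e : Fin n → Π x : S, V x) (q : S) (O : Set S) (a b c d : ℝ), IsBox D e q O a b c d ∧
      x ∈ boxPart q O a b c d := by
  obtain ⟨O, e, -, hx, hn⟩ := hfr.exists_isNice x Filter.univ_mem
  obtain ⟨a, b, c, d, hab, hcd, hz, hs⟩ := exists_box_subset
    (isOpen_extChartAt_image hn.isOpen hn.subset) (mem_image_of_mem (extChartAt 𝓘(ℝ, ℂ) x) hx)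
  exact ⟨e, x, O, a, b, c, d, { hn with lt₁ := hab, lt₂ := hcd, box_subset := hs }, hx, hz⟩

/-- Near every point the killed vectors are described by a linear functional in a parallel frame. -/
lemma exists_killedAt_iff (L : coh₂ (extOp hfr) univ →ₗ[ℝ] ℝ) (x : S) :
    ∃ (e : Fin n → Π x : S, V x) (U : Set S) (W₀ : Submodule ℝ (Fin n → ℝ)), x ∈ U ∧
      FlatFrame D e U ∧ ∀ y ∈ U, ∀ v, KilledAt hfr L y v ↔ frameCoef (fun i ↦ e i y) v ∈ W₀ := by
  obtain ⟨e, q, O, a, b, c, d, h, hx⟩ := hfr.exists_isBox x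
  obtain ⟨T, hT⟩ := h.exists_class hfr
  refine ⟨e, boxPart q O a b c d, LinearMap.ker (L.comp T), hx,
    h.toFlatFrame.mono h.isOpen_boxPart inter_subset_left, fun y hy v ↦ ?_⟩
  have hv := frameSum_frameCoef (h.bij y hy.1) v
  refine ⟨fun hk ↦ h.of_killedAt hT hy (by rwa [hv]), fun hk ↦ ?_⟩
  have := h.killedAt_of hT hy (L := L) hk
  rwa [hv] at this

/-- The vectors killed by a functional. -/
def killed (L : coh₂ (extOp hfr) univ →ₗ[ℝ] ℝ) (x : S) : Submodule ℝ (V x) where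
  carrier := {v | KilledAt hfr L x v}
  add_mem' := by
    obtain ⟨e, U, W₀, hx, -, h⟩ := exists_killedAt_iff L x
    intro v w hv hw
    have hv' := (h x hx v).1 hv
    have hw' := (h x hx w).1 hw
    refine (h x hx _).2 ?_
    rw [_root_.map_add]
    exact W₀.add_mem hv' hw'
  zero_mem' := by
    obtain ⟨e, U, W₀, hx, -, h⟩ := exists_killedAt_iff L x
    refine (h x hx _).2 ?_
    rw [_root_.map_zero]
    exact W₀.zero_mem
  smul_mem' := by
    obtain ⟨e, U, W₀, hx, -, h⟩ := exists_killedAt_iff L x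
    intro r v hv
    have hv' := (h x hx v).1 hv
    refine (h x hx _).2 ?_
    rw [_root_.map_smul]
    exact W₀.smul_mem r hv'

/-- Throughout a box the killed vectors are those with coefficients in the kernel of `L ∘ T`, with
the same `T` at every point. -/
lemma isParallelFamily_killed (L : coh₂ (extOp hfr) univ →ₗ[ℝ] ℝ) :
    IsParallelFamily D (killed L) := by
  intro x
  obtain ⟨e, U, W₀, hx, he, h⟩ := exists_killedAt_iff L x
  refine ⟨U, n, e, W₀, hx, he, fun y hy ↦ ?_⟩
  ext v
  refine (h y hy v).trans ⟨fun hv ↦ ⟨_, hv, frameSum_frameCoef (he.bij y hy) v⟩, ?_⟩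
  rintro ⟨a, ha, rfl⟩
  rwa [frameCoef_frameSum (he.bij y hy)]

/-- A functional killing all two-forms with small support vanishes. -/
lemma eq_zero_of_local [CompactSpace S] (L : coh₂ (extOp hfr) univ →ₗ[ℝ] ℝ)
    (h : ∀ x, ∃ U, IsOpen U ∧ x ∈ U ∧ ∀ (w : Π x, (twoSheaf 𝓘(ℝ, ℂ) F V).X x)
      (hw : ∀ y, (twoSheaf 𝓘(ℝ, ℂ) F V).smooth w y), (∀ y ∉ U, w y = 0) →
      L (twoClass hfr w hw) = 0) : L = 0 := by
  choose U hUo hxU hU using h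
  obtain ⟨t, ht⟩ := CompactSpace.elim_nhds_subcover U fun x ↦ (hUo x).mem_nhds (hxU x)
  -- A partition of unity writes any two-form as a finite sum of forms with small support.
  obtain ⟨ρ, hρ⟩ := SmoothPartitionOfUnity.exists_isSubordinate 𝓘(ℝ, ℂ) (isClosed_univ (X := S))
    (fun x : t ↦ U x) (fun x ↦ hUo x) (fun y _ ↦ by
      have : y ∈ ⋃ x ∈ t, U x := by rw [ht]; trivial
      obtain ⟨x, hx, hy⟩ := mem_iUnion₂.1 this
      exact mem_iUnion.2 ⟨⟨x, hx⟩, hy⟩)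
  refine LinearMap.ext ?_
  rintro ⟨z⟩
  let f : ((SheafOp.zero (twoSheaf 𝓘(ℝ, ℂ) F V) (FineSheaf.zero 𝓘(ℝ, ℂ) S)).ker univ) →ₗ[ℝ] ℝ :=
    L.comp (Submodule.mkQ _)
  have hz : ∀ i : t, ∀ y, (twoSheaf 𝓘(ℝ, ℂ) F V).smooth (fun y ↦ ρ i y • z.1 y) y := fun i y ↦
    (twoSheaf 𝓘(ℝ, ℂ) F V).smooth_mul (ρ i).contMDiff.contMDiffAt (z.2 y trivial).1
  have hsum : z = ∑ i, (⟨fun y ↦ ρ i y • z.1 y, fun y _ ↦ ⟨hz i y, rfl⟩⟩ :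
      (SheafOp.zero (twoSheaf 𝓘(ℝ, ℂ) F V) (FineSheaf.zero 𝓘(ℝ, ℂ) S)).ker univ) := by
    refine Subtype.ext (funext fun y ↦ ?_)
    rw [AddSubmonoidClass.coe_finsetSum, Finset.sum_apply]
    have h1 : ∑ i, ρ i y = 1 := by
      rw [← finsum_eq_sum_of_fintype]
      exact ρ.sum_eq_one (mem_univ y)
    refine Eq.trans ?_ (Finset.sum_smul ..)
    rw [h1, one_smul]
  show f z = 0
  rw [hsum, _root_.map_sum]
  refine Finset.sum_eq_zero fun i _ ↦ hU i _ (hz i) fun y hy ↦ ?_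
  have h1 : ρ i y = 0 := image_eq_zero_of_notMem_tsupport fun h1 ↦ hy (hρ i h1)
  rw [h1, zero_smul]

/-- For an irreducible connection, a functional on top degree classes which kills a non-zero
vector vanishes. -/
theorem exists_detecting [CompactSpace S] [PreconnectedSpace S] (hfr : HasFlatFrames D n)
    (hD : IsIrreducibleConn D) (x : S) : ∃ T : (Fin n → ℝ) →ₗ[ℝ] coh₂ (extOp hfr) univ,
      ∀ (L : coh₂ (extOp hfr) univ →ₗ[ℝ] ℝ) (v : Fin n → ℝ), v ≠ 0 → L (T v) = 0 → L = 0 := by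
  obtain ⟨e, q, O, a, b, c, d, h, hx⟩ := hfr.exists_isBox x
  obtain ⟨T, hT⟩ := h.exists_class hfr
  refine ⟨T, fun L v hv hL ↦ ?_⟩
  have hk : frameSum (fun i ↦ e i x) v ∈ killed L x := h.killedAt_of hT hx hL
  rcases (isParallelFamily_killed L).eq_bot_or_eq_top hD with h0 | h1
  · rw [h0 x, Submodule.mem_bot] at hk
    exact absurd ((h.bij x hx.1).1 (hk.trans (_root_.map_zero _).symm)) hv
  -- If every vector is killed, then so is every form supported in a box, since its class depends
  -- only on its integral.
  · refine eq_zero_of_local L fun y ↦ ?_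
    obtain ⟨e', q', O', a', b', c', d', h', hy⟩ := hfr.exists_isBox y
    obtain ⟨T', hT'⟩ := h'.exists_class hfr
    refine ⟨_, h'.isOpen_boxPart, hy, fun w hw h0 ↦ ?_⟩
    obtain ⟨γ, hγ, hγs, hwγ, -⟩ := h'.exists_eq_boxForm hw h0
    rw [twoClass_congr (hw' := h'.smooth_boxForm hγ hγs) hwγ, hT' γ hγ hγs]
    refine h'.of_killedAt hT' hy ?_
    have : frameSum (fun i ↦ e' i y) (boxIntegral a' b' c' d' γ) ∈ killed L y := by
      rw [h1 y]
      trivial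
    exact this

/-- The second cohomology of an irreducible connection of rank at least two vanishes. -/
theorem finrank_coh₂_eq_zero [CompactSpace S] [PreconnectedSpace S] [Nonempty S]
    (hfr : HasFlatFrames D n) (hD : IsIrreducibleConn D) (hn : 1 < n) :
    Module.finrank ℝ (coh₂ (extOp hfr) univ) = 0 := by
  obtain ⟨x⟩ := ‹Nonempty S›
  obtain ⟨T, hT⟩ := exists_detecting hfr hD x
  have hL : ∀ L : coh₂ (extOp hfr) univ →ₗ[ℝ] ℝ, L = 0 := by
    intro L
    -- A functional on a space of dimension at least two has a non-zero kernel vector, so every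
    -- functional on top classes kills something.
    have h1 : LinearMap.ker (L.comp T) ≠ ⊥ := LinearMap.ker_ne_bot_of_finrank_lt (by simpa using hn)
    obtain ⟨v, hv, hv0⟩ := (Submodule.ne_bot_iff _).1 h1
    exact hT L v hv0 hv
  have : Subsingleton (coh₂ (extOp hfr) univ) := subsingleton_of_forall_eq 0 fun w ↦
    (Module.forall_dual_apply_eq_zero_iff ℝ w).1 fun L ↦ by rw [hL L]; rfl
  exact Module.finrank_zero_of_subsingleton

/-- The second cohomology of a connection of rank one is at most one-dimensional. -/
theorem finrank_coh₂_le_one [CompactSpace S] [PreconnectedSpace S] [Nonempty S]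
    (hfr : HasFlatFrames D 1) (hD : IsIrreducibleConn D) :
    Module.finrank ℝ (coh₂ (extOp hfr) univ) ≤ 1 := by
  obtain ⟨x⟩ := ‹Nonempty S›
  obtain ⟨T, hT⟩ := exists_detecting hfr hD x
  -- A class outside the line of `T 1` would be separated from it by a functional, which kills `T 1`
  -- and is therefore zero.
  refine finrank_le_one (T fun _ ↦ 1) fun w ↦ ?_
  rw [← Submodule.mem_span_singleton]
  by_contra hw
  obtain ⟨L, hL, hL'⟩ := Submodule.exists_le_ker_of_notMem hw
  refine hL ?_
  have h1 : L (T fun _ ↦ 1) = 0 := hL' (Submodule.mem_span_singleton_self _)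
  rw [hT L (fun _ ↦ 1) (fun h ↦ one_ne_zero (congrFun h 0)) h1]
  rfl

end TopDegreeVanishing
end

/-! ### Integration of two-forms and Stokes' theorem. -/

noncomputable section
section Integration

/-- The integral of a derivative of a compactly supported function vanishes. -/
lemma integral_fderiv_eq_zero {E G : Type*} [NormedAddCommGroup E] [NormedSpace ℝ E]
    [FiniteDimensional ℝ E] [MeasurableSpace E] [BorelSpace E] {μ : MeasureTheory.Measure E}
    [μ.IsAddHaarMeasure] [NormedAddCommGroup G] [NormedSpace ℝ G] {g : E → G}
    (hg : ContDiff ℝ ∞ g) (hc : HasCompactSupport g) (v : E) : ∫ x, fderiv ℝ g x v ∂μ = 0 := by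
  have hd : Continuous fun x ↦ fderiv ℝ g x v := (hg.continuous_fderiv (by simp)).clm_apply
    continuous_const
  -- Integration by parts against the constant function one.
  have h := integral_smul_fderiv_eq_neg_fderiv_smul_of_integrable (μ := μ) (f := fun _ : E ↦ (1 : ℝ))
    (g := g) (v := v) (by simp)
    (by
      simp only [one_smul]
      exact hd.integrable_of_hasCompactSupport (hc.fderiv_apply ℝ v))
    (by
      simp only [one_smul]
      exact hg.continuous.integrable_of_hasCompactSupport hc)
    (fun _ _ ↦ differentiableAt_const _) (fun x _ ↦ hg.differentiable (by simp) x)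
  simpa using h

variable {S : Type*} [TopologicalSpace S] [ChartedSpace ℂ S] [IsManifold 𝓘(ℂ) ω S]

/-- Coordinate changes of a Riemann surface preserve the orientation. -/
lemma exists_hasFDerivAt_coord_change {q q' y : S} (hq : y ∈ (chartAt ℂ q).source)
    (hq' : y ∈ (chartAt ℂ q').source) : ∃ c : ℂ, HasFDerivAt
      (extChartAt 𝓘(ℝ, ℂ) q' ∘ (extChartAt 𝓘(ℝ, ℂ) q).symm)
      ((ContinuousLinearMap.toSpanSingleton ℂ c).restrictScalars ℝ : ℂ →L[ℝ] ℂ)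
      (extChartAt 𝓘(ℝ, ℂ) q y) := by
  have hy : y ∈ (extChartAt 𝓘(ℂ) q).source := by rwa [extChartAt_source]
  have h1 : ContDiffWithinAt ℂ ω (extChartAt 𝓘(ℂ) q' ∘ (extChartAt 𝓘(ℂ) q).symm) (range 𝓘(ℂ))
      (extChartAt 𝓘(ℂ) q y) := by
    refine contDiffWithinAt_ext_coord_change q' q ?_
    rw [PartialEquiv.trans_source]
    refine ⟨(extChartAt 𝓘(ℂ) q).map_source hy, ?_⟩
    rw [mem_preimage, (extChartAt 𝓘(ℂ) q).left_inv hy, extChartAt_source]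
    exact hq'
  have h2 : DifferentiableAt ℂ (extChartAt 𝓘(ℂ) q' ∘ (extChartAt 𝓘(ℂ) q).symm)
      (extChartAt 𝓘(ℂ) q y) := by
    rw [modelWithCornersSelf_coe, range_id, contDiffWithinAt_univ] at h1
    exact h1.differentiableAt (by simp)
  exact ⟨_, h2.hasDerivAt.hasFDerivAt.restrictScalars ℝ⟩

variable {F : Type*} [NormedAddCommGroup F] [NormedSpace ℝ F] [FiniteDimensional ℝ F]
  {V : S → Type*} [TopologicalSpace (TotalSpace F V)]
  [∀ x, AddCommGroup (V x)] [∀ x, Module ℝ (V x)] [∀ x, TopologicalSpace (V x)]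
  [∀ x, IsTopologicalAddGroup (V x)] [∀ x, ContinuousSMul ℝ (V x)]
  [FiberBundle F V] [VectorBundle ℝ F V]
  {D : CovariantDerivative 𝓘(ℝ, ℂ) F V} {n : ℕ}
  {ι : Type} [Fintype ι] {e : ι → Π x : S, V x} {q q' : S} {K : Set S}
  {w w' : Π x : S, TangentSpace 𝓘(ℝ, ℂ) x → TangentSpace 𝓘(ℝ, ℂ) x → V x}

/-- The coefficient of a two-form in a chart and a frame. -/
def twoCoef (e : ι → Π x : S, V x) (q : S)
    (w : Π x : S, TangentSpace 𝓘(ℝ, ℂ) x → TangentSpace 𝓘(ℝ, ℂ) x → V x) : ℂ → ι → ℝ :=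
  (extChartAt 𝓘(ℝ, ℂ) q).target.indicator ((fun y ↦ frameCoef (fun i ↦ e i y)
    (w y (coordField 𝓘(ℝ, ℂ) q 1 y) (coordField 𝓘(ℝ, ℂ) q Complex.I y))) ∘
      (extChartAt 𝓘(ℝ, ℂ) q).symm)

lemma twoCoef_extChartAt {y : S} (hy : y ∈ (chartAt ℂ q).source) :
    twoCoef e q w (extChartAt 𝓘(ℝ, ℂ) q y) = frameCoef (fun i ↦ e i y)
      (w y (coordField 𝓘(ℝ, ℂ) q 1 y) (coordField 𝓘(ℝ, ℂ) q Complex.I y)) := by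
  have hy' : y ∈ (extChartAt 𝓘(ℝ, ℂ) q).source := by rwa [extChartAt_source]
  refine (indicator_of_mem ((extChartAt 𝓘(ℝ, ℂ) q).map_source hy') _).trans ?_
  rw [Function.comp_apply, (extChartAt 𝓘(ℝ, ℂ) q).left_inv hy']

lemma exists_of_twoCoef_ne_zero (h0 : ∀ y ∉ K, w y = 0) {z : ℂ} (hz : twoCoef e q w z ≠ 0) :
    ∃ y ∈ K, y ∈ (chartAt ℂ q).source ∧ extChartAt 𝓘(ℝ, ℂ) q y = z := by
  have hzt := mem_of_indicator_ne_zero hz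
  have hs := (extChartAt 𝓘(ℝ, ℂ) q).map_target hzt
  rw [extChartAt_source] at hs
  refine ⟨_, ?_, hs, (extChartAt 𝓘(ℝ, ℂ) q).right_inv hzt⟩
  by_contra hK
  refine hz ?_
  rw [← (extChartAt 𝓘(ℝ, ℂ) q).right_inv hzt, twoCoef_extChartAt hs, h0 _ hK]
  exact map_zero _

/-- The integral of a two-form over a chart. -/
def chartIntegral (e : ι → Π x : S, V x) (q : S)
    (w : Π x : S, TangentSpace 𝓘(ℝ, ℂ) x → TangentSpace 𝓘(ℝ, ℂ) x → V x) : ι → ℝ :=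
  ∫ z, twoCoef e q w z

/-- The integral of a two-form does not depend on the chart. -/
theorem chartIntegral_eq (hw : ∀ y, IsAlt (w y)) (hq : K ⊆ (chartAt ℂ q).source)
    (hq' : K ⊆ (chartAt ℂ q').source) (h0 : ∀ y ∉ K, w y = 0) :
    chartIntegral e q w = chartIntegral e q' w := by
  let φ := extChartAt 𝓘(ℝ, ℂ) q
  let φ' := extChartAt 𝓘(ℝ, ℂ) q'
  let Z := (chartAt ℂ q).source ∩ (chartAt ℂ q').source
  have hZo : IsOpen Z := (chartAt ℂ q).open_source.inter (chartAt ℂ q').open_source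
  have hφ : ∀ y ∈ Z, φ.symm (φ y) = y := fun y hy ↦
    φ.left_inv (by simpa only [φ, extChartAt_source] using hy.1)
  have hm : MeasurableSet (φ '' Z) :=
    (isOpen_extChartAt_image hZo inter_subset_left).measurableSet
  choose! c hc using fun y (hy : y ∈ Z) ↦ exists_hasFDerivAt_coord_change hy.1 hy.2
  have him : (φ' ∘ φ.symm) '' (φ '' Z) = φ' '' Z := by
    ext z
    constructor
    · rintro ⟨_, ⟨y, hy, rfl⟩, rfl⟩
      exact ⟨y, hy, (congrArg φ' (hφ y hy)).symm⟩
    · rintro ⟨y, hy, rfl⟩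
      exact ⟨_, ⟨y, hy, rfl⟩, congrArg φ' (hφ y hy)⟩
  have hinj : InjOn (φ' ∘ φ.symm) (φ '' Z) := by
    rintro _ ⟨y, hy, rfl⟩ _ ⟨y', hy', rfl⟩ h
    have h1 : φ' y = φ' y' := by
      refine (congrArg φ' (hφ y hy)).symm.trans (h.trans (congrArg φ' (hφ y' hy')))
    rw [φ'.injOn (by simpa only [φ', extChartAt_source] using hy.2)
      (by simpa only [φ', extChartAt_source] using hy'.2) h1]
  have h1 := MeasureTheory.integral_image_eq_integral_abs_det_fderiv_smul MeasureTheory.volume hm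
    (f := φ' ∘ φ.symm) (f' := fun z ↦ ((ContinuousLinearMap.toSpanSingleton ℂ
      (c (φ.symm z))).restrictScalars ℝ : ℂ →L[ℝ] ℂ))
    (by
      rintro _ ⟨y, hy, rfl⟩
      rw [hφ y hy]
      exact (hc y hy).hasFDerivWithinAt) hinj (twoCoef e q' w)
  have hin : ∀ {q : S}, (∀ z, twoCoef e q w z ≠ 0 → z ∈ extChartAt 𝓘(ℝ, ℂ) q '' Z) →
      chartIntegral e q w = ∫ z in extChartAt 𝓘(ℝ, ℂ) q '' Z, twoCoef e q w z := fun h ↦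
    (MeasureTheory.setIntegral_eq_integral_of_forall_compl_eq_zero fun z hz ↦ by
      by_contra h1
      exact hz (h z h1)).symm
  have hout : ∀ {q : S}, ∀ z, twoCoef e q w z ≠ 0 → z ∈ extChartAt 𝓘(ℝ, ℂ) q '' Z := by
    intro q z hz
    obtain ⟨y, hy, -, rfl⟩ := exists_of_twoCoef_ne_zero h0 hz
    exact ⟨y, ⟨hq hy, hq' hy⟩, rfl⟩
  rw [hin hout, hin hout]
  rw [him] at h1
  refine Eq.trans ?_ h1.symm
  refine MeasureTheory.setIntegral_congr_fun hm ?_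
  rintro _ ⟨y, hy, rfl⟩
  have hco : ∀ u : ℂ, coordField 𝓘(ℝ, ℂ) q u y = coordField 𝓘(ℝ, ℂ) q' (u * c y) y := by
    intro u
    have h2 := mvfderiv_coordField (I := 𝓘(ℝ, ℂ)) hy.1 (f := φ')
      ((contMDiffAt_extChartAt' (n := ∞) hy.2).mdifferentiableAt (by simp)) u
    rw [(hc y hy).fderiv] at h2
    rw [← coordField_mfderiv hy.2 (coordField 𝓘(ℝ, ℂ) q u y)]
    exact congrArg (fun u : ℂ ↦ coordField 𝓘(ℝ, ℂ) q' u y) h2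
  -- Multiplication by `c` has real determinant `|c|²`. This is non-negative and equals the factor
  -- by which the coefficient of a two-form changes, so the absolute value in the change of
  -- variables does no harm.
  have hdet : ((ContinuousLinearMap.toSpanSingleton ℂ (c y)).restrictScalars ℝ : ℂ →L[ℝ] ℂ).det =
      Complex.normSq (c y) := by
    rw [← Algebra.norm_complex_apply]
    simp [ContinuousLinearMap.det, LinearMap.det_restrictScalars]
  show twoCoef e q w (φ y) = |ContinuousLinearMap.det _| • twoCoef e q' w (φ' (φ.symm (φ y)))
  rw [hφ y hy, hdet, abs_of_nonneg (Complex.normSq_nonneg _)]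
  refine (twoCoef_extChartAt hy.1).trans ?_
  refine Eq.trans ?_ (congrArg _ (twoCoef_extChartAt hy.2).symm)
  rw [hco, hco, (hw y).apply_eq, map_smul]
  congr 1
  simp [Complex.normSq_apply]

section

variable [T2Space S] [CompactSpace S]

/-- A smooth function supported in a chart gives a smooth compactly supported function on the
plane. -/
lemma contDiff_indicator_chart {G : Type*} [NormedAddCommGroup G] [NormedSpace ℝ G]
    (hK : IsClosed K) (hq : K ⊆ (chartAt ℂ q).source) {c : S → G}
    (hc : ∀ y ∈ (chartAt ℂ q).source, ContMDiffAt 𝓘(ℝ, ℂ) 𝓘(ℝ, G) ∞ c y) (h0 : ∀ y ∉ K, c y = 0) :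
    ContDiff ℝ ∞ ((extChartAt 𝓘(ℝ, ℂ) q).target.indicator (c ∘ (extChartAt 𝓘(ℝ, ℂ) q).symm)) ∧
      HasCompactSupport
        ((extChartAt 𝓘(ℝ, ℂ) q).target.indicator (c ∘ (extChartAt 𝓘(ℝ, ℂ) q).symm)) := by
  let φ := extChartAt 𝓘(ℝ, ℂ) q
  have hKs : K ⊆ φ.source := by rwa [extChartAt_source]
  have hKc : IsCompact (φ '' K) := hK.isCompact.image_of_continuousOn
    ((continuousOn_extChartAt q).mono hKs)
  have hz : ∀ z ∉ φ '' K, φ.target.indicator (c ∘ φ.symm) z = 0 := by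
    intro z hz
    by_contra h
    have hzt := mem_of_indicator_ne_zero h
    rw [indicator_of_mem hzt] at h
    refine hz ⟨φ.symm z, ?_, φ.right_inv hzt⟩
    by_contra hk
    exact h (h0 _ hk)
  refine ⟨contDiff_iff_contDiffAt.2 fun z ↦ ?_, HasCompactSupport.intro hKc hz⟩
  by_cases hzt : z ∈ φ.target
  · have hs := φ.map_target hzt
    rw [extChartAt_source] at hs
    have h1 := contDiffAt_comp_extChartAt_symm hs (hc (φ.symm z) hs)
    have h2 : extChartAt 𝓘(ℝ, ℂ) q (φ.symm z) = z := φ.right_inv hzt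
    rw [h2] at h1
    refine h1.congr_of_eventuallyEq ?_
    filter_upwards [(isOpen_extChartAt_target q).mem_nhds hzt] with x hx using indicator_of_mem hx _
  · have hzK : z ∉ φ '' K := by
      rintro ⟨y, hy, rfl⟩
      exact hzt (φ.map_source (hKs hy))
    refine (contDiffAt_const (c := (0 : G))).congr_of_eventuallyEq ?_
    filter_upwards [hKc.isClosed.isOpen_compl.mem_nhds hzK] with x hx using hz x hx

variable (he : FlatFrame D e univ)
include he

lemma integrable_twoCoef (hK : IsClosed K) (hq : K ⊆ (chartAt ℂ q).source)
    (hw : ∀ y, (twoSheaf 𝓘(ℝ, ℂ) F V).smooth w y) (h0 : ∀ y ∉ K, w y = 0) :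
    MeasureTheory.Integrable (twoCoef e q w) := by
  have h := contDiff_indicator_chart hK hq (c := fun y ↦ frameCoef (fun i ↦ e i y)
    (w y (coordField 𝓘(ℝ, ℂ) q 1 y) (coordField 𝓘(ℝ, ℂ) q Complex.I y)))
    (fun y hy ↦ he.contMDiffAt_coef trivial ((hw y).2 q hy _ _)) (fun y hy ↦ by
      rw [h0 y hy]
      exact map_zero _)
  exact h.1.continuous.integrable_of_hasCompactSupport h.2

lemma chartIntegral_sum {κ : Type*} (t : Finset κ) (hK : IsClosed K)
    (hq : K ⊆ (chartAt ℂ q).source)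
    {w : κ → Π x : S, TangentSpace 𝓘(ℝ, ℂ) x → TangentSpace 𝓘(ℝ, ℂ) x → V x}
    (hw : ∀ k y, (twoSheaf 𝓘(ℝ, ℂ) F V).smooth (w k) y) (h0 : ∀ k, ∀ y ∉ K, w k y = 0) :
    chartIntegral e q (fun y ↦ ∑ k ∈ t, w k y) = ∑ k ∈ t, chartIntegral e q (w k) := by
  unfold chartIntegral
  rw [← MeasureTheory.integral_finsetSum _ fun k _ ↦ integrable_twoCoef he hK hq (hw k) (h0 k)]
  congr 1
  funext z
  by_cases hz : z ∈ (extChartAt 𝓘(ℝ, ℂ) q).target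
  · have hs := (extChartAt 𝓘(ℝ, ℂ) q).map_target hz
    rw [extChartAt_source] at hs
    rw [← (extChartAt 𝓘(ℝ, ℂ) q).right_inv hz, twoCoef_extChartAt hs,
      Finset.sum_congr rfl fun k _ ↦ twoCoef_extChartAt hs, ← map_sum, Finset.sum_apply,
      Finset.sum_apply]
  · refine (indicator_of_notMem hz _).trans (Eq.symm ?_)
    exact Finset.sum_eq_zero fun k _ ↦ indicator_of_notMem hz _

/-- Stokes' theorem for forms supported in a chart. -/
lemma chartIntegral_extTwo (hK : IsClosed K) (hq : K ⊆ (chartAt ℂ q).source)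
    {ξ : Π x : S, TangentSpace 𝓘(ℝ, ℂ) x →L[ℝ] V x} (hξ : ∀ y, FormSmoothAt 𝓘(ℝ, ℂ) F ξ y)
    (h0 : ∀ y ∉ K, ξ y = 0) : chartIntegral e q (extTwo D ξ) = 0 := by
  let φ := extChartAt 𝓘(ℝ, ℂ) q
  obtain ⟨hg, hc⟩ := contDiff_indicator_chart hK hq (c := formCoef 𝓘(ℝ, ℂ) e q ξ)
    (fun y hy ↦ he.contMDiffAt_formCoef trivial hy (hξ y)) (fun y hy ↦ by
      ext1 u
      rw [formCoef_apply, h0 y hy]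
      exact map_zero _)
  set g := φ.target.indicator (formCoef 𝓘(ℝ, ℂ) e q ξ ∘ φ.symm)
  have hgd : ∀ (u v z : ℂ), fderiv ℝ g z u v = fderiv ℝ (fun z ↦ g z v) z u := by
    intro u v z
    rw [fderiv_clm_apply (hg.differentiable (by simp) z) (differentiableAt_const _)]
    simp
  have hK' : IsClosed (φ '' K) := (hK.isCompact.image_of_continuousOn
    ((continuousOn_extChartAt q).mono (by rwa [extChartAt_source]))).isClosed
  have key : twoCoef e q (extTwo D ξ) = fun z ↦ fderiv ℝ (fun z ↦ g z Complex.I) z 1 -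
      fderiv ℝ (fun z ↦ g z 1) z Complex.I := by
    funext z
    rw [← hgd, ← hgd]
    by_cases hz : z ∈ φ.target
    · have hs := φ.map_target hz
      rw [extChartAt_source] at hs
      have e1 : g =ᶠ[𝓝 z] formCoef 𝓘(ℝ, ℂ) e q ξ ∘ φ.symm := by
        filter_upwards [(isOpen_extChartAt_target q).mem_nhds hz] with x hx using indicator_of_mem hx _
      rw [e1.fderiv_eq]
      have hzz : extChartAt 𝓘(ℝ, ℂ) q (φ.symm z) = z := φ.right_inv hz
      have h2 := twoCoef_extChartAt (e := e) (w := extTwo D ξ) hs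
      rw [extTwo_apply (hξ _) (contMDiffAt_coordField hs 1) (contMDiffAt_coordField hs Complex.I),
        he.extD_coordField trivial hs (hξ _), frameCoef_frameSum (he.bij _ trivial), hzz] at h2
      exact h2
    · have e1 : g =ᶠ[𝓝 z] 0 := by
        have hzK : z ∉ φ '' K := by
          rintro ⟨y, hy, rfl⟩
          exact hz (φ.map_source (by simpa only [φ, extChartAt_source] using hq hy))
        filter_upwards [hK'.isOpen_compl.mem_nhds hzK] with x hx
        by_contra h1
        have hxt := mem_of_indicator_ne_zero h1
        refine h1 ((indicator_of_mem hxt _).trans ?_)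
        have h3 : φ.symm x ∉ K := fun h ↦ hx ⟨_, h, φ.right_inv hxt⟩
        ext1 u
        rw [Function.comp_apply, formCoef_apply, h0 _ h3]
        exact map_zero _
      rw [e1.fderiv_eq]
      refine (indicator_of_notMem hz _).trans ?_
      simp
  have hgs : ∀ v : ℂ, ContDiff ℝ ∞ fun z ↦ g z v := fun v ↦ hg.clm_apply contDiff_const
  have hcs : ∀ v : ℂ, HasCompactSupport fun z ↦ g z v := fun v ↦
    hc.comp_left (g := fun L : ℂ →L[ℝ] (ι → ℝ) ↦ L v) rfl
  have hi : ∀ u v : ℂ, MeasureTheory.Integrable fun z ↦ fderiv ℝ (fun z ↦ g z v) z u := fun u v ↦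
    (((hgs v).continuous_fderiv (by simp)).clm_apply
      continuous_const).integrable_of_hasCompactSupport ((hcs v).fderiv_apply ℝ u)
  unfold chartIntegral
  rw [key, MeasureTheory.integral_sub (hi _ _) (hi _ _), integral_fderiv_eq_zero (hgs _) (hcs _),
    integral_fderiv_eq_zero (hgs _) (hcs _), sub_zero]

omit he in
lemma SheafOp.map_finsetSum {Φ Ψ : FineSheaf 𝓘(ℝ, ℂ) S} (d : SheafOp Φ Ψ) {κ : Type*}
    (t : Finset κ) {s : κ → Π x, Φ.X x} {x : S} (h : ∀ k, Φ.smooth (s k) x) :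
    Φ.smooth (∑ k ∈ t, s k) x ∧ d (∑ k ∈ t, s k) x = ∑ k ∈ t, d (s k) x := by
  classical
  induction t using Finset.induction_on with
  | empty => exact ⟨Φ.smooth_zero x, d.map_zero x⟩
  | insert k t hk ih =>
    rw [Finset.sum_insert hk, Finset.sum_insert hk]
    exact ⟨Φ.smooth_add (h k) ih.1, (d.map_add (h k) ih.1).trans (congrArg _ ih.2)⟩

/-- Stokes' theorem on a closed surface. -/
theorem chartIntegral_eq_zero_of_exact (hfr : HasFlatFrames D n) (hK : IsClosed K)
    (hq : K ⊆ (chartAt ℂ q).source) {ξ : Π x : S, TangentSpace 𝓘(ℝ, ℂ) x →L[ℝ] V x}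
    (hξ : ∀ y, FormSmoothAt 𝓘(ℝ, ℂ) F ξ y) (h0 : ∀ y ∉ K, extTwo D ξ y = 0) :
    chartIntegral e q (extTwo D ξ) = 0 := by
  obtain ⟨t, ht⟩ := CompactSpace.elim_nhds_subcover (fun x : S ↦ (chartAt ℂ x).source)
    fun x ↦ (chartAt ℂ x).open_source.mem_nhds (mem_chart_source ℂ x)
  obtain ⟨ρ, hρ⟩ := SmoothPartitionOfUnity.exists_isSubordinate 𝓘(ℝ, ℂ) (isClosed_univ (X := S))
    (fun x : t ↦ (chartAt ℂ (x : S)).source) (fun x ↦ (chartAt ℂ (x : S)).open_source)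
    (fun y _ ↦ by
      have : y ∈ ⋃ x ∈ t, (chartAt ℂ x).source := by rw [ht]; trivial
      obtain ⟨x, hx, hy⟩ := mem_iUnion₂.1 this
      exact mem_iUnion.2 ⟨⟨x, hx⟩, hy⟩)
  have h1 : ∀ y, ∑ i, ρ i y = 1 := fun y ↦ by
    rw [← finsum_eq_sum_of_fintype]
    exact ρ.sum_eq_one (mem_univ y)
  have hρ0 : ∀ i, ∀ y ∉ tsupport (ρ i), ρ i y = 0 := fun i y hy ↦ image_eq_zero_of_notMem_tsupport hy
  have hρK : ∀ i, IsClosed (tsupport (ρ i)) := fun i ↦ isClosed_tsupport _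
  let A := twoSheaf 𝓘(ℝ, ℂ) F V
  let η : t → Π x : S, TangentSpace 𝓘(ℝ, ℂ) x →L[ℝ] V x := fun i y ↦ ρ i y • ξ y
  have hη : ∀ i y, FormSmoothAt 𝓘(ℝ, ℂ) F (η i) y := fun i y ↦
    (formSheaf 𝓘(ℝ, ℂ) F V).smooth_mul (ρ i).contMDiff.contMDiffAt (hξ y)
  have hη0 : ∀ i, ∀ y ∉ tsupport (ρ i), η i y = 0 := fun i y hy ↦ by
    show ρ i y • ξ y = 0
    rw [hρ0 i y hy, zero_smul]
  have hd : ∀ {ζ : Π x : S, TangentSpace 𝓘(ℝ, ℂ) x →L[ℝ] V x},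
      (∀ y, FormSmoothAt 𝓘(ℝ, ℂ) F ζ y) → ∀ y, A.smooth (extTwo D ζ) y := fun h y ↦
    (extOp hfr).smooth_map (Filter.Eventually.of_forall h)
  have hd0 : ∀ i, ∀ y ∉ tsupport (ρ i), extTwo D (η i) y = 0 := fun i y hy ↦
    ((extOp hfr).map_congr (s := 0) ((formSheaf 𝓘(ℝ, ℂ) F V).smooth_zero y) (by
      filter_upwards [(hρK i).isOpen_compl.mem_nhds hy] with z hz using hη0 i z hz)).trans
        ((extOp hfr).map_zero y)
  have hm : ∀ (i : t) {w : Π x, A.X x}, (∀ y, A.smooth w y) →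
      ∀ y, A.smooth (fun y ↦ ρ i y • w y) y := fun i w hw y ↦
    A.smooth_mul (ρ i).contMDiff.contMDiffAt (hw y)
  have hsum : ∀ y, extTwo D ξ y = ∑ i, extTwo D (η i) y := by
    intro y
    have e1 : ξ = ∑ i, η i := by
      funext y
      rw [Finset.sum_apply]
      refine Eq.trans ?_ (Finset.sum_smul ..)
      rw [h1, one_smul]
    refine (congrArg (fun ζ ↦ extTwo D ζ y) e1).trans ?_
    exact ((extOp hfr).map_finsetSum Finset.univ (fun i ↦ hη i y)).2
  have hpart : ∀ (w : Π x, A.X x), w = fun y ↦ ∑ i, ρ i y • w y := fun w ↦ by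
    funext y
    rw [← Finset.sum_smul, h1, one_smul]
  -- The form `ρ_i d(ρ_j ξ)` is supported in both charts `i` and `j`, so its integral may be moved
  -- from one to the other. Summing over `i` in chart `j` then leaves `d(ρ_j ξ)`, whose integral
  -- vanishes.
  let T : t → t → Π x, A.X x := fun i j y ↦ ρ i y • extTwo D (η j) y
  have hT : ∀ i j y, A.smooth (T i j) y := fun i j ↦ hm i (hd (hη j))
  have hTi : ∀ i j, ∀ y ∉ tsupport (ρ i), T i j y = 0 := fun i j y hy ↦ by
    show ρ i y • extTwo D (η j) y = 0
    rw [hρ0 i y hy, zero_smul]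
  have hTj : ∀ i j, ∀ y ∉ tsupport (ρ j), T i j y = 0 := fun i j y hy ↦ by
    show ρ i y • extTwo D (η j) y = 0
    rw [hd0 j y hy, smul_zero]
  calc chartIntegral e q (extTwo D ξ)
      = ∑ i, chartIntegral e q (fun y ↦ ρ i y • extTwo D ξ y) := by
        refine (congrArg (chartIntegral e q) (hpart _)).trans
          (chartIntegral_sum he Finset.univ hK hq (fun i ↦ hm i (hd hξ)) fun i y hy ↦ ?_)
        exact (congrArg (ρ i y • ·) (h0 y hy)).trans (smul_zero _)
    _ = ∑ i : t, chartIntegral e (i : S) (fun y ↦ ρ i y • extTwo D ξ y) := by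
        refine Finset.sum_congr rfl fun i _ ↦ chartIntegral_eq (K := K ∩ tsupport (ρ i))
          (fun y ↦ (hm i (hd hξ) y).1) (inter_subset_left.trans hq) (inter_subset_right.trans (hρ i))
          fun y hy ↦ ?_
        by_cases hyK : y ∈ K
        · rw [hρ0 i y fun h ↦ hy ⟨hyK, h⟩, zero_smul]
        · rw [h0 y hyK, smul_zero]
    _ = ∑ i : t, ∑ j, chartIntegral e (i : S) (T i j) := by
        refine Finset.sum_congr rfl fun i _ ↦ ?_
        rw [← chartIntegral_sum he Finset.univ (hρK i) (hρ i) (hT i) (hTi i)]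
        congr 1
        funext y
        rw [hsum y]
        exact Finset.smul_sum
    _ = ∑ i, ∑ j : t, chartIntegral e (j : S) (T i j) := by
        refine Finset.sum_congr rfl fun i _ ↦ Finset.sum_congr rfl fun j _ ↦
          chartIntegral_eq (K := tsupport (ρ i) ∩ tsupport (ρ j)) (fun y ↦ (hT i j y).1)
          (inter_subset_left.trans (hρ i)) (inter_subset_right.trans (hρ j)) fun y hy ↦ ?_
        by_cases hyi : y ∈ tsupport (ρ i)
        · exact hTj i j y fun h ↦ hy ⟨hyi, h⟩
        · exact hTi i j y hyi
    _ = ∑ j : t, chartIntegral e (j : S) (extTwo D (η j)) := by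
        rw [Finset.sum_comm]
        refine Finset.sum_congr rfl fun j _ ↦ ?_
        rw [← chartIntegral_sum he Finset.univ (hρK j) (hρ j) (fun i ↦ hT i j) (fun i ↦ hTj i j)]
        exact congrArg (chartIntegral e (j : S)) (hpart _).symm
    _ = 0 := Finset.sum_eq_zero fun j _ ↦ chartIntegral_extTwo he (hρK j) (hρ j) (hη j) (hη0 j)

end

open SheafOp

/-- The second cohomology of a closed surface with coefficients in a trivial flat bundle does not
vanish. -/
theorem nontrivial_coh₂ [T2Space S] [CompactSpace S] [Nonempty S] (hfr : HasFlatFrames D n)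
    (hn : 0 < n) {e : Fin n → Π x : S, V x} (he : FlatFrame D e univ) :
    Nontrivial (coh₂ (extOp hfr) univ) := by
  obtain ⟨x⟩ := ‹Nonempty S›
  obtain ⟨O, -, hx, hO⟩ := he.exists_isNice (mem_univ x) Filter.univ_mem
  obtain ⟨a, b, c, d, hab, hcd, hz, hs⟩ := exists_box_subset
    (isOpen_extChartAt_image hO.isOpen hO.subset) (mem_image_of_mem (extChartAt 𝓘(ℝ, ℂ) x) hx)
  have h : IsBox D e x O a b c d := { hO with lt₁ := hab, lt₂ := hcd, box_subset := hs }
  -- A non-negative bump of integral one. Were its class zero, Stokes' theorem would make the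
  -- integral vanish.
  obtain ⟨φ, hφ, hφs, hφ0, hφ1⟩ := exists_boxIntegral_eq (G := ℝ) hab hcd
  let γ : ℂ → Fin n → ℝ := fun z ↦ φ z • fun _ ↦ 1
  have hγ : ContDiff ℝ ∞ γ := hφ.smul contDiff_const
  have hγs : ∀ z, γ z ≠ 0 → z ∈ Ioo a b ×ℂ Ioo c d := fun z hz ↦
    hφs z fun h0 ↦ hz (by simp [γ, h0])
  refine ⟨_, 0, fun h0 : twoClass hfr _ (h.smooth_boxForm hγ hγs) = 0 ↦ ?_⟩
  obtain ⟨ξ, hξ⟩ := cls_eq_zero.1 h0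
  have hw : extendZero O (frameTwoForm e x γ) = extTwo D ξ := funext fun y ↦ (hξ y trivial).2
  obtain ⟨K, hK, hKO, hK0⟩ := h.exists_closed
  have hoff : ∀ y ∉ K, extendZero O (frameTwoForm e x γ) y = 0 := by
    intro y hy
    by_cases hyO : y ∈ O
    · have h1 : γ (extChartAt 𝓘(ℝ, ℂ) x y) = 0 := by
        by_contra h1
        exact hK0 y hyO hy (mem_closedBox (hγs _ h1))
      rw [extendZero_of_mem hyO]
      funext u v
      unfold frameTwoForm
      rw [h1, smul_zero, _root_.map_zero]
      rfl
    · exact extendZero_of_notMem hyO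
  have hI : chartIntegral e x (extTwo D ξ) = 0 :=
    chartIntegral_eq_zero_of_exact he hfr hK (hKO.trans h.subset) (fun y ↦ (hξ y trivial).1)
      fun y hy ↦ (congrFun hw y).symm.trans (hoff y hy)
  have hco : twoCoef e x (extTwo D ξ) = γ := by
    rw [← hw]
    funext z
    by_cases hzt : z ∈ extChartAt 𝓘(ℝ, ℂ) x '' O
    · obtain ⟨y, hy, rfl⟩ := hzt
      rw [twoCoef_extChartAt (h.subset hy), extendZero_of_mem hy,
        frameTwoForm_coordField (h.subset hy), frameCoef_frameSum (he.bij y trivial)]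
    · have h1 : γ z = 0 := by
        by_contra h1
        exact hzt (hs (mem_closedBox (hγs _ h1)))
      rw [h1]
      by_contra h2
      obtain ⟨y, hy, -, rfl⟩ := exists_of_twoCoef_ne_zero hoff h2
      exact hzt ⟨y, hKO hy, rfl⟩
  have hc : HasCompactSupport φ := HasCompactSupport.intro
    (isCompact_Icc.reProdIm isCompact_Icc) fun z hz ↦ by
      by_contra h1
      exact hz (mem_closedBox (hφs z h1))
  have hint : MeasureTheory.Integrable φ := hφ.continuous.integrable_of_hasCompactSupport hc
  have h1 : ∫ z, φ z = 0 := by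
    unfold chartIntegral at hI
    rw [hco] at hI
    have h2 := congrFun hI ⟨0, hn⟩
    rw [integral_smul_const] at h2
    simpa using h2
  have h2 : φ = 0 := by
    have h3 := (MeasureTheory.integral_eq_zero_iff_of_nonneg hφ0 hint).1 h1
    exact MeasureTheory.Measure.eq_of_ae_eq h3 hφ.continuous continuous_const
  have h3 := hφ1 (le_refl a) le_rfl le_rfl le_rfl 1
  rw [h2] at h3
  simp [boxIntegral] at h3

end Integration
end

/-! ### The trivial line bundle. -/

noncomputable section
section TrivialBundle

variable {S : Type*} [TopologicalSpace S] [ChartedSpace ℂ S] [IsManifold 𝓘(ℝ, ℂ) ∞ S]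

/-- The trivial connection on the trivial line bundle has a global parallel frame. -/
lemma flatFrame_trivialConnection :
    FlatFrame (trivialConnection 𝓘(ℝ, ℂ) S) (fun (_ : Fin 1) (_ : S) ↦ (1 : ℝ)) univ where
  isOpen := isOpen_univ
  smooth _ x _ := by
    refine (Bundle.contMDiffAt_section (E := Bundle.Trivial S ℝ) x).2 ?_
    exact contMDiffAt_const (c := (1 : ℝ))
  bij x _ := by
    have h : ∀ a, frameSum (fun _ : Fin 1 ↦ (1 : ℝ)) a = a 0 := fun a ↦ by
      refine (Fintype.linearCombination_apply ℝ _ a).trans ?_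
      simp
    constructor
    · intro a b hab
      funext i
      rw [Subsingleton.elim i 0]
      exact (h a).symm.trans (hab.trans (h b))
    · intro v
      exact ⟨fun _ ↦ v, h _⟩
  flat _ x _ := mvfderiv_const (1 : ℝ)

lemma hasFlatFrames_trivialConnection : HasFlatFrames (trivialConnection 𝓘(ℝ, ℂ) S) 1 :=
  fun _ ↦ ⟨univ, _, mem_univ _, flatFrame_trivialConnection⟩

/-- In rank one a family of subspaces of constant dimension is zero or everything, whatever the
connection. -/
lemma isIrreducibleConn_trivialConnection :
    IsIrreducibleConn (trivialConnection 𝓘(ℝ, ℂ) S) := by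
  rintro W ⟨k, hk⟩ - -
  have hf : ∀ x : S, Module.finrank ℝ (Bundle.Trivial S ℝ x) = 1 := fun x ↦ Module.finrank_self ℝ
  have : ∀ x : S, Module.Finite ℝ (Bundle.Trivial S ℝ x) := fun x ↦ Module.Finite.self ℝ
  rcases Nat.eq_zero_or_pos k with rfl | h0
  · exact Or.inl fun x ↦ Submodule.finrank_eq_zero.1 (hk x)
  · refine Or.inr fun x ↦ Submodule.eq_top_of_finrank_eq (le_antisymm (Submodule.finrank_le _) ?_)
    rw [hf, hk]
    exact h0

end TrivialBundle

/-! ### The Euler characteristic of a flat bundle on a closed surface. -/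

section EulerCharacteristic

open SheafOp

variable {S : Type*} [TopologicalSpace S] [ChartedSpace ℂ S] [IsManifold 𝓘(ℝ, ℂ) ∞ S] [T2Space S]
  {F : Type*} [NormedAddCommGroup F] [NormedSpace ℝ F] [FiniteDimensional ℝ F]
  {V : S → Type*} [TopologicalSpace (TotalSpace F V)]
  [∀ x, AddCommGroup (V x)] [∀ x, Module ℝ (V x)] [∀ x, TopologicalSpace (V x)]
  [∀ x, IsTopologicalAddGroup (V x)] [∀ x, ContinuousSMul ℝ (V x)]
  [FiberBundle F V] [VectorBundle ℝ F V]
  {D : CovariantDerivative 𝓘(ℝ, ℂ) F V} {n : ℕ}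

/-- An irreducible connection of rank at least two has no parallel sections. -/
lemma finrank_coh₀_eq_zero [PreconnectedSpace S] (hfr : HasFlatFrames D n)
    (hD : IsIrreducibleConn D) (hn : 1 < n) : Module.finrank ℝ (coh₀ (derivOp hfr) univ) = 0 := by
  have : Subsingleton (coh₀ (derivOp hfr) univ) := by
    refine subsingleton_of_forall_eq 0 ?_
    rintro ⟨s⟩
    refine cls_eq_zero.2 ⟨0, fun y _ ↦ ⟨trivial, ?_⟩⟩
    refine eq_zero_of_parallel hD (fun x ↦ ?_) (fun y ↦ (s.2 y trivial).1)
      (fun y ↦ (s.2 y trivial).2) y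
    obtain ⟨U, e, hx, he⟩ := hfr x
    exact ⟨U, n, e, hn, hx, he⟩
  exact Module.finrank_zero_of_subsingleton

/-- The parallel sections of a trivial flat bundle. -/
lemma finrank_coh₀_of_flatFrame [ConnectedSpace S] {m : ℕ} (hfr : HasFlatFrames D m)
    {e : Fin n → Π x : S, V x} (he : FlatFrame D e univ) :
    Module.finrank ℝ (coh₀ (derivOp hfr) univ) = n := by
  let f₀ : (Fin n → ℝ) →ₗ[ℝ] (derivOp hfr).ker univ :=
    { toFun := fun a ↦ ⟨fun y ↦ frameSum (fun i ↦ e i y) a, fun y hy ↦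
        ⟨he.smoothAt_sum hy contMDiffAt_const, he.deriv_const hy a⟩⟩
      map_add' := fun a b ↦ Subtype.ext (funext fun y ↦ _root_.map_add _ a b)
      map_smul' := fun c a ↦ Subtype.ext (funext fun y ↦ _root_.map_smul _ c a) }
  let f : (Fin n → ℝ) →ₗ[ℝ] coh₀ (derivOp hfr) univ := (Submodule.mkQ _).comp f₀
  obtain ⟨x₀⟩ := (inferInstance : Nonempty S)
  have hf : Function.Bijective f := by
    constructor
    · rw [← LinearMap.ker_eq_bot, LinearMap.ker_eq_bot']
      intro a ha
      obtain ⟨t, ht⟩ := cls_eq_zero.1 ha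
      exact (he.bij x₀ trivial).1 ((ht x₀ trivial).2.trans (_root_.map_zero _).symm)
    · rintro ⟨s⟩
      have hl : IsLocallyConstant fun y ↦ frameCoef (fun i ↦ e i y) (s.1 y) := by
        rw [IsLocallyConstant.iff_eventually_eq]
        intro x
        obtain ⟨O, -, hx, hO⟩ := he.exists_isNice (mem_univ x) Filter.univ_mem
        obtain ⟨a, ha⟩ := hO.eq_frameSum (fun y _ ↦ (s.2 y trivial).1) fun y _ ↦ (s.2 y trivial).2
        filter_upwards [hO.isOpen.mem_nhds hx] with y hy
        rw [ha y hy, ha x hx, frameCoef_frameSum (he.bij _ trivial),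
          frameCoef_frameSum (he.bij _ trivial)]
      refine ⟨frameCoef (fun i ↦ e i x₀) (s.1 x₀), cls_eq.2 ⟨0, fun y hy ↦ ⟨trivial, ?_⟩⟩⟩
      refine sub_eq_zero.2 ?_
      show frameSum (fun i ↦ e i y) _ = s.1 y
      rw [hl.apply_eq_of_preconnectedSpace x₀ y]
      exact frameSum_frameCoef (he.bij y trivial) (s.1 y)
  rw [← (LinearEquiv.ofBijective f hf).finrank_eq, Module.finrank_fin_fun]

/-- The Euler characteristic of a flat bundle is its rank times that of the trivial line bundle. -/
theorem exists_hasEuler_univ [CompactSpace S] (hfr : HasFlatFrames D n) :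
    ∃ c : ℤ, HasEuler (derivOp hfr) (extOp hfr) univ (n * c) ∧
      HasEuler (derivOp (hasFlatFrames_trivialConnection (S := S)))
        (extOp hasFlatFrames_trivialConnection) univ c := by
  classical
  choose O e hxO he using id hfr
  -- One cover serves both complexes: on each non-empty intersection the Euler characteristics are
  -- the ranks `n` and `1`.
  obtain ⟨s, U, hU, hs, hJ⟩ := exists_good_cover 𝓘(ℝ, ℂ) fun x ↦ (he x).isOpen.mem_nhds (hxO x)
  rw [← hs]
  refine exists_hasEuler_biUnion (isComplex_twisted _) (isComplex_twisted _)
    (fun A B hA hB ↦ exists_isCutoff hA hB) n s U hU fun J hJne ↦ ?_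
  obtain ⟨p, hp, hc⟩ := hJ J hJne
  have ho : IsOpen (⋂ x ∈ J, U x) := isOpen_biInter_finset fun x _ ↦ hU x
  rcases (⋂ x ∈ J, U x).eq_empty_or_nonempty with h0 | hne
  · rw [h0]
    refine ⟨0, ?_, hasEuler_empty⟩
    rw [mul_zero]
    exact hasEuler_empty
  · have h1 : IsNice D (e p) p (⋂ x ∈ J, U x) :=
      { (he p).mono ho fun y hy ↦ (hp hy).1 with
        subset := fun y hy ↦ (hp hy).2
        convex := hc }
    have h2 : IsNice (trivialConnection 𝓘(ℝ, ℂ) S) (fun (_ : Fin 1) (_ : S) ↦ (1 : ℝ)) p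
        (⋂ x ∈ J, U x) :=
      { flatFrame_trivialConnection.mono ho (subset_univ _) with
        subset := fun y hy ↦ (hp hy).2
        convex := hc }
    refine ⟨1, ?_, by exact_mod_cast h2.hasEuler _ hne⟩
    rw [mul_one]
    exact h1.hasEuler _ hne

end EulerCharacteristic

/-- The first cohomology of a closed Riemann surface with coefficients in an irreducible flat
bundle of rank three. -/
theorem finrank_twistedH1_of_irreducible {S : Type*} [TopologicalSpace S] [ChartedSpace ℂ S]
    [IsManifold 𝓘(ℂ) ω S] [T2Space S] [CompactSpace S] [ConnectedSpace S]
    {g : ℕ} (hg : 1 < g) (hS : HasGenus S g)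
    {F : Type*} [NormedAddCommGroup F] [NormedSpace ℝ F] [FiniteDimensional ℝ F]
    {V : S → Type*} [TopologicalSpace (TotalSpace F V)]
    [∀ x, AddCommGroup (V x)] [∀ x, Module ℝ (V x)] [∀ x, TopologicalSpace (V x)]
    [∀ x, IsTopologicalAddGroup (V x)] [∀ x, ContinuousSMul ℝ (V x)]
    [FiberBundle F V] [VectorBundle ℝ F V]
    {D : CovariantDerivative 𝓘(ℝ, ℂ) F V} (hfr : HasFlatFrames D 3) (hD : IsIrreducibleConn D) :
    Module.Finite ℝ (TwistedH1 D) ∧ Module.finrank ℝ (TwistedH1 D) = 6 * g - 6 := by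
  have hfr' := hasFlatFrames_trivialConnection (S := S)
  obtain ⟨c, h, h'⟩ := exists_hasEuler_univ hfr
  obtain ⟨E⟩ := nonempty_twistedH1_equiv_coh hfr
  obtain ⟨E'⟩ := nonempty_twistedH1_equiv_coh hfr'
  have := h.finite₁
  have := h'.finite₂
  have hn := nontrivial_coh₂ hfr' one_pos flatFrame_trivialConnection
  have b0 := finrank_coh₀_of_flatFrame hfr' flatFrame_trivialConnection
  have b1 : Module.finrank ℝ _ = 2 * g := E'.finrank_eq.symm.trans hS
  have b2 := le_antisymm (finrank_coh₂_le_one hfr' isIrreducibleConn_trivialConnection)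
    Module.finrank_pos
  have a0 := finrank_coh₀_eq_zero hfr hD (by norm_num)
  have a2 := finrank_coh₂_eq_zero hfr hD (by norm_num)
  -- The two Euler characteristics read `-h¹ = 3 c` and `1 - 2g + 1 = c`.
  have h1 := h.eq
  have h2 := h'.eq
  rw [a0, a2] at h1
  rw [b0, b1, b2] at h2
  refine ⟨Module.Finite.equiv E.symm, ?_⟩
  rw [E.finrank_eq]
  push_cast at h1 h2
  omega

end

/-! ### The main theorem. -/

set_option maxHeartbeats 2000000 in
theorem mainTheorem2
    -- a compact connected Riemann surface of genus `g > 1`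
    {S : Type*} [TopologicalSpace S] [ChartedSpace ℂ S] [IsManifold 𝓘(ℂ) ω S]
    [T2Space S] [CompactSpace S] [ConnectedSpace S]
    (g : ℕ) (hg : 1 < g) (hS : HasGenus S g)
    -- a smooth real vector bundle of rank three with an `SO(2,1)` structure such that `E ≅ TS ⊕ ℝ`
    {E : S → Type*} [TopologicalSpace (TotalSpace (EuclideanSpace ℝ (Fin 3)) E)]
    [∀ x, AddCommGroup (E x)] [∀ x, Module ℝ (E x)] [∀ x, TopologicalSpace (E x)]
    [∀ x, IsTopologicalAddGroup (E x)] [∀ x, ContinuousSMul ℝ (E x)]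
    [FiberBundle (EuclideanSpace ℝ (Fin 3)) E] [VectorBundle ℝ (EuclideanSpace ℝ (Fin 3)) E]
    [ContMDiffVectorBundle ∞ (EuclideanSpace ℝ (Fin 3)) E 𝓘(ℝ, ℂ)]
    (h : LorentzMetric 𝓘(ℝ, ℂ) (EuclideanSpace ℝ (Fin 3)) E) (hE : h.IsTangentPlusLine)
    -- a smooth, flat, irreducible `SO(2,1)` connection on `E`
    (B : CovariantDerivative 𝓘(ℝ, ℂ) (EuclideanSpace ℝ (Fin 3)) E)
    (hB_smooth : B.ContMDiffCovariantDerivative ∞)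
    (hB_metric : IsMetricOn (EuclideanSpace ℝ (Fin 3)) B h.form univ)
    (hB_flat : IsFlatOn (EuclideanSpace ℝ (Fin 3)) B univ)
    (hB_irred : IsIrreducibleConn B) :
    -- flatness of `π^*∇_B + ξ` is the Cartan equation
    (∀ ξ, (B.cylinder.addTranslation ξ).IsFlat ↔ ξ ∈ closedForms B.cylinder) ∧
    -- `H¹(π^*∇_B)` is the vector space of gauge classes of flat connections `π^*∇_B + ξ`
    (∃ (_ : AddCommGroup (GaugeClasses B.cylinder h.cylForm))
      (_ : Module ℝ (GaugeClasses B.cylinder h.cylForm))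
      (Φ : TwistedH1 B.cylinder ≃ₗ[ℝ] GaugeClasses B.cylinder h.cylForm),
      ∀ (ξ : closedForms B.cylinder) (A : FlatISOConnection B.cylinder h.cylForm),
        A.1 = B.cylinder.addTranslation ξ.1 → Φ (cohClass B.cylinder ξ) = Quot.mk _ A) ∧
    -- for closed `ξ`, `g_ξ` is, where `ξ` is invertible, a flat Lorentzian metric with
    -- Levi-Civita connection `ξ⁻¹ ∘ π^*∇_B ∘ ξ`
    (∀ ξ ∈ closedForms B.cylinder,
      IsFlatLorentzOn (pulledMetric h.cylForm ξ) (pulledConnection B.cylinder ξ)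
        {p | (ξ p).IsInvertible}) ∧
    -- for invertible closed `ξ`, equality of metric tensors determines the form up to sign, and
    -- then the forms present the same metric
    (∀ ξ ∈ closedForms B.cylinder, ∀ ξ' ∈ closedForms B.cylinder, (∀ p, (ξ p).IsInvertible) →
      (pulledMetric h.cylForm ξ = pulledMetric h.cylForm ξ' ↔ ξ' = ξ ∨ ξ' = -ξ) ∧
      (pulledMetric h.cylForm ξ = pulledMetric h.cylForm ξ' ↔
        SameMetric B.cylinder h.cylForm ξ ξ')) ∧
    -- `H¹(π^*∇_B) / ℤ₂` is the space of equivalence classes of inextensible, flat, singular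
    -- Lorentzian metrics `g_ξ`
    (∃ Ψ : MulAction.orbitRel.Quotient ℤˣ (TwistedH1 B.cylinder) ≃
        MetricClasses B.cylinder h.cylForm IsInextensible,
      ∀ ξ : {ξ : closedForms B.cylinder // IsInextensible (pulledMetric h.cylForm ξ.1)},
        Ψ (Quotient.mk _ (cohClass B.cylinder ξ.1)) = Quot.mk _ ξ) ∧
    -- the same without the restriction to inextensible metrics
    (∃ Ψ : MulAction.orbitRel.Quotient ℤˣ (TwistedH1 B.cylinder) ≃
        MetricClasses B.cylinder h.cylForm (fun _ ↦ True),
      ∀ ξ : {ξ : closedForms B.cylinder // True},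
        Ψ (Quotient.mk _ (cohClass B.cylinder ξ.1)) = Quot.mk _ ξ) ∧
    -- `h¹ = 6g - 6`
    Module.Finite ℝ (TwistedH1 B.cylinder) ∧
    Module.finrank ℝ (TwistedH1 B.cylinder) = 6 * g - 6 := by
  have hfr : HasFlatFrames B 3 := by
    -- The frame produced has length the dimension of the model fibre, which is rewritten as `3`.
    have h0 : ∀ m, m = 3 → HasFlatFrames B m → HasFlatFrames B 3 := by
      rintro _ rfl h1
      exact h1
    exact h0 _ finrank_euclideanSpace_fin (exists_flatFrame hB_smooth hB_flat)
  have h3 : Odd 3 := by decide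
  have hb := h.isParallelLorentz_cylForm hB_metric hfr
  have hsc : HasScalarCommutant B.cylinder := exists_scalar_of_commute h3 hfr hB_irred
  obtain ⟨eqv⟩ := nonempty_twistedH1_cylinder_equiv hfr
  obtain ⟨hfin, hdim⟩ := finrank_twistedH1_of_irreducible hg hS hfr hB_irred
  have p1 := addTranslation_isFlat_iff hfr.cylinder
  have p2 := exists_gaugeClasses_equiv h3 hfr.cylinder hsc hb.isMetricOn
  have p4 : ∀ ξ ∈ closedForms B.cylinder, ∀ ξ' ∈ closedForms B.cylinder, _ → _ :=
    fun ξ hξ ξ' hξ' hinv ↦ pulledMetric_eq_iff hb hsc hξ hξ' hinv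
  -- The inextensible representative of each class is the one pulled back from the surface.
  have p5 := exists_metricClasses_equiv (P := IsInextensible) hb hsc fun ξ ↦ by
    obtain ⟨η, hη⟩ := exists_cohomologous_cylPull hfr ξ
    exact ⟨_, hη, isInextensible_cylPull hfr hb η⟩
  have p6 := exists_metricClasses_equiv (P := fun _ ↦ True) hb hsc fun ξ ↦
    ⟨ξ, by rw [sub_self]; exact zero_mem _, trivial⟩
  exact ⟨p1, p2, fun ξ hξ ↦ isFlatLorentzOn_pulledMetric hfr.cylinder hb hξ, p4, p5, p6,
    Module.Finite.equiv eqv, eqv.finrank_eq.symm.trans hdim⟩
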